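/- Let $\mathbb B$ be a compact smooth manifold with boundary of dimension $n+1$, $n\ge 0$, with a fixed collar $[0,1[\times\partial\mathbb B$, coordinates $(x,y)$, of its boundary. A cut-off function is a function $0\le\omega\in C^\infty_c([0,1[)$ with $\omega=1$ near $0$. For $s,\gamma\in\mathbb R$ and $1<p<\infty$ the cone Sobolev space $\mathcal H^{s,\gamma}_p(\mathbb B)$ consists of all distributions $u\in H^s_{p,loc}(\operatorname{int}\mathbb B)$ such that $S_\gamma(\omega u)\in H^s_p(\mathbb R\times\partial\mathbb B)$ for every cut-off function $\omega$, where $(S_\gamma\varphi)(r,y)=e^{(\frac{n+1}{2}-\gamma)r}\varphi(e^{-r},y)$. It is a Banach space, with the norm obtained from a cut-off function and finitely many localized charts (different choices give equivalent norms). **Lemma (multipliers).** Let $1<p,q<\infty$, $\sigma>0$ and $\gamma\in\mathbb R$, and let $m\in\mathcal H^{\sigma+(n+1)/q,\,(n+1)/2}_q(\mathbb B)$. Then $m$ is a locally integrable function on $\operatorname{int}\mathbb B$, and for every $s$ with $-\sigma<s<\sigma$ multiplication by $m$ defines a bounded linear operator on $\mathcal H^{s,\gamma}_p(\mathbb B)$;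 that is, there is a unique bounded linear operator $T$ on $\mathcal H^{s,\gamma}_p(\mathbb B)$ such that $Tu=m\,u$ (the pointwise product) for every $u\in\mathcal H^{s,\gamma}_p(\mathbb B)$ that is a locally integrable function on $\operatorname{int}\mathbb B$. -/

import Mathlib

open Set Filter Topology MeasureTheory TopologicalSpace
open scoped Manifold ContDiff Distributions SchwartzMap ENNReal NNReal

noncomputable section

namespace Cone

/-- Euclidean space `ℝ^d`. -/
abbrev Euc (d : ℕ) : Type := EuclideanSpace ℝ (Fin d)

/-! ### Bessel potential spaces for localized distributions on `ℝ^d` -/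

/-- A real test function on `ℝ^d`, as a (complex valued) Schwartz function. -/
def testToSchwartz {d : ℕ} (φ : 𝓓((⊤ : Opens (Euc d)), ℝ)) : 𝓢(Euc d, ℂ) :=
  (φ.hasCompactSupport.comp_left (g := Complex.ofRealCLM) (map_zero _)).toSchwartzMap
    (Complex.ofRealCLM.contDiff.comp φ.contDiff)

/-- `w = χ v` as distributions on `ℝ^d`, where `v` is a distribution on the open set `Ω` and `χ` is
a smooth function on `ℝ^d` whose support (closed in `ℝ^d`) lies in `Ω`; the product is extended by
zero outside `Ω`. -/
def IsLocalization {d : ℕ} {Ω : Opens (Euc d)} (v : 𝓓'(Ω, ℂ)) (χ : Euc d → ℝ)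
    (w : 𝓢'(Euc d, ℂ)) : Prop :=
  ∀ (φ : 𝓓((⊤ : Opens (Euc d)), ℝ)) (ψ : 𝓓(Ω, ℝ)),
    (∀ x, ψ x = χ x * φ x) → w (testToSchwartz φ) = v ψ

/-- `χ v` belongs to the Bessel potential space `H^s_p(ℝ^d)`. -/
def LocMem {d : ℕ} (s : ℝ) (p : ℝ≥0∞) [Fact (1 ≤ p)] {Ω : Opens (Euc d)} (v : 𝓓'(Ω, ℂ))
    (χ : Euc d → ℝ) : Prop :=
  ∃ w : 𝓢'(Euc d, ℂ), IsLocalization v χ w ∧ TemperedDistribution.MemSobolev s p w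

/-- The norm of `χ v` in `H^s_p(ℝ^d)`, that is, the `L^p` norm of its Bessel potential of order `s`
(and `∞` if `χ v` does not belong to that space). -/
def locNorm {d : ℕ} (s : ℝ) (p : ℝ≥0∞) [Fact (1 ≤ p)] {Ω : Opens (Euc d)} (v : 𝓓'(Ω, ℂ))
    (χ : Euc d → ℝ) : ℝ≥0∞ :=
  ⨅ (w : 𝓢'(Euc d, ℂ)) (f : Lp ℂ p (volume : Measure (Euc d)))
    (_ : IsLocalization v χ w ∧
      TemperedDistribution.besselPotential (Euc d) ℂ s w = (f : 𝓢'(Euc d, ℂ))), ‖f‖ₑ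

section Loc

variable {d : ℕ} {s : ℝ} {p : ℝ≥0∞} [Fact (1 ≤ p)] {Ω : Opens (Euc d)} {v v' : 𝓓'(Ω, ℂ)}
  {χ : Euc d → ℝ}

lemma LocMem.zero : LocMem s p (0 : 𝓓'(Ω, ℂ)) χ :=
  ⟨0, fun _ _ _ => rfl, TemperedDistribution.memSobolev_fun_zero _ _ _ _⟩

lemma LocMem.add (h : LocMem s p v χ) (h' : LocMem s p v' χ) : LocMem s p (v + v') χ := by
  obtain ⟨w, hw, hs⟩ := h
  obtain ⟨w', hw', hs'⟩ := h'
  refine ⟨w + w', fun φ ψ e => ?_, hs.add hs'⟩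
  change w _ + w' _ = v _ + v' _
  rw [hw φ ψ e, hw' φ ψ e]

lemma LocMem.smul (a : ℂ) (h : LocMem s p v χ) : LocMem s p (a • v) χ := by
  obtain ⟨w, hw, hs⟩ := h
  refine ⟨a • w, fun φ ψ e => ?_, hs.smul a⟩
  change a • w _ = a • v _
  rw [hw φ ψ e]

end Loc

/-! ### Coordinates on `ℝ × ℝ^n` -/

/-- The point `(r, y)` of `ℝ^(n+1) = ℝ × ℝ^n`. -/
def consPt {n : ℕ} (r : ℝ) (y : Euc n) : Euc (n + 1) :=
  WithLp.toLp 2 (Fin.cons r y.ofLp : Fin (n + 1) → ℝ)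

/-- The component `y` of the point `(r, y)` of `ℝ^(n+1) = ℝ × ℝ^n`. -/
def tailPt {n : ℕ} (v : Euc (n + 1)) : Euc n :=
  WithLp.toLp 2 (fun i => v i.succ)

@[simp] lemma consPt_zero {n : ℕ} (r : ℝ) (y : Euc n) : consPt r y 0 = r := rfl

@[simp] lemma tailPt_consPt {n : ℕ} (r : ℝ) (y : Euc n) : tailPt (consPt r y) = y := rfl

@[simp] lemma consPt_tailPt {n : ℕ} (v : Euc (n + 1)) : consPt (v 0) (tailPt v) = v := by
  ext i
  refine Fin.cases ?_ (fun j => ?_) i <;> rfl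

lemma contDiff_consPt {n : ℕ} :
    ContDiff ℝ ∞ (fun z : ℝ × Euc n => consPt z.1 z.2) := by
  rw [contDiff_euclidean]
  intro i
  refine Fin.cases ?_ (fun j => ?_) i
  · exact contDiff_fst
  · exact (contDiff_euclidean.1 contDiff_snd) j

lemma contDiff_tailPt {n : ℕ} : ContDiff ℝ ∞ (tailPt : Euc (n + 1) → Euc n) := by
  rw [contDiff_euclidean]
  intro i
  exact (contDiff_euclidean.1 contDiff_id) i.succ

/-- The point `x ≥ 0` of the half line `[0, ∞[` (for `x < 0`, the point `0`). -/
def halfPt (x : ℝ) : EuclideanHalfSpace 1 :=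
  ⟨WithLp.toLp 2 (fun _ => max x 0), le_max_right _ _⟩

/-! ### The manifold with boundary and its collar -/

section Manifold

variable (n : ℕ) (B : Type*) [TopologicalSpace B] [ChartedSpace (EuclideanHalfSpace (n + 1)) B]
  (Y : Type*) [TopologicalSpace Y] [ChartedSpace (Euc n) Y]

/-- A smooth chart of the interior of the `(n+1)`-dimensional manifold with boundary `B`, that is, a
diffeomorphism of an open subset of the interior of `B` onto an open subset of `ℝ^(n+1)`. -/
structure InteriorChart where
  /-- the coordinate map -/
  toChart : OpenPartialHomeomorph B (Euc (n + 1))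
  source_subset : toChart.source ⊆ (𝓡∂ (n + 1)).interior B
  contMDiffOn : ContMDiffOn (𝓡∂ (n + 1)) (𝓡 (n + 1)) ∞ toChart toChart.source
  contMDiffOn_symm :
    ContMDiffOn (𝓡 (n + 1)) (𝓡∂ (n + 1)) ∞ toChart.symm toChart.target

/-- A smooth chart of the `n`-dimensional manifold `Y`. -/
abbrev BoundaryChart : Type _ :=
  {η : OpenPartialHomeomorph Y (Euc n) // η ∈ IsManifold.maximalAtlas (𝓡 n) ∞ Y}

variable {n B Y}

/-- The image of an interior chart, as an open subset of `ℝ^(n+1)`. -/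
def InteriorChart.dom (κ : InteriorChart n B) : Opens (Euc (n + 1)) :=
  ⟨κ.toChart.target, κ.toChart.open_target⟩

/-- The image of a boundary chart, as an open subset of `ℝ^n`. -/
def BoundaryChart.dom (η : BoundaryChart n Y) : Opens (Euc n) :=
  ⟨η.1.target, η.1.open_target⟩

variable (n B Y)

/-- A collar `[0,1[ × Y` of the boundary of `B`: a diffeomorphism of `[0,1[ × Y` onto an open
neighbourhood of the boundary of `B`. In particular `Y`, embedded as `{0} × Y`, is the boundary
of `B`. -/
structure Collar where
  /-- the diffeomorphism -/
  toMap : OpenPartialHomeomorph (EuclideanHalfSpace 1 × Y) B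
  source_eq : toMap.source = {z | z.1.val 0 < 1}
  boundary_subset : (𝓡∂ (n + 1)).boundary B ⊆ toMap.target
  contMDiffOn :
    ContMDiffOn ((𝓡∂ 1).prod (𝓡 n)) (𝓡∂ (n + 1)) ∞ toMap toMap.source
  contMDiffOn_symm :
    ContMDiffOn (𝓡∂ (n + 1)) ((𝓡∂ 1).prod (𝓡 n)) ∞ toMap.symm toMap.target

/-! ### Distributions on the interior -/

/-- Distributions on the interior of `B`: families of distributions `u_κ` on the images of the
smooth charts `κ` of the interior (with `u_κ` playing the role of `u ∘ κ⁻¹`) that are compatible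
with the changes of coordinates: `⟨u_κ, φ⟩ = ⟨u_κ', |det Dτ| (φ ∘ τ)⟩` with `τ = κ ∘ κ'⁻¹`. -/
def IntDistribution : Submodule ℂ (∀ κ : InteriorChart n B, 𝓓'(κ.dom, ℂ)) where
  carrier := {u | ∀ (κ κ' : InteriorChart n B) (φ : 𝓓(κ.dom, ℝ)) (φ' : 𝓓(κ'.dom, ℝ)),
    tsupport φ ⊆ κ.toChart.target ∩ κ.toChart.symm ⁻¹' κ'.toChart.source →
    tsupport φ' ⊆ κ'.toChart.target ∩ κ'.toChart.symm ⁻¹' κ.toChart.source →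
    (∀ x ∈ κ'.toChart.target ∩ κ'.toChart.symm ⁻¹' κ.toChart.source,
      φ' x = |(fderiv ℝ (κ.toChart ∘ κ'.toChart.symm) x).det| *
        φ (κ.toChart (κ'.toChart.symm x))) →
    u κ φ = u κ' φ'}
  zero_mem' := fun _ _ _ _ _ _ _ => rfl
  add_mem' := by
    intro u v hu hv κ κ' φ φ' h h' e
    change u κ φ + v κ φ = u κ' φ' + v κ' φ'
    rw [hu κ κ' φ φ' h h' e, hv κ κ' φ φ' h h' e]
  smul_mem' := by
    intro a u hu κ κ' φ φ' h h' e
    change a • u κ φ = a • u κ' φ'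
    rw [hu κ κ' φ φ' h h' e]

variable {n B Y}

/-- The distribution `u` on the interior of `B` is (given by) the locally integrable function
`f`. -/
def Represents (u : IntDistribution n B) (f : B → ℂ) : Prop :=
  ∀ κ : InteriorChart n B,
    LocallyIntegrableOn (fun x => f (κ.toChart.symm x)) κ.toChart.target volume ∧
    ∀ φ : 𝓓(κ.dom, ℝ), u.1 κ φ = ∫ x, (φ x : ℂ) * f (κ.toChart.symm x)


lemma continuous_halfPt : Continuous halfPt := by
  unfold halfPt
  refine Continuous.subtype_mk ?_ _
  exact (PiLp.continuous_toLp 2 _).comp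
    (continuous_pi fun _ => continuous_id.max continuous_const)

lemma contMDiffOn_halfPt : ContMDiffOn 𝓘(ℝ, ℝ) (𝓡∂ 1) ∞ halfPt (Ioi 0) := by
  have h1 : ContMDiffOn 𝓘(ℝ, ℝ) (𝓡 1) ∞
      (fun x : ℝ => (WithLp.toLp 2 (fun _ => x) : Euc 1)) (Ioi 0) := by
    apply ContMDiff.contMDiffOn
    rw [contMDiff_iff_contDiff, contDiff_euclidean]
    exact fun _ => contDiff_id
  have h2 := ((𝓡∂ 1).contMDiffOn_symm (n := ∞)).comp h1 (by
    intro x hx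
    change _ ∈ range (𝓡∂ 1)
    rw [range_modelWithCornersEuclideanHalfSpace]
    exact le_of_lt (mem_Ioi.1 hx))
  refine h2.congr fun x hx => ?_
  apply Subtype.ext
  ext i
  fin_cases i
  simp [halfPt, modelWithCornersEuclideanHalfSpace]

/-- The coordinates `(r, η(y))`, with `x = e^{-r}`, on `]0,∞[ × V`, where `η` is a chart of `Y` with
domain `V`. -/
def logCoord (η : OpenPartialHomeomorph Y (Euc n)) :
    OpenPartialHomeomorph (EuclideanHalfSpace 1 × Y) (Euc (n + 1)) where
  toFun z := consPt (-Real.log (z.1.val 0)) (η z.2)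
  invFun v := (halfPt (Real.exp (-v 0)), η.symm (tailPt v))
  source := {z | 0 < z.1.val 0} ∩ {z | z.2 ∈ η.source}
  target := {v | tailPt v ∈ η.target}
  map_source' z hz := η.map_source hz.2
  map_target' v hv := by
    refine ⟨?_, η.map_target hv⟩
    simp [halfPt, Real.exp_pos]
  left_inv' := by
    rintro ⟨x, y⟩ ⟨hx, hy⟩
    have hx' : 0 < x.val 0 := hx
    refine Prod.ext ?_ (η.left_inv hy)
    apply Subtype.ext
    ext i
    fin_cases i
    simp [halfPt, Real.exp_log hx', hx'.le]
  right_inv' v hv := by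
    have : max (Real.exp (-v 0)) 0 = Real.exp (-v 0) := max_eq_left (Real.exp_pos _).le
    simp only [halfPt, this, Real.log_exp, neg_neg, η.right_inv hv, consPt_tailPt]
  open_source := by
    refine IsOpen.inter ?_ (η.open_source.preimage continuous_snd)
    refine isOpen_lt continuous_const ?_
    exact (PiLp.continuous_apply 2 _ 0).comp (continuous_subtype_val.comp continuous_fst)
  open_target := η.open_target.preimage contDiff_tailPt.continuous
  continuousOn_toFun := by
    refine contDiff_consPt.continuous.comp_continuousOn (ContinuousOn.prodMk ?_ ?_)
    · refine (ContinuousOn.log ?_ fun z hz => (ne_of_gt hz.1)).neg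
      exact ((PiLp.continuous_apply 2 _ 0).comp
        (continuous_subtype_val.comp continuous_fst)).continuousOn
    · exact η.continuousOn.comp continuous_snd.continuousOn fun z hz => hz.2
  continuousOn_invFun := by
    refine ContinuousOn.prodMk (Continuous.continuousOn ?_) ?_
    · exact continuous_halfPt.comp (Real.continuous_exp.comp (PiLp.continuous_apply 2 _ 0).neg)
    · exact η.continuousOn_symm.comp contDiff_tailPt.continuous.continuousOn fun v hv => hv

lemma contMDiffOn_logCoord (η : BoundaryChart n Y) :
    ContMDiffOn ((𝓡∂ 1).prod (𝓡 n)) (𝓡 (n + 1)) ∞ (logCoord η.1) (logCoord η.1).source := by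
  have hx : ContMDiff ((𝓡∂ 1).prod (𝓡 n)) 𝓘(ℝ, ℝ) ∞
      (fun z : EuclideanHalfSpace 1 × Y => z.1.val 0) := by
    have h0 : ContMDiff (𝓡 1) 𝓘(ℝ, ℝ) ∞ (fun v : Euc 1 => v 0) :=
      contMDiff_iff_contDiff.2 ((contDiff_euclidean.1 contDiff_id) 0)
    exact h0.comp (((𝓡∂ 1).contMDiff (n := ∞)).comp contMDiff_fst)
  have hlog : ContMDiffOn ((𝓡∂ 1).prod (𝓡 n)) 𝓘(ℝ, ℝ) ∞
      (fun z : EuclideanHalfSpace 1 × Y => -Real.log (z.1.val 0)) (logCoord η.1).source := by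
    have hl : ContMDiffOn 𝓘(ℝ, ℝ) 𝓘(ℝ, ℝ) ∞ (fun x : ℝ => -Real.log x) (Ioi 0) := by
      rw [contMDiffOn_iff_contDiffOn]
      exact (Real.contDiffOn_log.mono fun x hx => ne_of_gt (mem_Ioi.1 hx)).neg
    exact hl.comp hx.contMDiffOn fun z hz => hz.1
  have hη : ContMDiffOn ((𝓡∂ 1).prod (𝓡 n)) (𝓡 n) ∞
      (fun z : EuclideanHalfSpace 1 × Y => η.1 z.2) (logCoord η.1).source :=
    (contMDiffOn_of_mem_maximalAtlas η.2).comp contMDiff_snd.contMDiffOn fun z hz => hz.2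
  have hc : ContMDiff 𝓘(ℝ, ℝ × Euc n) (𝓡 (n + 1)) ∞ (fun z : ℝ × Euc n => consPt z.1 z.2) :=
    contMDiff_iff_contDiff.2 contDiff_consPt
  exact hc.comp_contMDiffOn (hlog.prodMk_space hη)

lemma contMDiffOn_logCoord_symm (η : BoundaryChart n Y) :
    ContMDiffOn (𝓡 (n + 1)) ((𝓡∂ 1).prod (𝓡 n)) ∞ (logCoord η.1).symm
      (logCoord η.1).target := by
  have he : ContMDiff (𝓡 (n + 1)) 𝓘(ℝ, ℝ) ∞ (fun v : Euc (n + 1) => Real.exp (-v 0)) :=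
    contMDiff_iff_contDiff.2 (((contDiff_euclidean.1 contDiff_id) 0).neg.exp)
  have ht : ContMDiff (𝓡 (n + 1)) (𝓡 n) ∞ (tailPt : Euc (n + 1) → Euc n) :=
    contMDiff_iff_contDiff.2 contDiff_tailPt
  refine ContMDiffOn.prodMk ?_ ?_
  · exact contMDiffOn_halfPt.comp he.contMDiffOn fun v _ => Real.exp_pos _
  · exact (contMDiffOn_symm_of_mem_maximalAtlas η.2).comp ht.contMDiffOn fun v hv => hv

lemma Collar.interior_of_pos [IsManifold (𝓡∂ (n + 1)) ∞ B] [IsManifold (𝓡 n) ∞ Y]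
    (c : Collar n B Y) {z : EuclideanHalfSpace 1 × Y} (hz : z ∈ c.toMap.source)
    (hpos : 0 < z.1.val 0) : c.toMap z ∈ (𝓡∂ (n + 1)).interior B := by
  have hloc : IsLocalDiffeomorphAt ((𝓡∂ 1).prod (𝓡 n)) (𝓡∂ (n + 1)) ∞ c.toMap z :=
    ⟨⟨c.toMap.toPartialEquiv, c.toMap.open_source, c.toMap.open_target, c.contMDiffOn,
      c.contMDiffOn_symm⟩, hz, fun _ _ => rfl⟩
  refine (hloc.isInteriorPoint_iff (by simp)).1 ?_
  change z ∈ ((𝓡∂ 1).prod (𝓡 n)).interior (EuclideanHalfSpace 1 × Y)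
  rw [ModelWithCorners.interior_prod]
  refine ⟨?_, BoundarylessManifold.isInteriorPoint⟩
  change extChartAt (𝓡∂ 1) z.1 z.1 ∈ interior (range (𝓡∂ 1))
  rw [interior_range_modelWithCornersEuclideanHalfSpace]
  have e : extChartAt (𝓡∂ 1) z.1 z.1 = z.1.val := by
    rw [extChartAt_coe, chartAt_self_eq]
    rfl
  rw [e]
  exact hpos

/-- The chart `c(x, y) ↦ (r, η(y))`, `x = e^{-r}`, of the part `]0,1[ × V` of the collar, where `V`
is the domain of the chart `η` of the boundary. Its image is `]0,∞[ × η(V)`. -/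
def Collar.logChart [IsManifold (𝓡∂ (n + 1)) ∞ B] [IsManifold (𝓡 n) ∞ Y]
    (c : Collar n B Y) (η : BoundaryChart n Y) : InteriorChart n B where
  toChart := c.toMap.symm.trans (logCoord η.1)
  source_subset := by
    intro z hz
    rw [OpenPartialHomeomorph.trans_source] at hz
    have h := c.interior_of_pos (c.toMap.map_target hz.1) hz.2.1
    rwa [c.toMap.right_inv hz.1] at h
  contMDiffOn := by
    rw [OpenPartialHomeomorph.trans_source]
    exact (contMDiffOn_logCoord η).comp (c.contMDiffOn_symm.mono inter_subset_left)
      fun z hz => hz.2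
  contMDiffOn_symm := by
    rw [OpenPartialHomeomorph.trans_target]
    exact c.contMDiffOn.comp ((contMDiffOn_logCoord_symm η).mono inter_subset_left)
      fun z hz => hz.2

lemma Collar.logChart_target [IsManifold (𝓡∂ (n + 1)) ∞ B] [IsManifold (𝓡 n) ∞ Y]
    (c : Collar n B Y) (η : BoundaryChart n Y) :
    (c.logChart η).toChart.target = {v | 0 < v 0 ∧ tailPt v ∈ η.1.target} := by
  ext v
  simp only [Collar.logChart, OpenPartialHomeomorph.trans_target, mem_inter_iff, mem_preimage]
  rw [OpenPartialHomeomorph.symm_target, c.source_eq]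
  change (tailPt v ∈ η.1.target ∧ max (Real.exp (-v 0)) 0 < 1) ↔ _
  rw [max_eq_left (Real.exp_pos _).le, Real.exp_lt_one_iff]
  constructor
  · exact fun h => ⟨by linarith [h.2], h.1⟩
  · exact fun h => ⟨h.2, by linarith [h.1]⟩

/-! ### Cone Sobolev spaces -/

/-- Cut-off functions near `x = 0`: `0 ≤ θ ∈ C^∞_c([0,1[)`, with `θ = 1` near `0`. (Only the values
on `[0,∞[` matter.) -/
structure Cutoff where
  /-- the function -/
  toFun : ℝ → ℝ
  contDiff : ContDiff ℝ ∞ toFun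
  nonneg : ∀ x, 0 ≤ toFun x
  eq_one : ∀ᶠ x in 𝓝 0, toFun x = 1
  eq_zero : ∃ a < 1, ∀ x, a ≤ x → toFun x = 0

/-- For a distribution `u` on the interior of `B`, the product of this function and of `u`, both in
the coordinates `(r, η(y))`, is `S_γ(θ u)` localized by the test function `ψ` on the domain of the
chart `η` of `Y`: here `(S_γ φ)(r, y) = e^{((n+1)/2 - γ) r} φ(e^{-r}, y)`. -/
def collarWeight (γ : ℝ) (θ : Cutoff) {η : BoundaryChart n Y} (ψ : 𝓓(η.dom, ℝ)) :
    Euc (n + 1) → ℝ :=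
  fun v => Real.exp ((((n : ℝ) + 1) / 2 - γ) * v 0) * θ.toFun (Real.exp (-v 0)) * ψ (tailPt v)

section Space

variable [IsManifold (𝓡∂ (n + 1)) ∞ B] [IsManifold (𝓡 n) ∞ Y]

/-- The cone Sobolev space `H^{s,γ}_p(B)`: distributions `u ∈ H^s_{p,loc}` on the interior of `B`
such that `S_γ(θ u) ∈ H^s_p(ℝ × Y)` for every cut-off function `θ`, the latter space being defined
by localization in the charts `id × η` of `ℝ × Y`. -/
def coneSobolev (c : Collar n B Y) (s γ : ℝ) (p : ℝ≥0∞) [Fact (1 ≤ p)] :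
    Submodule ℂ (IntDistribution n B) where
  carrier := {u |
    (∀ (κ : InteriorChart n B) (χ : 𝓓(κ.dom, ℝ)), LocMem s p (u.1 κ) χ) ∧
    (∀ (θ : Cutoff) (η : BoundaryChart n Y) (ψ : 𝓓(η.dom, ℝ)),
      LocMem s p (u.1 (c.logChart η)) (collarWeight γ θ ψ))}
  zero_mem' := ⟨fun _ _ => LocMem.zero, fun _ _ _ => LocMem.zero⟩
  add_mem' hu hv := ⟨fun κ χ => (hu.1 κ χ).add (hv.1 κ χ),
    fun θ η ψ => (hu.2 θ η ψ).add (hv.2 θ η ψ)⟩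
  smul_mem' a _ hu := ⟨fun κ χ => (hu.1 κ χ).smul a, fun θ η ψ => (hu.2 θ η ψ).smul a⟩

/-- The choices that go into the definition of a norm on `H^{s,γ}_p(B)`: a cut-off function, finitely
many localized charts covering the boundary, and finitely many localized charts of the interior
covering the rest of `B`. -/
structure NormData (c : Collar n B Y) where
  /-- the cut-off function -/
  θ : Cutoff
  /-- the number of charts of the boundary -/
  k : ℕ
  /-- the charts of the boundary -/
  η : Fin k → BoundaryChart n Y
  /-- the localizing functions on the boundary -/
  ψ : ∀ i, 𝓓((η i).dom, ℝ)
  /-- the number of charts of the interior -/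
  l : ℕ
  /-- the charts of the interior -/
  κ : Fin l → InteriorChart n B
  /-- the localizing functions in the interior -/
  χ : ∀ j, 𝓓((κ j).dom, ℝ)
  cover_boundary : ∀ y : Y, ∃ i, y ∈ (η i).1.source ∧ ψ i ((η i).1 y) ≠ 0
  cover_interior : ∀ z ∈ (𝓡∂ (n + 1)).interior B,
    (∃ w ∈ c.toMap.source, c.toMap w = z ∧ θ.toFun (w.1.val 0) ≠ 0) ∨
    ∃ j, z ∈ (κ j).toChart.source ∧ χ j ((κ j).toChart z) ≠ 0

/-- The norm on `H^{s,γ}_p(B)`, which makes it a Banach space, for a choice of norm data; different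
choices yield equivalent norms. -/
def coneNorm {c : Collar n B Y} (N : NormData c) (s γ : ℝ) (p : ℝ≥0∞) [Fact (1 ≤ p)]
    (u : IntDistribution n B) : ℝ≥0∞ :=
  ∑ i, locNorm s p (u.1 (c.logChart (N.η i))) (collarWeight γ N.θ (N.ψ i)) +
  ∑ j, locNorm s p (u.1 (N.κ j)) (N.χ j)

end Space

end Manifold
end Cone
end

/-! Since `m` has weight (n+1)/2, the exponential factor of `collarWeight` is trivial for it. In the
coordinate r = -log x it is an unweighted H^{σ+(n+1)/q}_q function all the way to r = ∞, and the
weight γ is carried by u alone. The analysis is thus a statement on ℝ^d, d = n+1: elements of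
H^{σ+d/q}_q multiply H^s_p when |s| < σ.

No singular integral theory is used for this. By a Sobolev embedding (`exists_multSeq`) the
multiplier is a sum of smooth functions h_k whose derivatives of order i are bounded by C_i
2^{k(i-σ)} (`MultSeq`). Multiplication by h_k on H^s_p has norm at most C 2^{-kσ} 2^{k|s|}
(`exists_bilinear_bound`), so the series of operators converges geometrically because |s| < σ
(`MultSeq.exists_operator`).

Both ingredients rest on subordination. Write Λ^r for the Bessel potential with symbol
(1+|ξ|²)^{r/2}. Its symbol is an integral over t > 0 of expressions in exp(-t²(1+|ξ|²)), and a
Gaussian is a mean of phases. Hence Λ^{-r} is an average of translations, in particular a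
contraction of L^p, and for 0 < r < 1 the operator Λ^r is a superposition of differences between a
function and its damped translates. The commutator of Λ^r with h is then an average of products of
h(·+z) - h with translations (`commutator_eq`). If h oscillates at frequency L, these differences
are O(min(1, L|z|)), which costs L^r, and iteration gives L^{|s|}. For the embedding, Λ^{-(σ+d/q)} f
is a superposition of convolutions of f with Gaussians of width proportional to t. Hölder's
inequality loses t^{-d/q}, and restricting t to dyadic intervals yields the h_k.

On the manifold, the product sends a test function φ to the sum of u(h_k φ). By
`MultSeq.eq_of_hasSum` this does not depend on the decomposition, so it is compatible with changes
of charts; if u is a function it is the integral of the pointwise product. Boundedness for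
`coneNorm` holds localization by localization.

Uniqueness is a localized density argument. The difference D of two candidates is bounded and kills
every element that is a function. Around each point of B, boundary points included, there is a
smooth multiplier g, equal to 1 near the point, such that g u is a limit of functions
(`IsPiece.exists_approx`). So D(g u) = 0 and u may be replaced by (1-g)u. By compactness finitely
many such replacements produce an element that vanishes near every point, that is, zero
(`eq_zero_of_represents`). -/

noncomputable section

namespace Cone

/-! ### Bessel potentials of Schwartz functions -/

section Bessel

open FourierTransform ProbabilityTheory

variable {d : ℕ}

/-- The Bessel potential of order `s`, on Schwartz functions. -/
def bessel (s : ℝ) : 𝓢(Euc d, ℂ) →L[ℂ] 𝓢(Euc d, ℂ) :=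
  SchwartzMap.fourierMultiplierCLM ℂ (fun x ↦ (((1 + ‖x‖ ^ 2) ^ (s / 2) : ℝ) : ℂ))

@[simp] lemma bessel_zero (u : 𝓢(Euc d, ℂ)) : bessel 0 u = u := by
  simp [bessel]

lemma bessel_bessel (s t : ℝ) (u : 𝓢(Euc d, ℂ)) : bessel s (bessel t u) = bessel (s + t) u := by
  simp only [bessel]
  rw [SchwartzMap.fourierMultiplierCLM_fourierMultiplierCLM_apply (by fun_prop) (by fun_prop)]
  congr
  ext x
  simp only [Pi.mul_apply]
  norm_cast
  rw [← Real.rpow_add (by positivity)]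
  congr 1
  ring

lemma besselPotential_coe (s : ℝ) (u : 𝓢(Euc d, ℂ)) :
    TemperedDistribution.besselPotential (Euc d) ℂ s (u : 𝓢'(Euc d, ℂ)) =
      (bessel s u : 𝓢'(Euc d, ℂ)) :=
  TemperedDistribution.fourierMultiplierCLM_toTemperedDistributionCLM_eq (by fun_prop) u

lemma fourierMultiplierCLM_apply_eq_integral {g : Euc d → ℂ} (hg : g.HasTemperateGrowth)
    (u : 𝓢(Euc d, ℂ)) (x : Euc d) :
    SchwartzMap.fourierMultiplierCLM ℂ g u x =
      ∫ ξ, Complex.exp (2 * Real.pi * inner ℝ ξ x * Complex.I) * (g ξ * 𝓕 u ξ) := by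
  rw [SchwartzMap.fourierMultiplierCLM_apply, SchwartzMap.fourierInv_coe, Real.fourierInv_eq']
  simp [SchwartzMap.smulLeftCLM_apply_apply hg]

/-- Transposing a multiplier exchanges the Fourier transform and its inverse, which amounts to
reflecting the symbol. For an even symbol nothing changes, so Bessel potentials are their own
transposes for the bilinear (not sesquilinear) pairing. -/
lemma fourierMultiplierCLM_symm {g : Euc d → ℂ} (hg : g.HasTemperateGrowth)
    (he : ∀ x, g (-x) = g x) (u : 𝓢(Euc d, ℂ)) :
    𝓕 (SchwartzMap.smulLeftCLM ℂ g (𝓕⁻ u)) = SchwartzMap.fourierMultiplierCLM ℂ g u := by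
  ext x
  rw [fourierMultiplierCLM_apply_eq_integral hg, SchwartzMap.fourier_coe, Real.fourier_eq',
    ← integral_neg_eq_self]
  refine integral_congr_ae (Eventually.of_forall fun ξ => ?_)
  simp only [SchwartzMap.smulLeftCLM_apply_apply hg, he, smul_eq_mul]
  rw [SchwartzMap.fourierInv_apply_eq]
  simp

lemma besselPotential_apply (s : ℝ) (w : 𝓢'(Euc d, ℂ)) (φ : 𝓢(Euc d, ℂ)) :
    TemperedDistribution.besselPotential (Euc d) ℂ s w φ = w (bessel s φ) := by
  rw [TemperedDistribution.besselPotential, TemperedDistribution.fourierMultiplierCLM_apply_apply,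
    fourierMultiplierCLM_symm (by fun_prop) (by simp)]
  rfl

lemma integral_bessel_mul (s : ℝ) (u φ : 𝓢(Euc d, ℂ)) :
    ∫ x, bessel s u x * φ x = ∫ x, u x * bessel s φ x := by
  have h := besselPotential_apply s (u : 𝓢'(Euc d, ℂ)) φ
  rw [besselPotential_coe] at h
  simpa [mul_comm] using h

lemma bessel_apply (s : ℝ) (u : 𝓢(Euc d, ℂ)) (x : Euc d) :
    bessel s u x = ∫ ξ, Complex.exp (2 * Real.pi * inner ℝ ξ x * Complex.I) *
      ((((1 + ‖ξ‖ ^ 2) ^ (s / 2) : ℝ) : ℂ) * 𝓕 u ξ) :=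
  fourierMultiplierCLM_apply_eq_integral (by fun_prop) u x

/-- The translate `x ↦ u (x + z)` of a Schwartz function. -/
def translate (z : Euc d) : 𝓢(Euc d, ℂ) →L[ℂ] 𝓢(Euc d, ℂ) :=
  SchwartzMap.compSubConstCLM ℂ (-z)

@[simp] lemma translate_apply (z : Euc d) (u : 𝓢(Euc d, ℂ)) (x : Euc d) :
    translate z u x = u (x + z) := by
  simp [translate]

lemma fourier_translate (z : Euc d) (u : 𝓢(Euc d, ℂ)) (ξ : Euc d) :
    𝓕 (translate z u) ξ =
      Complex.exp (2 * Real.pi * inner ℝ ξ z * Complex.I) * 𝓕 u ξ := by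
  rw [SchwartzMap.fourier_coe, SchwartzMap.fourier_coe, Real.fourier_eq', Real.fourier_eq',
    ← integral_sub_right_eq_self _ z, ← integral_const_mul]
  refine integral_congr_ae (Eventually.of_forall fun x => ?_)
  simp only [translate_apply, sub_add_cancel, smul_eq_mul, ← mul_assoc, ← Complex.exp_add]
  congr 2
  rw [inner_sub_left, real_inner_comm z ξ]
  push_cast
  ring

/-- Used in the induction on the order, where the translate of a Bessel potential must again be a
Bessel potential of something with the same norm. -/
lemma bessel_translate (s : ℝ) (z : Euc d) (u : 𝓢(Euc d, ℂ)) :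
    bessel s (translate z u) = translate z (bessel s u) := by
  ext x
  rw [translate_apply, bessel_apply, bessel_apply]
  refine integral_congr_ae (Eventually.of_forall fun ξ => ?_)
  simp only [fourier_translate]
  rw [inner_add_right]
  push_cast
  rw [mul_add, add_mul, Complex.exp_add]
  ring

/-- The scale that makes `exp (-‖ξ‖²)` the Fourier transform of the Gaussian. -/
def gaussScale : ℝ := √2 / (2 * Real.pi)

lemma gaussScale_pos : 0 < gaussScale := by unfold gaussScale; positivity

/-- The characteristic function of the standard Gaussian at 2π t `gaussScale` ξ; the scale is chosen
so that half the square of 2π `gaussScale` is 1. -/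
lemma integral_exp_stdGaussian (t : ℝ) (ξ : Euc d) :
    ∫ y, Complex.exp (2 * Real.pi * inner ℝ ξ ((t * gaussScale) • y) * Complex.I)
      ∂(stdGaussian (Euc d)) = Complex.exp (-(t ^ 2 * ‖ξ‖ ^ 2 : ℝ)) := by
  have h := charFun_stdGaussian ((2 * Real.pi * (t * gaussScale)) • ξ)
  rw [charFun_apply] at h
  convert h using 3
  · congr 1
    rw [inner_smul_right, inner_smul_right, real_inner_comm]
    push_cast; ring
  · rw [norm_smul]
    have : ‖2 * Real.pi * (t * gaussScale)‖ ^ 2 = 2 * t ^ 2 := by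
      rw [Real.norm_eq_abs, sq_abs, gaussScale]
      field_simp
      rw [Real.sq_sqrt (by norm_num)]
      ring
    rw [← Complex.ofReal_pow, mul_pow, this]
    push_cast; ring

/-- The phase of the Fourier transform. -/
def phase (ξ z : Euc d) : ℂ := Complex.exp (2 * Real.pi * inner ℝ ξ z * Complex.I)

lemma norm_phase (ξ z : Euc d) : ‖phase ξ z‖ = 1 := by
  have : phase ξ z = Complex.exp ((2 * Real.pi * inner ℝ ξ z : ℝ) * Complex.I) := by
    simp [phase]
  rw [this, Complex.norm_exp_ofReal_mul_I]

lemma norm_one_sub_phase_le (ξ z : Euc d) : ‖1 - phase ξ z‖ ≤ 2 * Real.pi * (‖ξ‖ * ‖z‖) := by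
  have : phase ξ z = Complex.exp (Complex.I * (2 * Real.pi * inner ℝ ξ z : ℝ)) := by
    simp [phase, mul_comm]
  rw [this, norm_sub_rev]
  refine (Real.norm_exp_I_mul_ofReal_sub_one_le).trans ?_
  rw [norm_mul, Real.norm_of_nonneg (by positivity)]
  gcongr
  exact norm_inner_le_norm ξ z

lemma continuous_phase : Continuous (fun q : Euc d × Euc d => phase q.1 q.2) := by
  unfold phase
  fun_prop

lemma measurable_phase : Measurable (fun q : Euc d × Euc d => phase q.1 q.2) :=
  continuous_phase.measurable

lemma phase_add (ξ x z : Euc d) : phase ξ (x + z) = phase ξ x * phase ξ z := by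
  simp only [phase, ← Complex.exp_add, inner_add_right]
  push_cast; ring_nf

lemma eq_integral_phase (w : 𝓢(Euc d, ℂ)) (x : Euc d) :
    w x = ∫ ξ, phase ξ x * 𝓕 w ξ := by
  have := bessel_apply 0 w x
  simpa [phase] using this

/-- A Fourier multiplier whose symbol is a superposition of phases is the superposition of the
corresponding translations. -/
lemma fourierMultiplier_eq_integral_translate {S : Type*} [MeasurableSpace S] {μ : Measure S}
    [SFinite μ] {a b : S → ℂ} {z : S → Euc d} (ha : Measurable a) (hb : Measurable b)
    (hz : Measurable z) {M : S → ℝ} (hM : Integrable M μ)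
    (hab : ∀ᵐ t ∂μ, ∀ ξ, ‖a t - b t * phase ξ (z t)‖ ≤ (1 + ‖ξ‖) * M t)
    {g : Euc d → ℂ} (hg : g.HasTemperateGrowth)
    (hgi : ∀ ξ, g ξ = ∫ t, (a t - b t * phase ξ (z t)) ∂μ) (w : 𝓢(Euc d, ℂ)) (x : Euc d) :
    SchwartzMap.fourierMultiplierCLM ℂ g w x = ∫ t, (a t * w x - b t * w (x + z t)) ∂μ := by
  rw [fourierMultiplierCLM_apply_eq_integral hg]
  have hx := eq_integral_phase w
  generalize (𝓕 w : 𝓢(Euc d, ℂ)) = v at hx ⊢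
  have e1 : ∀ ξ, Complex.exp (2 * Real.pi * inner ℝ ξ x * Complex.I) * (g ξ * v ξ) =
      ∫ t, (phase ξ x * v ξ) * (a t - b t * phase ξ (z t)) ∂μ := by
    intro ξ
    rw [integral_const_mul, ← hgi, phase]
    ring
  simp_rw [e1]
  have hmeas : Measurable (fun q : Euc d × S => (phase q.1 x * v q.1) *
      (a q.2 - b q.2 * phase q.1 (z q.2))) := by
    have h1 := measurable_phase.comp
      (measurable_fst.prodMk measurable_const : Measurable (fun q : Euc d × S => (q.1, x)))
    have h2 := measurable_phase.comp
      (measurable_fst.prodMk (hz.comp measurable_snd) :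
        Measurable (fun q : Euc d × S => (q.1, z q.2)))
    have h3 : Measurable (fun q : Euc d × S => v q.1) :=
      v.continuous.measurable.comp measurable_fst
    exact (h1.mul h3).mul ((ha.comp measurable_snd).sub ((hb.comp measurable_snd).mul h2))
  -- The bound `hab` grows linearly in ξ; one moment of the Schwartz function `v`, which stands for
  -- the Fourier transform of `w`, pays for it in Fubini's theorem.
  have hw : Integrable (fun ξ => (1 + ‖ξ‖) * ‖v ξ‖) := by
    have h0 : Integrable (fun ξ => ‖v ξ‖) := v.integrable.norm
    have h1 : Integrable (fun ξ => ‖ξ‖ ^ 1 * ‖v ξ‖) := v.integrable_pow_mul volume 1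
    refine (h0.add h1).congr (Eventually.of_forall fun ξ => ?_)
    simp; ring
  have hint : Integrable (fun q : Euc d × S => (phase q.1 x * v q.1) *
      (a q.2 - b q.2 * phase q.1 (z q.2))) (volume.prod μ) := by
    refine (hw.mul_prod hM).mono' hmeas.aestronglyMeasurable ?_
    have := (Measure.quasiMeasurePreserving_snd (μ := (volume : Measure (Euc d)))).ae hab
    filter_upwards [this] with q hq
    rw [norm_mul, norm_mul, norm_phase, one_mul]
    calc _ ≤ ‖v q.1‖ * ((1 + ‖q.1‖) * M q.2) := by gcongr; exact hq q.1
      _ = _ := by ring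
  rw [integral_integral_swap hint]
  refine integral_congr_ae (Eventually.of_forall fun t => ?_)
  simp only
  rw [hx x, hx (x + z t), ← integral_const_mul,
    ← integral_const_mul, ← integral_sub]
  · refine integral_congr_ae (Eventually.of_forall fun ξ => ?_)
    simp only [phase_add]; ring
  · refine Integrable.const_mul (Integrable.mono' v.integrable.norm ?_ ?_) _
    · exact ((continuous_phase.comp (continuous_id.prodMk continuous_const)).mul
        v.continuous).aestronglyMeasurable
    · exact Eventually.of_forall fun ξ => by simp [norm_phase]
  · refine Integrable.const_mul (Integrable.mono' v.integrable.norm ?_ ?_) _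
    · exact ((continuous_phase.comp (continuous_id.prodMk continuous_const)).mul
        v.continuous).aestronglyMeasurable
    · exact Eventually.of_forall fun ξ => by simp [norm_phase]

attribute [irreducible] bessel

end Bessel

/-! ### Duality of L^p and L^p', tested on Schwartz functions -/

section Duality

variable {d : ℕ} {p p' : ℝ≥0∞} [Fact (1 ≤ p)] [Fact (1 ≤ p')] [hpp : ENNReal.HolderConjugate p p']

/-- The pairing of `L^p` and `L^p'`. -/
def lpPair (p p' : ℝ≥0∞) [Fact (1 ≤ p)] [Fact (1 ≤ p')] [ENNReal.HolderConjugate p p'] :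
    Lp ℂ p (volume : Measure (Euc d)) →L[ℂ] Lp ℂ p' (volume : Measure (Euc d)) →L[ℂ] ℂ :=
  (ContinuousLinearMap.mul ℂ ℂ).lpPairing volume p p'

lemma lpPair_apply (f : Lp ℂ p (volume : Measure (Euc d))) (g : Lp ℂ p' (volume : Measure (Euc d))) :
    lpPair p p' f g = ∫ x, f x * g x := by
  simp [lpPair, ContinuousLinearMap.lpPairing_eq_integral]

lemma norm_lpPair_le (f : Lp ℂ p (volume : Measure (Euc d)))
    (g : Lp ℂ p' (volume : Measure (Euc d))) : ‖lpPair p p' f g‖ ≤ ‖f‖ * ‖g‖ := by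
  have h := (ContinuousLinearMap.mul ℂ ℂ).norm_holder_apply_apply_le (r := 1) f g
  have e : lpPair p p' f g = ∫ x, ((ContinuousLinearMap.mul ℂ ℂ).holder 1 f g) x := by
    rw [lpPair_apply]
    exact integral_congr_ae ((ContinuousLinearMap.mul ℂ ℂ).coeFn_holder f g).symm
  rw [e]
  refine (norm_integral_le_integral_norm _).trans ?_
  rw [← L1.norm_eq_integral_norm]
  refine h.trans ?_
  gcongr
  exact (mul_le_of_le_one_left (norm_nonneg _) (ContinuousLinearMap.opNorm_mul_le ℂ ℂ))

lemma lpPair_toLp (f : Lp ℂ p (volume : Measure (Euc d))) (φ : 𝓢(Euc d, ℂ)) :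
    lpPair p p' f (φ.toLp p') = ∫ x, f x * φ x := by
  rw [lpPair_apply]
  refine integral_congr_ae ?_
  filter_upwards [φ.coeFn_toLp p' volume] with x hx
  rw [hx]

lemma lpPair_toLp_toLp (u φ : 𝓢(Euc d, ℂ)) :
    lpPair p p' (u.toLp p) (φ.toLp p') = ∫ x, u x * φ x := by
  rw [lpPair_toLp]
  refine integral_congr_ae ?_
  filter_upwards [u.coeFn_toLp p volume] with x hx
  rw [hx]

lemma coe_Lp_apply (f : Lp ℂ p (volume : Measure (Euc d))) (φ : 𝓢(Euc d, ℂ)) :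
    (f : 𝓢'(Euc d, ℂ)) φ = lpPair p p' f (φ.toLp p') := by
  rw [lpPair_toLp, Lp.toTemperedDistribution_apply]
  simp [mul_comm]

/-- The extremal function for Hölder's inequality is g = |f|^{P-2} times the conjugate of f: the
pairing is then ‖f‖^P, while ‖g‖ = ‖f‖^{P-1} because p'(P-1) = p. -/
lemma norm_le_of_lpPair_le (hp : p < ⊤) (hp1 : 1 < p) (f : Lp ℂ p (volume : Measure (Euc d)))
    {C : ℝ} (hC : 0 ≤ C) (h : ∀ g : Lp ℂ p' (volume : Measure (Euc d)), ‖lpPair p p' f g‖ ≤ C * ‖g‖) :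
    ‖f‖ ≤ C := by
  have hp' : p' ≠ ⊤ := by
    have : p' < ⊤ := (ENNReal.HolderConjugate.lt_top_iff_one_lt p' p).2 hp1
    exact this.ne
  have hp0 : p ≠ 0 := (zero_lt_one.trans hp1).ne'
  set P := p.toReal with hP
  have hP1 : 1 < P := by
    rw [hP, ← ENNReal.toReal_one]
    exact (ENNReal.toReal_lt_toReal ENNReal.one_ne_top hp.ne).2 hp1
  have hmul : p' * ENNReal.ofReal (P - 1) = p := by
    have h1 := ENNReal.HolderConjugate.sub_one_mul_inv p p' hp.ne
    have h2 : ENNReal.ofReal (P - 1) = p - 1 := by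
      rw [ENNReal.ofReal_sub _ zero_le_one, ENNReal.ofReal_one, hP, ENNReal.ofReal_toReal hp.ne]
    have h0 : p' ≠ 0 := ENNReal.HolderConjugate.ne_zero p' p
    rw [h2]
    calc p' * (p - 1) = p' * ((p - 1) * (p⁻¹ * p)) := by
          rw [ENNReal.inv_mul_cancel hp0 hp.ne, mul_one]
      _ = p' * (((p - 1) * p⁻¹) * p) := by rw [mul_assoc]
      _ = (p' * p'⁻¹) * p := by rw [h1, mul_assoc]
      _ = p := by rw [ENNReal.mul_inv_cancel h0 hp', one_mul]
  have hf := Lp.memLp f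
  set g : Euc d → ℂ := fun x => ((‖f x‖ ^ (P - 2) : ℝ) : ℂ) * (starRingEnd ℂ) (f x) with hg
  have hgn : ∀ x, ‖g x‖ = ‖f x‖ ^ (P - 1) := by
    intro x
    simp only [hg, norm_mul, Complex.norm_real, RCLike.norm_conj]
    rw [Real.norm_of_nonneg (by positivity)]
    rcases (norm_nonneg (f x)).eq_or_lt with h0 | h0
    · rw [← h0, Real.zero_rpow (sub_pos.2 hP1).ne', mul_zero]
    · nth_rewrite 2 [← Real.rpow_one ‖f x‖]
      rw [← Real.rpow_add h0]
      congr 1; ring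
  have hfg : ∀ x, f x * g x = ((‖f x‖ ^ P : ℝ) : ℂ) := by
    intro x
    have : f x * g x = ((‖f x‖ ^ (P - 2) : ℝ) : ℂ) * (f x * (starRingEnd ℂ) (f x)) := by
      simp only [hg]; ring
    rw [this, Complex.mul_conj, Complex.normSq_eq_norm_sq, ← Complex.ofReal_mul]
    congr 1
    rcases (norm_nonneg (f x)).eq_or_lt with h0 | h0
    · rw [← h0, Real.zero_rpow (by linarith : P ≠ 0)]; simp
    · rw [← Real.rpow_natCast, ← Real.rpow_add h0]
      congr 1; push_cast; ring
  have hgm : AEStronglyMeasurable g volume := by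
    have h1 := hf.1.norm.aemeasurable.pow_const (P - 2)
    have h2 := Complex.measurable_ofReal.comp_aemeasurable h1
    exact (h2.mul (Complex.continuous_conj.measurable.comp_aemeasurable
      hf.1.aemeasurable)).aestronglyMeasurable
  have hgnorm : eLpNorm g p' volume = eLpNorm f p volume ^ (P - 1) := by
    rw [← eLpNorm_norm g]
    simp_rw [hgn]
    rw [eLpNorm_norm_rpow _ (by linarith), hmul]
  have hgL : MemLp g p' volume := ⟨hgm, by
    rw [hgnorm]; exact ENNReal.rpow_lt_top_of_nonneg (by linarith) hf.2.ne⟩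
  have h1 := h (hgL.toLp g)
  have h2 : lpPair p p' f (hgL.toLp g) = ((‖f‖ ^ P : ℝ) : ℂ) := by
    rw [lpPair_apply]
    have : ∫ x, f x * (hgL.toLp g) x = ∫ x, ((‖f x‖ ^ P : ℝ) : ℂ) := by
      refine integral_congr_ae ?_
      filter_upwards [hgL.coeFn_toLp] with x hx
      rw [hx, hfg]
    rw [this, integral_complex_ofReal]
    congr 1
    rw [Lp.norm_def, hf.eLpNorm_eq_integral_rpow_norm hp0 hp.ne, ENNReal.toReal_ofReal
      (by positivity), ← Real.rpow_mul (by positivity), ← hP, inv_mul_cancel₀ (by linarith),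
      Real.rpow_one]
  have h3 : ‖hgL.toLp g‖ = ‖f‖ ^ (P - 1) := by
    rw [Lp.norm_toLp, hgnorm, ← ENNReal.toReal_rpow, Lp.norm_def]
  rw [h2, h3, Complex.norm_real, Real.norm_of_nonneg (by positivity)] at h1
  rcases (norm_nonneg f).eq_or_lt with h0 | h0
  · rwa [← h0]
  · have : ‖f‖ ^ P = ‖f‖ * ‖f‖ ^ (P - 1) := by
      nth_rewrite 2 [← Real.rpow_one ‖f‖]
      rw [← Real.rpow_add h0]
      congr 1; ring
    rw [this] at h1
    exact le_of_mul_le_mul_right h1 (by positivity)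

/-- The norm of `L^p` is determined by the pairing with Schwartz functions. -/
lemma norm_le_of_integral_le (hp : p < ⊤) (hp1 : 1 < p) (f : Lp ℂ p (volume : Measure (Euc d)))
    {C : ℝ} (hC : 0 ≤ C) (h : ∀ φ : 𝓢(Euc d, ℂ), ‖∫ x, f x * φ x‖ ≤ C * ‖φ.toLp p'‖) :
    ‖f‖ ≤ C := by
  have hp' : p' ≠ ⊤ := by
    have : p' < ⊤ := (ENNReal.HolderConjugate.lt_top_iff_one_lt p' p).2 hp1
    exact this.ne
  refine norm_le_of_lpPair_le (p' := p') hp hp1 f hC fun g => ?_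
  refine (SchwartzMap.denseRange_toLpCLM (F := ℂ) (E := Euc d) (μ := volume) hp').induction_on
    (p := fun g => ‖lpPair p p' f g‖ ≤ C * ‖g‖) g ?_ fun φ => ?_
  · exact isClosed_le (by fun_prop) (by fun_prop)
  · have := h φ
    rwa [← lpPair_toLp (p' := p')] at this

attribute [irreducible] lpPair

end Duality

/-! ### Subordination: Bessel potentials as superpositions of translations -/

section Subordination

open FourierTransform ProbabilityTheory

variable {d : ℕ}

/-- The product of the Lebesgue measure of `]0,∞[` and of the Gaussian measure. -/
def subMeasure (d : ℕ) : Measure (ℝ × Euc d) :=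
  (volume.restrict (Ioi 0)).prod (stdGaussian (Euc d))

instance : SFinite (subMeasure d) := by unfold subMeasure; infer_instance

/-- The translations occurring in the subordination formulas. -/
def subShift (ε : ℝ) (q : ℝ × Euc d) : Euc d := (ε * q.1 * gaussScale) • q.2

lemma continuous_subShift (ε : ℝ) : Continuous (subShift (d := d) ε) := by
  unfold subShift; fun_prop

lemma norm_subShift {ε : ℝ} (hε : |ε| = 1) {q : ℝ × Euc d} (hq : 0 < q.1) :
    ‖subShift ε q‖ = gaussScale * q.1 * ‖q.2‖ := by
  rw [subShift, norm_smul, norm_mul, norm_mul, Real.norm_eq_abs, hε,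
    Real.norm_of_nonneg gaussScale_pos.le, Real.norm_of_nonneg hq.le]
  ring

lemma ae_subMeasure_pos : ∀ᵐ q ∂(subMeasure d), 0 < q.1 := by
  have : ∀ᵐ t ∂(volume.restrict (Ioi (0 : ℝ))), 0 < t := ae_restrict_mem measurableSet_Ioi
  exact (Measure.quasiMeasurePreserving_fst (ν := stdGaussian (Euc d))).ae this

lemma integrable_norm_stdGaussian : Integrable (fun y : Euc d => 1 + ‖y‖) (stdGaussian (Euc d)) :=
  (integrable_const 1).add (IsGaussian.integrable_id (μ := stdGaussian (Euc d))).norm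

/-- Near 0 the integrand is t^{-r}, integrable since r < 1; near infinity it is t^{-r-1}, integrable
since r > 0. -/
lemma integrableOn_rpow_mul_min {r : ℝ} (hr : 0 < r) (hr1 : r < 1) :
    IntegrableOn (fun t : ℝ => t ^ (-r - 1) * min 1 t) (Ioi 0) := by
  rw [← Ioc_union_Ioi_eq_Ioi zero_le_one]
  refine IntegrableOn.union ?_ ?_
  · have : IntegrableOn (fun t : ℝ => t ^ (-r)) (Ioc 0 1) := by
      rw [← intervalIntegrable_iff_integrableOn_Ioc_of_le zero_le_one]
      exact intervalIntegral.intervalIntegrable_rpow' (by linarith)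
    refine this.congr_fun (fun t ht => ?_) measurableSet_Ioc
    simp only
    rw [min_eq_right ht.2]
    nth_rewrite 3 [← Real.rpow_one t]
    rw [← Real.rpow_add ht.1]
    congr 1; ring
  · have : IntegrableOn (fun t : ℝ => t ^ (-r - 1)) (Ioi 1) :=
      integrableOn_Ioi_rpow_of_lt (by linarith) zero_lt_one
    refine this.congr_fun (fun t ht => ?_) measurableSet_Ioi
    simp only
    rw [min_eq_left (mem_Ioi.1 ht).le, mul_one]

lemma one_sub_exp_neg_sq_le {t : ℝ} (ht : 0 ≤ t) : 1 - Real.exp (-t ^ 2) ≤ min 1 t := by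
  have h1 : 1 - Real.exp (-t ^ 2) ≤ 1 := by linarith [Real.exp_pos (-t ^ 2)]
  refine le_min h1 ?_
  rcases le_total t 1 with h | h
  · have := Real.add_one_le_exp (-t ^ 2)
    nlinarith
  · linarith

/-- The constant in the subordination formula for positive fractional powers. -/
def subConst (r : ℝ) : ℝ := ∫ t in Ioi (0 : ℝ), t ^ (-r - 1) * (1 - Real.exp (-t ^ 2))

lemma integrableOn_subConst {r : ℝ} (hr : 0 < r) (hr1 : r < 1) :
    IntegrableOn (fun t : ℝ => t ^ (-r - 1) * (1 - Real.exp (-t ^ 2))) (Ioi 0) := by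
  refine (integrableOn_rpow_mul_min hr hr1).mono' ?_ ?_
  · exact (by fun_prop : Measurable fun t : ℝ =>
      t ^ (-r - 1) * (1 - Real.exp (-t ^ 2))).aestronglyMeasurable
  · filter_upwards [ae_restrict_mem measurableSet_Ioi] with t ht
    have ht' : 0 < t := ht
    have h0 : 0 ≤ 1 - Real.exp (-t ^ 2) := by
      rw [sub_nonneg, Real.exp_le_one_iff]
      have := sq_nonneg t
      linarith
    rw [Real.norm_of_nonneg (mul_nonneg (by positivity) h0)]
    gcongr
    exact one_sub_exp_neg_sq_le ht'.le

lemma subConst_pos {r : ℝ} (hr : 0 < r) (hr1 : r < 1) : 0 < subConst r := by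
  rw [subConst, setIntegral_pos_iff_support_of_nonneg_ae _ (integrableOn_subConst hr hr1)]
  · have : Ioi (0 : ℝ) ⊆ Function.support
        (fun t : ℝ => t ^ (-r - 1) * (1 - Real.exp (-t ^ 2))) ∩ Ioi 0 := by
      intro t ht
      have ht' : 0 < t := ht
      refine ⟨?_, ht⟩
      have h1 : Real.exp (-t ^ 2) < 1 := by rw [Real.exp_lt_one_iff]; nlinarith
      exact (mul_pos (by positivity) (by linarith)).ne'
    exact lt_of_lt_of_le (by simp) (measure_mono this)
  · filter_upwards [ae_restrict_mem measurableSet_Ioi] with t ht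
    have ht' : 0 < t := ht
    have h0 : 0 ≤ 1 - Real.exp (-t ^ 2) := by
      rw [sub_nonneg, Real.exp_le_one_iff]
      have := sq_nonneg t
      linarith
    exact mul_nonneg (by positivity) h0

/-- Homogeneity: substitute Xt for t. With X² = 1+|ξ|² this expresses the symbol of Λ^r through
Gaussians. -/
lemma integral_subConst {r X : ℝ} (hX : 0 < X) :
    ∫ t in Ioi (0 : ℝ), t ^ (-r - 1) * (1 - Real.exp (-(t ^ 2 * X ^ 2))) = X ^ r * subConst r := by
  have h := integral_comp_mul_left_Ioi
    (fun t : ℝ => t ^ (-r - 1) * (1 - Real.exp (-t ^ 2))) 0 hX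
  rw [mul_zero] at h
  have h2 : ∫ t in Ioi (0 : ℝ), t ^ (-r - 1) * (1 - Real.exp (-(t ^ 2 * X ^ 2))) =
      X ^ (r + 1) * ∫ t in Ioi (0 : ℝ), (X * t) ^ (-r - 1) * (1 - Real.exp (-(X * t) ^ 2)) := by
    rw [← integral_const_mul]
    refine setIntegral_congr_fun measurableSet_Ioi fun t ht => ?_
    have ht' : 0 < t := ht
    rw [Real.mul_rpow hX.le ht'.le, ← mul_assoc, ← mul_assoc, ← Real.rpow_add hX, mul_pow]
    have : r + 1 + (-r - 1) = 0 := by ring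
    rw [this, Real.rpow_zero, one_mul, mul_comm (X ^ 2)]
  rw [h2, h, smul_eq_mul, subConst, Real.rpow_add hX, Real.rpow_one]
  field_simp

/-- The constant in the subordination formula for negative fractional powers. -/
def subConstNeg (r : ℝ) : ℝ := ∫ t in Ioi (0 : ℝ), t ^ (r - 1) * Real.exp (-t ^ 2)

lemma integrableOn_subConstNeg {r : ℝ} (hr : 0 < r) :
    IntegrableOn (fun t : ℝ => t ^ (r - 1) * Real.exp (-t ^ 2)) (Ioi 0) := by
  simpa using integrableOn_rpow_mul_exp_neg_mul_sq (b := 1) one_pos (s := r - 1) (by linarith)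

lemma subConstNeg_pos {r : ℝ} (hr : 0 < r) : 0 < subConstNeg r := by
  rw [subConstNeg, setIntegral_pos_iff_support_of_nonneg_ae _ (integrableOn_subConstNeg hr)]
  · have : Ioi (0 : ℝ) ⊆ Function.support
        (fun t : ℝ => t ^ (r - 1) * Real.exp (-t ^ 2)) ∩ Ioi 0 := by
      intro t ht
      have ht' : 0 < t := ht
      exact ⟨(mul_pos (by positivity) (Real.exp_pos _)).ne', ht⟩
    exact lt_of_lt_of_le (by simp) (measure_mono this)
  · filter_upwards [ae_restrict_mem measurableSet_Ioi] with t ht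
    have ht' : 0 < t := ht
    exact mul_nonneg (by positivity) (Real.exp_pos _).le

lemma integral_subConstNeg {r X : ℝ} (hX : 0 < X) :
    ∫ t in Ioi (0 : ℝ), t ^ (r - 1) * Real.exp (-(t ^ 2 * X ^ 2)) = X ^ (-r) * subConstNeg r := by
  have h := integral_comp_mul_left_Ioi
    (fun t : ℝ => t ^ (r - 1) * Real.exp (-t ^ 2)) 0 hX
  rw [mul_zero] at h
  have h2 : ∫ t in Ioi (0 : ℝ), t ^ (r - 1) * Real.exp (-(t ^ 2 * X ^ 2)) =
      X ^ (-r + 1) * ∫ t in Ioi (0 : ℝ), (X * t) ^ (r - 1) * Real.exp (-(X * t) ^ 2) := by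
    rw [← integral_const_mul]
    refine setIntegral_congr_fun measurableSet_Ioi fun t ht => ?_
    have ht' : 0 < t := ht
    rw [Real.mul_rpow hX.le ht'.le, ← mul_assoc, ← mul_assoc, ← Real.rpow_add hX, mul_pow]
    have : -r + 1 + (r - 1) = 0 := by ring
    rw [this, Real.rpow_zero, one_mul, mul_comm (X ^ 2)]
  rw [h2, h, smul_eq_mul, subConstNeg, Real.rpow_add hX, Real.rpow_one]
  field_simp

lemma phase_subShift_integral (ε : ℝ) (t : ℝ) (ξ : Euc d) :
    ∫ y, phase ξ (subShift ε (t, y)) ∂(stdGaussian (Euc d)) =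
      ((Real.exp (-((ε * t) ^ 2 * ‖ξ‖ ^ 2)) : ℝ) : ℂ) := by
  have := integral_exp_stdGaussian (ε * t) ξ
  simpa [phase, subShift] using this

lemma measurable_phase_subShift (ε : ℝ) (ξ : Euc d) :
    Measurable (fun q : ℝ × Euc d => phase ξ (subShift ε q)) := by
  have h := measurable_phase.comp (measurable_const.prodMk (continuous_subShift ε).measurable :
    Measurable (fun q : ℝ × Euc d => (ξ, subShift ε q)))
  exact h

lemma one_add_norm_sq_rpow (ξ : Euc d) (r : ℝ) :
    (1 + ‖ξ‖ ^ 2) ^ (r / 2) = √(1 + ‖ξ‖ ^ 2) ^ r := by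
  rw [Real.sqrt_eq_rpow, ← Real.rpow_mul (by positivity)]
  congr 1; ring

/-- The density in the subordination formula for negative fractional powers. -/
def subDensity (r : ℝ) (q : ℝ × Euc d) : ℝ := (subConstNeg r)⁻¹ * (q.1 ^ (r - 1) * Real.exp (-q.1 ^ 2))

lemma measurable_subDensity (r : ℝ) : Measurable (subDensity (d := d) r) := by
  unfold subDensity; fun_prop

lemma integrable_subDensity {r : ℝ} (hr : 0 < r) :
    Integrable (subDensity (d := d) r) (subMeasure d) := by
  have h := (Integrable.mul_prod (integrableOn_subConstNeg hr)
    (integrable_const (1 : ℝ) : Integrable _ (stdGaussian (Euc d)))).const_mul (subConstNeg r)⁻¹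
  simp only [mul_one] at h
  exact h

lemma subDensity_nonneg {r : ℝ} (hr : 0 < r) :
    ∀ᵐ q ∂(subMeasure d), 0 ≤ subDensity r q := by
  filter_upwards [ae_subMeasure_pos] with q hq
  have := subConstNeg_pos hr
  unfold subDensity
  positivity

/-- The total mass one is what makes the Bessel potentials of negative order contractions, rather
than merely bounded. -/
lemma integral_subDensity {r : ℝ} (hr : 0 < r) : ∫ q, subDensity r q ∂(subMeasure d) = 1 := by
  rw [subMeasure, integral_prod _ (integrable_subDensity hr)]
  simp only [subDensity, integral_const, probReal_univ, smul_eq_mul, one_mul]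
  rw [integral_const_mul, ← subConstNeg, inv_mul_cancel₀ (subConstNeg_pos hr).ne']

/-- In exp(-t²(1+|ξ|²)) the factor exp(-t²) goes into the density, and exp(-t²|ξ|²) is the Gaussian
mean of the phases of the shifts. The symbol is thus an average of phases, so the operator is an
average of translations. -/
lemma bessel_neg_apply {r : ℝ} (hr : 0 < r) (w : 𝓢(Euc d, ℂ)) (x : Euc d) :
    bessel (-r) w x = ∫ q, (subDensity r q : ℂ) * w (x + subShift 1 q) ∂(subMeasure d) := by
  have hb : Measurable (fun q : ℝ × Euc d => -(subDensity r q : ℂ)) :=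
    (Complex.measurable_ofReal.comp (measurable_subDensity r)).neg
  have hbound : ∀ᵐ q ∂(subMeasure d), ∀ ξ,
      ‖(0 : ℂ) - -(subDensity r q : ℂ) * phase ξ (subShift 1 q)‖ ≤ (1 + ‖ξ‖) * subDensity r q := by
    filter_upwards [subDensity_nonneg hr] with q hq ξ
    simp only [zero_sub, neg_mul, neg_neg, norm_mul, norm_phase, mul_one, Complex.norm_real,
      Real.norm_of_nonneg hq]
    nlinarith [norm_nonneg ξ]
  have hint : ∀ ξ, Integrable (fun q : ℝ × Euc d => (subDensity r q : ℂ) *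
      phase ξ (subShift 1 q)) (subMeasure d) := by
    intro ξ
    refine ((integrable_subDensity hr).const_mul (1 + ‖ξ‖)).mono' ?_ ?_
    · exact ((Complex.measurable_ofReal.comp (measurable_subDensity r)).mul
        (measurable_phase_subShift 1 ξ)).aestronglyMeasurable
    · filter_upwards [hbound] with q hq
      simpa using hq ξ
  have := fourierMultiplier_eq_integral_translate (μ := subMeasure d) (a := fun _ => 0)
    (b := fun q => -(subDensity r q : ℂ)) (z := subShift 1) measurable_const hb
    (continuous_subShift 1).measurable (integrable_subDensity hr) hbound
    (g := fun x => (((1 + ‖x‖ ^ 2) ^ (-r / 2) : ℝ) : ℂ)) (by fun_prop) ?_ w x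
  · simpa [bessel] using this
  · intro ξ
    simp only [zero_sub, neg_mul, neg_neg]
    have hi := hint ξ
    rw [subMeasure] at hi ⊢
    rw [integral_prod _ hi]
    have e : ∀ t : ℝ, ∫ y, (subDensity r (t, y) : ℂ) * phase ξ (subShift 1 (t, y))
        ∂(stdGaussian (Euc d)) = (((subConstNeg r)⁻¹ *
          (t ^ (r - 1) * Real.exp (-(t ^ 2 * √(1 + ‖ξ‖ ^ 2) ^ 2))) : ℝ) : ℂ) := by
      intro t
      simp only [subDensity]
      rw [integral_const_mul, phase_subShift_integral, ← Complex.ofReal_mul,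
        Real.sq_sqrt (by positivity), mul_assoc, mul_assoc, ← Real.exp_add]
      ring_nf
    simp_rw [e]
    rw [integral_complex_ofReal, integral_const_mul, integral_subConstNeg (by positivity),
      one_add_norm_sq_rpow]
    have := (subConstNeg_pos hr).ne'
    field_simp

/-- The singularity t^{-r-1} at 0 is compensated by a difference. Once the Gaussian is spread into
phases, this difference is only O(t) near 0 and not O(t²), which is why r < 1 is imposed. -/
lemma bessel_pos_bound {r : ℝ} (hr : 0 < r) (hr1 : r < 1) {ε : ℝ} (hε : |ε| = 1) :
    ∀ᵐ q ∂(subMeasure d), ∀ ξ, ‖(((subConst r)⁻¹ * q.1 ^ (-r - 1) : ℝ) : ℂ) -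
      (((subConst r)⁻¹ * q.1 ^ (-r - 1) * Real.exp (-q.1 ^ 2) : ℝ) : ℂ) * phase ξ (subShift ε q)‖ ≤
      (1 + ‖ξ‖) * ((subConst r)⁻¹ * (3 + 2 * Real.pi * gaussScale) *
        ((q.1 ^ (-r - 1) * min 1 q.1) * (1 + ‖q.2‖))) := by
  filter_upwards [ae_subMeasure_pos] with q hq ξ
  have hc := subConst_pos hr hr1
  have hs := gaussScale_pos
  set t := q.1
  have hm : 0 < min 1 t := lt_min one_pos hq
  have h1 : ‖(1 : ℂ) - (Real.exp (-t ^ 2) : ℝ) * phase ξ (subShift ε q)‖ ≤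
      min 1 t + ‖1 - phase ξ (subShift ε q)‖ := by
    have : (1 : ℂ) - (Real.exp (-t ^ 2) : ℝ) * phase ξ (subShift ε q) =
        ((1 - Real.exp (-t ^ 2) : ℝ) : ℂ) * phase ξ (subShift ε q) +
          (1 - phase ξ (subShift ε q)) := by push_cast; ring
    rw [this]
    refine (norm_add_le _ _).trans ?_
    rw [norm_mul, norm_phase, mul_one, Complex.norm_real, Real.norm_of_nonneg]
    · gcongr
      exact one_sub_exp_neg_sq_le hq.le
    · rw [sub_nonneg, Real.exp_le_one_iff]
      have := sq_nonneg t
      linarith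
  have h2 : ‖1 - phase ξ (subShift ε q)‖ ≤
      min 1 t * (2 + 2 * Real.pi * gaussScale * (‖ξ‖ * ‖q.2‖)) := by
    have ha : ‖1 - phase ξ (subShift ε q)‖ ≤ 2 := by
      refine (norm_sub_le _ _).trans ?_
      rw [norm_phase, norm_one]; norm_num
    have hb := norm_one_sub_phase_le ξ (subShift ε q)
    rw [norm_subShift hε hq] at hb
    have hn : 0 ≤ 2 * Real.pi * gaussScale * (‖ξ‖ * ‖q.2‖) := by positivity
    rcases le_total 1 t with h | h
    · rw [min_eq_left h]; linarith
    · rw [min_eq_right h]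
      calc _ ≤ _ := hb
        _ = t * (2 * Real.pi * gaussScale * (‖ξ‖ * ‖q.2‖)) := by simp only [t]; ring
        _ ≤ _ := by gcongr; linarith
  have e : (((subConst r)⁻¹ * t ^ (-r - 1) : ℝ) : ℂ) -
      (((subConst r)⁻¹ * t ^ (-r - 1) * Real.exp (-t ^ 2) : ℝ) : ℂ) * phase ξ (subShift ε q) =
      (((subConst r)⁻¹ * t ^ (-r - 1) : ℝ) : ℂ) *
        ((1 : ℂ) - (Real.exp (-t ^ 2) : ℝ) * phase ξ (subShift ε q)) := by push_cast; ring
  rw [e, norm_mul, Complex.norm_real, Real.norm_of_nonneg (by positivity)]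
  have h3 : min 1 t + ‖1 - phase ξ (subShift ε q)‖ ≤
      min 1 t * ((1 + ‖ξ‖) * (3 + 2 * Real.pi * gaussScale) * (1 + ‖q.2‖)) := by
    refine (add_le_add_right h2 _).trans ?_
    rw [← mul_one_add]
    gcongr
    have hn : 0 ≤ 2 * Real.pi * gaussScale := by positivity
    nlinarith [norm_nonneg ξ, norm_nonneg q.2, mul_nonneg (norm_nonneg ξ) (norm_nonneg q.2),
      mul_nonneg hn (norm_nonneg q.2), mul_nonneg hn (norm_nonneg ξ)]
  calc _ ≤ (subConst r)⁻¹ * t ^ (-r - 1) *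
        (min 1 t * ((1 + ‖ξ‖) * (3 + 2 * Real.pi * gaussScale) * (1 + ‖q.2‖))) := by
        gcongr
        exact h1.trans h3
    _ = _ := by ring

lemma integrable_subMajorant {r : ℝ} (hr : 0 < r) (hr1 : r < 1) :
    Integrable (fun q : ℝ × Euc d => (q.1 ^ (-r - 1) * min 1 q.1) * (1 + ‖q.2‖))
      (subMeasure d) :=
  Integrable.mul_prod (integrableOn_rpow_mul_min hr hr1) integrable_norm_stdGaussian

/-- Both signs of ε are available because the Gaussian is symmetric. The commutator formula uses one
sign for each of its two functions. -/
lemma bessel_pos_apply {r : ℝ} (hr : 0 < r) (hr1 : r < 1) {ε : ℝ} (hε : |ε| = 1)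
    (w : 𝓢(Euc d, ℂ)) (x : Euc d) :
    bessel r w x = ∫ q, ((((subConst r)⁻¹ * q.1 ^ (-r - 1) : ℝ) : ℂ) * w x -
      (((subConst r)⁻¹ * q.1 ^ (-r - 1) * Real.exp (-q.1 ^ 2) : ℝ) : ℂ) * w (x + subShift ε q))
        ∂(subMeasure d) := by
  have hM := (integrable_subMajorant (d := d) hr hr1).const_mul
    ((subConst r)⁻¹ * (3 + 2 * Real.pi * gaussScale))
  have hbound := bessel_pos_bound (d := d) hr hr1 hε
  have ha : Measurable (fun q : ℝ × Euc d => (((subConst r)⁻¹ * q.1 ^ (-r - 1) : ℝ) : ℂ)) :=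
    Complex.measurable_ofReal.comp (by fun_prop)
  have hb : Measurable (fun q : ℝ × Euc d =>
      (((subConst r)⁻¹ * q.1 ^ (-r - 1) * Real.exp (-q.1 ^ 2) : ℝ) : ℂ)) :=
    Complex.measurable_ofReal.comp (by fun_prop)
  have hint : ∀ ξ, Integrable (fun q : ℝ × Euc d => (((subConst r)⁻¹ * q.1 ^ (-r - 1) : ℝ) : ℂ) -
      (((subConst r)⁻¹ * q.1 ^ (-r - 1) * Real.exp (-q.1 ^ 2) : ℝ) : ℂ) *
        phase ξ (subShift ε q)) (subMeasure d) := by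
    intro ξ
    refine (hM.const_mul (1 + ‖ξ‖)).mono' ?_ ?_
    · exact (ha.sub (hb.mul (measurable_phase_subShift ε ξ))).aestronglyMeasurable
    · filter_upwards [hbound] with q hq using hq ξ
  rw [bessel]
  refine fourierMultiplier_eq_integral_translate ha hb (continuous_subShift ε).measurable hM hbound
    (g := fun x => (((1 + ‖x‖ ^ 2) ^ (r / 2) : ℝ) : ℂ)) (by fun_prop) (fun ξ => ?_) w x
  have hi := hint ξ
  rw [subMeasure] at hi ⊢
  rw [integral_prod _ hi]
  have e : ∀ t : ℝ, ∫ y, ((((subConst r)⁻¹ * t ^ (-r - 1) : ℝ) : ℂ) -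
      (((subConst r)⁻¹ * t ^ (-r - 1) * Real.exp (-t ^ 2) : ℝ) : ℂ) *
        phase ξ (subShift ε (t, y))) ∂(stdGaussian (Euc d)) = (((subConst r)⁻¹ *
        (t ^ (-r - 1) * (1 - Real.exp (-(t ^ 2 * √(1 + ‖ξ‖ ^ 2) ^ 2)))) : ℝ) : ℂ) := by
    intro t
    have hph : Integrable (fun y => phase ξ (subShift ε (t, y))) (stdGaussian (Euc d)) := by
      refine (integrable_const (1 : ℝ)).mono' ?_ (Eventually.of_forall fun y => (norm_phase _ _).le)
      exact ((measurable_phase_subShift ε ξ).comp measurable_prodMk_left).aestronglyMeasurable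
    rw [integral_sub (integrable_const _) (hph.const_mul _), integral_const, integral_const_mul,
      phase_subShift_integral, ← Complex.ofReal_mul,
      Real.sq_sqrt (by positivity), mul_assoc, mul_assoc, ← Real.exp_add, mul_pow,
      ← sq_abs ε, hε]
    simp only [probReal_univ, one_smul]
    rw [← Complex.ofReal_sub]
    ring_nf
  simp_rw [e]
  rw [integral_complex_ofReal, integral_const_mul, integral_subConst (by positivity),
    one_add_norm_sq_rpow]
  have := (subConst_pos hr hr1).ne'
  field_simp

end Subordination

/-! ### Contractivity, derivative bounds at frequency L, and the commutator formula -/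

section Commutator

open FourierTransform ProbabilityTheory

variable {d : ℕ} {p p' : ℝ≥0∞} [Fact (1 ≤ p)] [Fact (1 ≤ p')] [hpp : ENNReal.HolderConjugate p p']

lemma norm_translate_toLp (z : Euc d) (u : 𝓢(Euc d, ℂ)) :
    ‖(translate z u).toLp p‖ = ‖u.toLp p‖ := by
  rw [SchwartzMap.norm_toLp, SchwartzMap.norm_toLp]
  congr 1
  have h := eLpNorm_comp_measurePreserving (p := p) (g := u) u.continuous.aestronglyMeasurable
    (measurePreserving_add_right (volume : Measure (Euc d)) z)
  rw [← h]
  congr 1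
  ext x
  simp

lemma norm_integral_mul_le (u φ : 𝓢(Euc d, ℂ)) :
    ‖∫ x, u x * φ x‖ ≤ ‖u.toLp p‖ * ‖φ.toLp p'‖ := by
  rw [← lpPair_toLp_toLp (p := p) (p' := p')]
  exact norm_lpPair_le _ _

lemma exists_norm_le (w : 𝓢(Euc d, ℂ)) : ∃ C : ℝ, 0 ≤ C ∧ ∀ x, ‖w x‖ ≤ C :=
  ⟨SchwartzMap.seminorm ℝ 0 0 w, apply_nonneg _ _, fun x => SchwartzMap.norm_le_seminorm ℝ w x⟩

lemma integrable_subDensity_mul {r : ℝ} (hr : 0 < r) (u φ : 𝓢(Euc d, ℂ)) :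
    Integrable (fun y : Euc d × (ℝ × Euc d) =>
      (subDensity r y.2 : ℂ) * u (y.1 + subShift 1 y.2) * φ y.1)
      ((volume : Measure (Euc d)).prod (subMeasure d)) := by
  obtain ⟨C, hC, hu⟩ := exists_norm_le u
  refine (Integrable.mul_prod (φ.integrable (μ := volume)).norm
    ((integrable_subDensity (d := d) hr).const_mul C)).mono' ?_ ?_
  · refine Measurable.aestronglyMeasurable ?_
    refine ((Complex.measurable_ofReal.comp ((measurable_subDensity r).comp measurable_snd)).mul
      ?_).mul (φ.continuous.measurable.comp measurable_fst)
    exact u.continuous.measurable.comp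
      (measurable_fst.add ((continuous_subShift 1).measurable.comp measurable_snd))
  · filter_upwards [(Measure.quasiMeasurePreserving_snd (μ := (volume : Measure (Euc d)))).ae
      (subDensity_nonneg (d := d) hr)] with y hy
    rw [norm_mul, norm_mul, Complex.norm_real, Real.norm_of_nonneg hy]
    calc _ ≤ subDensity r y.2 * C * ‖φ y.1‖ := by gcongr; exact hu _
      _ = _ := by ring

/-- Bessel potentials of negative order are contractions of `L^p`. -/
lemma norm_bessel_neg_le (hp : p < ⊤) (hp1 : 1 < p) {r : ℝ} (hr : 0 < r) (u : 𝓢(Euc d, ℂ)) :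
    ‖(bessel (-r) u).toLp p‖ ≤ ‖u.toLp p‖ := by
  have hp' : ENNReal.HolderConjugate p (1 - p⁻¹)⁻¹ :=
    ENNReal.HolderConjugate.inv_one_sub_inv' hp1.le
  have : Fact (1 ≤ (1 - p⁻¹)⁻¹) := by simp [fact_iff]
  refine norm_le_of_integral_le (p' := (1 - p⁻¹)⁻¹) hp hp1 _ (norm_nonneg _) fun φ => ?_
  have e1 : ∫ x, ((bessel (-r) u).toLp p volume) x * φ x = ∫ x, bessel (-r) u x * φ x := by
    refine integral_congr_ae ?_
    filter_upwards [(bessel (-r) u).coeFn_toLp p volume] with x hx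
    rw [hx]
  -- The average over translations is taken outside the pairing, where each translate of `u` has the
  -- norm of `u` and the weights add up to one.
  have e2 : ∫ x, bessel (-r) u x * φ x =
      ∫ q, (∫ x, (subDensity r q : ℂ) * u (x + subShift 1 q) * φ x) ∂(subMeasure d) := by
    rw [← integral_integral_swap (integrable_subDensity_mul hr u φ)]
    refine integral_congr_ae (Eventually.of_forall fun x => ?_)
    simp only
    rw [bessel_neg_apply hr, integral_mul_const]
  rw [e1, e2]
  have e3 : ∀ q, ∫ x, (subDensity r q : ℂ) * u (x + subShift 1 q) * φ x =
      (subDensity r q : ℂ) * ∫ x, translate (subShift 1 q) u x * φ x := by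
    intro q
    rw [← integral_const_mul]
    refine integral_congr_ae (Eventually.of_forall fun x => ?_)
    simp only [translate_apply]; ring
  simp_rw [e3]
  refine (norm_integral_le_of_norm_le
    ((integrable_subDensity (d := d) hr).mul_const (‖u.toLp p‖ * ‖φ.toLp (1 - p⁻¹)⁻¹‖)) ?_).trans ?_
  · filter_upwards [subDensity_nonneg (d := d) hr] with q hq
    rw [norm_mul, Complex.norm_real, Real.norm_of_nonneg hq]
    gcongr
    rw [← norm_translate_toLp (subShift 1 q) u]
    exact norm_integral_mul_le _ _
  · rw [integral_mul_const, integral_subDensity hr, one_mul]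

/-- Bounds on derivatives that scale like those of functions with frequencies of size `L`. -/
structure DerivBound {F : Type*} [NormedAddCommGroup F] [NormedSpace ℝ F]
    (N : ℕ) (A L : ℝ) (h : Euc d → F) : Prop where
  contDiff : ContDiff ℝ ∞ h
  bound : ∀ i ≤ N, ∀ x, ‖iteratedFDeriv ℝ i h x‖ ≤ A * L ^ i

lemma DerivBound.norm_le {F : Type*} [NormedAddCommGroup F] [NormedSpace ℝ F]
    {N : ℕ} {A L : ℝ} {h : Euc d → F} (hh : DerivBound N A L h) (x : Euc d) : ‖h x‖ ≤ A := by
  simpa using hh.bound 0 (Nat.zero_le _) x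

lemma DerivBound.nonneg {F : Type*} [NormedAddCommGroup F] [NormedSpace ℝ F]
    {N : ℕ} {A L : ℝ} {h : Euc d → F} (hh : DerivBound N A L h) : 0 ≤ A :=
  (norm_nonneg _).trans (hh.norm_le 0)

lemma DerivBound.mono {F : Type*} [NormedAddCommGroup F] [NormedSpace ℝ F]
    {N M : ℕ} (hNM : M ≤ N) {A L : ℝ} {h : Euc d → F} (hh : DerivBound N A L h) :
    DerivBound M A L h :=
  ⟨hh.contDiff, fun i hi => hh.bound i (hi.trans hNM)⟩

/-- The 2 comes from the triangle inequality and L‖z‖ from the mean value inequality, which spends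
one derivative. Differences of functions of frequency L are again functions of frequency L with a
smaller amplitude, so the estimate can be iterated. -/
lemma DerivBound.diff {F : Type*} [NormedAddCommGroup F] [NormedSpace ℝ F]
    {N : ℕ} {A L : ℝ} {h : Euc d → F} (hh : DerivBound (N + 1) A L h) (z : Euc d) :
    DerivBound N (A * min 2 (L * ‖z‖)) L (fun x => h (x + z) - h x) := by
  have hA := hh.nonneg
  have hs : ContDiff ℝ ∞ (fun x => h (x + z)) := hh.contDiff.comp (contDiff_id.add contDiff_const)
  refine ⟨hs.sub hh.contDiff, fun i hi x => ?_⟩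
  have e : iteratedFDeriv ℝ i (fun x => h (x + z) - h x) x =
      iteratedFDeriv ℝ i h (x + z) - iteratedFDeriv ℝ i h x := by
    have := iteratedFDeriv_sub_apply (𝕜 := ℝ) (i := i) (x := x)
      (hs.of_le (by exact_mod_cast le_top)).contDiffAt
      (hh.contDiff.of_le (by exact_mod_cast le_top)).contDiffAt
    rw [iteratedFDeriv_comp_add_right] at this
    exact this
  rw [e]
  have h1 : ‖iteratedFDeriv ℝ i h (x + z) - iteratedFDeriv ℝ i h x‖ ≤ A * L ^ i * 2 := by
    refine (norm_sub_le _ _).trans ?_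
    have := hh.bound i (by omega) (x + z)
    have := hh.bound i (by omega) x
    linarith
  have h2 : ‖iteratedFDeriv ℝ i h (x + z) - iteratedFDeriv ℝ i h x‖ ≤ A * L ^ (i + 1) * ‖z‖ := by
    have := Convex.norm_image_sub_le_of_norm_fderiv_le (𝕜 := ℝ) (f := iteratedFDeriv ℝ i h)
      (s := univ) (C := A * L ^ (i + 1)) (x := x) (y := x + z)
      (fun y _ => (hh.contDiff.differentiable_iteratedFDeriv (by exact_mod_cast ENat.natCast_lt_top i)).differentiableAt)
      (fun y _ => by
        rw [norm_fderiv_iteratedFDeriv]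
        exact hh.bound (i + 1) (by omega) y) convex_univ (mem_univ _) (mem_univ _)
    simpa using this
  rcases le_total 2 (L * ‖z‖) with h | h
  · rw [min_eq_left h]
    linarith
  · rw [min_eq_right h]
    calc _ ≤ _ := h2
      _ = _ := by ring

lemma exists_diff_bound (w : 𝓢(Euc d, ℂ)) {ε : ℝ} (hε : |ε| = 1) :
    ∃ C : ℝ, 0 ≤ C ∧ ∀ (x : Euc d) (q : ℝ × Euc d), 0 < q.1 →
      ‖w (x + subShift ε q) - w x‖ ≤ C * (min 1 q.1 * (1 + ‖q.2‖)) := by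
  obtain ⟨S, hS, hw⟩ := exists_norm_le w
  set D := SchwartzMap.seminorm ℝ 0 1 w
  have hD : 0 ≤ D := apply_nonneg _ _
  have hs := gaussScale_pos
  refine ⟨2 * S + D * gaussScale, by positivity, fun x q hq => ?_⟩
  have h1 : ‖w (x + subShift ε q) - w x‖ ≤ 2 * S := by
    refine (norm_sub_le _ _).trans ?_
    linarith [hw (x + subShift ε q), hw x]
  have h2 : ‖w (x + subShift ε q) - w x‖ ≤ D * gaussScale * (q.1 * ‖q.2‖) := by
    have := Convex.norm_image_sub_le_of_norm_fderiv_le (𝕜 := ℝ) (f := w)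
      (s := univ) (C := D) (x := x) (y := x + subShift ε q)
      (fun y _ => w.differentiableAt)
      (fun y _ => by
        rw [← norm_iteratedFDeriv_one]
        exact SchwartzMap.norm_iteratedFDeriv_le_seminorm ℝ w 1 y) convex_univ (mem_univ _)
        (mem_univ _)
    rw [add_sub_cancel_left, norm_subShift hε hq] at this
    linarith
  have hy := norm_nonneg q.2
  rcases le_total 1 q.1 with h | h
  · rw [min_eq_left h]
    have : 0 ≤ D * gaussScale := by positivity
    nlinarith
  · rw [min_eq_right h]
    have : 0 ≤ D * gaussScale := by positivity
    calc _ ≤ _ := h2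
      _ ≤ (2 * S + D * gaussScale) * (q.1 * (1 + ‖q.2‖)) := by
        gcongr
        · linarith
        · linarith

/-- The kernel of the commutators. -/
def subKernel (r : ℝ) (q : ℝ × Euc d) : ℝ := (subConst r)⁻¹ * q.1 ^ (-r - 1) * Real.exp (-q.1 ^ 2)

lemma measurable_subKernel (r : ℝ) : Measurable (subKernel (d := d) r) := by
  unfold subKernel; fun_prop

lemma subKernel_nonneg {r : ℝ} (hr : 0 < r) (hr1 : r < 1) {q : ℝ × Euc d} (hq : 0 < q.1) :
    0 ≤ subKernel r q := by
  have := subConst_pos hr hr1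
  unfold subKernel
  positivity

lemma subKernel_le {r : ℝ} (hr : 0 < r) (hr1 : r < 1) {q : ℝ × Euc d} (hq : 0 < q.1) :
    subKernel r q ≤ (subConst r)⁻¹ * q.1 ^ (-r - 1) := by
  have := subConst_pos hr hr1
  unfold subKernel
  refine mul_le_of_le_one_right (by positivity) ?_
  rw [Real.exp_le_one_iff]
  linarith [sq_nonneg q.1]

lemma integrable_bessel_pos {r : ℝ} (hr : 0 < r) (hr1 : r < 1) {ε : ℝ} (hε : |ε| = 1)
    (w : 𝓢(Euc d, ℂ)) (x : Euc d) :
    Integrable (fun q => (((subConst r)⁻¹ * q.1 ^ (-r - 1) : ℝ) : ℂ) * w x -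
      (subKernel r q : ℂ) * w (x + subShift ε q)) (subMeasure d) := by
  obtain ⟨C, hC, hw⟩ := exists_diff_bound w hε
  have hc := subConst_pos hr hr1
  refine ((integrable_subMajorant (d := d) hr hr1).const_mul
    ((subConst r)⁻¹ * (‖w x‖ + C))).mono' ?_ ?_
  · refine Measurable.aestronglyMeasurable ?_
    refine ((Complex.measurable_ofReal.comp (by fun_prop)).mul_const _).sub
      ((Complex.measurable_ofReal.comp (measurable_subKernel r)).mul ?_)
    exact w.continuous.measurable.comp (measurable_const.add (continuous_subShift ε).measurable)
  · filter_upwards [ae_subMeasure_pos] with q hq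
    have e : (((subConst r)⁻¹ * q.1 ^ (-r - 1) : ℝ) : ℂ) * w x -
        (subKernel r q : ℂ) * w (x + subShift ε q) =
        (((subConst r)⁻¹ * q.1 ^ (-r - 1) * (1 - Real.exp (-q.1 ^ 2)) : ℝ) : ℂ) * w x -
        (subKernel r q : ℂ) * (w (x + subShift ε q) - w x) := by
      simp only [subKernel]; push_cast; ring
    rw [e]
    refine (norm_sub_le _ _).trans ?_
    rw [norm_mul, norm_mul, Complex.norm_real, Complex.norm_real,
      Real.norm_of_nonneg (subKernel_nonneg hr hr1 hq), Real.norm_of_nonneg]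
    · have hm : 0 ≤ min 1 q.1 := le_min zero_le_one hq.le
      have h1 := one_sub_exp_neg_sq_le hq.le
      have h2 := hw x q hq
      have h3 := subKernel_le hr hr1 hq
      have h0 := subKernel_nonneg hr hr1 hq
      calc _ ≤ (subConst r)⁻¹ * q.1 ^ (-r - 1) * min 1 q.1 * ‖w x‖ +
            (subConst r)⁻¹ * q.1 ^ (-r - 1) * (C * (min 1 q.1 * (1 + ‖q.2‖))) := by gcongr
        _ ≤ (subConst r)⁻¹ * q.1 ^ (-r - 1) * (min 1 q.1 * (1 + ‖q.2‖)) * ‖w x‖ +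
            (subConst r)⁻¹ * q.1 ^ (-r - 1) * (C * (min 1 q.1 * (1 + ‖q.2‖))) := by
            have hmm : min 1 q.1 ≤ min 1 q.1 * (1 + ‖q.2‖) :=
              le_mul_of_one_le_right hm (by linarith [norm_nonneg q.2])
            gcongr ?_ + _
            refine mul_le_mul_of_nonneg_right ?_ (norm_nonneg _)
            exact mul_le_mul_of_nonneg_left hmm (by have := Real.rpow_nonneg hq.le (-r-1); positivity)
        _ = _ := by ring
    · refine mul_nonneg (by positivity) ?_
      rw [sub_nonneg, Real.exp_le_one_iff]
      linarith [sq_nonneg q.1]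

lemma subShift_neg_one (q : ℝ × Euc d) : subShift (-1) q = -subShift 1 q := by
  simp [subShift]

/-- The commutator of a fractional power and of a multiplication, in bilinear form. -/
lemma commutator_eq {r : ℝ} (hr : 0 < r) (hr1 : r < 1) {A : ℝ} {h : Euc d → ℂ}
    (hc : Continuous h) (hA : ∀ x, ‖h x‖ ≤ A) (v w : 𝓢(Euc d, ℂ)) :
    ∫ x, h x * v x * bessel r w x = (∫ x, h x * bessel r v x * w x) -
      ∫ q, (subKernel r q : ℂ) *
        (∫ x, (h (x + subShift 1 q) - h x) * translate (subShift 1 q) v x * w x)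
        ∂(subMeasure d) := by
  have hint : ∀ f g : 𝓢(Euc d, ℂ), ∀ k : Euc d → ℂ, Continuous k → (∃ B, ∀ x, ‖k x‖ ≤ B) →
      Integrable (fun x => k x * f x * g x) := by
    rintro f g k hk ⟨B, hB⟩
    obtain ⟨C, hC, hf⟩ := exists_norm_le f
    refine ((g.integrable (μ := volume)).norm.const_mul (B * C)).mono'
      ((hk.mul f.continuous).mul g.continuous).aestronglyMeasurable
      (Eventually.of_forall fun x => ?_)
    rw [norm_mul, norm_mul]
    have := hB x
    have := hf x
    have : 0 ≤ B := (norm_nonneg _).trans (hB x)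
    gcongr
  obtain ⟨Cv, hCv, hv⟩ := exists_diff_bound v (ε := 1) (by simp)
  obtain ⟨Cw, hCw, hw⟩ := exists_diff_bound w (ε := -1) (by simp)
  have hk := subConst_pos hr hr1
  have hA0 : 0 ≤ A := (norm_nonneg _).trans (hA 0)
  -- Using opposite shifts for v and w, the singular terms t^{-r-1} h v w of the two subordination
  -- formulas cancel. What remains is a combination of differences, integrable jointly in x and the
  -- shift.
  have hF : Integrable (fun y : Euc d × (ℝ × Euc d) => h y.1 * ((subKernel r y.2 : ℂ) *
      (w y.1 * v (y.1 + subShift 1 y.2) - v y.1 * w (y.1 + subShift (-1) y.2))))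
      ((volume : Measure (Euc d)).prod (subMeasure d)) := by
    have hm := Integrable.mul_prod (((w.integrable (μ := volume)).norm.const_mul Cv).add
      ((v.integrable (μ := volume)).norm.const_mul Cw))
      ((integrable_subMajorant (d := d) hr hr1).const_mul (A * (subConst r)⁻¹))
    refine hm.mono' ?_ ?_
    · refine Measurable.aestronglyMeasurable ?_
      have h1 : Measurable (fun y : Euc d × (ℝ × Euc d) => v (y.1 + subShift 1 y.2)) :=
        v.continuous.measurable.comp
          (measurable_fst.add ((continuous_subShift 1).measurable.comp measurable_snd))
      have h2 : Measurable (fun y : Euc d × (ℝ × Euc d) => w (y.1 + subShift (-1) y.2)) :=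
        w.continuous.measurable.comp
          (measurable_fst.add ((continuous_subShift (-1)).measurable.comp measurable_snd))
      have h3 : Measurable (fun y : Euc d × (ℝ × Euc d) => (subKernel r y.2 : ℂ)) :=
        Complex.measurable_ofReal.comp ((measurable_subKernel r).comp measurable_snd)
      exact (hc.measurable.comp measurable_fst).mul (h3.mul
        (((w.continuous.measurable.comp measurable_fst).mul h1).sub
          ((v.continuous.measurable.comp measurable_fst).mul h2)))
    · filter_upwards [(Measure.quasiMeasurePreserving_snd (μ := (volume : Measure (Euc d)))).ae
        (ae_subMeasure_pos (d := d))] with y hy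
      have e : w y.1 * v (y.1 + subShift 1 y.2) - v y.1 * w (y.1 + subShift (-1) y.2) =
          w y.1 * (v (y.1 + subShift 1 y.2) - v y.1) -
          v y.1 * (w (y.1 + subShift (-1) y.2) - w y.1) := by ring
      rw [e, norm_mul, norm_mul, Complex.norm_real, Real.norm_of_nonneg (subKernel_nonneg hr hr1 hy)]
      have h1 := hv y.1 y.2 hy
      have h2 := hw y.1 y.2 hy
      have h3 := subKernel_le hr hr1 hy
      have h0 := subKernel_nonneg hr hr1 hy
      have hm : 0 ≤ min 1 y.2.1 := le_min zero_le_one hy.le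
      calc _ ≤ A * ((subConst r)⁻¹ * y.2.1 ^ (-r - 1) *
            (‖w y.1‖ * (Cv * (min 1 y.2.1 * (1 + ‖y.2.2‖))) +
              ‖v y.1‖ * (Cw * (min 1 y.2.1 * (1 + ‖y.2.2‖))))) := by
            gcongr
            · exact hA _
            · refine (norm_sub_le _ _).trans ?_
              rw [norm_mul, norm_mul]
              gcongr
        _ = _ := by simp only [Pi.add_apply]; ring
  have e1 : (∫ x, h x * v x * bessel r w x) - (∫ x, h x * bessel r v x * w x) =
      ∫ q, (∫ x, h x * ((subKernel r q : ℂ) *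
      (w x * v (x + subShift 1 q) - v x * w (x + subShift (-1) q)))) ∂(subMeasure d) := by
    rw [← integral_sub (hint _ _ h hc ⟨A, hA⟩) (hint _ _ h hc ⟨A, hA⟩),
      ← integral_integral_swap hF]
    refine integral_congr_ae (Eventually.of_forall fun x => ?_)
    simp only
    have hi1 := integrable_bessel_pos hr hr1 (ε := -1) (by simp) w x
    have hi2 := integrable_bessel_pos hr hr1 (ε := 1) (by simp) v x
    rw [bessel_pos_apply hr hr1 (ε := -1) (by simp) w x,
      bessel_pos_apply hr hr1 (ε := 1) (by simp) v x, integral_const_mul]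
    simp only [subKernel] at hi1 hi2
    rw [mul_assoc, mul_assoc, ← mul_sub, ← integral_const_mul, ← integral_mul_const,
      ← integral_sub (hi1.const_mul _) (hi2.mul_const _)]
    congr 1
    refine integral_congr_ae (Eventually.of_forall fun q => ?_)
    simp only [subKernel]
    ring
  rw [sub_eq_iff_eq_add'.1 e1, sub_eq_add_neg, ← integral_neg]
  congr 1
  refine integral_congr_ae (Eventually.of_forall fun q => ?_)
  simp only
  set z := subShift 1 q with hz
  have hcz : Continuous fun x => h (x + z) := by fun_prop
  have t1 : ∫ x, h x * ((subKernel r q : ℂ) *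
      (w x * v (x + z) - v x * w (x + subShift (-1) q))) =
      (subKernel r q : ℂ) * ((∫ x, h x * translate z v x * w x) -
        (∫ x, h x * v x * translate (-z) w x)) := by
    rw [← integral_sub (hint _ _ h hc ⟨A, hA⟩) (hint _ _ h hc ⟨A, hA⟩), ← integral_const_mul]
    refine integral_congr_ae (Eventually.of_forall fun x => ?_)
    simp only [translate_apply, subShift_neg_one, ← hz]
    ring
  -- Shifting the integration variable by z takes the translation off `w`; it lands on `v` and on
  -- `h`, and this is where the difference of `h` appears.
  have t2 : ∫ x, h x * v x * translate (-z) w x = ∫ x, h (x + z) * translate z v x * w x := by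
    rw [← integral_add_right_eq_self _ z]
    refine integral_congr_ae (Eventually.of_forall fun x => ?_)
    simp [translate_apply]
  rw [t1, t2, ← mul_neg]
  congr 1
  rw [← integral_sub (hint _ _ h hc ⟨A, hA⟩) (hint _ _ _ hcz ⟨A, fun x => hA _⟩), ← integral_neg]
  refine integral_congr_ae (Eventually.of_forall fun x => ?_)
  simp only
  ring

end Commutator

/-! ### The bilinear estimate for multiplication at a single frequency -/

section Bilinear

open FourierTransform ProbabilityTheory

variable {d : ℕ} {p p' : ℝ≥0∞} [Fact (1 ≤ p)] [Fact (1 ≤ p')] [hpp : ENNReal.HolderConjugate p p']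

/-- The substitution of Lt for t; this is the source of the factor L^r that each commutator costs.
-/
lemma integral_scaled_min {r : ℝ} (hr : 0 < r) (hr1 : r < 1) {L : ℝ} (hL : 0 < L) :
    IntegrableOn (fun t : ℝ => t ^ (-r - 1) * min 1 (L * t)) (Ioi 0) ∧
    ∫ t in Ioi (0 : ℝ), t ^ (-r - 1) * min 1 (L * t) =
      L ^ r * ∫ t in Ioi (0 : ℝ), t ^ (-r - 1) * min 1 t := by
  have e : EqOn (fun t : ℝ => t ^ (-r - 1) * min 1 (L * t))
      (fun t => L ^ (r + 1) * ((L * t) ^ (-r - 1) * min 1 (L * t))) (Ioi 0) := by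
    intro t ht
    have ht' : (0 : ℝ) ≤ t := (mem_Ioi.1 ht).le
    simp only
    rw [Real.mul_rpow hL.le ht', ← mul_assoc, ← mul_assoc, ← Real.rpow_add hL]
    simp
  have hi := integrableOn_rpow_mul_min hr hr1
  have hi' : IntegrableOn (fun t : ℝ => (L * t) ^ (-r - 1) * min 1 (L * t)) (Ioi 0) := by
    rw [integrableOn_Ioi_comp_mul_left_iff (fun t : ℝ => t ^ (-r - 1) * min 1 t) 0 hL, mul_zero]
    exact hi
  refine ⟨(integrableOn_congr_fun e measurableSet_Ioi).2 (hi'.const_mul _), ?_⟩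
  rw [setIntegral_congr_fun measurableSet_Ioi e, integral_const_mul,
    integral_comp_mul_left_Ioi (fun t : ℝ => t ^ (-r - 1) * min 1 t) 0 hL, mul_zero, smul_eq_mul,
    ← mul_assoc]
  congr 1
  rw [Real.rpow_add hL, Real.rpow_one]
  field_simp

lemma norm_integral_bounded_mul_le {A : ℝ} {h : Euc d → ℂ} (hc : Continuous h)
    (hA : ∀ x, ‖h x‖ ≤ A) (u ψ : 𝓢(Euc d, ℂ)) :
    ‖∫ x, h x * u x * ψ x‖ ≤ A * (‖u.toLp p‖ * ‖ψ.toLp p'‖) := by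
  have hA0 : 0 ≤ A := (norm_nonneg _).trans (hA 0)
  have hb : ∀ᵐ x ∂(volume : Measure (Euc d)), ‖h x * u x‖ ≤ A * ‖u x‖ := by
    refine Eventually.of_forall fun x => ?_
    rw [norm_mul]
    gcongr
    exact hA x
  have hm : MemLp (fun x => h x * u x) p (volume : Measure (Euc d)) :=
    (u.memLp p volume).of_le_mul (hc.mul u.continuous).aestronglyMeasurable hb
  have e : ∫ x, h x * u x * ψ x = lpPair p p' hm.toLp (ψ.toLp p') := by
    rw [lpPair_toLp]
    refine integral_congr_ae ?_
    filter_upwards [hm.coeFn_toLp] with x hx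
    rw [hx]
  rw [e, ← mul_assoc]
  refine (norm_lpPair_le _ _).trans ?_
  gcongr
  rw [Lp.norm_toLp, SchwartzMap.norm_toLp, ← ENNReal.toReal_ofReal hA0, ← ENNReal.toReal_mul]
  exact ENNReal.toReal_mono (ENNReal.mul_ne_top ENNReal.ofReal_ne_top (u.memLp p volume).2.ne)
    (eLpNorm_le_mul_eLpNorm_of_ae_le_mul hb p)

/-- Induction on the number N of factors Λ^r. Moving one factor from ψ to u leaves the case N, plus
an average over z of the case N for h(·+z) - h. There u is replaced by Λ^{-r} of a translate of u,
whose norm is no larger. The amplitude min(2, L‖z‖) of the difference, integrated against t^{-r-1},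
contributes L^r; each step spends one of the N derivatives of h. -/
lemma exists_bilinear_bound_nat (hp : p < ⊤) (hp1 : 1 < p) {r : ℝ} (hr : 0 < r) (hr1 : r < 1)
    (N : ℕ) : ∃ C : ℝ, 0 ≤ C ∧ ∀ (A L : ℝ) (h : Euc d → ℂ), 1 ≤ L → DerivBound N A L h →
      ∀ u ψ : 𝓢(Euc d, ℂ), ‖∫ x, h x * bessel (-(N * r)) u x * bessel (N * r) ψ x‖ ≤
        C * A * L ^ (N * r) * (‖u.toLp p‖ * ‖ψ.toLp p'‖) := by
  induction N with
  | zero =>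
    refine ⟨1, zero_le_one, fun A L h hL hh u ψ => ?_⟩
    simpa using norm_integral_bounded_mul_le hh.contDiff.continuous hh.norm_le u ψ
  | succ N ih =>
    obtain ⟨C, hC, ih⟩ := ih
    set I := ∫ t in Ioi (0 : ℝ), t ^ (-r - 1) * min 1 t
    set G := ∫ y : Euc d, (1 + ‖y‖) ∂(stdGaussian (Euc d))
    have hI : 0 ≤ I := setIntegral_nonneg measurableSet_Ioi fun t ht => by
      have : (0 : ℝ) < t := ht
      positivity
    have hG : 0 ≤ G := integral_nonneg fun y => by positivity
    have hk := subConst_pos hr hr1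
    have hs := gaussScale_pos
    refine ⟨C + C * ((subConst r)⁻¹ * (2 + gaussScale)) * (I * G), by positivity,
      fun A L h hL hh u ψ => ?_⟩
    have hA := hh.nonneg
    have hL0 : 0 < L := by linarith
    set U := ‖u.toLp p‖ * ‖ψ.toLp p'‖ with hU
    have hU0 : 0 ≤ U := by positivity
    set v := bessel (-((N + 1 : ℕ) * r)) u with hv
    set w := bessel (N * r) ψ with hw
    have ew : bessel ((N + 1 : ℕ) * r) ψ = bessel r w := by
      rw [hw, bessel_bessel]; congr 2; push_cast; ring
    have ev : bessel r v = bessel (-(N * r)) u := by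
      rw [hv, bessel_bessel]; congr 2; push_cast; ring
    -- The spare factor Λ^{-r} is absorbed into the function to which the induction hypothesis is
    -- applied; being a contraction, it does no harm.
    have ez : ∀ z, translate z v = bessel (-(N * r)) (bessel (-r) (translate z u)) := by
      intro z
      rw [hv, ← bessel_translate, bessel_bessel]; congr 2; push_cast; ring
    rw [ew, commutator_eq hr hr1 hh.contDiff.continuous hh.norm_le, ev]
    have hr' : L ^ (((N + 1 : ℕ) : ℝ) * r) = L ^ (N * r) * L ^ r := by
      rw [← Real.rpow_add hL0]; congr 1; push_cast; ring
    have hLr : 1 ≤ L ^ r := Real.one_le_rpow hL hr.le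
    have hLN : 0 ≤ L ^ (N * r) := by positivity
    have h1 := ih A L h hL (hh.mono (Nat.le_succ N)) u ψ
    set K := C * A * L ^ (N * r) * U with hK
    have hK0 : 0 ≤ K := by positivity
    obtain ⟨hi, he⟩ := integral_scaled_min hr hr1 hL0
    have h2 : ‖∫ q, (subKernel r q : ℂ) *
        (∫ x, (h (x + subShift 1 q) - h x) * translate (subShift 1 q) v x * w x) ∂(subMeasure d)‖ ≤
        ∫ q, (K * ((subConst r)⁻¹ * (2 + gaussScale))) *
          ((q.1 ^ (-r - 1) * min 1 (L * q.1)) * (1 + ‖q.2‖)) ∂(subMeasure d) := by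
      refine norm_integral_le_of_norm_le
        ((Integrable.mul_prod hi integrable_norm_stdGaussian).const_mul _) ?_
      filter_upwards [ae_subMeasure_pos] with q hq
      have hz := norm_subShift (ε := 1) (by simp) hq
      set z := subShift 1 q
      have h3 := ih _ L _ hL (hh.diff z) (bessel (-r) (translate z u)) ψ
      rw [← ez, ← hw] at h3
      have h4 : ‖(bessel (-r) (translate z u)).toLp p‖ ≤ ‖u.toLp p‖ :=
        (norm_bessel_neg_le hp hp1 hr _).trans_eq (norm_translate_toLp z u)
      have hy := norm_nonneg q.2
      have h5 : min 2 (L * ‖z‖) ≤ (2 + gaussScale) * (min 1 (L * q.1) * (1 + ‖q.2‖)) := by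
        rw [hz]
        rcases le_total 1 (L * q.1) with h | h
        · rw [min_eq_left h]
          refine (min_le_left _ _).trans ?_
          nlinarith
        · rw [min_eq_right h]
          refine (min_le_right _ _).trans ?_
          have h0 : 0 ≤ L * q.1 := by positivity
          calc L * (gaussScale * q.1 * ‖q.2‖) = gaussScale * (L * q.1 * ‖q.2‖) := by ring
            _ ≤ _ := by
              gcongr
              · linarith
              · linarith
      have h6 := subKernel_le hr hr1 hq
      have h0 := subKernel_nonneg hr hr1 hq
      have hm : 0 ≤ min 1 (L * q.1) := le_min zero_le_one (by positivity)
      have hm2 : 0 ≤ min 2 (L * ‖z‖) := le_min zero_le_two (by positivity)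
      rw [norm_mul, Complex.norm_real, Real.norm_of_nonneg h0]
      calc _ ≤ (subConst r)⁻¹ * q.1 ^ (-r - 1) * (C * (A * ((2 + gaussScale) *
            (min 1 (L * q.1) * (1 + ‖q.2‖)))) * L ^ (N * r) * U) := by
            refine mul_le_mul h6 (h3.trans ?_) (norm_nonneg _) (by positivity)
            rw [hU]
            gcongr
        _ = _ := by rw [hK]; ring
    have h7 : ∫ q, (K * ((subConst r)⁻¹ * (2 + gaussScale))) *
          ((q.1 ^ (-r - 1) * min 1 (L * q.1)) * (1 + ‖q.2‖)) ∂(subMeasure d) =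
        (K * ((subConst r)⁻¹ * (2 + gaussScale))) * (L ^ r * I * G) := by
      rw [integral_const_mul, subMeasure, integral_prod_mul
        (fun t : ℝ => t ^ (-r - 1) * min 1 (L * t)) (fun y : Euc d => 1 + ‖y‖), he]
    refine (norm_sub_le _ _).trans ?_
    rw [h7] at h2
    rw [hr']
    calc _ ≤ K * L ^ r + (K * ((subConst r)⁻¹ * (2 + gaussScale))) * (L ^ r * I * G) := by
          refine add_le_add (h1.trans ?_) h2
          -- The main term is only O(L^{Nr}); L ≥ 1 lets it be absorbed into the bound of the
          -- commutator.
          exact le_mul_of_one_le_right hK0 hLr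
      _ = _ := by rw [hK]; ring

/-- An arbitrary order is cut into N equal parts of size below 1. For negative s the roles of u and
ψ, hence of p and p', are exchanged. -/
lemma exists_bilinear_bound (hp : p < ⊤) (hp1 : 1 < p) (hp' : p' < ⊤) (hp1' : 1 < p') (s : ℝ) :
    ∃ (N : ℕ) (C : ℝ), 0 ≤ C ∧ ∀ (A L : ℝ) (h : Euc d → ℂ), 1 ≤ L → DerivBound N A L h →
      ∀ u ψ : 𝓢(Euc d, ℂ), ‖∫ x, h x * bessel (-s) u x * bessel s ψ x‖ ≤
        C * A * L ^ |s| * (‖u.toLp p‖ * ‖ψ.toLp p'‖) := by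
  -- The extra 1 makes |s|/N strictly less than 1, as the subordination formula requires, even when
  -- |s| is an integer.
  set N := ⌈|s|⌉₊ + 1 with hN
  have hN0 : (0 : ℝ) < N := by positivity
  have hsN : |s| < N := by
    rw [hN]; push_cast
    linarith [Nat.le_ceil |s|]
  rcases eq_or_ne s 0 with rfl | hs
  · refine ⟨0, 1, zero_le_one, fun A L h hL hh u ψ => ?_⟩
    simpa using norm_integral_bounded_mul_le hh.contDiff.continuous hh.norm_le u ψ
  have hr : 0 < |s| / N := by positivity
  have hr1 : |s| / N < 1 := by rwa [div_lt_one hN0]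
  have e : (N : ℝ) * (|s| / N) = |s| := by field_simp
  rcases le_total 0 s with h0 | h0
  · obtain ⟨C, hC, H⟩ := exists_bilinear_bound_nat (d := d) (p := p) (p' := p') hp hp1 hr hr1 N
    rw [e] at H
    refine ⟨N, C, hC, fun A L h hL hh u ψ => ?_⟩
    have := H A L h hL hh u ψ
    rwa [abs_of_nonneg h0] at this ⊢
  · have : ENNReal.HolderConjugate p' p := hpp.symm
    obtain ⟨C, hC, H⟩ := exists_bilinear_bound_nat (d := d) (p := p') (p' := p) hp' hp1' hr hr1 N
    rw [e] at H
    refine ⟨N, C, hC, fun A L h hL hh u ψ => ?_⟩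
    have := H A L h hL hh ψ u
    rw [abs_of_nonpos h0, neg_neg] at this
    rw [abs_of_nonpos h0, mul_comm ‖u.toLp p volume‖]
    refine le_trans (le_of_eq ?_) this
    congr 1
    refine integral_congr_ae (Eventually.of_forall fun x => ?_)
    simp only
    ring

end Bilinear

/-! ### Multiplication on Bessel potential spaces by sums of dyadic pieces -/

section Multiplier

open FourierTransform ProbabilityTheory

variable {d : ℕ}

/-- Sequences of smooth functions that behave like the dyadic pieces of a function of Hölder-Zygmund
regularity `σ`. -/
structure MultSeq {F : Type*} [NormedAddCommGroup F] [NormedSpace ℝ F]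
    (σ : ℝ) (h : ℕ → Euc d → F) : Prop where
  contDiff : ∀ k, ContDiff ℝ ∞ (h k)
  bound : ∀ i : ℕ, ∃ C : ℝ, 0 ≤ C ∧ ∀ k x,
    ‖iteratedFDeriv ℝ i (h k) x‖ ≤ C * (2 : ℝ) ^ ((k : ℝ) * (i - σ))

/-- The k-th piece has amplitude 2^{-kσ} and frequency 2^k; finitely many derivatives are handled
with a common constant. -/
lemma MultSeq.derivBound {F : Type*} [NormedAddCommGroup F] [NormedSpace ℝ F] {σ : ℝ}
    {h : ℕ → Euc d → F} (hh : MultSeq σ h) (N : ℕ) : ∃ C : ℝ, 0 ≤ C ∧ ∀ k : ℕ,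
      DerivBound N (C * (2 : ℝ) ^ (-((k : ℝ) * σ))) ((2 : ℝ) ^ (k : ℝ)) (h k) := by
  choose C hC H using hh.bound
  refine ⟨∑ i ∈ Finset.range (N + 1), C i, Finset.sum_nonneg fun i _ => hC i, fun k =>
    ⟨hh.contDiff k, fun i hi x => (H i k x).trans ?_⟩⟩
  have e : (2 : ℝ) ^ ((k : ℝ) * (i - σ)) =
      (2 : ℝ) ^ (-((k : ℝ) * σ)) * ((2 : ℝ) ^ (k : ℝ)) ^ i := by
    rw [← Real.rpow_natCast ((2 : ℝ) ^ (k : ℝ)) i, ← Real.rpow_mul zero_le_two,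
      ← Real.rpow_add zero_lt_two]
    congr 1; ring
  rw [e, ← mul_assoc]
  gcongr
  exact Finset.single_le_sum (fun j _ => hC j) (Finset.mem_range.2 (by omega))

lemma summable_two_rpow {σ : ℝ} (hσ : 0 < σ) : Summable fun k : ℕ => (2 : ℝ) ^ (-((k : ℝ) * σ)) := by
  have e : ∀ k : ℕ, (2 : ℝ) ^ (-((k : ℝ) * σ)) = ((2 : ℝ) ^ (-σ)) ^ k := fun k => by
    rw [← Real.rpow_natCast, ← Real.rpow_mul zero_le_two]; congr 1; ring
  simp_rw [e]
  exact summable_geometric_of_lt_one (by positivity)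
    (Real.rpow_lt_one_of_one_lt_of_neg one_lt_two (by linarith))

lemma MultSeq.exists_norm_le {F : Type*} [NormedAddCommGroup F] [NormedSpace ℝ F] {σ : ℝ}
    {h : ℕ → Euc d → F} (hh : MultSeq σ h) : ∃ C : ℝ, 0 ≤ C ∧ ∀ k x,
      ‖h k x‖ ≤ C * (2 : ℝ) ^ (-((k : ℝ) * σ)) := by
  obtain ⟨C, hC, H⟩ := hh.derivBound 0
  exact ⟨C, hC, fun k x => (H k).norm_le x⟩

lemma MultSeq.hasTemperateGrowth {σ : ℝ} {h : ℕ → Euc d → ℝ} (hh : MultSeq σ h) (k : ℕ) :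
    (fun x => (h k x : ℂ)).HasTemperateGrowth := by
  have h1 : (h k).HasTemperateGrowth := by
    refine ⟨hh.contDiff k, fun i => ?_⟩
    obtain ⟨C, hC, H⟩ := hh.bound i
    exact ⟨0, _, fun x => by simpa using H k x⟩
  exact Complex.ofRealCLM.hasTemperateGrowth.comp h1

lemma DerivBound.ofReal {N : ℕ} {A L : ℝ} {h : Euc d → ℝ} (hh : DerivBound N A L h) :
    DerivBound N A L (fun x => (h x : ℂ)) := by
  refine ⟨Complex.ofRealCLM.contDiff.comp hh.contDiff, fun i hi x => ?_⟩
  have := LinearIsometry.norm_iteratedFDeriv_comp_left (𝕜 := ℝ) Complex.ofRealLI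
    (f := h) (x := x) (n := ∞) hh.contDiff.contDiffAt (i := i) (by exact_mod_cast le_top)
  exact (le_of_eq this).trans (hh.bound i hi x)

/-- The product of a real function and of a Schwartz function. -/
def mulS (h : Euc d → ℝ) : 𝓢(Euc d, ℂ) →L[ℂ] 𝓢(Euc d, ℂ) :=
  SchwartzMap.smulLeftCLM ℂ (fun x => (h x : ℂ))

lemma MultSeq.mulS_apply {σ : ℝ} {h : ℕ → Euc d → ℝ} (hh : MultSeq σ h) (k : ℕ)
    (φ : 𝓢(Euc d, ℂ)) (x : Euc d) : mulS (h k) φ x = h k x * φ x := by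
  rw [mulS, SchwartzMap.smulLeftCLM_apply_apply (hh.hasTemperateGrowth k), smul_eq_mul]

section

variable {p p' : ℝ≥0∞} [Fact (1 ≤ p)] [Fact (1 ≤ p')] [hpp : ENNReal.HolderConjugate p p']

/-- Turns every question about w in H^s_p into one about f in L^p: w is recovered from f by Λ^{-s},
which is its own transpose. -/
lemma apply_eq_lpPair {s : ℝ} {w : 𝓢'(Euc d, ℂ)} {f : Lp ℂ p (volume : Measure (Euc d))}
    (hw : TemperedDistribution.besselPotential (Euc d) ℂ s w = (f : 𝓢'(Euc d, ℂ)))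
    (φ : 𝓢(Euc d, ℂ)) : w φ = lpPair p p' f ((bessel (-s) φ).toLp p') := by
  rw [← coe_Lp_apply, ← hw, besselPotential_apply, bessel_bessel]
  simp

omit [Fact (1 ≤ p')] hpp in
lemma eq_of_eq_on_schwartz (hp : p ≠ ⊤) {X : Type*} [TopologicalSpace X] [T2Space X]
    {F G : Lp ℂ p (volume : Measure (Euc d)) → X}
    (hF : Continuous F) (hG : Continuous G) (h : ∀ u : 𝓢(Euc d, ℂ), F (u.toLp p) = G (u.toLp p))
    (f : Lp ℂ p (volume : Measure (Euc d))) : F f = G f := by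
  have hdense : DenseRange (SchwartzMap.toLpCLM ℂ ℂ p (volume : Measure (Euc d))) :=
    SchwartzMap.denseRange_toLpCLM hp
  exact congrFun (hdense.equalizer hF hG (funext h)) f

omit [Fact (1 ≤ p')] hpp in
lemma exists_extension (hp : p ≠ ⊤) (a : 𝓢(Euc d, ℂ) →L[ℂ] Lp ℂ p (volume : Measure (Euc d)))
    {c : ℝ} (hc : 0 ≤ c) (h : ∀ u, ‖a u‖ ≤ c * ‖u.toLp p volume‖) :
    ∃ A : Lp ℂ p (volume : Measure (Euc d)) →L[ℂ] Lp ℂ p (volume : Measure (Euc d)),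
      ‖A‖ ≤ c ∧ ∀ u : 𝓢(Euc d, ℂ), A (u.toLp p) = a u := by
  have hdense : DenseRange (SchwartzMap.toLpCLM ℂ ℂ p (volume : Measure (Euc d))) :=
    SchwartzMap.denseRange_toLpCLM hp
  exact ⟨a.toLinearMap.extendOfNorm (SchwartzMap.toLpCLM ℂ ℂ p volume).toLinearMap,
    LinearMap.opNorm_extendOfNorm_le hdense hc h,
    fun u => LinearMap.extendOfNorm_eq hdense ⟨c, h⟩ u⟩

lemma continuous_lpPair_left (g : Lp ℂ p' (volume : Measure (Euc d))) :
    Continuous fun f : Lp ℂ p (volume : Measure (Euc d)) => lpPair p p' f g :=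
  (lpPair p p').continuous.clm_apply continuous_const

lemma hasSum_lpPair_left (g : Lp ℂ p' (volume : Measure (Euc d)))
    {a : ℕ → Lp ℂ p (volume : Measure (Euc d))} {b} (h : HasSum a b) :
    HasSum (fun k => lpPair p p' (a k) g) (lpPair p p' b g) :=
  h.map ((lpPair p p').flip g) (continuous_lpPair_left g)

lemma lpPair_congr_of_schwartz (hp : p ≠ ⊤)
    (A : Lp ℂ p (volume : Measure (Euc d)) →L[ℂ] Lp ℂ p (volume : Measure (Euc d)))
    (g g' : Lp ℂ p' (volume : Measure (Euc d)))
    (h : ∀ u : 𝓢(Euc d, ℂ), lpPair p p' (u.toLp p) g = lpPair p p' (A (u.toLp p)) g')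
    (f : Lp ℂ p (volume : Measure (Euc d))) : lpPair p p' f g = lpPair p p' (A f) g' :=
  eq_of_eq_on_schwartz hp (continuous_lpPair_left g)
    ((continuous_lpPair_left g').comp A.continuous) h f

lemma hasSum_lpPair_of_summable
    {A : ℕ → Lp ℂ p (volume : Measure (Euc d)) →L[ℂ] Lp ℂ p (volume : Measure (Euc d))}
    (hA : Summable A) (f : Lp ℂ p (volume : Measure (Euc d)))
    {g : ℕ → Lp ℂ p' (volume : Measure (Euc d))} {g' : Lp ℂ p' (volume : Measure (Euc d))}
    (h : ∀ k, lpPair p p' f (g k) = lpPair p p' (A k f) g') :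
    HasSum (fun k => lpPair p p' f (g k)) (lpPair p p' ((∑' k, A k) f) g') := by
  have h4 : HasSum (fun k => A k f) ((∑' k, A k) f) :=
    hA.hasSum.mapL (ContinuousLinearMap.apply ℂ _ f)
  rw [funext h]
  exact hasSum_lpPair_left g' h4

/-- The operator A is Λ^s h Λ^{-s}, multiplication by h on H^s_p transported to L^p. It is bounded
on Schwartz functions by the bilinear estimate and duality, then extended by density, along with its
transposition identity. -/
lemma exists_mul_operator (hp : p < ⊤) (hp1 : 1 < p) {s c : ℝ} (hc : 0 ≤ c)
    {h : Euc d → ℝ} (hh : (fun x => (h x : ℂ)).HasTemperateGrowth)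
    (H : ∀ u ψ : 𝓢(Euc d, ℂ), ‖∫ x, (h x : ℂ) * bessel (-s) u x * bessel s ψ x‖ ≤
        c * (‖u.toLp p‖ * ‖ψ.toLp p'‖)) :
    ∃ A : Lp ℂ p (volume : Measure (Euc d)) →L[ℂ] Lp ℂ p (volume : Measure (Euc d)), ‖A‖ ≤ c ∧
      ∀ f φ, lpPair p p' f ((bessel (-s) (mulS h φ)).toLp p') =
        lpPair p p' (A f) ((bessel (-s) φ).toLp p') := by
  have hm : ∀ (φ : 𝓢(Euc d, ℂ)) x, mulS h φ x = h x * φ x := fun φ x => by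
    rw [mulS, SchwartzMap.smulLeftCLM_apply_apply hh, smul_eq_mul]
  set T : 𝓢(Euc d, ℂ) →L[ℂ] Lp ℂ p (volume : Measure (Euc d)) :=
    SchwartzMap.toLpCLM ℂ ℂ p volume ∘L bessel s ∘L mulS h ∘L bessel (-s)
  have hT : ∀ u, T u = (bessel s (mulS h (bessel (-s) u))).toLp p := fun u => rfl
  have hTn : ∀ u, ‖T u‖ ≤ c * ‖u.toLp p volume‖ := by
    intro u
    refine norm_le_of_integral_le (p' := p') hp hp1 _ (by positivity) fun φ => ?_
    rw [← lpPair_toLp (p := p) (p' := p'), hT, lpPair_toLp_toLp, integral_bessel_mul]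
    refine le_trans (le_of_eq ?_) ((H u φ).trans_eq (mul_assoc _ _ _).symm)
    congr 1
    refine integral_congr_ae (Eventually.of_forall fun x => ?_)
    simp only [hm]
  obtain ⟨A, hA, hAe⟩ := exists_extension (d := d) hp.ne T hc hTn
  refine ⟨A, hA, fun f φ => ?_⟩
  refine lpPair_congr_of_schwartz hp.ne A _ _ (fun u => ?_) f
  rw [hAe, hT, lpPair_toLp_toLp, lpPair_toLp_toLp, integral_bessel_mul,
    ← integral_bessel_mul, bessel_bessel]
  refine integral_congr_ae (Eventually.of_forall fun x => ?_)
  simp only [hm, add_neg_cancel, bessel_zero]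
  ring

/-- The amplitude 2^{-kσ} and the loss 2^{k|s|} combine to 2^{-k(σ-|s|)}, a convergent geometric
series. The sum of the operators exists in operator norm, although the h_k need not be summable in
any H^s_p. -/
lemma MultSeq.exists_operator (hp : p < ⊤) (hp1 : 1 < p) (hp' : p' < ⊤) (hp1' : 1 < p') {s σ : ℝ}
    (hs : |s| < σ) {h : ℕ → Euc d → ℝ} (hh : MultSeq σ h) :
    ∃ S : Lp ℂ p (volume : Measure (Euc d)) →L[ℂ] Lp ℂ p (volume : Measure (Euc d)),
      ∀ f φ, HasSum (fun k => lpPair p p' f ((bessel (-s) (mulS (h k) φ)).toLp p'))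
        (lpPair p p' (S f) ((bessel (-s) φ).toLp p')) := by
  obtain ⟨N, C, hC, H⟩ := exists_bilinear_bound (d := d) hp hp1 hp' hp1' s
  obtain ⟨D, hD, hB⟩ := hh.derivBound N
  have hca : ∀ k : ℕ, C * (D * (2 : ℝ) ^ (-((k : ℝ) * σ))) * ((2 : ℝ) ^ (k : ℝ)) ^ |s| =
      C * D * (2 : ℝ) ^ (-((k : ℝ) * (σ - |s|))) := by
    intro k
    rw [← Real.rpow_mul zero_le_two, mul_assoc, mul_assoc, ← Real.rpow_add zero_lt_two, mul_assoc]
    congr 3; ring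
  choose A hAn hAe using fun k : ℕ => exists_mul_operator (d := d) (p := p) (p' := p') hp hp1
    (c := C * D * (2 : ℝ) ^ (-((k : ℝ) * (σ - |s|)))) (by positivity) (hh.hasTemperateGrowth k)
    (fun u ψ => (H _ _ _ (Real.one_le_rpow one_le_two (Nat.cast_nonneg k)) (hB k).ofReal u ψ).trans_eq
      (by rw [hca]))
  have hsum : Summable A :=
    Summable.of_norm_bounded ((summable_two_rpow (sub_pos.2 hs)).mul_left (C * D)) hAn
  exact ⟨∑' k, A k, fun f φ => hasSum_lpPair_of_summable hsum f fun k => hAe k f φ⟩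

/-- On Schwartz functions u the functional can be computed by dominated convergence, and only the
pointwise sum of the h_k times φ enters. As Schwartz functions are dense, this sum determines the
functional, whatever the decomposition. -/
lemma MultSeq.eq_of_hasSum_aux (hp : p < ⊤) (hp1 : 1 < p) (hp' : p' < ⊤) (hp1' : 1 < p') {s σ : ℝ}
    (hs : |s| < σ) {h : ℕ → Euc d → ℝ} (hh : MultSeq σ h) :
    ∀ φ, ∃ S : Lp ℂ p (volume : Measure (Euc d)) →L[ℂ] ℂ,
      (∀ f, HasSum (fun k => lpPair p p' f ((bessel (-s) (mulS (h k) φ)).toLp p')) (S f)) ∧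
      ∀ u : 𝓢(Euc d, ℂ), S (u.toLp p) = ∫ x, bessel (-s) u x * (((∑' k, h k x : ℝ) : ℂ) * φ x) := by
  intro φ
  obtain ⟨S, hS⟩ := hh.exists_operator hp hp1 hp' hp1' hs
  set P : Lp ℂ p' (volume : Measure (Euc d)) := (bessel (-s) φ).toLp p'
  set S' : Lp ℂ p (volume : Measure (Euc d)) →L[ℂ] ℂ := ((lpPair p p').flip P) ∘L S with hS'
  have hS1 : ∀ f, S' f = lpPair p p' (S f) P := fun f => by
    rw [hS', ContinuousLinearMap.comp_apply, ContinuousLinearMap.flip_apply]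
  refine ⟨S', fun f => by rw [hS1]; exact hS f φ, fun u => ?_⟩
  obtain ⟨C, hC, hb⟩ := hh.exists_norm_le
  have hσ : 0 < σ := (abs_nonneg s).trans_lt hs
  obtain ⟨D, hD, hu⟩ := Cone.exists_norm_le (bessel (-s) u)
  have hsum := (summable_two_rpow hσ).mul_left C
  have h2 : HasSum (fun k => ∫ x, bessel (-s) u x * ((h k x : ℂ) * φ x))
      (∫ x, bessel (-s) u x * (((∑' k, h k x : ℝ) : ℂ) * φ x)) := by
    refine hasSum_integral_of_dominated_convergence
      (fun k x => D * (C * (2 : ℝ) ^ (-((k : ℝ) * σ)) * ‖φ x‖)) (fun k => ?_) (fun k => ?_) ?_ ?_ ?_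
    · exact ((bessel (-s) u).continuous.mul ((Complex.continuous_ofReal.comp
        (hh.contDiff k).continuous).mul φ.continuous)).aestronglyMeasurable
    · refine Eventually.of_forall fun x => ?_
      rw [norm_mul, norm_mul, Complex.norm_real]
      have := hu x
      have := hb k x
      gcongr
    · exact Eventually.of_forall fun x => (hsum.mul_right _).mul_left _
    · have : (fun x => ∑' k : ℕ, D * (C * (2 : ℝ) ^ (-((k : ℝ) * σ)) * ‖φ x‖)) =
          fun x => (D * ∑' k : ℕ, (C * (2 : ℝ) ^ (-((k : ℝ) * σ)))) * ‖φ x‖ := by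
        ext x
        rw [tsum_mul_left, tsum_mul_right, mul_assoc]
      rw [this]
      exact (φ.integrable (μ := volume)).norm.const_mul _
    · refine Eventually.of_forall fun x => ?_
      have : Summable fun k => h k x := Summable.of_norm_bounded hsum (hb · x)
      exact ((Complex.hasSum_ofReal.2 this.hasSum).mul_right _).mul_left _
  have h3 := hS (u.toLp p) φ
  rw [hS1]
  refine h3.unique ?_
  convert h2 using 2 with k
  rw [lpPair_toLp_toLp, ← integral_bessel_mul]
  refine integral_congr_ae (Eventually.of_forall fun x => ?_)
  simp only [hh.mulS_apply]

end

variable {p : ℝ≥0∞} [Fact (1 ≤ p)]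

lemma conj_facts (hp : p < ⊤) (hp1 : 1 < p) : (1 - p⁻¹)⁻¹ < ⊤ ∧ 1 < (1 - p⁻¹)⁻¹ := by
  constructor
  · rw [ENNReal.inv_lt_top, tsub_pos_iff_lt]
    exact ENNReal.inv_lt_one.2 hp1
  · rw [ENNReal.one_lt_inv]
    exact ENNReal.sub_lt_self ENNReal.one_ne_top one_ne_zero (ENNReal.inv_ne_zero.2 hp.ne)

/-- Multiplication by `∑ h_k` is bounded on `H^s_p` for `|s| < σ`. -/
theorem MultSeq.exists_mul (hp : p < ⊤) (hp1 : 1 < p) {s σ : ℝ}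
    (hs : |s| < σ) {h : ℕ → Euc d → ℝ} (hh : MultSeq σ h) :
    ∃ C : ℝ≥0, ∀ (w : 𝓢'(Euc d, ℂ)) (f : Lp ℂ p (volume : Measure (Euc d))),
      TemperedDistribution.besselPotential (Euc d) ℂ s w = (f : 𝓢'(Euc d, ℂ)) →
      ∃ (w' : 𝓢'(Euc d, ℂ)) (g : Lp ℂ p (volume : Measure (Euc d))),
        TemperedDistribution.besselPotential (Euc d) ℂ s w' = (g : 𝓢'(Euc d, ℂ)) ∧
        ‖g‖ₑ ≤ C * ‖f‖ₑ ∧ ∀ φ, HasSum (fun k => w (mulS (h k) φ)) (w' φ) := by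
  have hp' : ENNReal.HolderConjugate p (1 - p⁻¹)⁻¹ :=
    ENNReal.HolderConjugate.inv_one_sub_inv' hp1.le
  have : Fact (1 ≤ (1 - p⁻¹)⁻¹) := by simp [fact_iff]
  obtain ⟨h1, h2⟩ := conj_facts hp hp1
  obtain ⟨S, hS⟩ := hh.exists_operator (p := p) (p' := (1 - p⁻¹)⁻¹) hp hp1 h1 h2 hs
  refine ⟨‖S‖₊, fun w f hw => ⟨TemperedDistribution.besselPotential (Euc d) ℂ (-s)
    ((S f : Lp ℂ p (volume : Measure (Euc d))) : 𝓢'(Euc d, ℂ)), S f, ?_, S.le_opENorm f, fun φ => ?_⟩⟩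
  · ext φ
    rw [besselPotential_apply, besselPotential_apply, bessel_bessel]
    simp
  · rw [besselPotential_apply, coe_Lp_apply (p' := (1 - p⁻¹)⁻¹)]
    simp_rw [apply_eq_lpPair (p' := (1 - p⁻¹)⁻¹) hw]
    exact hS f φ

/-- The product by `∑ h_k` does not depend on the decomposition. -/
theorem MultSeq.eq_of_hasSum (hp : p < ⊤) (hp1 : 1 < p) {s σ σ' : ℝ} (hs : |s| < σ) (hs' : |s| < σ')
    {h h' : ℕ → Euc d → ℝ} (hh : MultSeq σ h) (hh' : MultSeq σ' h') {w : 𝓢'(Euc d, ℂ)}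
    (hw : TemperedDistribution.MemSobolev s p w) {φ φ' : 𝓢(Euc d, ℂ)}
    (e : ∀ x, ((∑' k, h k x : ℝ) : ℂ) * φ x = ((∑' k, h' k x : ℝ) : ℂ) * φ' x) {a a' : ℂ}
    (ha : HasSum (fun k => w (mulS (h k) φ)) a) (ha' : HasSum (fun k => w (mulS (h' k) φ')) a') :
    a = a' := by
  have hp' : ENNReal.HolderConjugate p (1 - p⁻¹)⁻¹ :=
    ENNReal.HolderConjugate.inv_one_sub_inv' hp1.le
  have : Fact (1 ≤ (1 - p⁻¹)⁻¹) := by simp [fact_iff]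
  obtain ⟨h1, h2⟩ := conj_facts hp hp1
  obtain ⟨f, hf⟩ := hw
  obtain ⟨S, hS, hSu⟩ := hh.eq_of_hasSum_aux (p := p) (p' := (1 - p⁻¹)⁻¹) hp hp1 h1 h2 hs φ
  obtain ⟨S', hS', hSu'⟩ := hh'.eq_of_hasSum_aux (p := p) (p' := (1 - p⁻¹)⁻¹) hp hp1 h1 h2 hs' φ'
  have key := eq_of_eq_on_schwartz hp.ne S.continuous S'.continuous (fun u => by
    rw [hSu, hSu']
    simp_rw [e]) f
  simp_rw [apply_eq_lpPair (p' := (1 - p⁻¹)⁻¹) hf] at ha ha'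
  rw [ha.unique (hS f), ha'.unique (hS' f), key]

end Multiplier

/-! ### Smoothness of superpositions of dilated and translated kernels -/

section Kernel

open ProbabilityTheory

variable {d : ℕ} {F : Type} [NormedAddCommGroup F] [NormedSpace ℝ F]

/-- Smooth functions all whose derivatives decay like `(1 + ‖z‖)^(-m)`. -/
structure KerDecay (m : ℕ) (K : Euc d → F) : Prop where
  contDiff : ContDiff ℝ ∞ K
  bound : ∀ i : ℕ, ∃ S : ℝ, 0 ≤ S ∧ ∀ z, ‖iteratedFDeriv ℝ i K z‖ ≤ S * ((1 + ‖z‖) ^ m)⁻¹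

lemma KerDecay.fderiv {m : ℕ} {K : Euc d → F} (hK : KerDecay m K) : KerDecay m (fderiv ℝ K) := by
  refine ⟨hK.contDiff.fderiv_right (by simp), fun i => ?_⟩
  obtain ⟨S, hS, h⟩ := hK.bound (i + 1)
  exact ⟨S, hS, fun z => by rw [norm_iteratedFDeriv_fderiv]; exact h z⟩

variable {Q : Type*} [MeasurableSpace Q] {μ : Measure Q} {m : ℕ}

/-- The weight varies slowly, so its value at x dominates it on the unit ball around x. This
supplies the majorant for differentiation under the integral. -/
lemma decay_le_of_norm_sub_le {Λ l : ℝ} (hl : |l| ≤ Λ) {x x' : Euc d}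
    (hx : ‖x' - x‖ ≤ 1) (b : Euc d) :
    ((1 + ‖l • x' + b‖) ^ m)⁻¹ ≤ (1 + Λ) ^ m * ((1 + ‖l • x + b‖) ^ m)⁻¹ := by
  have hΛ : 0 ≤ Λ := (abs_nonneg _).trans hl
  have h1 : ‖l • x + b‖ ≤ ‖l • x' + b‖ + Λ := by
    have e : l • x + b = (l • x' + b) - l • (x' - x) := by rw [smul_sub]; abel
    rw [e]
    refine (norm_sub_le _ _).trans ?_
    rw [norm_smul, Real.norm_eq_abs]
    have : |l| * ‖x' - x‖ ≤ Λ * 1 := by gcongr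
    linarith
  have h2 : 1 + ‖l • x + b‖ ≤ (1 + Λ) * (1 + ‖l • x' + b‖) := by
    nlinarith [norm_nonneg (l • x' + b)]
  rw [← div_eq_mul_inv, le_div_iff₀ (by positivity), inv_mul_le_iff₀ (by positivity), ← mul_pow,
    mul_comm (1 + ‖l • x' + b‖)]
  gcongr

lemma kernel_integrable {c l : Q → ℝ} {b : Q → Euc d} (hc : Measurable c) (hl : Measurable l)
    (hb : Measurable b)
    (hI : ∀ x, Integrable (fun q => |c q| * ((1 + ‖l q • x + b q‖) ^ m)⁻¹) μ)
    {K : Euc d → F} {S : ℝ} (hKc : Continuous K) (hK : ∀ z, ‖K z‖ ≤ S * ((1 + ‖z‖) ^ m)⁻¹) (x : Euc d) :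
    Integrable (fun q => c q • K (l q • x + b q)) μ := by
  refine ((hI x).const_mul S).mono' ?_ ?_
  · refine hc.aestronglyMeasurable.smul ?_
    exact hKc.stronglyMeasurable.comp_measurable ((hl.smul_const x).add hb) |>.aestronglyMeasurable
  · refine Eventually.of_forall fun q => ?_
    rw [norm_smul, Real.norm_eq_abs]
    calc |c q| * ‖K (l q • x + b q)‖ ≤ |c q| * (S * ((1 + ‖l q • x + b q‖) ^ m)⁻¹) := by
          gcongr; exact hK _
      _ = _ := by ring

lemma kernel_hasFDerivAt {c l : Q → ℝ} {b : Q → Euc d} (hc : Measurable c) (hl : Measurable l)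
    (hb : Measurable b) {Λ : ℝ} (hΛ : ∀ᵐ q ∂μ, |l q| ≤ Λ)
    (hI : ∀ x, Integrable (fun q => |c q| * ((1 + ‖l q • x + b q‖) ^ m)⁻¹) μ)
    {K : Euc d → F} (hK : KerDecay m K) (x : Euc d) :
    HasFDerivAt (fun x => ∫ q, c q • K (l q • x + b q) ∂μ)
      (∫ q, (c q * l q) • fderiv ℝ K (l q • x + b q) ∂μ) x := by
  obtain ⟨S, hS, hKS⟩ := hK.bound 0
  obtain ⟨S', hS', hKS'⟩ := hK.bound 1
  simp only [norm_iteratedFDeriv_zero] at hKS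
  simp only [norm_iteratedFDeriv_one] at hKS'
  have hmeas : ∀ x, Measurable fun q => l q • x + b q := fun x => (hl.smul_const x).add hb
  refine hasFDerivAt_integral_of_dominated_of_fderiv_le
    (bound := fun q => Λ * S' * (1 + Λ) ^ m * (|c q| * ((1 + ‖l q • x + b q‖) ^ m)⁻¹))
    (F' := fun x q => (c q * l q) • fderiv ℝ K (l q • x + b q))
    (Metric.ball_mem_nhds x one_pos)
    (Eventually.of_forall fun x => (kernel_integrable hc hl hb hI hK.contDiff.continuous hKS x).1)
    (kernel_integrable hc hl hb hI hK.contDiff.continuous hKS x) ?_ ?_ ((hI x).const_mul _) ?_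
  · exact (hc.mul hl).aestronglyMeasurable.smul
      (hK.fderiv.contDiff.continuous.stronglyMeasurable.comp_measurable (hmeas x)).aestronglyMeasurable
  · filter_upwards [hΛ] with q hq y hy
    have hy' : ‖y - x‖ ≤ 1 := by
      rw [← dist_eq_norm]; exact (Metric.mem_ball.1 hy).le
    have hΛ0 : 0 ≤ Λ := (abs_nonneg _).trans hq
    have := decay_le_of_norm_sub_le (m := m) hq hy' (b q)
    rw [norm_smul, norm_mul, Real.norm_eq_abs, Real.norm_eq_abs]
    calc _ ≤ |c q| * Λ * (S' * ((1 + Λ) ^ m * ((1 + ‖l q • x + b q‖) ^ m)⁻¹)) := by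
          gcongr
          exact (hKS' _).trans (by gcongr)
      _ = _ := by ring
  · refine Eventually.of_forall fun q y _ => ?_
    have h1 : HasFDerivAt (fun x => l q • x + b q) (l q • ContinuousLinearMap.id ℝ (Euc d)) y :=
      ((hasFDerivAt_id y).const_smul (l q)).add_const (b q)
    have h2 := ((hK.contDiff.differentiable (by simp)) (l q • y + b q)).hasFDerivAt.comp y h1
    have h3 := h2.const_smul (c q)
    have e : c q • (fderiv ℝ K (l q • y + b q) ∘L (l q • ContinuousLinearMap.id ℝ (Euc d))) =
        (c q * l q) • fderiv ℝ K (l q • y + b q) := by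
      ext v
      simp [mul_smul]
    rw [e] at h3
    exact h3

/-- Superpositions of dilates and translates of a kernel are smooth, with bounds. -/
lemma kernel_contDiff {l : Q → ℝ} {b : Q → Euc d} (hl : Measurable l)
    (hb : Measurable b) {Λ : ℝ} (hΛ0 : 0 ≤ Λ) (hΛ : ∀ᵐ q ∂μ, |l q| ≤ Λ) (n : ℕ) :
    ∀ {F : Type} [NormedAddCommGroup F] [NormedSpace ℝ F] {c : Q → ℝ}, Measurable c →
    (∀ x, Integrable (fun q => |c q| * ((1 + ‖l q • x + b q‖) ^ m)⁻¹) μ) →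
    ∀ {M : ℝ}, (∀ x, ∫ q, |c q| * ((1 + ‖l q • x + b q‖) ^ m)⁻¹ ∂μ ≤ M) →
    ∀ {K : Euc d → F}, KerDecay m K →
    ContDiff ℝ n (fun x : Euc d => ∫ q, c q • K (l q • x + b q) ∂μ) ∧
    ∀ S, (∀ z, ‖iteratedFDeriv ℝ n K z‖ ≤ S * ((1 + ‖z‖) ^ m)⁻¹) →
      ∀ x, ‖iteratedFDeriv ℝ n (fun x => ∫ q, c q • K (l q • x + b q) ∂μ) x‖ ≤ S * Λ ^ n * M := by
  -- Each derivative multiplies the coefficient by the dilation parameter `l` and replaces `K` by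
  -- its derivative. The latter takes values in another space, so `F`, `c`, `M` and `K` all have to
  -- vary in the induction.
  induction n with
  | zero =>
    intro F _ _ c hc hI M hM K hK
    have hcont : Continuous (fun x => ∫ q, c q • K (l q • x + b q) ∂μ) :=
      continuous_iff_continuousAt.2 fun x => (kernel_hasFDerivAt hc hl hb hΛ hI hK x).continuousAt
    refine ⟨by rw [Nat.cast_zero]; exact contDiff_zero.2 hcont, fun S hS x => ?_⟩
    simp only [norm_iteratedFDeriv_zero] at hS ⊢
    have hS0 : 0 ≤ S := by
      have := (norm_nonneg _).trans (hS 0)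
      simpa using this
    refine (norm_integral_le_of_norm_le ((hI x).const_mul S) (Eventually.of_forall fun q => ?_)).trans ?_
    · rw [norm_smul, Real.norm_eq_abs]
      calc |c q| * ‖K (l q • x + b q)‖ ≤ |c q| * (S * ((1 + ‖l q • x + b q‖) ^ m)⁻¹) := by
            gcongr; exact hS _
        _ = _ := by ring
    · rw [integral_const_mul, pow_zero, mul_one]
      gcongr
      exact hM x
  | succ n ih =>
    intro F _ _ c hc hI M hM K hK
    have hd := kernel_hasFDerivAt hc hl hb hΛ hI hK
    have hle : ∀ x, ∀ᵐ q ∂μ, |c q * l q| * ((1 + ‖l q • x + b q‖) ^ m)⁻¹ ≤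
        Λ * (|c q| * ((1 + ‖l q • x + b q‖) ^ m)⁻¹) := by
      intro x
      filter_upwards [hΛ] with q hq
      rw [abs_mul, mul_comm |c q|, mul_assoc]
      gcongr
    have hI' : ∀ x, Integrable (fun q => |c q * l q| * ((1 + ‖l q • x + b q‖) ^ m)⁻¹) μ := by
      intro x
      refine ((hI x).const_mul Λ).mono' ?_ ?_
      · refine Measurable.aestronglyMeasurable ?_
        have : Measurable fun q => l q • x + b q := (hl.smul_const x).add hb
        fun_prop
      · filter_upwards [hle x] with q hq
        rw [Real.norm_of_nonneg (by positivity)]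
        exact hq
    have hM' : ∀ x, ∫ q, |c q * l q| * ((1 + ‖l q • x + b q‖) ^ m)⁻¹ ∂μ ≤ Λ * M := by
      intro x
      refine (integral_mono_ae (hI' x) ((hI x).const_mul Λ) (hle x)).trans ?_
      rw [integral_const_mul]
      gcongr
      exact hM x
    obtain ⟨h1, h2⟩ := ih (hc.mul hl) hI' hM' hK.fderiv
    have hfd : fderiv ℝ (fun x => ∫ q, c q • K (l q • x + b q) ∂μ) =
        fun x => ∫ q, (c q * l q) • fderiv ℝ K (l q • x + b q) ∂μ :=
      funext fun x => (hd x).fderiv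
    refine ⟨?_, fun S hS x => ?_⟩
    · rw [Nat.cast_add, Nat.cast_one, contDiff_succ_iff_fderiv]
      refine ⟨fun x => (hd x).differentiableAt, by simp, ?_⟩
      rw [hfd]
      exact h1
    · rw [← norm_iteratedFDeriv_fderiv, hfd]
      refine (h2 S (fun z => by rw [norm_iteratedFDeriv_fderiv]; exact hS z) x).trans_eq ?_
      ring

end Kernel

/-! ### The Gaussian density and its derivatives -/

section Gauss

open ProbabilityTheory FourierTransform

variable {d : ℕ}

/-- The density of the standard Gaussian measure. -/
def gaussKer (d : ℕ) (x : Euc d) : ℝ := (2 * Real.pi) ^ (-(d / 2 : ℝ)) * Real.exp (-(‖x‖ ^ 2 / 2))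

lemma exists_pow_mul_exp_le (M : ℕ) : ∃ C : ℝ, 0 ≤ C ∧ ∀ t : ℝ, 0 ≤ t →
    (1 + t) ^ M * Real.exp (-(t ^ 2 / 2)) ≤ C := by
  -- (1+t)^M ≤ M! e^{1+t}, and 1 + t - t²/2 has its maximum 3/2 at t = 1.
  refine ⟨(M.factorial : ℝ) * Real.exp (3 / 2), by positivity, fun t ht => ?_⟩
  have h1 : (1 + t) ^ M ≤ M.factorial * Real.exp (1 + t) := by
    have := Real.pow_div_factorial_le_exp (1 + t) (by linarith) M
    rw [div_le_iff₀ (by positivity)] at this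
    linarith
  calc _ ≤ M.factorial * Real.exp (1 + t) * Real.exp (-(t ^ 2 / 2)) := by gcongr
    _ = M.factorial * Real.exp (1 + t - t ^ 2 / 2) := by
      rw [mul_assoc, ← Real.exp_add]; congr 2
    _ ≤ _ := by
      gcongr
      nlinarith [sq_nonneg (t - 1)]

/-- By the bound for derivatives of a composition, each derivative of the Gaussian is at most the
Gaussian times a power of 1+‖z‖, and the exponential absorbs any power. -/
lemma kerDecay_gaussKer (m : ℕ) : KerDecay m (gaussKer d) := by
  have hq : (fun x : Euc d => -(‖x‖ ^ 2 / 2)).HasTemperateGrowth := by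
    have : (fun x : Euc d => -((1 / 2 : ℝ) * ‖x‖ ^ 2)).HasTemperateGrowth := by fun_prop
    convert this using 3
    ring
  have hc : ContDiff ℝ ∞ (fun x : Euc d => Real.exp (-(‖x‖ ^ 2 / 2))) :=
    Real.contDiff_exp.comp hq.1
  refine ⟨contDiff_const.mul hc, fun i => ?_⟩
  obtain ⟨k, C, hC, H⟩ := hq.norm_iteratedFDeriv_le_uniform i
  obtain ⟨D, hD, hE⟩ := exists_pow_mul_exp_le (k * i + m)
  set a := (2 * Real.pi) ^ (-(d / 2 : ℝ))
  have ha : 0 ≤ a := by positivity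
  refine ⟨a * (i.factorial * (1 + C) ^ i * D), by positivity, fun z => ?_⟩
  have h1 : ‖iteratedFDeriv ℝ i (fun x : Euc d => Real.exp (-(‖x‖ ^ 2 / 2))) z‖ ≤
      i.factorial * Real.exp (-(‖z‖ ^ 2 / 2)) * ((1 + C) * (1 + ‖z‖) ^ k) ^ i := by
    refine norm_iteratedFDeriv_comp_le (𝕜 := ℝ) (g := Real.exp)
      (f := fun x : Euc d => -(‖x‖ ^ 2 / 2)) (N := ∞) Real.contDiff_exp hq.1
      (by exact_mod_cast le_top) z (fun j _ => ?_) (fun j hj hji => ?_)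
    · rw [norm_iteratedFDeriv_eq_norm_iteratedDeriv, iteratedDeriv_eq_iterate, Real.iter_deriv_exp,
        Real.norm_of_nonneg (Real.exp_pos _).le]
    · have h2 : (1 : ℝ) ≤ (1 + C) * (1 + ‖z‖) ^ k := by
        have : (1 : ℝ) ≤ (1 + ‖z‖) ^ k := one_le_pow₀ (by linarith [norm_nonneg z])
        nlinarith
      refine (H j hji z).trans (le_trans ?_ (le_self_pow₀ h2 (by omega)))
      gcongr
      linarith
  have h3 : iteratedFDeriv ℝ i (gaussKer d) z =
      a • iteratedFDeriv ℝ i (fun x : Euc d => Real.exp (-(‖x‖ ^ 2 / 2))) z := by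
    rw [← iteratedFDeriv_const_smul_apply (hc.of_le (by exact_mod_cast le_top)).contDiffAt]
    rfl
  rw [h3, norm_smul, Real.norm_of_nonneg ha, mul_assoc a]
  gcongr
  refine h1.trans ?_
  have h4 := hE ‖z‖ (norm_nonneg z)
  rw [← div_eq_mul_inv, le_div_iff₀ (by positivity)]
  calc _ = i.factorial * (1 + C) ^ i * ((1 + ‖z‖) ^ (k * i + m) * Real.exp (-(‖z‖ ^ 2 / 2))) := by
        rw [mul_pow, pow_add, pow_mul]; ring
    _ ≤ _ := by gcongr

lemma gaussKer_nonneg (x : Euc d) : 0 ≤ gaussKer d x := by unfold gaussKer; positivity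

lemma gaussKer_neg (x : Euc d) : gaussKer d (-x) = gaussKer d x := by simp [gaussKer]

lemma continuous_gaussKer : Continuous (gaussKer d) := (kerDecay_gaussKer 0).contDiff.continuous

/-- The two finite measures have the same characteristic function; the density's is the Fourier
transform of a Gaussian at the frequency -t/(2π). -/
lemma stdGaussian_eq_withDensity :
    stdGaussian (Euc d) = (volume : Measure (Euc d)).withDensity
      (fun x => ENNReal.ofReal (gaussKer d x)) := by
  have hi : Integrable (fun x : Euc d => Real.exp (-(1 / 2) * ‖x‖ ^ 2)) := by
    have := GaussianFourier.integrable_cexp_neg_mul_sq_norm_add (V := Euc d) (b := 1 / 2) (by norm_num)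
      0 0
    have := this.norm
    refine this.congr (Eventually.of_forall fun x => ?_)
    simp only [Complex.norm_exp]
    congr 1
    simp [← Complex.ofReal_pow]
  have hi' : Integrable (gaussKer d) := by
    refine (hi.const_mul ((2 * Real.pi) ^ (-(d / 2 : ℝ)))).congr (Eventually.of_forall fun x => ?_)
    simp only [gaussKer]; congr 2; ring
  have : IsFiniteMeasure ((volume : Measure (Euc d)).withDensity
      (fun x => ENNReal.ofReal (gaussKer d x))) :=
    isFiniteMeasure_withDensity_ofReal hi'.2
  refine Measure.ext_of_charFun (funext fun t => ?_)
  rw [charFun_stdGaussian, charFun_apply, integral_withDensity_eq_integral_toReal_smul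
    (by exact (continuous_gaussKer.measurable.ennreal_ofReal)) (by simp)]
  have h := fourier_gaussian_innerProductSpace (V := Euc d) (b := 1 / 2) (by norm_num)
    (-(2 * Real.pi)⁻¹ • t)
  rw [Real.fourier_eq'] at h
  have e : ∀ x : Euc d, (ENNReal.ofReal (gaussKer d x)).toReal •
      Complex.exp (inner ℝ x t * Complex.I) = ((2 * Real.pi) ^ (-(d / 2 : ℝ)) : ℝ) *
      (Complex.exp (((-2 * Real.pi * inner ℝ x (-(2 * Real.pi)⁻¹ • t) : ℝ) : ℂ) * Complex.I) •
        Complex.exp (-(1 / 2) * ‖x‖ ^ 2)) := by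
    intro x
    rw [ENNReal.toReal_ofReal (gaussKer_nonneg x), inner_smul_right, gaussKer, Complex.real_smul]
    push_cast
    have hp : (Real.pi : ℂ) ≠ 0 := by exact_mod_cast Real.pi_ne_zero
    rw [smul_eq_mul, mul_assoc, mul_comm (Complex.exp (-(_ / 2)))]
    congr 3 <;> field_simp
  simp_rw [e]
  rw [integral_const_mul, h]
  have hp : (0 : ℝ) < 2 * Real.pi := by positivity
  have e1 : (((2 * Real.pi) ^ (-(d / 2 : ℝ)) : ℝ) : ℂ) *
      ((Real.pi : ℂ) / (1 / 2)) ^ ((Module.finrank ℝ (Euc d) : ℂ) / 2) = 1 := by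
    have e2 : ((Real.pi : ℂ) / (1 / 2)) ^ ((Module.finrank ℝ (Euc d) : ℂ) / 2) =
        (((2 * Real.pi) ^ (d / 2 : ℝ) : ℝ) : ℂ) := by
      rw [Complex.ofReal_cpow hp.le, finrank_euclideanSpace_fin]
      push_cast
      congr 1
      ring
    rw [e2, ← Complex.ofReal_mul, ← Real.rpow_add hp]
    simp
  rw [← mul_assoc, e1, one_mul, norm_smul]
  congr 1
  have : ‖-(2 * Real.pi)⁻¹‖ ^ 2 = (2 * Real.pi)⁻¹ ^ 2 := by rw [Real.norm_eq_abs, sq_abs, neg_sq]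
  rw [← Complex.ofReal_pow (_ * _), mul_pow, this]
  push_cast
  have hp : (Real.pi : ℂ) ≠ 0 := by exact_mod_cast Real.pi_ne_zero
  field_simp

end Gauss

/-! ### Hölder estimates for the kernel coefficients -/

section Weight

variable {d : ℕ}

/-- The weight that controls the kernels. -/
def decay (d : ℕ) (z : Euc d) : ℝ := ((1 + ‖z‖) ^ (d + 1))⁻¹

lemma decay_nonneg (z : Euc d) : 0 ≤ decay d z := by unfold decay; positivity

lemma continuous_decay : Continuous (decay d) := by
  unfold decay
  refine Continuous.inv₀ (by fun_prop) fun z => by positivity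

lemma integrable_decay_rpow {r : ℝ} (hr : 1 ≤ r) : Integrable (fun z : Euc d => decay d z ^ r) := by
  have h := integrable_one_add_norm (E := Euc d) (μ := volume) (r := (d + 1 : ℕ) * r) (by
    rw [finrank_euclideanSpace_fin]
    push_cast
    nlinarith [(Nat.cast_nonneg d : (0 : ℝ) ≤ d)])
  refine h.congr (Eventually.of_forall fun z => ?_)
  simp only [decay]
  rw [Real.inv_rpow (by positivity), Real.rpow_neg (by positivity), Real.rpow_mul (by positivity),
    Real.rpow_natCast]

variable {q : ℝ≥0∞} {g : Euc d → ℝ}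

/-- Hölder's inequality; the L^{r'} norm of the weight dilated by τ scales as τ^{d/r'}. The weight
lies in every L^{r'} with r' ≥ 1 because its exponent d+1 exceeds d. -/
lemma integral_mul_decay_le {r r' : ℝ} (hr : r.HolderConjugate r')
    (hg : MemLp g (ENNReal.ofReal r)) (x : Euc d) {τ : ℝ} (hτ : 0 < τ) :
    Integrable (fun y => |g y| * decay d (τ⁻¹ • (x - y))) ∧
    ∫ y, |g y| * decay d (τ⁻¹ • (x - y)) ≤ (eLpNorm g (ENNReal.ofReal r) volume).toReal *
      ((∫ z : Euc d, decay d z ^ r') ^ (1 / r') * (τ ^ d) ^ (1 / r')) := by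
  have hi := integrable_decay_rpow (d := d) hr.symm.lt.le
  have hi' : Integrable (fun y => decay d (τ⁻¹ • (x - y)) ^ r') :=
    (hi.comp_smul (inv_ne_zero hτ.ne')).comp_sub_left x
  have hm : MemLp (fun y => decay d (τ⁻¹ • (x - y))) (ENNReal.ofReal r') := by
    rw [← integrable_norm_rpow_iff]
    · rw [ENNReal.toReal_ofReal hr.symm.nonneg]
      refine hi'.congr (Eventually.of_forall fun y => ?_)
      simp only [Real.norm_of_nonneg (decay_nonneg _)]
    · exact (continuous_decay.comp (by fun_prop)).aestronglyMeasurable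
    · simpa using hr.symm.pos
    · exact ENNReal.ofReal_ne_top
  have hc : ENNReal.HolderConjugate (ENNReal.ofReal r) (ENNReal.ofReal r') := hr.ennrealOfReal
  refine ⟨hg.norm.integrable_mul hm, ?_⟩
  refine (integral_mul_le_Lp_mul_Lq_of_nonneg hr (Eventually.of_forall fun y => abs_nonneg (g y))
    (Eventually.of_forall fun y => decay_nonneg _) hg.norm hm).trans_eq ?_
  congr 1
  · rw [MemLp.eLpNorm_eq_integral_rpow_norm (by simpa using hr.pos) ENNReal.ofReal_ne_top hg,
      ENNReal.toReal_ofReal (by positivity), ENNReal.toReal_ofReal hr.nonneg, one_div]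
    rfl
  · rw [integral_sub_left_eq_self (fun y => decay d (τ⁻¹ • y) ^ r') volume x,
      Measure.integral_comp_inv_smul volume (fun y => decay d y ^ r') τ, smul_eq_mul,
      finrank_euclideanSpace_fin, abs_of_pos (by positivity), mul_comm,
      Real.mul_rpow (integral_nonneg fun z => Real.rpow_nonneg (decay_nonneg z) _) (by positivity)]

/-- The coefficients in the superposition of Gaussian kernels that gives the Bessel potential of
order `-a` of `g`. -/
def kerCoef (a : ℝ) (g : Euc d → ℝ) (v : ℝ × Euc d) : ℝ :=
  (subConstNeg a)⁻¹ * (v.1 ^ (a - 1) * Real.exp (-v.1 ^ 2)) * ((v.1 * gaussScale) ^ d)⁻¹ * g v.2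

/-- The dilation parameter of the kernels. -/
def kerScale (v : ℝ × Euc d) : ℝ := (v.1 * gaussScale)⁻¹

/-- The translation parameter of the kernels. -/
def kerShift (v : ℝ × Euc d) : Euc d := -((v.1 * gaussScale)⁻¹ • v.2)

lemma kerScale_add_kerShift (v : ℝ × Euc d) (x : Euc d) :
    kerScale v • x + kerShift v = (v.1 * gaussScale)⁻¹ • (x - v.2) := by
  rw [kerScale, kerShift, smul_sub, sub_eq_add_neg]

lemma measurable_kerScale : Measurable (kerScale (d := d)) := by unfold kerScale; fun_prop
lemma measurable_kerShift : Measurable (kerShift (d := d)) := by unfold kerShift; fun_prop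
lemma measurable_kerCoef (a : ℝ) (hg : Measurable g) : Measurable (kerCoef a g) := by
  unfold kerCoef; fun_prop

/-- This is where the embedding loses d/r derivatives. The normalization t^{-d} of the kernel and
the factor t^{d/r'} from Hölder's inequality leave t^{-d/r}, which turns t^{σ+d/r-1} into t^{σ-1},
an integrable singularity. -/
lemma kerCoef_weight {r r' : ℝ} (hr : r.HolderConjugate r') {σ : ℝ} (hσ : 0 < σ) :
    ∃ D : ℝ, 0 ≤ D ∧ ∀ (g : Euc d → ℝ), Measurable g → MemLp g (ENNReal.ofReal r) →
      ∀ I ⊆ Ioi (0 : ℝ), MeasurableSet I → ∀ x : Euc d,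
        Integrable (fun v => |kerCoef (σ + d / r) g v| * decay d (kerScale v • x + kerShift v))
          ((volume.restrict I).prod volume) ∧
        ∫ v, |kerCoef (σ + d / r) g v| * decay d (kerScale v • x + kerShift v)
          ∂((volume.restrict I).prod volume) ≤ D * (eLpNorm g (ENNReal.ofReal r) volume).toReal *
            ∫ t in I, t ^ (σ - 1) * Real.exp (-t ^ 2) := by
  set a := σ + d / r with ha
  have ha0 : 0 < a := by have := hr.pos; positivity
  have hk := subConstNeg_pos ha0
  have hs := gaussScale_pos
  set w := (∫ z : Euc d, decay d z ^ r') ^ (1 / r')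
  have hw : 0 ≤ w := Real.rpow_nonneg (integral_nonneg fun z => Real.rpow_nonneg (decay_nonneg z) _) _
  set D := (subConstNeg a)⁻¹ * (gaussScale ^ (-(d / r) : ℝ) * w) with hD
  refine ⟨D, by positivity, fun g hgm hg I hI hIm x => ?_⟩
  set G := (eLpNorm g (ENNReal.ofReal r) volume).toReal
  have hG : 0 ≤ G := ENNReal.toReal_nonneg
  have hpos : ∀ᵐ t ∂(volume.restrict I), 0 < t := by
    filter_upwards [ae_restrict_mem hIm] with t ht using hI ht
  have e : ∀ t : ℝ, 0 < t → ∀ y, |kerCoef a g (t, y)| *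
      decay d (kerScale (t, y) • x + kerShift (t, y)) =
      ((subConstNeg a)⁻¹ * (t ^ (a - 1) * Real.exp (-t ^ 2)) * ((t * gaussScale) ^ d)⁻¹) *
        (|g y| * decay d ((t * gaussScale)⁻¹ • (x - y))) := by
    intro t ht y
    rw [kerScale_add_kerShift, kerCoef, abs_mul, abs_of_nonneg (by positivity)]
    ring
  have hle : ∀ t : ℝ, 0 < t → ∫ y, |kerCoef a g (t, y)| *
      decay d (kerScale (t, y) • x + kerShift (t, y)) ≤ D * G * (t ^ (σ - 1) * Real.exp (-t ^ 2)) := by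
    intro t ht
    simp_rw [e t ht]
    rw [integral_const_mul]
    refine (mul_le_mul_of_nonneg_left (integral_mul_decay_le hr hg x
      (mul_pos ht hs)).2 (by positivity)).trans_eq ?_
    have e1 : ((t * gaussScale) ^ d)⁻¹ * ((t * gaussScale) ^ d) ^ (1 / r') =
        t ^ (-(d / r) : ℝ) * gaussScale ^ (-(d / r) : ℝ) := by
      rw [← Real.mul_rpow ht.le hs.le, ← Real.rpow_natCast, ← Real.rpow_mul (by positivity),
        ← Real.rpow_neg (by positivity), ← Real.rpow_add (by positivity)]
      congr 1
      have := hr.inv_add_inv_eq_one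
      rw [one_div, div_eq_mul_inv]
      linear_combination (d : ℝ) * this
    have e2 : t ^ (σ - 1) = t ^ (a - 1) * t ^ (-(d / r) : ℝ) := by
      rw [← Real.rpow_add ht]; congr 1; rw [ha]; ring
    rw [e2, hD]
    linear_combination (subConstNeg a)⁻¹ * (t ^ (a - 1) * Real.exp (-t ^ 2)) * G * w * e1
  have hmeas : AEStronglyMeasurable (fun v : ℝ × Euc d => |kerCoef a g v| *
      decay d (kerScale v • x + kerShift v)) ((volume.restrict I).prod volume) := by
    refine Measurable.aestronglyMeasurable ?_
    have h1 := measurable_kerCoef a hgm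
    have h2 := continuous_decay.measurable.comp
      ((measurable_kerScale (d := d)).smul_const x |>.add measurable_kerShift)
    exact (h1.norm).mul h2
  have hint : IntegrableOn (fun t : ℝ => t ^ (σ - 1) * Real.exp (-t ^ 2)) I :=
    (integrableOn_subConstNeg hσ).mono_set hI
  have hnn : ∀ v : ℝ × Euc d, 0 ≤ |kerCoef a g v| * decay d (kerScale v • x + kerShift v) :=
    fun v => mul_nonneg (abs_nonneg _) (decay_nonneg _)
  have hI1 : Integrable (fun v => |kerCoef a g v| * decay d (kerScale v • x + kerShift v))
      ((volume.restrict I).prod volume) := by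
    rw [integrable_prod_iff hmeas]
    constructor
    · filter_upwards [hpos] with t ht
      simp_rw [e t ht]
      exact (integral_mul_decay_le hr hg x (mul_pos ht hs)).1.const_mul _
    · refine (hint.const_mul (D * G)).mono' hmeas.norm.integral_prod_right' ?_
      filter_upwards [hpos] with t ht
      simp_rw [Real.norm_of_nonneg (hnn _)]
      rw [Real.norm_of_nonneg (integral_nonneg fun y => hnn (t, y))]
      exact hle t ht
  refine ⟨hI1, ?_⟩
  rw [integral_prod _ hI1, ← integral_const_mul]
  refine integral_mono_ae hI1.integral_prod_left (hint.const_mul _) ?_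
  filter_upwards [hpos] with t ht using hle t ht

end Weight

/-! ### Dyadic decomposition in the scale of the Gaussian kernels -/

section Decomposition

open ProbabilityTheory

variable {d : ℕ}

lemma MultSeq.summable {F : Type*} [NormedAddCommGroup F] [NormedSpace ℝ F] [CompleteSpace F]
    {σ : ℝ} (hσ : 0 < σ) {h : ℕ → Euc d → F} (hh : MultSeq σ h) (x : Euc d) :
    Summable fun k => h k x := by
  obtain ⟨C, -, hb⟩ := hh.exists_norm_le
  exact Summable.of_norm_bounded ((summable_two_rpow hσ).mul_left C) (hb · x)

lemma MultSeq.continuous_tsum {F : Type*} [NormedAddCommGroup F] [NormedSpace ℝ F] [CompleteSpace F]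
    {σ : ℝ} (hσ : 0 < σ) {h : ℕ → Euc d → F} (hh : MultSeq σ h) :
    Continuous fun x => ∑' k, h k x := by
  obtain ⟨C, -, hb⟩ := hh.exists_norm_le
  exact _root_.continuous_tsum (fun k => (hh.contDiff k).continuous)
    ((summable_two_rpow hσ).mul_left C) fun k x => hb k x

/-- The dyadic partition of the half line. -/
def dyadic : ℕ → Set ℝ := disjointed fun k : ℕ => Ioi ((2 : ℝ) ^ (-(k : ℝ)))

lemma dyadic_subset (k : ℕ) : dyadic k ⊆ Ioi ((2 : ℝ) ^ (-(k : ℝ))) := disjointed_subset _ _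

lemma dyadic_subset_Ioi (k : ℕ) : dyadic k ⊆ Ioi 0 :=
  (dyadic_subset k).trans (Ioi_subset_Ioi (by positivity))

lemma measurableSet_dyadic (k : ℕ) : MeasurableSet (dyadic k) :=
  MeasurableSet.disjointed (fun _ => measurableSet_Ioi) k

lemma iUnion_dyadic : ⋃ k, dyadic k = Ioi 0 := by
  rw [dyadic, iUnion_disjointed]
  refine Subset.antisymm (iUnion_subset fun k => Ioi_subset_Ioi (by positivity)) fun t ht => ?_
  obtain ⟨k, hk⟩ := exists_pow_lt_of_lt_one (mem_Ioi.1 ht) (by norm_num : (1 / 2 : ℝ) < 1)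
  refine mem_iUnion.2 ⟨k, ?_⟩
  rw [mem_Ioi, Real.rpow_neg zero_le_two, Real.rpow_natCast]
  simpa using hk

lemma dyadic_succ_subset (k : ℕ) : dyadic (k + 1) ⊆ Ioc 0 ((2 : ℝ) ^ (-(k : ℝ))) := by
  intro t ht
  refine ⟨dyadic_subset_Ioi _ ht, ?_⟩
  have hd : Disjoint (dyadic (k + 1)) (Ioi ((2 : ℝ) ^ (-(k : ℝ)))) := by
    have : Monotone fun k : ℕ => Ioi ((2 : ℝ) ^ (-(k : ℝ))) := fun i j hij =>
      Ioi_subset_Ioi (Real.rpow_le_rpow_of_exponent_le one_le_two (by simpa using hij))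
    rw [dyadic, this.disjointed_add_one]
    exact disjoint_sdiff_left
  by_contra h
  exact hd.le_bot ⟨ht, not_le.1 h⟩

lemma integral_dyadic_le {σ : ℝ} (hσ : 0 < σ) : ∃ C : ℝ, 0 ≤ C ∧ ∀ k : ℕ,
    ∫ t in dyadic k, t ^ (σ - 1) * Real.exp (-t ^ 2) ≤ C * (2 : ℝ) ^ (-((k : ℝ) * σ)) := by
  have h1 := subConstNeg_pos hσ
  -- The first term serves k = 0, where the whole integral is an upper bound. The second serves k+1:
  -- those scales are at most 2^{-k} and not 2^{-(k+1)}, whence the factor 2^σ.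
  refine ⟨subConstNeg σ + 2 ^ σ / σ, by positivity, fun k => ?_⟩
  have hnn : ∀ t ∈ Ioi (0 : ℝ), 0 ≤ t ^ (σ - 1) * Real.exp (-t ^ 2) := fun t ht => by
    have : (0 : ℝ) < t := ht
    positivity
  rcases k with _ | k
  · simp only [Nat.cast_zero, zero_mul, neg_zero, Real.rpow_zero, mul_one]
    have : ∫ t in dyadic 0, t ^ (σ - 1) * Real.exp (-t ^ 2) ≤ subConstNeg σ :=
      setIntegral_mono_set (integrableOn_subConstNeg hσ)
        ((ae_restrict_mem measurableSet_Ioi).mono hnn) (dyadic_subset_Ioi 0).eventuallyLE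
    have : 0 ≤ 2 ^ σ / σ := by positivity
    linarith
  · set b := (2 : ℝ) ^ (-(k : ℝ))
    have hb : 0 < b := by positivity
    have hi : IntegrableOn (fun t : ℝ => t ^ (σ - 1)) (Ioc 0 b) := by
      rw [← intervalIntegrable_iff_integrableOn_Ioc_of_le hb.le]
      exact intervalIntegral.intervalIntegrable_rpow' (by linarith)
    calc _ ≤ ∫ t in dyadic (k + 1), t ^ (σ - 1) := by
          refine setIntegral_mono_on
            ((integrableOn_subConstNeg hσ).mono_set (dyadic_subset_Ioi _))
            (hi.mono_set (dyadic_succ_subset k)) (measurableSet_dyadic _) fun t ht => ?_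
          have : (0 : ℝ) < t := dyadic_subset_Ioi _ ht
          refine mul_le_of_le_one_right (by positivity) ?_
          rw [Real.exp_le_one_iff]
          linarith [sq_nonneg t]
      _ ≤ ∫ t in Ioc 0 b, t ^ (σ - 1) :=
          setIntegral_mono_set hi ((ae_restrict_mem measurableSet_Ioc).mono fun t ht =>
            Real.rpow_nonneg ht.1.le _) (dyadic_succ_subset k).eventuallyLE
      _ = b ^ σ / σ := by
          rw [← intervalIntegral.integral_of_le hb.le, integral_rpow (Or.inl (by linarith))]
          simp [Real.zero_rpow hσ.ne']
      _ = 2 ^ σ / σ * (2 : ℝ) ^ (-(((k + 1 : ℕ) : ℝ) * σ)) := by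
          rw [div_mul_eq_mul_div, ← Real.rpow_add zero_lt_two, ← Real.rpow_mul zero_le_two]
          congr 2
          push_cast
          ring
      _ ≤ _ := by gcongr; linarith

/-- The superposition of Gaussian kernels over a set of scales. -/
def kerSum (a : ℝ) (g : Euc d → ℝ) (I : Set ℝ) (x : Euc d) : ℝ :=
  ∫ v, kerCoef a g v • gaussKer d (kerScale v • x + kerShift v) ∂((volume.restrict I).prod volume)

variable {r r' σ : ℝ}

lemma kerSum_integrable (hr : r.HolderConjugate r') (hσ : 0 < σ) {g : Euc d → ℝ}
    (hgm : Measurable g) (hg : MemLp g (ENNReal.ofReal r)) {I : Set ℝ} (hI : I ⊆ Ioi 0)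
    (hIm : MeasurableSet I) (x : Euc d) :
    Integrable (fun v => kerCoef (σ + d / r) g v • gaussKer d (kerScale v • x + kerShift v))
      ((volume.restrict I).prod volume) := by
  obtain ⟨D, hD, H⟩ := kerCoef_weight (d := d) hr hσ
  obtain ⟨S, hS, hK⟩ := (kerDecay_gaussKer (d := d) (d + 1)).bound 0
  simp only [norm_iteratedFDeriv_zero] at hK
  exact kernel_integrable (measurable_kerCoef _ hgm) measurable_kerScale measurable_kerShift
    (fun x => (H g hgm hg I hI hIm x).1) continuous_gaussKer hK x

/-- A sup bound linear in the L^r norm; it makes the pointwise formula continuous in its L^r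
argument, so that it can be identified on Schwartz functions. -/
lemma kerSum_bound (hr : r.HolderConjugate r') (hσ : 0 < σ) :
    ∃ C : ℝ, 0 ≤ C ∧ ∀ (g : Euc d → ℝ), Measurable g → MemLp g (ENNReal.ofReal r) → ∀ x,
      |kerSum (σ + d / r) g (Ioi 0) x| ≤ C * (eLpNorm g (ENNReal.ofReal r) volume).toReal := by
  obtain ⟨D, hD, H⟩ := kerCoef_weight (d := d) hr hσ
  obtain ⟨S, hS, hK⟩ := (kerDecay_gaussKer (d := d) (d + 1)).bound 0
  simp only [norm_iteratedFDeriv_zero] at hK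
  have h1 := subConstNeg_pos hσ
  refine ⟨S * D * subConstNeg σ, by positivity, fun g hgm hg x => ?_⟩
  obtain ⟨hi, hb⟩ := H g hgm hg (Ioi 0) Subset.rfl measurableSet_Ioi x
  rw [← Real.norm_eq_abs, kerSum]
  refine (norm_integral_le_of_norm_le (hi.const_mul S) (Eventually.of_forall fun v => ?_)).trans ?_
  · rw [norm_smul, Real.norm_eq_abs]
    have := hK (kerScale v • x + kerShift v)
    calc _ ≤ |kerCoef (σ + d / r) g v| * (S * ((1 + ‖kerScale v • x + kerShift v‖) ^ (d + 1))⁻¹) := by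
          gcongr
      _ = _ := by rw [decay]; ring
  · rw [integral_const_mul]
    calc _ ≤ S * (D * (eLpNorm g (ENNReal.ofReal r) volume).toReal *
            ∫ t in Ioi (0 : ℝ), t ^ (σ - 1) * Real.exp (-t ^ 2)) := by gcongr
      _ = _ := by rw [subConstNeg]; ring

/-- On the k-th dyadic piece t > 2^{-k}, so kernels are dilated by at most 2^k/`gaussScale` and each
derivative costs at most a multiple of 2^k, while the total weight of the coefficients is
O(2^{-kσ}). -/
lemma multSeq_kerSum (hr : r.HolderConjugate r') (hσ : 0 < σ) {g : Euc d → ℝ}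
    (hgm : Measurable g) (hg : MemLp g (ENNReal.ofReal r)) :
    MultSeq σ (fun k => kerSum (σ + d / r) g (dyadic k)) := by
  obtain ⟨D, hD, H⟩ := kerCoef_weight (d := d) hr hσ
  obtain ⟨C, hC, hdy⟩ := integral_dyadic_le hσ
  have hs := gaussScale_pos
  set G := (eLpNorm g (ENNReal.ofReal r) volume).toReal
  have hG : 0 ≤ G := ENNReal.toReal_nonneg
  have key := fun (k n : ℕ) => kernel_contDiff (m := d + 1)
    (μ := (volume.restrict (dyadic k)).prod (volume : Measure (Euc d)))
    (measurable_kerScale (d := d)) measurable_kerShift (Λ := 2 ^ (k : ℝ) / gaussScale)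
    (by positivity) (by
      have : ∀ᵐ t ∂(volume.restrict (dyadic k)), t ∈ dyadic k :=
        ae_restrict_mem (measurableSet_dyadic k)
      filter_upwards [(Measure.quasiMeasurePreserving_fst
        (ν := (volume : Measure (Euc d)))).ae this] with v hv
      have h1 : (2 : ℝ) ^ (-(k : ℝ)) < v.1 := dyadic_subset k hv
      have h0 : 0 < (2 : ℝ) ^ (-(k : ℝ)) := by positivity
      have h2 : 0 < v.1 := h0.trans h1
      rw [kerScale, abs_of_pos (by positivity), mul_inv, div_eq_mul_inv]
      gcongr
      rw [← neg_neg (k : ℝ), Real.rpow_neg zero_le_two]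
      gcongr) n
    (measurable_kerCoef (σ + d / r) hgm)
    (fun x => (H g hgm hg (dyadic k) (dyadic_subset_Ioi k) (measurableSet_dyadic k) x).1)
    (M := D * G * (C * (2 : ℝ) ^ (-((k : ℝ) * σ))))
    (fun x => ((H g hgm hg (dyadic k) (dyadic_subset_Ioi k) (measurableSet_dyadic k) x).2).trans
      (by gcongr; exact hdy k))
    (kerDecay_gaussKer (d := d) (d + 1))
  refine ⟨fun k => contDiff_infty.2 fun n => (key k n).1, fun i => ?_⟩
  obtain ⟨S, hS, hK⟩ := (kerDecay_gaussKer (d := d) (d + 1)).bound i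
  refine ⟨S * (gaussScale⁻¹) ^ i * (D * G * C), by positivity, fun k x => ?_⟩
  refine ((key k i).2 S hK x).trans_eq ?_
  have e : (2 : ℝ) ^ ((k : ℝ) * (i - σ)) =
      (2 : ℝ) ^ (-((k : ℝ) * σ)) * ((2 : ℝ) ^ (k : ℝ)) ^ i := by
    rw [← Real.rpow_natCast ((2 : ℝ) ^ (k : ℝ)) i, ← Real.rpow_mul zero_le_two,
      ← Real.rpow_add zero_lt_two]
    congr 1; ring
  rw [e, div_eq_mul_inv, mul_pow]
  ring

lemma hasSum_kerSum (hr : r.HolderConjugate r') (hσ : 0 < σ) {g : Euc d → ℝ}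
    (hgm : Measurable g) (hg : MemLp g (ENNReal.ofReal r)) (x : Euc d) :
    HasSum (fun k => kerSum (σ + d / r) g (dyadic k) x) (kerSum (σ + d / r) g (Ioi 0) x) := by
  have e : ∀ I : Set ℝ, (volume.restrict I).prod (volume : Measure (Euc d)) =
      (volume.prod volume).restrict (I ×ˢ univ) := fun I => by
    rw [← Measure.prod_restrict, Measure.restrict_univ]
  have hu : (Ioi (0 : ℝ)) ×ˢ (univ : Set (Euc d)) = ⋃ k, dyadic k ×ˢ univ := by
    rw [← iUnion_dyadic, iUnion_prod_const]
  have hi := kerSum_integrable hr hσ hgm hg Subset.rfl measurableSet_Ioi x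
  simp only [kerSum]
  rw [e, hu] at hi ⊢
  simp_rw [e]
  refine hasSum_integral_iUnion (fun k => (measurableSet_dyadic k).prod MeasurableSet.univ) ?_ hi
  intro i j hij
  exact Disjoint.set_prod_left (disjoint_disjointed _ hij) _ _

end Decomposition

/-! ### The Sobolev embedding -/

section Embedding

open ProbabilityTheory

variable {d : ℕ} {r r' σ : ℝ}

/-- The function given by the Gaussian superposition formula for the Bessel potential of order
`-a` of `f`. -/
def kerTotal (a : ℝ) (f : Euc d → ℂ) (x : Euc d) : ℂ :=
  (kerSum a (fun y => (f y).re) (Ioi 0) x : ℂ) + kerSum a (fun y => (f y).im) (Ioi 0) x * Complex.I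

lemma kerSum_congr {a : ℝ} {g g' : Euc d → ℝ} (h : g =ᵐ[volume] g') (I : Set ℝ) (x : Euc d) :
    kerSum a g I x = kerSum a g' I x := by
  refine integral_congr_ae ?_
  filter_upwards [(Measure.quasiMeasurePreserving_snd (μ := volume.restrict I)).ae h] with v hv
  simp only [kerCoef, hv]

lemma kerSum_sub (hr : r.HolderConjugate r') (hσ : 0 < σ) {g g' : Euc d → ℝ}
    (hgm : Measurable g) (hg : MemLp g (ENNReal.ofReal r))
    (hgm' : Measurable g') (hg' : MemLp g' (ENNReal.ofReal r)) (x : Euc d) :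
    kerSum (σ + d / r) (fun y => g y - g' y) (Ioi 0) x =
      kerSum (σ + d / r) g (Ioi 0) x - kerSum (σ + d / r) g' (Ioi 0) x := by
  simp only [kerSum]
  rw [← integral_sub (kerSum_integrable hr hσ hgm hg Subset.rfl measurableSet_Ioi x)
    (kerSum_integrable hr hσ hgm' hg' Subset.rfl measurableSet_Ioi x)]
  refine integral_congr_ae (Eventually.of_forall fun v => ?_)
  simp only [kerCoef, smul_eq_mul]
  ring

lemma integral_stdGaussian_comp {τ : ℝ} (hτ : 0 < τ) (U : 𝓢(Euc d, ℂ)) (x : Euc d) :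
    ∫ z, U (x + τ • z) ∂(stdGaussian (Euc d)) =
      ∫ y, (((τ ^ d)⁻¹ * gaussKer d (τ⁻¹ • (x - y)) : ℝ) : ℂ) * U y := by
  rw [stdGaussian_eq_withDensity, integral_withDensity_eq_integral_toReal_smul
    continuous_gaussKer.measurable.ennreal_ofReal (by simp)]
  set f : Euc d → ℂ := fun z => (gaussKer d (τ⁻¹ • z) : ℂ) * U (x + z)
  have e1 : ∀ z, (ENNReal.ofReal (gaussKer d z)).toReal • U (x + τ • z) = f (τ • z) := fun z => by
    simp only [f]
    rw [ENNReal.toReal_ofReal (gaussKer_nonneg z), smul_smul, inv_mul_cancel₀ hτ.ne', one_smul,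
      Complex.real_smul]
  simp_rw [e1]
  rw [Measure.integral_comp_smul, finrank_euclideanSpace_fin, abs_of_pos (by positivity),
    ← integral_add_left_eq_self (fun y => (((τ ^ d)⁻¹ * gaussKer d (τ⁻¹ • (x - y)) : ℝ) : ℂ) * U y) x,
    ← integral_smul]
  refine integral_congr_ae (Eventually.of_forall fun z => ?_)
  simp only [f, Complex.real_smul]
  have : x - (x + z) = -z := by abel
  rw [this, smul_neg, gaussKer_neg]
  push_cast
  ring

/-- The subordination formula for Λ^{-a}, with the Gaussian average of translates rewritten at each
scale t as a convolution. In that form the formula no longer needs U to be smooth. -/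
lemma kerTotal_schwartz (hr : r.HolderConjugate r') (hσ : 0 < σ) (U : 𝓢(Euc d, ℂ)) (x : Euc d) :
    kerTotal (σ + d / r) U x = bessel (-(σ + d / r)) U x := by
  set a := σ + d / r with ha
  have ha0 : 0 < a := by have := hr.pos; positivity
  have hs := gaussScale_pos
  have i1 := kerSum_integrable hr hσ (Complex.measurable_re.comp U.continuous.measurable)
    (U.memLp (ENNReal.ofReal r) volume).re Subset.rfl measurableSet_Ioi x
  have i2 := kerSum_integrable hr hσ (Complex.measurable_im.comp U.continuous.measurable)
    (U.memLp (ENNReal.ofReal r) volume).im Subset.rfl measurableSet_Ioi x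
  rw [← ha] at i1 i2
  set F : ℝ × Euc d → ℂ := fun v => ((kerCoef a (fun _ => 1) v *
    gaussKer d (kerScale v • x + kerShift v) : ℝ) : ℂ) * U v.2 with hF
  have hFe : ∀ v, F v = ((kerCoef a (Complex.re ∘ U) v • gaussKer d (kerScale v • x + kerShift v) : ℝ) : ℂ) +
      ((kerCoef a (Complex.im ∘ U) v • gaussKer d (kerScale v • x + kerShift v) : ℝ) : ℂ) *
        Complex.I := by
    intro v
    simp only [hF, kerCoef, Function.comp, smul_eq_mul]
    conv_lhs => rw [← Complex.re_add_im (U v.2)]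
    push_cast
    ring
  have hFi : Integrable F ((volume.restrict (Ioi 0)).prod volume) := by
    rw [funext hFe]
    exact i1.ofReal.add (i2.ofReal.mul_const _)
  have e1 : kerTotal a U x = ∫ v, F v ∂((volume.restrict (Ioi 0)).prod volume) := by
    rw [funext hFe, integral_add i1.ofReal (i2.ofReal.mul_const _), integral_mul_const]
    have k1 := integral_ofReal (𝕜 := ℂ) (μ := (volume.restrict (Ioi 0)).prod volume)
      (f := fun v => kerCoef a (Complex.re ∘ U) v • gaussKer d (kerScale v • x + kerShift v))
    have k2 := integral_ofReal (𝕜 := ℂ) (μ := (volume.restrict (Ioi 0)).prod volume)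
      (f := fun v => kerCoef a (Complex.im ∘ U) v • gaussKer d (kerScale v • x + kerShift v))
    exact (congrArg₂ (fun z w => z + w * Complex.I) k1 k2).symm
  obtain ⟨C, hC, hU⟩ := exists_norm_le U
  have hGi : Integrable (fun q : ℝ × Euc d => (subDensity a q : ℂ) * U (x + subShift 1 q))
      ((volume.restrict (Ioi 0)).prod (stdGaussian (Euc d))) := by
    refine ((integrable_subDensity (d := d) ha0).mul_const C).mono' ?_ ?_
    · refine Measurable.aestronglyMeasurable ?_
      exact (Complex.measurable_ofReal.comp (measurable_subDensity a)).mul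
        (U.continuous.measurable.comp (measurable_const.add (continuous_subShift 1).measurable))
    · filter_upwards [subDensity_nonneg (d := d) ha0] with v hv
      rw [norm_mul, Complex.norm_real, Real.norm_of_nonneg hv]
      gcongr
      exact hU _
  rw [e1, bessel_neg_apply ha0, subMeasure, integral_prod _ hFi, integral_prod _ hGi]
  refine integral_congr_ae ?_
  filter_upwards [ae_restrict_mem (measurableSet_Ioi (a := (0 : ℝ)))] with t ht
  have ht' : 0 < t * gaussScale := mul_pos ht hs
  have e2 : ∫ y, (subDensity a (t, y) : ℂ) * U (x + subShift 1 (t, y)) ∂(stdGaussian (Euc d)) =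
      (((subConstNeg a)⁻¹ * (t ^ (a - 1) * Real.exp (-t ^ 2)) : ℝ) : ℂ) *
        ∫ z, U (x + (t * gaussScale) • z) ∂(stdGaussian (Euc d)) := by
    rw [← integral_const_mul]
    simp only [subDensity, subShift, one_mul]
  rw [e2, integral_stdGaussian_comp ht', ← integral_const_mul]
  refine integral_congr_ae (Eventually.of_forall fun y => ?_)
  simp only [hF]
  rw [kerScale_add_kerShift, kerCoef]
  push_cast
  ring

lemma measurable_coe_Lp {q : ℝ≥0∞} (f : Lp ℂ q (volume : Measure (Euc d))) : Measurable f :=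
  (Lp.stronglyMeasurable f).measurable

/-- Real and imaginary parts are estimated separately, as the pieces are real valued; hence the
constant C + C. -/
lemma kerTotal_sub_le (hr : r.HolderConjugate r') (hσ : 0 < σ) :
    ∃ C : ℝ, 0 ≤ C ∧ ∀ f g : Lp ℂ (ENNReal.ofReal r) (volume : Measure (Euc d)), ∀ x,
      ‖kerTotal (σ + d / r) f x - kerTotal (σ + d / r) g x‖ ≤ C * ‖f - g‖ := by
  obtain ⟨C, hC, H⟩ := kerSum_bound (d := d) hr hσ
  refine ⟨C + C, by positivity, fun f g x => ?_⟩
  have hfm := measurable_coe_Lp f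
  have hgm := measurable_coe_Lp g
  have hf := Lp.memLp f
  have hg := Lp.memLp g
  have h1 := H _ ((Complex.measurable_re.comp hfm).sub (Complex.measurable_re.comp hgm))
    (hf.re.sub hg.re) x
  have h2 := H _ ((Complex.measurable_im.comp hfm).sub (Complex.measurable_im.comp hgm))
    (hf.im.sub hg.im) x
  have k1 : kerSum (σ + d / r) (Complex.re ∘ f - Complex.re ∘ g) (Ioi 0) x =
      kerSum (σ + d / r) (fun y => (f y).re) (Ioi 0) x -
        kerSum (σ + d / r) (fun y => (g y).re) (Ioi 0) x :=
    kerSum_sub hr hσ (Complex.measurable_re.comp hfm) hf.re (Complex.measurable_re.comp hgm) hg.re x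
  have k2 : kerSum (σ + d / r) (Complex.im ∘ f - Complex.im ∘ g) (Ioi 0) x =
      kerSum (σ + d / r) (fun y => (f y).im) (Ioi 0) x -
        kerSum (σ + d / r) (fun y => (g y).im) (Ioi 0) x :=
    kerSum_sub hr hσ (Complex.measurable_im.comp hfm) hf.im (Complex.measurable_im.comp hgm) hg.im x
  rw [k1] at h1
  rw [k2] at h2
  have n1 : (eLpNorm (Complex.re ∘ f - Complex.re ∘ g) (ENNReal.ofReal r) volume).toReal ≤ ‖f - g‖ := by
    rw [Lp.norm_def]
    refine ENNReal.toReal_mono (Lp.memLp (f - g)).2.ne ?_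
    refine eLpNorm_mono_ae ?_
    filter_upwards [Lp.coeFn_sub f g] with y hy
    rw [hy]
    simp only [Pi.sub_apply, Function.comp, ← Complex.sub_re]
    exact Complex.abs_re_le_norm _
  have n2 : (eLpNorm (Complex.im ∘ f - Complex.im ∘ g) (ENNReal.ofReal r) volume).toReal ≤ ‖f - g‖ := by
    rw [Lp.norm_def]
    refine ENNReal.toReal_mono (Lp.memLp (f - g)).2.ne ?_
    refine eLpNorm_mono_ae ?_
    filter_upwards [Lp.coeFn_sub f g] with y hy
    rw [hy]
    simp only [Pi.sub_apply, Function.comp, ← Complex.sub_im]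
    exact Complex.abs_im_le_norm _
  have e : kerTotal (σ + d / r) f x - kerTotal (σ + d / r) g x =
      ((kerSum (σ + d / r) (fun y => (f y).re) (Ioi 0) x -
        kerSum (σ + d / r) (fun y => (g y).re) (Ioi 0) x : ℝ) : ℂ) +
      ((kerSum (σ + d / r) (fun y => (f y).im) (Ioi 0) x -
        kerSum (σ + d / r) (fun y => (g y).im) (Ioi 0) x : ℝ) : ℂ) * Complex.I := by
    simp only [kerTotal]; push_cast; ring
  rw [e, add_mul]
  refine (norm_add_le _ _).trans (add_le_add ?_ ?_)
  · rw [Complex.norm_real]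
    exact h1.trans (by gcongr)
  · rw [norm_mul, Complex.norm_I, mul_one, Complex.norm_real]
    exact h2.trans (by gcongr)

lemma kerTotal_eq_tsum (hr : r.HolderConjugate r') (hσ : 0 < σ)
    (f : Lp ℂ (ENNReal.ofReal r) (volume : Measure (Euc d))) (x : Euc d) :
    kerTotal (σ + d / r) f x =
      ((∑' k, kerSum (σ + d / r) (fun y => (f y).re) (dyadic k) x : ℝ) : ℂ) +
      ((∑' k, kerSum (σ + d / r) (fun y => (f y).im) (dyadic k) x : ℝ) : ℂ) * Complex.I := by
  have h1 : HasSum (fun k => kerSum (σ + d / r) (fun y => (f y).re) (dyadic k) x) _ :=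
    hasSum_kerSum hr hσ (Complex.measurable_re.comp (measurable_coe_Lp f)) (Lp.memLp f).re x
  have h2 : HasSum (fun k => kerSum (σ + d / r) (fun y => (f y).im) (dyadic k) x) _ :=
    hasSum_kerSum hr hσ (Complex.measurable_im.comp (measurable_coe_Lp f)) (Lp.memLp f).im x
  rw [h1.tsum_eq, h2.tsum_eq]
  rfl

lemma continuous_kerTotal (hr : r.HolderConjugate r') (hσ : 0 < σ)
    (f : Lp ℂ (ENNReal.ofReal r) (volume : Measure (Euc d))) :
    Continuous (kerTotal (σ + d / r) f) := by
  rw [funext (kerTotal_eq_tsum hr hσ f)]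
  have h1 := (multSeq_kerSum hr hσ (Complex.measurable_re.comp (measurable_coe_Lp f))
    (Lp.memLp f).re).continuous_tsum hσ
  have h2 := (multSeq_kerSum hr hσ (Complex.measurable_im.comp (measurable_coe_Lp f))
    (Lp.memLp f).im).continuous_tsum hσ
  exact (Complex.continuous_ofReal.comp h1).add ((Complex.continuous_ofReal.comp h2).mul_const _)

lemma exists_norm_kerTotal_le (hr : r.HolderConjugate r') (hσ : 0 < σ)
    (f : Lp ℂ (ENNReal.ofReal r) (volume : Measure (Euc d))) :
    ∃ C : ℝ, ∀ x, ‖kerTotal (σ + d / r) f x‖ ≤ C := by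
  obtain ⟨C, hC, H⟩ := kerTotal_sub_le (d := d) hr hσ
  refine ⟨C * ‖f - 0‖ + 0, fun x => ?_⟩
  have e : kerTotal (σ + d / r) ((0 : Lp ℂ (ENNReal.ofReal r) (volume : Measure (Euc d))) : Euc d → ℂ) x
      = 0 := by
    have h0 : ∀ᵐ y ∂(volume : Measure (Euc d)),
        ((0 : Lp ℂ (ENNReal.ofReal r) (volume : Measure (Euc d))) : Euc d → ℂ) y = 0 := by
      filter_upwards [Lp.coeFn_zero ℂ (ENNReal.ofReal r) (volume : Measure (Euc d))] with y hy
      rw [hy]; rfl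
    have k : ∀ g : Euc d → ℝ, g =ᵐ[volume] (fun _ => 0) → kerSum (σ + d / r) g (Ioi 0) x = 0 := by
      intro g hg
      rw [kerSum_congr hg]
      simp [kerSum, kerCoef]
    rw [kerTotal, k _ (by filter_upwards [h0] with y hy; rw [hy, Complex.zero_re]),
      k _ (by filter_upwards [h0] with y hy; rw [hy, Complex.zero_im])]
    simp
  have := H f 0 x
  rw [e, sub_zero] at this
  linarith

/-- The Sobolev embedding of `H^(σ + d/q)_q` in the Hölder-Zygmund space of order `σ`, in the form of
a dyadic decomposition. -/
theorem exists_multSeq {q : ℝ≥0∞} [Fact (1 ≤ q)] (hq : 1 < q) (hq' : q < ⊤) (hσ : 0 < σ)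
    {w : 𝓢'(Euc d, ℂ)} (hw : TemperedDistribution.MemSobolev (σ + d / q.toReal) q w) :
    ∃ h₁ h₂ : ℕ → Euc d → ℝ, MultSeq σ h₁ ∧ MultSeq σ h₂ ∧ ∀ φ : 𝓢(Euc d, ℂ),
      w φ = ∫ x, (((∑' k, h₁ k x : ℝ) : ℂ) + ((∑' k, h₂ k x : ℝ) : ℂ) * Complex.I) * φ x := by
  set r := q.toReal with hrq
  have hqr : q = ENNReal.ofReal r := (ENNReal.ofReal_toReal hq'.ne).symm
  have hr1 : 1 < r := by
    rw [hqr] at hq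
    simpa using hq
  have hr : r.HolderConjugate r.conjExponent := Real.HolderConjugate.conjExponent hr1
  clear_value r
  subst hqr
  obtain ⟨f, hf⟩ := hw
  refine ⟨fun k => kerSum (σ + d / r) (fun y => (f y).re) (dyadic k),
    fun k => kerSum (σ + d / r) (fun y => (f y).im) (dyadic k),
    multSeq_kerSum hr hσ (Complex.measurable_re.comp (measurable_coe_Lp f)) (Lp.memLp f).re,
    multSeq_kerSum hr hσ (Complex.measurable_im.comp (measurable_coe_Lp f)) (Lp.memLp f).im,
    fun φ => ?_⟩
  simp_rw [← kerTotal_eq_tsum hr hσ f]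
  have hp' : ENNReal.HolderConjugate (ENNReal.ofReal r) (1 - (ENNReal.ofReal r)⁻¹)⁻¹ :=
    ENNReal.HolderConjugate.inv_one_sub_inv' hq.le
  have : Fact (1 ≤ (1 - (ENNReal.ofReal r)⁻¹)⁻¹) := by simp [fact_iff]
  rw [apply_eq_lpPair (p' := (1 - (ENNReal.ofReal r)⁻¹)⁻¹) hf]
  obtain ⟨C, hC, H⟩ := kerTotal_sub_le (d := d) hr hσ
  have hint : ∀ g : Lp ℂ (ENNReal.ofReal r) (volume : Measure (Euc d)),
      Integrable (fun x => kerTotal (σ + d / r) g x * φ x) := by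
    intro g
    obtain ⟨D, hD⟩ := exists_norm_kerTotal_le hr hσ g
    exact (φ.integrable (μ := volume)).bdd_mul (continuous_kerTotal hr hσ g).aestronglyMeasurable
      (Eventually.of_forall hD)
  -- For fixed `φ` both sides are continuous in `f` for the L^q norm, and for Schwartz `f` they
  -- agree because Λ^{-a} is its own transpose.
  refine eq_of_eq_on_schwartz hq'.ne (continuous_lpPair_left _)
    (G := fun f => ∫ x, kerTotal (σ + d / r) f x * φ x) ?_ (fun U => ?_) f
  · refine (LipschitzWith.of_dist_le_mul (K := ⟨C * ∫ x, ‖φ x‖, by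
      have : 0 ≤ ∫ x, ‖φ x‖ := integral_nonneg fun x => norm_nonneg (φ x)
      positivity⟩) fun g g' => ?_).continuous
    rw [dist_eq_norm, dist_eq_norm, ← integral_sub (hint g) (hint g')]
    refine (norm_integral_le_of_norm_le
      ((φ.integrable (μ := volume)).norm.const_mul (C * ‖g - g'‖))
      (Eventually.of_forall fun x => ?_)).trans_eq ?_
    · rw [← sub_mul, norm_mul]
      gcongr
      exact H g g' x
    · rw [integral_const_mul]
      exact mul_right_comm _ _ _
  · have e : ∀ x, kerTotal (σ + d / r) (U.toLp (ENNReal.ofReal r) volume) x =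
        bessel (-(σ + d / r)) U x := by
      intro x
      rw [← kerTotal_schwartz hr hσ, kerTotal, kerTotal]
      have := U.coeFn_toLp (ENNReal.ofReal r) volume
      have k1 : (fun y => (U.toLp (ENNReal.ofReal r) volume y).re) =ᵐ[volume] fun y => (U y).re := by
        filter_upwards [this] with y hy
        rw [hy]
      have k2 : (fun y => (U.toLp (ENNReal.ofReal r) volume y).im) =ᵐ[volume] fun y => (U y).im := by
        filter_upwards [this] with y hy
        rw [hy]
      rw [kerSum_congr k1, kerSum_congr k2]
    simp_rw [e]
    rw [lpPair_toLp_toLp, integral_bessel_mul]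

end Embedding

/-! ### Operations on dyadic sequences, cut-offs and test functions -/

section TestFunctions

variable {d d' : ℕ}

/-- Functions all of whose derivatives are bounded. -/
structure BddDeriv {F : Type*} [NormedAddCommGroup F] [NormedSpace ℝ F] (a : Euc d → F) : Prop where
  contDiff : ContDiff ℝ ∞ a
  bound : ∀ i : ℕ, ∃ C : ℝ, ∀ x, ‖iteratedFDeriv ℝ i a x‖ ≤ C

lemma BddDeriv.of_hasCompactSupport {F : Type*} [NormedAddCommGroup F] [NormedSpace ℝ F]
    {a : Euc d → F} (h : ContDiff ℝ ∞ a) (h' : HasCompactSupport a) : BddDeriv a := by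
  refine ⟨h, fun i => ?_⟩
  exact (h.continuous_iteratedFDeriv (by exact_mod_cast le_top)).bounded_above_of_compact_support
    (h'.iteratedFDeriv i)

lemma BddDeriv.mul {a b : Euc d → ℝ} (ha : BddDeriv a) (hb : BddDeriv b) :
    BddDeriv (fun x => a x * b x) := by
  refine ⟨ha.contDiff.mul hb.contDiff, fun i => ?_⟩
  choose A hA using ha.bound
  choose C hC using hb.bound
  refine ⟨∑ j ∈ Finset.range (i + 1), (i.choose j : ℝ) * A j * C (i - j), fun x => ?_⟩
  refine (norm_iteratedFDeriv_mul_le ha.contDiff hb.contDiff x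
    (by exact_mod_cast le_top)).trans (Finset.sum_le_sum fun j _ => ?_)
  have h1 := (norm_nonneg _).trans (hA j x)
  gcongr
  · exact hA j x
  · exact hC _ x

lemma BddDeriv.comp_clm {F : Type*} [NormedAddCommGroup F] [NormedSpace ℝ F]
    {a : Euc d → F} (ha : BddDeriv a) (T : Euc d' →L[ℝ] Euc d) : BddDeriv (fun x => a (T x)) := by
  refine ⟨ha.contDiff.comp T.contDiff, fun i => ?_⟩
  obtain ⟨C, hC⟩ := ha.bound i
  refine ⟨C * ∏ _j : Fin i, ‖T‖, fun x => ?_⟩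
  have e : (fun x => a (T x)) = a ∘ T := rfl
  rw [e, T.iteratedFDeriv_comp_right ha.contDiff x (by exact_mod_cast le_top)]
  refine (ContinuousMultilinearMap.norm_compContinuousLinearMap_le _ _).trans ?_
  gcongr
  exact hC _

lemma BddDeriv.const {F : Type*} [NormedAddCommGroup F] [NormedSpace ℝ F] (c : F) :
    BddDeriv (fun _ : Euc d => c) := by
  refine ⟨contDiff_const, fun i => ?_⟩
  rcases Nat.eq_zero_or_pos i with rfl | hi
  · exact ⟨‖c‖, fun x => by simp⟩
  · refine ⟨0, fun x => ?_⟩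
    rw [iteratedFDeriv_const_of_ne hi.ne' c]; simp

lemma BddDeriv.sub {a b : Euc d → ℝ} (ha : BddDeriv a) (hb : BddDeriv b) :
    BddDeriv (fun x => a x - b x) := by
  refine ⟨ha.contDiff.sub hb.contDiff, fun i => ?_⟩
  obtain ⟨A, hA⟩ := ha.bound i
  obtain ⟨C, hC⟩ := hb.bound i
  refine ⟨A + C, fun x => ?_⟩
  have : iteratedFDeriv ℝ i (fun x => a x - b x) x =
      iteratedFDeriv ℝ i a x - iteratedFDeriv ℝ i b x :=
    fun_iteratedFDeriv_sub_apply (ha.contDiff.contDiffAt.of_le (by exact_mod_cast le_top))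
      (hb.contDiff.contDiffAt.of_le (by exact_mod_cast le_top))
  rw [this]
  exact (norm_sub_le _ _).trans (add_le_add (hA x) (hC x))

lemma two_rpow_le {σ : ℝ} {i j k : ℕ} (h : j ≤ i) :
    (2 : ℝ) ^ ((k : ℝ) * (j - σ)) ≤ (2 : ℝ) ^ ((k : ℝ) * (i - σ)) := by
  apply Real.rpow_le_rpow_of_exponent_le one_le_two
  have : (j : ℝ) ≤ i := by exact_mod_cast h
  gcongr

/-- Leibniz' rule; derivatives that fall on a do not produce a factor 2^k, which only helps since k
≥ 0. -/
lemma MultSeq.mul_left {σ : ℝ} {h : ℕ → Euc d → ℝ} (hh : MultSeq σ h) {a : Euc d → ℝ}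
    (ha : BddDeriv a) : MultSeq σ (fun k x => a x * h k x) := by
  refine ⟨fun k => ha.contDiff.mul (hh.contDiff k), fun i => ?_⟩
  choose A hA using ha.bound
  choose C hC0 hC using hh.bound
  have hA0 : ∀ j, 0 ≤ A j := fun j => (norm_nonneg _).trans (hA j 0)
  refine ⟨∑ j ∈ Finset.range (i + 1), (i.choose j : ℝ) * A j * C (i - j),
    Finset.sum_nonneg fun j _ => mul_nonneg (mul_nonneg (by positivity) (hA0 j)) (hC0 _),
    fun k x => ?_⟩
  rw [Finset.sum_mul]
  refine (norm_iteratedFDeriv_mul_le ha.contDiff (hh.contDiff k) x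
    (by exact_mod_cast le_top)).trans (Finset.sum_le_sum fun j _ => ?_)
  rw [mul_assoc _ (C (i - j))]
  have := hA0 j
  have h3 := hC0 (i - j)
  gcongr
  · exact hA j x
  · exact (hC _ k x).trans (mul_le_mul_of_nonneg_left (two_rpow_le (by omega)) h3)

/-- The sequence whose only term is `a`. -/
def singleSeq (a : Euc d → ℝ) (k : ℕ) : Euc d → ℝ := if k = 0 then a else 0

/-- Only the index k = 0 is occupied, and there the power of 2 equals 1 for every σ. Smooth bounded
functions thus fit into the same framework as the multiplier. -/
lemma BddDeriv.multSeq {a : Euc d → ℝ} (ha : BddDeriv a) (σ : ℝ) :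
    MultSeq σ (singleSeq a) := by
  refine ⟨fun k => ?_, fun i => ?_⟩
  · unfold singleSeq
    split_ifs
    · exact ha.contDiff
    · exact contDiff_const
  · obtain ⟨C, hC⟩ := ha.bound i
    have h0 := (norm_nonneg _).trans (hC 0)
    refine ⟨C, h0, fun k x => ?_⟩
    unfold singleSeq
    split_ifs with h
    · subst h; simpa using hC x
    · rw [iteratedFDeriv_zero]
      simp only [Pi.zero_apply, norm_zero]
      positivity

lemma hasSum_singleSeq (a : Euc d → ℝ) (x : Euc d) : HasSum (fun k => singleSeq a k x) (a x) := by
  have := hasSum_ite_eq (0 : ℕ) (a x)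
  refine this.congr_fun fun k => ?_
  unfold singleSeq
  split_ifs <;> simp

lemma tsum_singleSeq (a : Euc d → ℝ) (x : Euc d) : ∑' k, singleSeq a k x = a x :=
  (hasSum_singleSeq a x).tsum_eq

/-- Dyadic decompositions survive a change of coordinates: in the chain rule the highest derivative
of h_k dominates. This is what makes the product independent of charts. -/
lemma MultSeq.comp {σ : ℝ} {h : ℕ → Euc d → ℝ} (hh : MultSeq σ h) {τ : Euc d' → Euc d}
    (hτ : BddDeriv τ) : MultSeq σ (fun k x => h k (τ x)) := by
  refine ⟨fun k => (hh.contDiff k).comp hτ.contDiff, fun i => ?_⟩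
  choose A hA using hτ.bound
  choose C hC0 hC using hh.bound
  have hA0 : ∀ j, 0 ≤ A j := fun j => (norm_nonneg _).trans (hA j 0)
  set D : ℝ := 1 + ∑ j ∈ Finset.range (i + 1), A j with hD
  have hD1 : 1 ≤ D := by
    have := Finset.sum_nonneg (s := Finset.range (i + 1)) fun j _ => hA0 j
    linarith
  set E : ℝ := ∑ j ∈ Finset.range (i + 1), C j with hE
  have hE0 : 0 ≤ E := Finset.sum_nonneg fun j _ => hC0 j
  refine ⟨(i.factorial : ℝ) * E * D ^ i, by positivity, fun k x => ?_⟩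
  have key := norm_iteratedFDeriv_comp_le (n := i) (hh.contDiff k) hτ.contDiff
    (by exact_mod_cast le_top) x (C := E * (2 : ℝ) ^ ((k : ℝ) * (i - σ))) (D := D)
    (fun j hj => (hC j k _).trans ?_) (fun j hj hj' => ?_)
  · refine key.trans (le_of_eq ?_)
    ring
  · refine mul_le_mul ?_ (two_rpow_le hj) (by positivity) hE0
    exact Finset.single_le_sum (fun j _ => hC0 j) (Finset.mem_range.2 (by omega))
  · refine ((hA j x).trans ?_).trans (le_self_pow₀ hD1 (by omega))
    have := Finset.single_le_sum (f := A) (fun j _ => hA0 j)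
      (Finset.mem_range.2 (by omega : j < i + 1))
    linarith

/-! ### Test functions -/

lemma contDiff_mul_of_tsupport_subset {F : Type*} [NormedAddCommGroup F] [NormedSpace ℝ F]
    {U : Set (Euc d)} (hU : IsOpen U) {a : Euc d → F} {f : Euc d → ℝ}
    (ha : ContDiffOn ℝ ∞ a U) (hf : ContDiff ℝ ∞ f) (hs : tsupport f ⊆ U) :
    ContDiff ℝ ∞ (fun x => f x • a x) := by
  refine contDiff_iff_contDiffAt.2 fun x => ?_
  by_cases hx : x ∈ tsupport f
  · exact hf.contDiffAt.smul (ha.contDiffAt (hU.mem_nhds (hs hx)))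
  · have : (fun x => f x • a x) =ᶠ[𝓝 x] fun _ => 0 := by
      filter_upwards [notMem_tsupport_iff_eventuallyEq.1 hx] with y hy
      simp [hy]
    exact contDiffAt_const.congr_of_eventuallyEq this

lemma exists_cutoff_closed {K U : Set (Euc d)} (hK : IsClosed K) (hU : IsOpen U) (hKU : K ⊆ U) :
    ∃ f : Euc d → ℝ, ContDiff ℝ ∞ f ∧ (∀ᶠ x in 𝓝ˢ K, f x = 1) ∧ tsupport f ⊆ U ∧
      ∀ x, f x ∈ Icc (0 : ℝ) 1 := by
  obtain ⟨f, h0, h1, h2⟩ := exists_contMDiffMap_zero_one_nhds_of_isClosed (n := ⊤)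
    𝓘(ℝ, Euc d) hU.isClosed_compl hK (disjoint_compl_left_iff_subset.2 hKU)
  refine ⟨f, f.contMDiff.contDiff, h1, fun x hx => ?_, h2⟩
  by_contra hxU
  exact (notMem_tsupport_iff_eventuallyEq.2
    (h0.filter_mono (nhds_le_nhdsSet (mem_compl hxU)))) hx

variable {Ω Ω' : Opens (Euc d)}

/-- The test function given by a compactly supported smooth function. -/
def mkTest (Ω : Opens (Euc d)) (f : Euc d → ℝ) (hf : ContDiff ℝ ∞ f) (hc : HasCompactSupport f)
    (hs : tsupport f ⊆ Ω) : 𝓓(Ω, ℝ) := ⟨f, hf, hc, hs⟩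

@[simp] lemma mkTest_apply {f : Euc d → ℝ} {hf : ContDiff ℝ ∞ f} {hc : HasCompactSupport f}
    {hs : tsupport f ⊆ Ω} (x : Euc d) : mkTest Ω f hf hc hs x = f x := rfl

lemma exists_test_eq_one {K : Set (Euc d)} (hK : IsCompact K) (hKU : K ⊆ Ω) :
    ∃ χ : 𝓓(Ω, ℝ), (∀ᶠ x in 𝓝ˢ K, χ x = 1) ∧ ∀ x, χ x ∈ Icc (0 : ℝ) 1 := by
  obtain ⟨V, hVo, hKV, hVU, hVc⟩ := exists_open_between_and_isCompact_closure hK Ω.isOpen hKU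
  obtain ⟨f, hf, h1, h2, h3⟩ := exists_cutoff_closed hK.isClosed hVo hKV
  exact ⟨mkTest Ω f hf (hVc.of_isClosed_subset (isClosed_tsupport f) (h2.trans subset_closure))
    (h2.trans (subset_closure.trans hVU)), h1, h3⟩

lemma exists_test_eq_one_near {K : Set (Euc d)} (hK : IsCompact K) (hKU : K ⊆ Ω) :
    ∃ χ : 𝓓(Ω, ℝ), ∀ x ∈ K, χ x = 1 := by
  obtain ⟨χ, h, _⟩ := exists_test_eq_one hK hKU
  exact ⟨χ, fun x hx => h.self_of_nhdsSet x hx⟩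

/-- The product of a smooth function and of a test function. -/
def mulTest (a : Euc d → ℝ) (ha : ContDiffOn ℝ ∞ a Ω) (φ : 𝓓(Ω, ℝ)) : 𝓓(Ω, ℝ) :=
  mkTest Ω (fun x => φ x • a x) (contDiff_mul_of_tsupport_subset Ω.isOpen ha φ.contDiff
    φ.tsupport_subset) φ.hasCompactSupport.smul_right
    ((tsupport_smul_subset_left φ a).trans φ.tsupport_subset)

@[simp] lemma mulTest_apply {a : Euc d → ℝ} {ha : ContDiffOn ℝ ∞ a Ω} {φ : 𝓓(Ω, ℝ)} (x : Euc d) :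
    mulTest a ha φ x = a x * φ x := by
  change φ x * a x = _
  ring

/-- A test function, as a test function on the whole space. -/
def toTop (φ : 𝓓(Ω, ℝ)) : 𝓓((⊤ : Opens (Euc d)), ℝ) :=
  mkTest ⊤ φ φ.contDiff φ.hasCompactSupport (subset_univ _)

@[simp] lemma toTop_apply (φ : 𝓓(Ω, ℝ)) (x : Euc d) : toTop φ x = φ x := rfl

@[simp] lemma testToSchwartz_apply (φ : 𝓓((⊤ : Opens (Euc d)), ℝ)) (x : Euc d) :
    testToSchwartz φ x = (φ x : ℂ) := rfl

lemma BddDeriv.test (φ : 𝓓(Ω, ℝ)) : BddDeriv φ :=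
  .of_hasCompactSupport φ.contDiff φ.hasCompactSupport

lemma test_eq_zero {φ : 𝓓(Ω, ℝ)} {x : Euc d} (hx : x ∉ Ω) : φ x = 0 :=
  image_eq_zero_of_notMem_tsupport fun h => hx (φ.tsupport_subset h)

/-- The inclusion of test functions with support in a fixed compact set into Schwartz functions. -/
def supportedToSchwartz (K : Compacts (Euc d)) : 𝓓_{K}(Euc d, ℝ) →L[ℝ] 𝓢(Euc d, ℂ) :=
  letI Φ : 𝓓_{K}(Euc d, ℝ) →ₗ[ℝ] 𝓢(Euc d, ℂ) :=
    { toFun f := testToSchwartz (toTop (Ω := ⊤) (mkTest ⊤ f f.contDiff f.hasCompactSupport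
        (subset_univ _)))
      map_add' f g := by ext x; simp
      map_smul' c f := by ext x; simp }
  { toLinearMap := Φ
    cont := by
      change Continuous Φ
      refine WithSeminorms.continuous_of_isBounded
        (ContDiffMapSupportedIn.withSeminorms ℝ (Euc d) ℝ ⊤ K)
        (schwartz_withSeminorms ℝ (Euc d) ℂ) _ ?_
      rintro ⟨k, i⟩
      obtain ⟨R, hR⟩ := K.isCompact.isBounded.exists_norm_le
      -- `R` may be negative when `K` is empty.
      have h0 : 0 ≤ (max R 0) ^ k := pow_nonneg (le_max_right _ _) _
      refine ⟨{i}, ⟨(max R 0) ^ k, h0⟩, fun f => ?_⟩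
      simp only [Finset.sup_singleton]
      refine SchwartzMap.seminorm_le_bound ℝ k i _ (mul_nonneg h0 (apply_nonneg _ _))
        fun x => ?_
      have e : ‖iteratedFDeriv ℝ i (Φ f) x‖ = ‖iteratedFDeriv ℝ i f x‖ :=
        LinearIsometry.norm_iteratedFDeriv_comp_left (𝕜 := ℝ) Complex.ofRealLI
          (f := f) (f.contDiff.contDiffAt.of_le (by exact_mod_cast le_top)) le_rfl
      rw [e]
      by_cases hx : x ∈ K
      · refine mul_le_mul (pow_le_pow_left₀ (norm_nonneg _) ((hR x hx).trans (le_max_left _ _)) _)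
          (ContDiffMapSupportedIn.norm_iteratedFDeriv_apply_le_seminorm_top ℝ) (norm_nonneg _) h0
      · rw [f.iteratedFDeriv_zero_on_compl hx]
        simp only [Pi.zero_apply, norm_zero, mul_zero]
        exact mul_nonneg h0 (apply_nonneg _ _) }

end TestFunctions

/-! ### Products of distributions with sums of dyadic pieces -/

section Pairing

variable {d d' : ℕ} {Ω : Opens (Euc d)} {σ s : ℝ} {p : ℝ≥0∞} [Fact (1 ≤ p)]

lemma exists_bddDeriv_eqOn {F : Type*} [NormedAddCommGroup F] [NormedSpace ℝ F]
    {V K : Set (Euc d)} (hV : IsOpen V) (hK : IsCompact K) (hKV : K ⊆ V) {τ : Euc d → F}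
    (hτ : ContDiffOn ℝ ∞ τ V) : ∃ τ' : Euc d → F, BddDeriv τ' ∧ EqOn τ' τ K := by
  obtain ⟨χ, hχ⟩ := exists_test_eq_one_near (Ω := ⟨V, hV⟩) hK hKV
  refine ⟨fun x => χ x • τ x, .of_hasCompactSupport
    (contDiff_mul_of_tsupport_subset hV hτ χ.contDiff χ.tsupport_subset)
    χ.hasCompactSupport.smul_right, fun x hx => ?_⟩
  simp [hχ x hx]

/-- A decomposition of a compactly supported function `G` into smooth dyadic pieces. -/
structure TestSeq (σ : ℝ) (G : Euc d → ℝ) (g : ℕ → 𝓓(Ω, ℝ)) : Prop where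
  multSeq : MultSeq σ fun k => ⇑(g k)
  supp : ∃ K : Set (Euc d), IsCompact K ∧ K ⊆ Ω ∧ ∀ k, ∀ x ∉ K, g k x = 0
  tsum_eq : ∀ x, ∑' k, g k x = G x

/-- All pieces live in one compact set, so v may be replaced by a localization in H^s_p. There
convergence is the multiplier theorem, and equality of the two sums is its independence of the
decomposition. -/
lemma TestSeq.exists_hasSum (hp : p < ⊤) (hp1 : 1 < p) (hs : |s| < σ) {v : 𝓓'(Ω, ℂ)}
    (hv : ∀ χ : 𝓓(Ω, ℝ), LocMem s p v χ) {G : Euc d → ℝ} {g g' : ℕ → 𝓓(Ω, ℝ)}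
    (hg : TestSeq σ G g) (hg' : TestSeq σ G g') :
    ∃ a, HasSum (fun k => v (g k)) a ∧ HasSum (fun k => v (g' k)) a := by
  obtain ⟨K, hK, hKΩ, hs1⟩ := hg.supp
  obtain ⟨K', hK', hKΩ', hs1'⟩ := hg'.supp
  obtain ⟨χ, hχ⟩ := exists_test_eq_one_near (hK.union hK') (union_subset hKΩ hKΩ')
  obtain ⟨w, hw, hmem⟩ := hv χ
  have key : ∀ φ : 𝓓(Ω, ℝ), (∀ x ∉ K ∪ K', φ x = 0) →
      w (testToSchwartz (toTop φ)) = v φ := fun φ hφ => by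
    refine hw _ _ fun x => ?_
    by_cases hx : x ∈ K ∪ K'
    · simp [hχ x hx]
    · simp [hφ x hx]
  have key2 : ∀ {g : ℕ → 𝓓(Ω, ℝ)}, MultSeq σ (fun k => ⇑(g k)) →
      (∀ k, ∀ x ∉ K ∪ K', g k x = 0) →
      ∀ k, v (g k) = w (mulS (g k) (testToSchwartz (toTop χ))) := by
    intro g hg hs k
    rw [← key _ (hs k)]
    congr 1
    ext x
    have := hg.mulS_apply k (testToSchwartz (toTop χ)) x
    rw [this]
    by_cases hx : x ∈ K ∪ K'
    · simp [hχ x hx]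
    · simp [hs k x hx]
  have k1 := key2 hg.multSeq fun k x hx => hs1 k x fun h => hx (Or.inl h)
  have k2 := key2 hg'.multSeq fun k x hx => hs1' k x fun h => hx (Or.inr h)
  obtain ⟨f, hf⟩ := id hmem
  obtain ⟨C, hC⟩ := hg.multSeq.exists_mul hp hp1 hs
  obtain ⟨C', hC'⟩ := hg'.multSeq.exists_mul hp hp1 hs
  obtain ⟨w1, _, _, _, h1⟩ := hC w f hf
  obtain ⟨w2, _, _, _, h2⟩ := hC' w f hf
  have e := MultSeq.eq_of_hasSum hp hp1 hs hs hg.multSeq hg'.multSeq hmem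
    (fun x => by rw [hg.tsum_eq, hg'.tsum_eq]) (h1 (testToSchwartz (toTop χ)))
    (h2 (testToSchwartz (toTop χ)))
  refine ⟨w1 (testToSchwartz (toTop χ)), ?_, ?_⟩
  · rw [funext k1]; exact h1 _
  · rw [funext k2, e]; exact h2 _

/-- The value of the distribution `v` on the compactly supported function `G`, defined through any
decomposition of `G` into smooth dyadic pieces. -/
def pairing (v : 𝓓'(Ω, ℂ)) (σ : ℝ) (G : Euc d → ℝ) : ℂ :=
  open Classical in
  if h : ∃ a, ∃ g : ℕ → 𝓓(Ω, ℝ), TestSeq σ G g ∧ HasSum (fun k => v (g k)) a then h.choose else 0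

lemma TestSeq.hasSum_pairing (hp : p < ⊤) (hp1 : 1 < p) (hs : |s| < σ) {v : 𝓓'(Ω, ℂ)}
    (hv : ∀ χ : 𝓓(Ω, ℝ), LocMem s p v χ) {G : Euc d → ℝ} {g : ℕ → 𝓓(Ω, ℝ)}
    (hg : TestSeq σ G g) : HasSum (fun k => v (g k)) (pairing v σ G) := by
  have h : ∃ a, ∃ g : ℕ → 𝓓(Ω, ℝ), TestSeq σ G g ∧ HasSum (fun k => v (g k)) a := by
    obtain ⟨a, ha, _⟩ := hg.exists_hasSum hp hp1 hs hv hg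
    exact ⟨a, g, hg, ha⟩
  rw [pairing, dif_pos h]
  obtain ⟨g', hg', h'⟩ := h.choose_spec
  obtain ⟨a, ha, ha'⟩ := hg.exists_hasSum hp hp1 hs hv hg'
  rwa [← h'.unique ha'] at ha

lemma MultSeq.testSeq {h : ℕ → Euc d → ℝ} (hh : MultSeq σ h) (φ : 𝓓(Ω, ℝ)) {G : Euc d → ℝ}
    (hG : ∀ x, φ x * ∑' k, h k x = G x) :
    TestSeq σ G (fun k => mulTest (h k) (hh.contDiff k).contDiffOn φ) := by
  refine ⟨?_, ⟨tsupport φ, φ.hasCompactSupport, φ.tsupport_subset, fun k x hx => ?_⟩, fun x => ?_⟩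
  · exact hh.mul_left (BddDeriv.test φ)
  · simp [image_eq_zero_of_notMem_tsupport hx]
  · simp only [mulTest_apply]
    rw [tsum_mul_right, mul_comm, hG]

/-- Functions that are locally the sum of a sequence of dyadic pieces. -/
def LocMult (Ω : Opens (Euc d)) (σ : ℝ) (F : Euc d → ℝ) : Prop :=
  ∀ χ : 𝓓(Ω, ℝ), ∃ h : ℕ → Euc d → ℝ, MultSeq σ h ∧ ∀ x, ∑' k, h k x = χ x * F x

lemma MultSeq.apply_mulTest {h : ℕ → Euc d → ℝ} (hh : MultSeq σ h) {v : 𝓓'(Ω, ℂ)}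
    {χ : Euc d → ℝ} {w : 𝓢'(Euc d, ℂ)} (hw : IsLocalization v χ w)
    {φ : 𝓓((⊤ : Opens (Euc d)), ℝ)} {ψ : 𝓓(Ω, ℝ)} (e : ∀ x, ψ x = χ x * φ x) (k : ℕ) :
    w (mulS (h k) (testToSchwartz φ)) = v (mulTest (h k) (hh.contDiff k).contDiffOn ψ) := by
  rw [← hw (mulTest (h k) (hh.contDiff k).contDiffOn φ) _ fun x => by simp only [mulTest_apply, e]; ring]
  congr 1
  ext x
  rw [hh.mulS_apply]
  simp

/-- Linearity and continuity of the product come for free: on test functions supported in K it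
coincides with a tempered distribution, the product of F with a localization of v. -/
lemma LocMult.exists_pairing_eq (hp : p < ⊤) (hp1 : 1 < p) (hs : |s| < σ) {v : 𝓓'(Ω, ℂ)}
    (hv : ∀ χ : 𝓓(Ω, ℝ), LocMem s p v χ) {F : Euc d → ℝ} (hF : LocMult Ω σ F)
    (K : Compacts (Euc d)) (hK : (K : Set (Euc d)) ⊆ Ω) :
    ∃ w : 𝓢'(Euc d, ℂ), ∀ φ : 𝓓(Ω, ℝ), (∀ x ∉ K, φ x = 0) →
      pairing v σ (fun x => φ x * F x) = w (testToSchwartz (toTop φ)) := by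
  obtain ⟨χ, hχ⟩ := exists_test_eq_one_near K.isCompact hK
  obtain ⟨h, hh, hF⟩ := hF χ
  obtain ⟨w, hw, f, hf⟩ := hv χ
  obtain ⟨C, hC⟩ := hh.exists_mul hp hp1 hs
  obtain ⟨w', _, _, _, h1⟩ := hC w f hf
  refine ⟨w', fun φ hφ => ?_⟩
  have ht := hh.testSeq φ (G := fun x => φ x * F x) fun x => by
    rw [hF]
    by_cases hx : x ∈ K
    · simp [hχ x hx]
    · simp [hφ x hx]
  have h2 := h1 (testToSchwartz (toTop φ))
  have e : ∀ x, φ x = χ x * toTop φ x := fun x => by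
    by_cases hx : x ∈ K
    · simp [hχ x hx]
    · simp [hφ x hx]
  simp_rw [hh.apply_mulTest hw e] at h2
  exact (ht.hasSum_pairing hp hp1 hs hv).unique h2

/-- The product of the distribution `v` and of the function `F`. -/
def multDist (v : 𝓓'(Ω, ℂ)) (σ : ℝ) (F : Euc d → ℝ)
    (H : ∀ K : Compacts (Euc d), (K : Set (Euc d)) ⊆ Ω →
      ∃ w : 𝓢'(Euc d, ℂ), ∀ φ : 𝓓(Ω, ℝ), (∀ x ∉ K, φ x = 0) →
        pairing v σ (fun x => φ x * F x) = w (testToSchwartz (toTop φ))) : 𝓓'(Ω, ℂ) :=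
  TestFunction.limitCLM ℝ (fun φ : 𝓓(Ω, ℝ) => pairing v σ (fun x => φ x * F x))
    (fun K hK => (ContinuousLinearMap.restrictScalars ℝ
      ((H K hK).choose : 𝓢(Euc d, ℂ) →L[ℂ] ℂ)) ∘L supportedToSchwartz K)
    (fun K hK f => (H K hK).choose_spec _ fun _ hx => f.zero_on_compl hx)

/-- Localizing commutes with multiplying. The cut-off χ need not have compact support, which matters
for the collar weights; the sum of the pieces has to equal F only where χ does not vanish. -/
lemma MultSeq.isLocalization (hp : p < ⊤) (hp1 : 1 < p) (hs : |s| < σ) {v v' : 𝓓'(Ω, ℂ)}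
    (hv : ∀ χ : 𝓓(Ω, ℝ), LocMem s p v χ) {F : Euc d → ℝ}
    (hv' : ∀ φ : 𝓓(Ω, ℝ), v' φ = pairing v σ (fun x => φ x * F x))
    {χ : Euc d → ℝ} {h : ℕ → Euc d → ℝ} (hh : MultSeq σ h)
    (hF : ∀ x ∈ Ω, χ x ≠ 0 → ∑' k, h k x = F x) {w w' : 𝓢'(Euc d, ℂ)} (hw : IsLocalization v χ w)
    (h1 : ∀ φ, HasSum (fun k => w (mulS (h k) φ)) (w' φ)) : IsLocalization v' χ w' := by
  intro φ ψ e
  have h2 := h1 (testToSchwartz φ)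
  simp_rw [hh.apply_mulTest hw e] at h2
  have ht := hh.testSeq ψ (G := fun x => ψ x * F x) fun x => by
    by_cases hx : ψ x = 0
    · simp [hx]
    · rw [hF x]
      · by_contra hΩ
        exact hx (test_eq_zero hΩ)
      · rintro h0
        rw [e, h0, zero_mul] at hx
        exact hx rfl
  rw [hv']
  exact h2.unique (ht.hasSum_pairing hp hp1 hs hv)

lemma locNorm_le {v : 𝓓'(Ω, ℂ)} {χ : Euc d → ℝ} {w : 𝓢'(Euc d, ℂ)}
    {f : Lp ℂ p (volume : Measure (Euc d))} (hw : IsLocalization v χ w)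
    (hf : TemperedDistribution.besselPotential (Euc d) ℂ s w = (f : 𝓢'(Euc d, ℂ))) :
    locNorm s p v χ ≤ ‖f‖ₑ :=
  iInf_le_of_le w (iInf_le_of_le f (iInf_le_of_le ⟨hw, hf⟩ le_rfl))

/-- Passing to the infimum needs C ≠ 0: when χ v is not in H^s_p the infimum is empty, equal to ∞,
and 0 · ∞ = 0 would falsify the inequality. -/
lemma le_mul_locNorm_add {v : 𝓓'(Ω, ℂ)} {χ : Euc d → ℝ} {C : ℝ≥0} (hC : C ≠ 0) {a b : ℝ≥0∞}
    (h : ∀ (w : 𝓢'(Euc d, ℂ)) (f : Lp ℂ p (volume : Measure (Euc d))), IsLocalization v χ w →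
      TemperedDistribution.besselPotential (Euc d) ℂ s w = (f : 𝓢'(Euc d, ℂ)) →
      a ≤ C * ‖f‖ₑ + b) : a ≤ C * locNorm s p v χ + b := by
  have h1 : (C : ℝ≥0∞) ≠ 0 := by simpa using hC
  unfold locNorm
  simp_rw [ENNReal.mul_iInf_of_ne h1 ENNReal.coe_ne_top, ENNReal.iInf_add]
  exact le_iInf fun w => le_iInf fun f => le_iInf fun hf => h w f hf.1 hf.2

lemma locNorm_add_le (v v' : 𝓓'(Ω, ℂ)) (χ : Euc d → ℝ) :
    locNorm s p (v + v') χ ≤ locNorm s p v χ + locNorm s p v' χ := by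
  have := le_mul_locNorm_add (s := s) (p := p) (v := v) (χ := χ) one_ne_zero
    (a := locNorm s p (v + v') χ) (b := locNorm s p v' χ) fun w f hw hf => ?_
  · simpa using this
  have := le_mul_locNorm_add (s := s) (p := p) (v := v') (χ := χ) one_ne_zero
    (a := locNorm s p (v + v') χ) (b := ‖f‖ₑ) fun w' f' hw' hf' => ?_
  · rw [ENNReal.coe_one, one_mul] at this ⊢
    rwa [add_comm ‖f‖ₑ]
  have h1 : IsLocalization (v + v') χ (w + w') := fun φ ψ e => by
    change w _ + w' _ = v _ + v' _
    rw [hw φ ψ e, hw' φ ψ e]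
  have h2 : TemperedDistribution.besselPotential (Euc d) ℂ s (w + w') =
      ((f + f' : Lp ℂ p (volume : Measure (Euc d))) : 𝓢'(Euc d, ℂ)) := by
    rw [map_add, hf, hf']
    exact (map_add (Lp.toTemperedDistributionCLM ℂ volume p) f f').symm
  refine (locNorm_le h1 h2).trans ((enorm_add_le _ _).trans_eq ?_)
  simp [add_comm]

lemma locNorm_smul_le {c : ℂ} (hc : c ≠ 0) (v : 𝓓'(Ω, ℂ)) (χ : Euc d → ℝ) :
    locNorm s p (c • v) χ ≤ ‖c‖₊ * locNorm s p v χ := by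
  have := le_mul_locNorm_add (s := s) (p := p) (v := v) (χ := χ) (C := ‖c‖₊) (by simpa using hc)
    (a := locNorm s p (c • v) χ) (b := 0) fun w f hw hf => ?_
  · simpa using this
  have h1 : IsLocalization (c • v) χ (c • w) := fun φ ψ e => by
    change c • w _ = c • v _
    rw [hw φ ψ e]
  have h2 : TemperedDistribution.besselPotential (Euc d) ℂ s (c • w) =
      ((c • f : Lp ℂ p (volume : Measure (Euc d))) : 𝓢'(Euc d, ℂ)) := by
    rw [map_smul, hf]
    exact (map_smul (Lp.toTemperedDistributionCLM ℂ volume p) c f).symm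
  refine (locNorm_le h1 h2).trans_eq ?_
  rw [enorm_smul, add_zero]
  rfl

lemma exists_locNorm_le (hp : p < ⊤) (hp1 : 1 < p) (hs : |s| < σ) {F : Euc d → ℝ}
    {χ : Euc d → ℝ} {h : ℕ → Euc d → ℝ} (hh : MultSeq σ h)
    (hF : ∀ x ∈ Ω, χ x ≠ 0 → ∑' k, h k x = F x) :
    ∃ C : ℝ≥0, ∀ v v' : 𝓓'(Ω, ℂ), (∀ χ : 𝓓(Ω, ℝ), LocMem s p v χ) →
      (∀ φ : 𝓓(Ω, ℝ), v' φ = pairing v σ (fun x => φ x * F x)) →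
      (LocMem s p v χ → LocMem s p v' χ) ∧ locNorm s p v' χ ≤ C * locNorm s p v χ := by
  obtain ⟨C, hC⟩ := hh.exists_mul (p := p) hp hp1 hs
  -- The 1 only keeps the constant away from zero, for the passage to the infimum.
  refine ⟨C + 1, fun v v' hv hv' => ⟨?_, ?_⟩⟩
  · rintro ⟨w, hw, f, hf⟩
    obtain ⟨w', g, hg, -, h1⟩ := hC w f hf
    exact ⟨w', hh.isLocalization hp hp1 hs hv hv' hF hw h1, g, hg⟩
  · have := le_mul_locNorm_add (s := s) (p := p) (v := v) (χ := χ) (C := C + 1) (by positivity)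
      (a := locNorm s p v' χ) (b := 0) fun w f hw hf => ?_
    · simpa using this
    obtain ⟨w', g, hg, hn, h1⟩ := hC w f hf
    refine (locNorm_le (hh.isLocalization hp hp1 hs hv hv' hF hw h1) hg).trans (hn.trans ?_)
    rw [add_zero]
    gcongr
    simp

end Pairing

/-! ### Multipliers of the cone Sobolev spaces -/

section Multipliers

variable {n : ℕ} {B : Type*} [TopologicalSpace B] [ChartedSpace (EuclideanHalfSpace (n + 1)) B]
  {Y : Type*} [TopologicalSpace Y] [ChartedSpace (Euc n) Y]

/-- The part of the image of the chart `κ'` where the change of coordinates to `κ` is defined. -/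
def InteriorChart.overlap (κ κ' : InteriorChart n B) : Set (Euc (n + 1)) :=
  κ'.toChart.target ∩ κ'.toChart.symm ⁻¹' κ.toChart.source

lemma InteriorChart.isOpen_overlap (κ κ' : InteriorChart n B) : IsOpen (κ.overlap κ') :=
  κ'.toChart.symm.isOpen_inter_preimage κ.toChart.open_source

lemma InteriorChart.contDiffOn_transition (κ κ' : InteriorChart n B) :
    ContDiffOn ℝ ∞ (κ.toChart ∘ κ'.toChart.symm) (κ.overlap κ') := by
  rw [← contMDiffOn_iff_contDiffOn]
  exact κ.contMDiffOn.comp (κ'.contMDiffOn_symm.mono inter_subset_left) inter_subset_right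

lemma IntDistribution.apply_mulTest (u : IntDistribution n B) {κ κ' : InteriorChart n B}
    {φ : 𝓓(κ.dom, ℝ)} {φ' : 𝓓(κ'.dom, ℝ)}
    (h : tsupport φ ⊆ κ'.overlap κ) (h' : tsupport φ' ⊆ κ.overlap κ')
    (e : ∀ x ∈ κ.overlap κ', φ' x = |(fderiv ℝ (κ.toChart ∘ κ'.toChart.symm) x).det| *
      φ (κ.toChart (κ'.toChart.symm x))) {a a' : Euc (n + 1) → ℝ}
    (ha : ContDiffOn ℝ ∞ a κ.dom) (ha' : ContDiffOn ℝ ∞ a' κ'.dom)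
    (haa' : ∀ x ∈ tsupport φ', a' x = a (κ.toChart (κ'.toChart.symm x))) :
    u.1 κ (mulTest a ha φ) = u.1 κ' (mulTest a' ha' φ') := by
  refine u.2 κ κ' _ _ ((tsupport_smul_subset_left φ a).trans h)
    ((tsupport_smul_subset_left φ' a').trans h') fun x hx => ?_
  by_cases h0 : x ∈ tsupport φ'
  · rw [mulTest_apply, mulTest_apply, e x hx, haa' x h0]
    ring
  · have h1 := image_eq_zero_of_notMem_tsupport h0
    have h2 := e x hx
    rw [h1] at h2
    rw [mulTest_apply, mulTest_apply, h1, mul_zero, mul_left_comm, ← h2, mul_zero]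

lemma Cutoff.exists_eq_one {a b : ℝ} (ha : 0 < a) (hab : a < b) (hb : b < 1) :
    ∃ θ : Cutoff, (∀ x ≤ a, θ.toFun x = 1) ∧ ∀ x, b ≤ x → θ.toFun x = 0 := by
  have h1 : ∀ x ≤ a, Real.smoothTransition ((b - x) / (b - a)) = 1 := fun x hx =>
    Real.smoothTransition.one_of_one_le ((one_le_div (by linarith)).2 (by linarith))
  have h2 : ∀ x, b ≤ x → Real.smoothTransition ((b - x) / (b - a)) = 0 := fun x hx =>
    Real.smoothTransition.zero_of_nonpos (div_nonpos_of_nonpos_of_nonneg (by linarith)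
      (by linarith))
  refine ⟨⟨fun x => Real.smoothTransition ((b - x) / (b - a)), ?_, fun x =>
    Real.smoothTransition.nonneg _, ?_, b, hb, h2⟩, h1, h2⟩
  · exact Real.smoothTransition.contDiff.comp ((contDiff_const.sub contDiff_id).div_const _)
  · filter_upwards [Iio_mem_nhds ha] with x hx
    exact h1 x (le_of_lt hx)

lemma Cutoff.exists_eq_one_of_ne_zero (θ : Cutoff) :
    ∃ θ' : Cutoff, ∀ x, θ.toFun x ≠ 0 → θ'.toFun x = 1 := by
  obtain ⟨a, ha, h⟩ := θ.eq_zero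
  have h1 : max a (1 / 2) < 1 := max_lt ha (by norm_num)
  obtain ⟨b, hb, hb'⟩ := exists_between h1
  obtain ⟨θ', h', -⟩ := Cutoff.exists_eq_one (lt_of_lt_of_le (by norm_num) (le_max_right a (1 / 2)))
    hb hb'
  refine ⟨θ', fun x hx => h' x ?_⟩
  by_contra hc
  exact hx (h x ((le_max_left _ _).trans (not_le.1 hc).le))

lemma collarWeight_ne_zero {γ : ℝ} {θ : Cutoff} {η : BoundaryChart n Y} {ψ : 𝓓(η.dom, ℝ)}
    {x : Euc (n + 1)} (h : collarWeight γ θ ψ x ≠ 0) :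
    θ.toFun (Real.exp (-x 0)) ≠ 0 ∧ ψ (tailPt x) ≠ 0 := by
  unfold collarWeight at h
  exact ⟨right_ne_zero_of_mul (left_ne_zero_of_mul h), right_ne_zero_of_mul h⟩

lemma collarWeight_half (θ : Cutoff) {η : BoundaryChart n Y} (ψ : 𝓓(η.dom, ℝ)) (x : Euc (n + 1)) :
    collarWeight (((n : ℝ) + 1) / 2) θ ψ x = θ.toFun (Real.exp (-x 0)) * ψ (tailPt x) := by
  simp [collarWeight]

/-- The exponential weight stays with u. For the multiplier the weight (n+1)/2 has no exponential,
so a plain cut-off can be 1 on the support of any other weight; this is why γ is arbitrary. -/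
lemma exists_collarWeight_eq_one (γ : ℝ) (θ : Cutoff) {η : BoundaryChart n Y} (ψ : 𝓓(η.dom, ℝ)) :
    ∃ (θ' : Cutoff) (ψ' : 𝓓(η.dom, ℝ)), ∀ x : Euc (n + 1), collarWeight γ θ ψ x ≠ 0 →
      collarWeight (((n : ℝ) + 1) / 2) θ' ψ' x = 1 := by
  obtain ⟨θ', hθ⟩ := θ.exists_eq_one_of_ne_zero
  obtain ⟨ψ', hψ⟩ := exists_test_eq_one_near ψ.hasCompactSupport ψ.tsupport_subset
  refine ⟨θ', ψ', fun x hx => ?_⟩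
  obtain ⟨h1, h2⟩ := collarWeight_ne_zero hx
  rw [collarWeight_half, hθ _ h1, hψ _ (subset_tsupport _ h2), one_mul]

variable [IsManifold (𝓡∂ (n + 1)) ∞ B] [IsManifold (𝓡 n) ∞ Y]

/-- Functions on `B` that are multipliers of the cone Sobolev spaces of order `|s| < σ`. -/
structure ConeMult (c : Collar n B Y) (σ : ℝ) (F : B → ℝ) : Prop where
  interior : ∀ κ : InteriorChart n B, LocMult κ.dom σ fun x => F (κ.toChart.symm x)
  collar : ∀ (θ : Cutoff) (η : BoundaryChart n Y) (ψ : 𝓓(η.dom, ℝ)),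
    ∃ h : ℕ → Euc (n + 1) → ℝ, MultSeq σ h ∧ ∀ x, ∑' k, h k x =
      collarWeight (((n : ℝ) + 1) / 2) θ ψ x * F ((c.logChart η).toChart.symm x)

variable {c : Collar n B Y} {σ s γ : ℝ} {p : ℝ≥0∞} [Fact (1 ≤ p)] {F : B → ℝ}

lemma ConeMult.exists_eq_of_ne_zero (hF : ConeMult c σ F) (κ : InteriorChart n B)
    (χ : 𝓓(κ.dom, ℝ)) : ∃ h : ℕ → Euc (n + 1) → ℝ, MultSeq σ h ∧
      ∀ x, χ x ≠ 0 → ∑' k, h k x = F (κ.toChart.symm x) := by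
  obtain ⟨χ', hχ'⟩ := exists_test_eq_one_near χ.hasCompactSupport χ.tsupport_subset
  obtain ⟨h, hh, hs⟩ := hF.interior κ χ'
  refine ⟨h, hh, fun x hx => ?_⟩
  rw [hs, hχ' x (subset_tsupport _ hx), one_mul]

lemma ConeMult.exists_eq_of_collarWeight_ne_zero (hF : ConeMult c σ F) (γ : ℝ) (θ : Cutoff)
    {η : BoundaryChart n Y} (ψ : 𝓓(η.dom, ℝ)) : ∃ h : ℕ → Euc (n + 1) → ℝ, MultSeq σ h ∧
      ∀ x, collarWeight γ θ ψ x ≠ 0 →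
        ∑' k, h k x = F ((c.logChart η).toChart.symm x) := by
  obtain ⟨θ', ψ', h1⟩ := exists_collarWeight_eq_one γ θ ψ
  obtain ⟨h, hh, hs⟩ := hF.collar θ' η ψ'
  refine ⟨h, hh, fun x hx => ?_⟩
  rw [hs, h1 x hx, one_mul]

/-- A decomposition of F in one chart, composed with the change of coordinates, is a decomposition
in the other. The identity holds term by term, because multiplication by a smooth piece respects the
compatibility of u. -/
lemma ConeMult.pairing_eq (hp : p < ⊤) (hp1 : 1 < p) (hs : |s| < σ) (hF : ConeMult c σ F)
    {u : IntDistribution n B} (hu : u ∈ coneSobolev c s γ p) {κ κ' : InteriorChart n B}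
    {φ : 𝓓(κ.dom, ℝ)} {φ' : 𝓓(κ'.dom, ℝ)}
    (h : tsupport φ ⊆ κ'.overlap κ) (h' : tsupport φ' ⊆ κ.overlap κ')
    (e : ∀ x ∈ κ.overlap κ', φ' x = |(fderiv ℝ (κ.toChart ∘ κ'.toChart.symm) x).det| *
      φ (κ.toChart (κ'.toChart.symm x))) :
    pairing (u.1 κ) σ (fun x => φ x * F (κ.toChart.symm x)) =
      pairing (u.1 κ') σ (fun x => φ' x * F (κ'.toChart.symm x)) := by
  obtain ⟨a, ha, hsum⟩ := hF.exists_eq_of_ne_zero κ φ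
  -- The transition map lives on the overlap only and its derivatives may blow up; a globally
  -- bounded map that agrees with it on the support of `φ'` is enough.
  obtain ⟨τ, hτ, hτe⟩ := exists_bddDeriv_eqOn (κ.isOpen_overlap κ') φ'.hasCompactSupport h'
    (κ.contDiffOn_transition κ')
  have ha' := ha.comp hτ
  have t1 := ha.testSeq φ (G := fun x => φ x * F (κ.toChart.symm x)) fun x => by
    by_cases h0 : φ x = 0
    · simp [h0]
    · rw [hsum x h0]
  have t2 := ha'.testSeq φ' (G := fun x => φ' x * F (κ'.toChart.symm x)) fun x => by
    by_cases h0 : φ' x = 0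
    · simp [h0]
    · have hx := subset_tsupport _ h0
      have h1 := e x (h' hx)
      rw [hτe hx, Function.comp_apply, hsum, κ.toChart.left_inv (h' hx).2]
      intro h2
      rw [h1, h2, mul_zero] at h0
      exact h0 rfl
  refine (t1.hasSum_pairing hp hp1 hs (hu.1 κ)).unique ?_
  have := t2.hasSum_pairing hp hp1 hs (hu.1 κ')
  refine this.congr_fun fun k => ?_
  exact IntDistribution.apply_mulTest u h h' e _ _ fun x hx => by rw [hτe hx]; rfl

/-- The product of `u` and of `F`. -/
def ConeMult.mul (hp : p < ⊤) (hp1 : 1 < p) (hs : |s| < σ) (hF : ConeMult c σ F)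
    (u : coneSobolev c s γ p) : IntDistribution n B :=
  ⟨fun κ => multDist (u.1.1 κ) σ (fun x => F (κ.toChart.symm x))
    fun K hK => (hF.interior κ).exists_pairing_eq hp hp1 hs (u.2.1 κ) K hK,
    fun _ _ _ _ h h' e => hF.pairing_eq hp hp1 hs u.2 h h' e⟩

lemma ConeMult.mul_apply (hp : p < ⊤) (hp1 : 1 < p) (hs : |s| < σ) (hF : ConeMult c σ F)
    (u : coneSobolev c s γ p) (κ : InteriorChart n B) (φ : 𝓓(κ.dom, ℝ)) :
    (hF.mul hp hp1 hs u).1 κ φ = pairing (u.1.1 κ) σ fun x => φ x * F (κ.toChart.symm x) := rfl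

lemma ConeMult.hasSum_mul (hp : p < ⊤) (hp1 : 1 < p) (hs : |s| < σ) (hF : ConeMult c σ F)
    (u : coneSobolev c s γ p) {κ : InteriorChart n B} {φ : 𝓓(κ.dom, ℝ)}
    {h : ℕ → Euc (n + 1) → ℝ} (hh : MultSeq σ h)
    (hsum : ∀ x, φ x ≠ 0 → ∑' k, h k x = F (κ.toChart.symm x)) :
    HasSum (fun k => u.1.1 κ (mulTest (h k) (hh.contDiff k).contDiffOn φ))
      ((hF.mul hp hp1 hs u).1 κ φ) := by
  rw [ConeMult.mul_apply]
  refine (hh.testSeq φ fun x => ?_).hasSum_pairing hp hp1 hs (u.2.1 κ)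
  by_cases h0 : φ x = 0
  · simp [h0]
  · rw [hsum x h0]

lemma ConeMult.mul_mem (hp : p < ⊤) (hp1 : 1 < p) (hs : |s| < σ) (hF : ConeMult c σ F)
    (u : coneSobolev c s γ p) : hF.mul hp hp1 hs u ∈ coneSobolev c s γ p := by
  constructor
  · intro κ χ
    obtain ⟨h, hh, hsum⟩ := hF.exists_eq_of_ne_zero κ χ
    obtain ⟨C, hC⟩ := exists_locNorm_le (Ω := κ.dom) (F := fun x => F (κ.toChart.symm x))
      hp hp1 hs hh fun x _ hx => hsum x hx
    exact (hC _ _ (u.2.1 κ) (hF.mul_apply hp hp1 hs u κ)).1 (u.2.1 κ χ)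
  · intro θ η ψ
    obtain ⟨h, hh, hsum⟩ := hF.exists_eq_of_collarWeight_ne_zero γ θ ψ
    obtain ⟨C, hC⟩ := exists_locNorm_le (Ω := (c.logChart η).dom)
      (F := fun x => F ((c.logChart η).toChart.symm x)) hp hp1 hs hh fun x _ hx => hsum x hx
    exact (hC _ _ (u.2.1 _) (hF.mul_apply hp hp1 hs u _)).1 (u.2.2 θ η ψ)

/-- Multiplication by `F` on the cone Sobolev space. -/
def ConeMult.op (γ : ℝ) (hp : p < ⊤) (hp1 : 1 < p) (hs : |s| < σ) (hF : ConeMult c σ F) :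
    coneSobolev c s γ p →ₗ[ℂ] coneSobolev c s γ p where
  toFun u := ⟨hF.mul hp hp1 hs u, hF.mul_mem hp hp1 hs u⟩
  map_add' u v := by
    refine Subtype.ext (Subtype.ext (funext fun κ => ContinuousLinearMap.ext fun φ => ?_))
    obtain ⟨h, hh, hsum⟩ := hF.exists_eq_of_ne_zero κ φ
    refine (hF.hasSum_mul hp hp1 hs (u + v) hh hsum).unique ?_
    exact (hF.hasSum_mul hp hp1 hs u hh hsum).add (hF.hasSum_mul hp hp1 hs v hh hsum)
  map_smul' a u := by
    refine Subtype.ext (Subtype.ext (funext fun κ => ContinuousLinearMap.ext fun φ => ?_))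
    obtain ⟨h, hh, hsum⟩ := hF.exists_eq_of_ne_zero κ φ
    refine (hF.hasSum_mul hp hp1 hs (a • u) hh hsum).unique ?_
    exact (hF.hasSum_mul hp hp1 hs u hh hsum).const_smul a

lemma ConeMult.hasSum_op (hp : p < ⊤) (hp1 : 1 < p) (hs : |s| < σ) (hF : ConeMult c σ F)
    (u : coneSobolev c s γ p) {κ : InteriorChart n B} {φ : 𝓓(κ.dom, ℝ)}
    {h : ℕ → Euc (n + 1) → ℝ} (hh : MultSeq σ h)
    (hsum : ∀ x, φ x ≠ 0 → ∑' k, h k x = F (κ.toChart.symm x)) :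
    HasSum (fun k => u.1.1 κ (mulTest (h k) (hh.contDiff k).contDiffOn φ))
      ((hF.op γ hp hp1 hs u).1.1 κ φ) :=
  hF.hasSum_mul hp hp1 hs u hh hsum

lemma ConeMult.locNorm_op_le (γ : ℝ) (hp : p < ⊤) (hp1 : 1 < p) (hs : |s| < σ)
    (hF : ConeMult c σ F) (κ : InteriorChart n B) (χ : 𝓓(κ.dom, ℝ)) :
    ∃ C : ℝ≥0, ∀ u : coneSobolev c s γ p,
      locNorm s p ((hF.op γ hp hp1 hs u).1.1 κ) χ ≤ C * locNorm s p (u.1.1 κ) χ := by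
  obtain ⟨h, hh, hsum⟩ := hF.exists_eq_of_ne_zero κ χ
  obtain ⟨C, hC⟩ := exists_locNorm_le (Ω := κ.dom) (F := fun x => F (κ.toChart.symm x))
    hp hp1 hs hh fun x _ hx => hsum x hx
  exact ⟨C, fun u => (hC _ _ (u.2.1 κ) (hF.mul_apply hp hp1 hs u κ)).2⟩

lemma ConeMult.locNorm_op_collarWeight_le (γ : ℝ) (hp : p < ⊤) (hp1 : 1 < p) (hs : |s| < σ)
    (hF : ConeMult c σ F) (θ : Cutoff) {η : BoundaryChart n Y} (ψ : 𝓓(η.dom, ℝ)) :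
    ∃ C : ℝ≥0, ∀ u : coneSobolev c s γ p,
      locNorm s p ((hF.op γ hp hp1 hs u).1.1 (c.logChart η)) (collarWeight γ θ ψ) ≤
        C * locNorm s p (u.1.1 (c.logChart η)) (collarWeight γ θ ψ) := by
  obtain ⟨h, hh, hsum⟩ := hF.exists_eq_of_collarWeight_ne_zero γ θ ψ
  obtain ⟨C, hC⟩ := exists_locNorm_le (Ω := (c.logChart η).dom)
    (F := fun x => F ((c.logChart η).toChart.symm x)) hp hp1 hs hh fun x _ hx => hsum x hx
  exact ⟨C, fun u => (hC _ _ (u.2.1 _) (hF.mul_apply hp hp1 hs u _)).2⟩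

lemma ConeMult.coneNorm_op_le (γ : ℝ) (hp : p < ⊤) (hp1 : 1 < p) (hs : |s| < σ)
    (hF : ConeMult c σ F) (N : NormData c) :
    ∃ C : ℝ≥0, ∀ u : coneSobolev c s γ p,
      coneNorm N s γ p (hF.op γ hp hp1 hs u).1 ≤ C * coneNorm N s γ p u.1 := by
  choose C hC using fun j => hF.locNorm_op_le γ hp hp1 hs (N.κ j) (N.χ j)
  choose D hD using fun i => hF.locNorm_op_collarWeight_le γ hp hp1 hs N.θ (N.ψ i)
  refine ⟨∑ j, C j + ∑ i, D i, fun u => ?_⟩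
  unfold coneNorm
  rw [mul_add, Finset.mul_sum, Finset.mul_sum]
  refine add_le_add (Finset.sum_le_sum fun i _ => (hD i u).trans ?_)
    (Finset.sum_le_sum fun j _ => (hC j u).trans ?_)
  · gcongr
    exact (Finset.single_le_sum (f := D) (fun _ _ => zero_le) (Finset.mem_univ i)).trans
      le_add_self
  · gcongr
    exact (Finset.single_le_sum (f := C) (fun _ _ => zero_le) (Finset.mem_univ j)).trans
      le_self_add

lemma coneNorm_add_le (N : NormData c) (u v : IntDistribution n B) :
    coneNorm N s γ p (u + v) ≤ coneNorm N s γ p u + coneNorm N s γ p v := by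
  unfold coneNorm
  rw [add_add_add_comm, ← Finset.sum_add_distrib, ← Finset.sum_add_distrib]
  exact add_le_add (Finset.sum_le_sum fun i _ => locNorm_add_le _ _ _)
    (Finset.sum_le_sum fun j _ => locNorm_add_le _ _ _)

lemma coneNorm_smul_le {a : ℂ} (ha : a ≠ 0) (N : NormData c) (u : IntDistribution n B) :
    coneNorm N s γ p (a • u) ≤ ‖a‖₊ * coneNorm N s γ p u := by
  unfold coneNorm
  rw [mul_add, Finset.mul_sum, Finset.mul_sum]
  exact add_le_add (Finset.sum_le_sum fun i _ => locNorm_smul_le ha _ _)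
    (Finset.sum_le_sum fun j _ => locNorm_smul_le ha _ _)

end Multipliers

/-! ### Distributions given by locally integrable functions -/

section Integrals

variable {d : ℕ} {Ω : Opens (Euc d)} {σ : ℝ}

lemma integrable_test_mul {G : Euc d → ℂ} (hG : LocallyIntegrableOn G Ω volume) (φ : 𝓓(Ω, ℝ)) :
    Integrable fun x => (φ x : ℂ) * G x := by
  have := TestFunction.integrable_bilin (ContinuousLinearMap.lsmul ℝ ℝ : ℝ →L[ℝ] ℂ →L[ℝ] ℂ) hG φ
  refine this.congr (Eventually.of_forall fun x => ?_)
  simp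

/-- The distribution given by a locally integrable function. -/
def distOf (Ω : Opens (Euc d)) (G : Euc d → ℂ) : 𝓓'(Ω, ℂ) :=
  TestFunction.integralAgainstBilinCLM (ContinuousLinearMap.lsmul ℝ ℝ : ℝ →L[ℝ] ℂ →L[ℝ] ℂ) volume G

lemma distOf_apply {G : Euc d → ℂ} (hG : LocallyIntegrableOn G Ω volume) (φ : 𝓓(Ω, ℝ)) :
    distOf Ω G φ = ∫ x, (φ x : ℂ) * G x := by
  refine (TestFunction.integralAgainstBilinCLM_eq_integral hG).trans ?_
  simp

lemma eqOn_of_integral_test_eq {F G : Euc d → ℂ} (hF : ContinuousOn F Ω) (hG : ContinuousOn G Ω)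
    (h : ∀ φ : 𝓓(Ω, ℝ), ∫ x, (φ x : ℂ) * F x = ∫ x, (φ x : ℂ) * G x) : EqOn F G Ω := by
  have hF' := hF.locallyIntegrableOn Ω.isOpen.measurableSet (μ := volume)
  have hG' := hG.locallyIntegrableOn Ω.isOpen.measurableSet (μ := volume)
  have h1 := Ω.isOpen.ae_eq_zero_of_integral_contDiff_smul_eq_zero (hF'.sub hG')
    fun g hg hc hs => by
      have h2 := h (mkTest Ω g hg hc hs)
      rw [← sub_eq_zero, ← integral_sub (integrable_test_mul hF' _)
        (integrable_test_mul hG' _)] at h2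
      rw [← h2]
      refine integral_congr_ae (Eventually.of_forall fun x => ?_)
      simp [mul_sub]
  refine Measure.eqOn_open_of_ae_eq (μ := volume) ?_ Ω.isOpen hF hG
  rw [EventuallyEq, ae_restrict_iff' Ω.isOpen.measurableSet]
  filter_upwards [h1] with x hx hxΩ
  exact sub_eq_zero.1 (hx hxΩ)

lemma MultSeq.hasSum_integral (hσ : 0 < σ) {h : ℕ → Euc d → ℝ} (hh : MultSeq σ h) {G : Euc d → ℂ}
    (hG : Integrable G) :
    HasSum (fun k => ∫ x, (h k x : ℂ) * G x) (∫ x, ((∑' k, h k x : ℝ) : ℂ) * G x) := by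
  obtain ⟨C, hC, hb⟩ := hh.exists_norm_le
  have hsum := (summable_two_rpow hσ).mul_left C
  refine hasSum_integral_of_dominated_convergence
    (fun k x => C * (2 : ℝ) ^ (-((k : ℝ) * σ)) * ‖G x‖) (fun k => ?_) (fun k => ?_) ?_ ?_ ?_
  · exact ((Complex.continuous_ofReal.comp (hh.contDiff k).continuous).aestronglyMeasurable).mul
      hG.aestronglyMeasurable
  · refine Eventually.of_forall fun x => ?_
    rw [norm_mul, Complex.norm_real]
    have := hb k x
    gcongr
  · exact Eventually.of_forall fun x => hsum.mul_right _
  · simp_rw [tsum_mul_right]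
    exact hG.norm.const_mul _
  · exact Eventually.of_forall fun x =>
      (Complex.hasSum_ofReal.2 (hh.summable hσ x).hasSum).mul_right _

end Integrals

/-! ### Changes of coordinates between interior charts -/

section Charts

variable {n : ℕ} {B : Type*} [TopologicalSpace B] [ChartedSpace (EuclideanHalfSpace (n + 1)) B]

lemma contDiff_det {d : ℕ} : ContDiff ℝ ∞ fun A : Euc d →L[ℝ] Euc d => A.det := by
  have e : (fun A : Euc d →L[ℝ] Euc d => A.det) = fun A => (Matrix.of fun i j =>
      (A (EuclideanSpace.single j 1)) i).det := by
    ext A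
    rw [ContinuousLinearMap.det, ← LinearMap.det_toMatrix (EuclideanSpace.basisFun _ ℝ).toBasis]
    congr 1
  rw [e]
  simp_rw [Matrix.det_apply]
  refine ContDiff.sum fun σ _ => ContDiff.const_smul _ (contDiff_prod fun i _ => ?_)
  exact (contDiff_euclidean.1 ((ContinuousLinearMap.apply ℝ (Euc d)
    (EuclideanSpace.single i (1 : ℝ))).contDiff)) (σ i)

namespace InteriorChart

variable (κ κ' : InteriorChart n B)

/-- The change of coordinates from `κ'` to `κ`. -/
def transition : Euc (n + 1) → Euc (n + 1) := κ.toChart ∘ κ'.toChart.symm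

lemma mapsTo_transition : MapsTo (κ.transition κ') (κ.overlap κ') (κ'.overlap κ) := by
  rintro x ⟨hx, hx'⟩
  refine ⟨κ.toChart.map_source hx', ?_⟩
  change κ.toChart.symm (κ.toChart (κ'.toChart.symm x)) ∈ κ'.toChart.source
  rw [κ.toChart.left_inv hx']
  exact κ'.toChart.map_target hx

lemma symm_transition {x : Euc (n + 1)} (hx : x ∈ κ.overlap κ') :
    κ.toChart.symm (κ.transition κ' x) = κ'.toChart.symm x :=
  κ.toChart.left_inv hx.2

lemma transition_transition {x : Euc (n + 1)} (hx : x ∈ κ.overlap κ') :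
    κ'.transition κ (κ.transition κ' x) = x := by
  change κ'.toChart (κ.toChart.symm (κ.transition κ' x)) = x
  rw [symm_transition κ κ' hx, κ'.toChart.right_inv hx.1]

lemma injOn_transition : InjOn (κ.transition κ') (κ.overlap κ') := fun x hx y hy h => by
  rw [← κ.transition_transition κ' hx, h, κ.transition_transition κ' hy]

lemma image_transition : κ.transition κ' '' (κ.overlap κ') = κ'.overlap κ :=
  (κ.mapsTo_transition κ').image_subset.antisymm fun x hx =>
    ⟨κ'.transition κ x, κ'.mapsTo_transition κ hx, κ'.transition_transition κ hx⟩

lemma differentiableAt_transition {x : Euc (n + 1)} (hx : x ∈ κ.overlap κ') :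
    DifferentiableAt ℝ (κ.transition κ') x :=
  ((κ.contDiffOn_transition κ').contDiffAt ((κ.isOpen_overlap κ').mem_nhds hx)).differentiableAt
    (by simp)

/-- Needed for smoothness of the absolute value of the Jacobian, and hence of the transported test
function. -/
lemma det_transition_ne_zero {x : Euc (n + 1)} (hx : x ∈ κ.overlap κ') :
    (fderiv ℝ (κ.transition κ') x).det ≠ 0 := by
  have h1 := (κ'.differentiableAt_transition κ (κ.mapsTo_transition κ' hx)).hasFDerivAt.comp x
    (κ.differentiableAt_transition κ' hx).hasFDerivAt
  have h2 : (κ'.transition κ ∘ κ.transition κ') =ᶠ[𝓝 x] id := by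
    filter_upwards [(κ.isOpen_overlap κ').mem_nhds hx] with y hy
    exact κ.transition_transition κ' hy
  have h3 := (h1.congr_of_eventuallyEq h2.symm).unique (hasFDerivAt_id x)
  have h4 := congrArg ContinuousLinearMap.det h3
  rw [ContinuousLinearMap.det, ContinuousLinearMap.toLinearMap_comp, LinearMap.det_comp] at h4
  intro h0
  rw [ContinuousLinearMap.det] at h0
  rw [h0, mul_zero, ContinuousLinearMap.det] at h4
  simp at h4

/-- The transformation of densities of a test function supported in the common domain of two
charts. -/
lemma exists_transfer {φ : 𝓓(κ.dom, ℝ)} (h : tsupport φ ⊆ κ'.overlap κ) :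
    ∃ φ' : 𝓓(κ'.dom, ℝ), tsupport φ' ⊆ κ.overlap κ' ∧
      (∀ x ∈ κ.overlap κ', φ' x = |(fderiv ℝ (κ.toChart ∘ κ'.toChart.symm) x).det| *
        φ (κ.toChart (κ'.toChart.symm x))) := by
  set V := κ.overlap κ' with hV
  set K : Set (Euc (n + 1)) := κ'.transition κ '' tsupport φ
  have hKV : K ⊆ V := (image_mono h).trans (κ'.mapsTo_transition κ).image_subset
  have hK : IsCompact K := φ.hasCompactSupport.isCompact.image_of_continuousOn
    ((κ'.contDiffOn_transition κ).continuousOn.mono h)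
  -- `χ` extends the transported density by zero outside the overlap without changing it, as it
  -- equals 1 on the image of the support.
  obtain ⟨χ, hχ⟩ := exists_test_eq_one_near (Ω := ⟨V, κ.isOpen_overlap κ'⟩) hK hKV
  set a : Euc (n + 1) → ℝ := fun x => |(fderiv ℝ (κ.transition κ') x).det| * φ (κ.transition κ' x)
  have ha : ContDiffOn ℝ ∞ a V := by
    have h1 := κ.contDiffOn_transition κ'
    have h2 : ContDiffOn ℝ ∞ (fderiv ℝ (κ.transition κ')) V :=
      h1.fderiv_of_isOpen (κ.isOpen_overlap κ') (by simp)
    have h3 : ContDiffOn ℝ ∞ (fun x => |(fderiv ℝ (κ.transition κ') x).det|) V := fun x hx =>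
      (contDiff_det.comp_contDiffOn h2 x hx).abs (κ.det_transition_ne_zero κ' hx)
    exact h3.mul (φ.contDiff.comp_contDiffOn h1)
  refine ⟨mkTest κ'.dom (fun x => χ x • a x)
    (contDiff_mul_of_tsupport_subset (κ.isOpen_overlap κ') ha χ.contDiff χ.tsupport_subset)
    χ.hasCompactSupport.smul_right ((tsupport_smul_subset_left _ _).trans
      (χ.tsupport_subset.trans inter_subset_left)),
    (tsupport_smul_subset_left _ _).trans χ.tsupport_subset, fun x hx => ?_⟩
  change χ x * a x = a x
  by_cases h0 : φ (κ.transition κ' x) = 0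
  · simp [a, h0]
  · rw [hχ x ⟨_, subset_tsupport _ h0, κ.transition_transition κ' hx⟩, one_mul]

lemma integral_transition {φ : 𝓓(κ.dom, ℝ)} {φ' : 𝓓(κ'.dom, ℝ)}
    (h : tsupport φ ⊆ κ'.overlap κ) (h' : tsupport φ' ⊆ κ.overlap κ')
    (e : ∀ x ∈ κ.overlap κ', φ' x = |(fderiv ℝ (κ.toChart ∘ κ'.toChart.symm) x).det| *
      φ (κ.toChart (κ'.toChart.symm x))) (G : B → ℂ) :
    ∫ x, (φ x : ℂ) * G (κ.toChart.symm x) = ∫ x, (φ' x : ℂ) * G (κ'.toChart.symm x) := by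
  have h0 : ∀ x ∉ κ'.overlap κ, (φ x : ℂ) * G (κ.toChart.symm x) = 0 := fun x hx => by
    simp [image_eq_zero_of_notMem_tsupport fun hm => hx (h hm)]
  have h0' : ∀ x ∉ κ.overlap κ', (φ' x : ℂ) * G (κ'.toChart.symm x) = 0 := fun x hx => by
    simp [image_eq_zero_of_notMem_tsupport fun hm => hx (h' hm)]
  rw [← setIntegral_eq_integral_of_forall_compl_eq_zero h0,
    ← setIntegral_eq_integral_of_forall_compl_eq_zero h0', ← κ.image_transition κ',
    integral_image_eq_integral_abs_det_fderiv_smul volume (κ.isOpen_overlap κ').measurableSet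
      (fun x hx => (κ.differentiableAt_transition κ' hx).hasFDerivAt.hasFDerivWithinAt)
      (κ.injOn_transition κ')]
  refine setIntegral_congr_fun (κ.isOpen_overlap κ').measurableSet fun x hx => ?_
  beta_reduce
  rw [symm_transition κ κ' hx, e x hx, Complex.real_smul]
  push_cast
  exact (mul_assoc _ _ _).symm

end InteriorChart

/-- The distribution on the interior of `B` given by a locally integrable function. -/
def intDistOf (G : B → ℂ) (hG : ∀ κ : InteriorChart n B,
    LocallyIntegrableOn (fun x => G (κ.toChart.symm x)) κ.toChart.target volume) :
    IntDistribution n B :=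
  ⟨fun κ => distOf κ.dom fun x => G (κ.toChart.symm x), fun κ κ' φ φ' h h' e => by
    rw [distOf_apply (hG κ), distOf_apply (hG κ')]
    exact κ.integral_transition κ' h h' e G⟩

lemma represents_intDistOf {G : B → ℂ} (hG : ∀ κ : InteriorChart n B,
    LocallyIntegrableOn (fun x => G (κ.toChart.symm x)) κ.toChart.target volume) :
    Represents (intDistOf G hG) G :=
  fun κ => ⟨hG κ, fun φ => distOf_apply (hG κ) φ⟩

end Charts

/-! ### Gluing localized continuous representatives -/

section Representation

variable {d : ℕ} {Ω : Opens (Euc d)} {σ : ℝ}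

/-- The distribution `χ v` is given by the continuous function `W`. -/
def RepBy (v : 𝓓'(Ω, ℂ)) (χ : Euc d → ℝ) (W : Euc d → ℂ) : Prop :=
  Continuous W ∧ ∀ (φ : 𝓓((⊤ : Opens (Euc d)), ℝ)) (ψ : 𝓓(Ω, ℝ)),
    (∀ x, ψ x = χ x * φ x) → v ψ = ∫ x, (φ x : ℂ) * W x

lemma LocMem.exists_repBy {q : ℝ≥0∞} [Fact (1 ≤ q)] (hq : 1 < q) (hq' : q < ⊤) (hσ : 0 < σ)
    {v : 𝓓'(Ω, ℂ)} {χ : Euc d → ℝ} (h : LocMem (σ + d / q.toReal) q v χ) :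
    ∃ h₁ h₂ : ℕ → Euc d → ℝ, MultSeq σ h₁ ∧ MultSeq σ h₂ ∧
      RepBy v χ fun x => ((∑' k, h₁ k x : ℝ) : ℂ) + ((∑' k, h₂ k x : ℝ) : ℂ) * Complex.I := by
  obtain ⟨w, hw, hmem⟩ := h
  obtain ⟨h₁, h₂, hh₁, hh₂, e⟩ := exists_multSeq hq hq' hσ hmem
  refine ⟨h₁, h₂, hh₁, hh₂, ?_, fun φ ψ hψ => ?_⟩
  · exact (Complex.continuous_ofReal.comp (hh₁.continuous_tsum hσ)).add
      ((Complex.continuous_ofReal.comp (hh₂.continuous_tsum hσ)).mul continuous_const)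
  · rw [← hw φ ψ hψ, e]
    refine integral_congr_ae (Eventually.of_forall fun x => ?_)
    exact mul_comm _ _

/-- Both sides are continuous and represent the product of χ, χ' and v. -/
lemma RepBy.mul_eq {v : 𝓓'(Ω, ℂ)} {χ : Euc d → ℝ} {W W' : Euc d → ℂ} (hχ : ContDiff ℝ ∞ χ)
    (h : RepBy v χ W) {χ' : 𝓓(Ω, ℝ)} (h' : RepBy v χ' W') (x : Euc d) :
    (χ' x : ℂ) * W x = χ x * W' x := by
  have h1 : Continuous fun x => (χ' x : ℂ) * W x :=
    (Complex.continuous_ofReal.comp χ'.continuous).mul h.1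
  have h2 : Continuous fun x => (χ x : ℂ) * W' x :=
    (Complex.continuous_ofReal.comp hχ.continuous).mul h'.1
  refine eqOn_of_integral_test_eq (Ω := ⊤) h1.continuousOn h2.continuousOn (fun φ => ?_)
    (mem_univ x)
  set ψ : 𝓓(Ω, ℝ) := mulTest (fun x => φ x * χ x) (φ.contDiff.mul hχ).contDiffOn χ'
  have k1 := h.2 (mulTest χ' χ'.contDiff.contDiffOn φ) ψ fun x => by simp [ψ]; ring
  have k2 := h'.2 (mulTest χ hχ.contDiffOn φ) ψ fun x => by simp [ψ]; ring
  rw [k1] at k2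
  refine Eq.trans ?_ (k2.trans ?_)
  · refine integral_congr_ae (Eventually.of_forall fun x => ?_)
    simp only [mulTest_apply]
    push_cast
    ring
  · refine integral_congr_ae (Eventually.of_forall fun x => ?_)
    simp only [mulTest_apply]
    push_cast
    ring

lemma RepBy.eq_zero {v : 𝓓'(Ω, ℂ)} {χ : Euc d → ℝ} {W : Euc d → ℂ}
    (h : RepBy v χ W) {x : Euc d} (hx : x ∉ tsupport χ) : W x = 0 := by
  refine eqOn_of_integral_test_eq (Ω := ⟨(tsupport χ)ᶜ, (isClosed_tsupport χ).isOpen_compl⟩)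
    (G := 0) h.1.continuousOn continuousOn_const (fun φ => ?_) hx
  have := h.2 (toTop φ) 0 fun y => ?_
  · rw [map_zero] at this
    simpa using this.symm
  · by_cases hy : y ∈ tsupport χ
    · rw [toTop_apply, test_eq_zero (φ := φ) (x := y) fun h => h hy, mul_zero]; rfl
    · rw [image_eq_zero_of_notMem_tsupport hy, zero_mul]; rfl

/-- The value F(x) is read off from the representative of χ v for a test function χ with χ(x) = 1;
by `RepBy.mul_eq` the choice is irrelevant. The last clause covers weights without compact support,
as needed in the collar. -/
lemma exists_continuous_repr {v : 𝓓'(Ω, ℂ)} (hv : ∀ χ : 𝓓(Ω, ℝ), ∃ W, RepBy v χ W) :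
    ∃ F : Euc d → ℂ, ContinuousOn F Ω ∧ (∀ φ : 𝓓(Ω, ℝ), v φ = ∫ x, (φ x : ℂ) * F x) ∧
      ∀ (χ : Euc d → ℝ) (W : Euc d → ℂ), ContDiff ℝ ∞ χ → tsupport χ ⊆ Ω → RepBy v χ W →
        ∀ x, W x = χ x * F x := by
  classical
  choose W hW using hv
  have hχ : ∀ x : Euc d, ∃ χ : 𝓓(Ω, ℝ), x ∈ Ω → χ x = 1 := fun x => by
    by_cases hx : x ∈ Ω
    · obtain ⟨χ, h⟩ := exists_test_eq_one_near (Ω := Ω) (K := {x}) isCompact_singleton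
        (by simpa using hx)
      exact ⟨χ, fun _ => h x rfl⟩
    · exact ⟨0, fun h => absurd h hx⟩
  choose X hX using hχ
  set F : Euc d → ℂ := fun x => W (X x) x with hFdef
  have key : ∀ (χ : Euc d → ℝ) (V : Euc d → ℂ), ContDiff ℝ ∞ χ → tsupport χ ⊆ Ω → RepBy v χ V →
      ∀ x, V x = χ x * F x := by
    intro χ V hχ hs h x
    by_cases hx : x ∈ Ω
    · have := h.mul_eq hχ (hW (X x)) x
      rwa [hX x hx, Complex.ofReal_one, one_mul] at this
    · have hx' : x ∉ tsupport χ := fun h => hx (hs h)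
      rw [h.eq_zero hx', image_eq_zero_of_notMem_tsupport hx']
      simp
  refine ⟨F, fun x hx => ?_, fun φ => ?_, key⟩
  · obtain ⟨χ, hχ, -⟩ := exists_test_eq_one (Ω := Ω) (K := {x}) isCompact_singleton
      (by simpa using hx)
    rw [nhdsSet_singleton] at hχ
    refine ContinuousAt.continuousWithinAt (((hW χ).1.continuousAt (x := x)).congr ?_)
    filter_upwards [hχ] with y hy
    rw [key χ _ χ.contDiff χ.tsupport_subset (hW χ), hy, Complex.ofReal_one, one_mul]
  · obtain ⟨χ, hχ⟩ := exists_test_eq_one_near φ.hasCompactSupport φ.tsupport_subset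
    have := (hW χ).2 (toTop φ) φ fun x => by
      by_cases hx : φ x = 0
      · simp [hx]
      · simp [hχ x (subset_tsupport _ hx)]
    rw [this]
    refine integral_congr_ae (Eventually.of_forall fun x => ?_)
    beta_reduce
    rw [key χ _ χ.contDiff χ.tsupport_subset (hW χ)]
    by_cases hx : φ x = 0
    · simp [hx]
    · simp [hχ x (subset_tsupport _ hx)]

end Representation

/-! ### The multiplier as a function, and the multiplication operator -/

section Existence

variable {n : ℕ} {B : Type*} [TopologicalSpace B] [ChartedSpace (EuclideanHalfSpace (n + 1)) B]
  {Y : Type*} [TopologicalSpace Y] [ChartedSpace (Euc n) Y]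

/-- The projection `(r, y) ↦ r`. -/
def headCLM (n : ℕ) : Euc (n + 1) →L[ℝ] ℝ := EuclideanSpace.proj 0

/-- The projection `(r, y) ↦ y`. -/
def tailCLM (n : ℕ) : Euc (n + 1) →L[ℝ] Euc n :=
  LinearMap.toContinuousLinearMap
    { toFun := tailPt
      map_add' := fun _ _ => rfl
      map_smul' := fun _ _ => rfl }

lemma Cutoff.contDiff_exp (θ : Cutoff) :
    ContDiff ℝ ∞ fun x : Euc (n + 1) => θ.toFun (Real.exp (-x 0)) :=
  θ.contDiff.comp (Real.contDiff_exp.comp (headCLM n).contDiff.neg)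

lemma contDiff_collarWeight (γ : ℝ) (θ : Cutoff) {η : BoundaryChart n Y} (ψ : 𝓓(η.dom, ℝ)) :
    ContDiff ℝ ∞ (collarWeight γ θ ψ) :=
  ((Real.contDiff_exp.comp (contDiff_const.mul (headCLM n).contDiff)).mul θ.contDiff_exp).mul
    (ψ.contDiff.comp contDiff_tailPt)

variable [IsManifold (𝓡∂ (n + 1)) ∞ B] [IsManifold (𝓡 n) ∞ Y]
variable {c : Collar n B Y} {σ s γ : ℝ} {p : ℝ≥0∞} [Fact (1 ≤ p)]

lemma tsupport_collarWeight_subset (c : Collar n B Y) (γ : ℝ) (θ : Cutoff) {η : BoundaryChart n Y}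
    (ψ : 𝓓(η.dom, ℝ)) : tsupport (collarWeight γ θ ψ) ⊆ (c.logChart η).dom := by
  obtain ⟨a, ha, h⟩ := θ.eq_zero
  have h1 : IsClosed {x : Euc (n + 1) | Real.exp (-x 0) ≤ a ∧ tailPt x ∈ tsupport ψ} := by
    refine IsClosed.inter (isClosed_le (Real.continuous_exp.comp (headCLM n).continuous.neg)
      continuous_const) ((isClosed_tsupport ψ).preimage contDiff_tailPt.continuous)
  refine (closure_minimal (fun x hx => ?_) h1).trans fun x hx => ?_
  · obtain ⟨h2, h3⟩ := collarWeight_ne_zero hx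
    refine ⟨?_, subset_tsupport _ h3⟩
    by_contra h4
    exact h2 (h _ (not_le.1 h4).le)
  · change x ∈ (c.logChart η).toChart.target
    rw [c.logChart_target]
    refine ⟨?_, ψ.tsupport_subset hx.2⟩
    have := Real.exp_lt_one_iff.1 (hx.1.trans_lt ha)
    linarith

/-- The Sobolev embedding in every chart gives continuous local representatives, which agree on
overlaps by the change of variables formula. The same decompositions, now known to sum to
localizations of f, are the multiplier property of its real and imaginary parts. -/
lemma exists_represents {q : ℝ≥0∞} [Fact (1 ≤ q)] (hq : 1 < q) (hq' : q < ⊤) (hσ : 0 < σ)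
    {m : IntDistribution n B}
    (hm : m ∈ coneSobolev c (σ + ((n : ℝ) + 1) / q.toReal) (((n : ℝ) + 1) / 2) q) :
    ∃ f : B → ℂ, Represents m f ∧ (∀ κ : InteriorChart n B,
        ContinuousOn (fun x => f (κ.toChart.symm x)) κ.toChart.target) ∧
      ConeMult c σ (fun z => (f z).re) ∧ ConeMult c σ (fun z => (f z).im) := by
  classical
  -- The embedding is stated with the dimension d = n+1 cast as one natural number.
  have hd : (n : ℝ) + 1 = ((n + 1 : ℕ) : ℝ) := by push_cast; rfl
  have hrep : ∀ (κ : InteriorChart n B) (χ : 𝓓(κ.dom, ℝ)), ∃ h₁ h₂ : ℕ → Euc (n + 1) → ℝ,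
      MultSeq σ h₁ ∧ MultSeq σ h₂ ∧ RepBy (m.1 κ) χ
        fun x => ((∑' k, h₁ k x : ℝ) : ℂ) + ((∑' k, h₂ k x : ℝ) : ℂ) * Complex.I := by
    intro κ χ
    have := hm.1 κ χ
    rw [hd] at this
    exact this.exists_repBy hq hq' hσ
  have hrep' : ∀ (θ : Cutoff) (η : BoundaryChart n Y) (ψ : 𝓓(η.dom, ℝ)),
      ∃ h₁ h₂ : ℕ → Euc (n + 1) → ℝ,
      MultSeq σ h₁ ∧ MultSeq σ h₂ ∧ RepBy (m.1 (c.logChart η)) (collarWeight (((n : ℝ) + 1) / 2) θ ψ)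
        fun x => ((∑' k, h₁ k x : ℝ) : ℂ) + ((∑' k, h₂ k x : ℝ) : ℂ) * Complex.I := by
    intro θ η ψ
    have := hm.2 θ η ψ
    rw [hd] at this
    have := this.exists_repBy hq hq' hσ
    rwa [← hd] at this
  choose F hFc hFi hFW using fun κ : InteriorChart n B =>
    exists_continuous_repr (v := m.1 κ) fun χ => by
      obtain ⟨_, _, _, _, h⟩ := hrep κ χ
      exact ⟨_, h⟩
  have hcompat : ∀ (κ κ' : InteriorChart n B), EqOn (F κ') (F κ ∘ κ.transition κ')
      (κ.overlap κ') := by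
    intro κ κ'
    have hc1 : ContinuousOn (F κ') (κ.overlap κ') := (hFc κ').mono inter_subset_left
    have hc2 : ContinuousOn (F κ ∘ κ.transition κ') (κ.overlap κ') :=
      ((hFc κ).mono inter_subset_left).comp (κ.contDiffOn_transition κ').continuousOn
        (κ.mapsTo_transition κ')
    refine eqOn_of_integral_test_eq (Ω := ⟨_, κ.isOpen_overlap κ'⟩) hc1 hc2 fun φ => ?_
    set φ₁ : 𝓓(κ'.dom, ℝ) := mkTest _ φ φ.contDiff φ.hasCompactSupport
      (φ.tsupport_subset.trans inter_subset_left)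
    obtain ⟨φ₂, h₂, e⟩ := κ'.exists_transfer κ (φ := φ₁) φ.tsupport_subset
    have k1 := hFi κ' φ₁
    have k2 := hFi κ φ₂
    rw [← m.2 κ' κ φ₁ φ₂ φ.tsupport_subset h₂ e, k1] at k2
    refine Eq.trans ?_ (k2.trans ?_)
    · rfl
    · have := κ'.integral_transition κ (φ := φ₁) (φ' := φ₂) φ.tsupport_subset h₂ e
        (fun z => F κ (κ.toChart z))
      refine Eq.trans ?_ (this.symm.trans rfl)
      refine integral_congr_ae (Eventually.of_forall fun x => ?_)
      beta_reduce
      by_cases hx : φ₂ x = 0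
      · simp [hx]
      · rw [κ.toChart.right_inv (h₂ (subset_tsupport _ hx)).1]
  set f : B → ℂ := fun z => if h : ∃ κ : InteriorChart n B, z ∈ κ.toChart.source
    then F h.choose (h.choose.toChart z) else 0 with hf
  have hfF : ∀ (κ : InteriorChart n B), ∀ x ∈ κ.toChart.target,
      f (κ.toChart.symm x) = F κ x := by
    intro κ x hx
    have h : ∃ κ' : InteriorChart n B, κ.toChart.symm x ∈ κ'.toChart.source :=
      ⟨κ, κ.toChart.map_target hx⟩
    rw [hf]
    beta_reduce
    rw [dif_pos h]
    exact (hcompat h.choose κ ⟨hx, h.choose_spec⟩).symm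
  have hfc : ∀ κ : InteriorChart n B,
      ContinuousOn (fun x => f (κ.toChart.symm x)) κ.toChart.target := fun κ =>
    (hFc κ).congr (hfF κ)
  have hW : ∀ (κ : InteriorChart n B) (χ : Euc (n + 1) → ℝ) (W : Euc (n + 1) → ℂ),
      ContDiff ℝ ∞ χ → tsupport χ ⊆ κ.dom → RepBy (m.1 κ) χ W →
      ∀ x, W x = χ x * f (κ.toChart.symm x) := by
    intro κ χ W h1 h2 h3 x
    rw [hFW κ χ W h1 h2 h3]
    by_cases hx : x ∈ κ.toChart.target
    · rw [hfF κ x hx]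
    · rw [image_eq_zero_of_notMem_tsupport fun h => hx (h2 h)]
      simp
  refine ⟨f, fun κ => ⟨(hfc κ).locallyIntegrableOn κ.toChart.open_target.measurableSet,
    fun φ => ?_⟩, hfc, ⟨fun κ χ => ?_, fun θ η ψ => ?_⟩, ⟨fun κ χ => ?_, fun θ η ψ => ?_⟩⟩
  · rw [hFi κ φ]
    refine integral_congr_ae (Eventually.of_forall fun x => ?_)
    beta_reduce
    by_cases hx : x ∈ κ.toChart.target
    · rw [hfF κ x hx]
    · rw [test_eq_zero (Ω := κ.dom) hx]
      simp
  · obtain ⟨h₁, h₂, hh₁, hh₂, h⟩ := hrep κ χ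
    refine ⟨h₁, hh₁, fun x => ?_⟩
    have := congrArg Complex.re (hW κ χ _ χ.contDiff χ.tsupport_subset h x)
    simpa using this
  · obtain ⟨h₁, h₂, hh₁, hh₂, h⟩ := hrep' θ η ψ
    refine ⟨h₁, hh₁, fun x => ?_⟩
    have := congrArg Complex.re (hW _ _ _ (contDiff_collarWeight _ θ ψ)
      (tsupport_collarWeight_subset c _ θ ψ) h x)
    simpa using this
  · obtain ⟨h₁, h₂, hh₁, hh₂, h⟩ := hrep κ χ
    refine ⟨h₂, hh₂, fun x => ?_⟩
    have := congrArg Complex.im (hW κ χ _ χ.contDiff χ.tsupport_subset h x)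
    simpa using this
  · obtain ⟨h₁, h₂, hh₁, hh₂, h⟩ := hrep' θ η ψ
    refine ⟨h₂, hh₂, fun x => ?_⟩
    have := congrArg Complex.im (hW _ _ _ (contDiff_collarWeight _ θ ψ)
      (tsupport_collarWeight_subset c _ θ ψ) h x)
    simpa using this

/-- The abstract product is a limit of integrals against partial sums of the decomposition; as these
converge uniformly, the limit is the integral of the pointwise product. -/
lemma ConeMult.op_apply_of_represents (hp : p < ⊤) (hp1 : 1 < p) (hs : |s| < σ) {F : B → ℝ}
    (hF : ConeMult c σ F) {u : coneSobolev c s γ p} {g : B → ℂ} (hg : Represents u.1 g)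
    (κ : InteriorChart n B) (φ : 𝓓(κ.dom, ℝ)) :
    (hF.op γ hp hp1 hs u).1.1 κ φ =
      ∫ x, (φ x : ℂ) * ((F (κ.toChart.symm x) : ℂ) * g (κ.toChart.symm x)) := by
  have hσ : 0 < σ := (abs_nonneg s).trans_lt hs
  obtain ⟨h, hh, hsum⟩ := hF.exists_eq_of_ne_zero κ φ
  have h1 := hh.hasSum_integral hσ (integrable_test_mul (Ω := κ.dom) (hg κ).1 φ)
  have h2 := hF.hasSum_op hp hp1 hs u hh hsum
  refine h2.unique ?_
  convert h1 using 1
  · ext k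
    rw [(hg κ).2]
    refine integral_congr_ae (Eventually.of_forall fun x => ?_)
    simp only [mulTest_apply]
    push_cast
    ring
  · refine integral_congr_ae (Eventually.of_forall fun x => ?_)
    beta_reduce
    by_cases hx : φ x = 0
    · simp [hx]
    · rw [hsum x hx]
      ring

/-- Test functions are real, so multipliers were treated as real functions; the complex multiplier
acts through its real and imaginary parts. -/
lemma exists_operator (hp : p < ⊤) (hp1 : 1 < p) (hs : |s| < σ) {f : B → ℂ}
    (hfc : ∀ κ : InteriorChart n B, ContinuousOn (fun x => f (κ.toChart.symm x)) κ.toChart.target)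
    (hre : ConeMult c σ (fun z => (f z).re)) (him : ConeMult c σ (fun z => (f z).im)) :
    ∃ T : coneSobolev c s γ p →ₗ[ℂ] coneSobolev c s γ p,
      (∀ N : NormData c, ∃ C : ℝ≥0, ∀ u : coneSobolev c s γ p,
        coneNorm N s γ p (T u).1 ≤ C * coneNorm N s γ p u.1) ∧
      (∀ (u : coneSobolev c s γ p) (g : B → ℂ), Represents u.1 g →
        Represents (T u).1 (fun z => f z * g z)) := by
  refine ⟨hre.op γ hp hp1 hs + Complex.I • him.op γ hp hp1 hs, fun N => ?_, fun u g hg κ => ?_⟩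
  · obtain ⟨C, hC⟩ := hre.coneNorm_op_le γ hp hp1 hs N
    obtain ⟨D, hD⟩ := him.coneNorm_op_le γ hp hp1 hs N
    refine ⟨C + D, fun u => (coneNorm_add_le N _ _).trans ?_⟩
    push_cast
    rw [add_mul]
    refine add_le_add (hC u) ((coneNorm_smul_le Complex.I_ne_zero N _).trans ?_)
    simpa using hD u
  · have hloc : LocallyIntegrableOn (fun x => f (κ.toChart.symm x) * g (κ.toChart.symm x))
        κ.toChart.target volume :=
      (hg κ).1.continuousOn_mul (hfc κ) κ.toChart.open_target.isLocallyClosed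
    refine ⟨hloc, fun φ => ?_⟩
    have hc : ∀ a : B → ℝ, ContinuousOn (fun x => a (κ.toChart.symm x)) κ.toChart.target →
        Integrable fun x => (φ x : ℂ) * ((a (κ.toChart.symm x) : ℂ) * g (κ.toChart.symm x)) :=
      fun _ ha => integrable_test_mul (Ω := κ.dom) ((hg κ).1.continuousOn_mul
        (Complex.continuous_ofReal.comp_continuousOn ha) κ.toChart.open_target.isLocallyClosed) φ
    change (hre.op γ hp hp1 hs u).1.1 κ φ + Complex.I * (him.op γ hp hp1 hs u).1.1 κ φ = _
    rw [hre.op_apply_of_represents hp hp1 hs hg, him.op_apply_of_represents hp hp1 hs hg,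
      ← integral_const_mul, ← integral_add (hc (fun z => (f z).re) (Complex.continuous_re.comp_continuousOn (hfc κ)))
        ((hc (fun z => (f z).im) (Complex.continuous_im.comp_continuousOn (hfc κ))).const_mul _)]
    refine integral_congr_ae (Eventually.of_forall fun x => ?_)
    beta_reduce
    conv_rhs => rw [← Complex.re_add_im (f (κ.toChart.symm x))]
    ring

end Existence

/-! ### Geometry of the collar, compactness, and adapted norm data -/

section Geometry

variable {n : ℕ}

/-- The inclusion of the open half space. -/
def openHalfSpace (n : ℕ) : OpenPartialHomeomorph (EuclideanHalfSpace (n + 1)) (Euc (n + 1)) where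
  toFun := 𝓡∂ (n + 1)
  invFun := (𝓡∂ (n + 1)).symm
  source := {x | 0 < x.val 0}
  target := {v | 0 < v 0}
  map_source' _ hx := hx
  map_target' v hv := by
    have h : v ∈ range (𝓡∂ (n + 1)) := by
      rw [range_modelWithCornersEuclideanHalfSpace]; exact le_of_lt (show 0 < v 0 from hv)
    have := (𝓡∂ (n + 1)).right_inv h
    change 0 < ((𝓡∂ (n + 1)) ((𝓡∂ (n + 1)).symm v)) 0
    rw [this]
    exact hv
  left_inv' x _ := (𝓡∂ (n + 1)).left_inv x
  right_inv' v hv := (𝓡∂ (n + 1)).right_inv (by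
    rw [range_modelWithCornersEuclideanHalfSpace]; exact le_of_lt (show 0 < v 0 from hv))
  open_source := isOpen_lt continuous_const ((headCLM n).continuous.comp continuous_subtype_val)
  open_target := isOpen_lt continuous_const (headCLM n).continuous
  continuousOn_toFun := (𝓡∂ (n + 1)).continuous.continuousOn
  continuousOn_invFun := (𝓡∂ (n + 1)).continuous_symm.continuousOn

variable {B : Type*} [TopologicalSpace B] [ChartedSpace (EuclideanHalfSpace (n + 1)) B]
  {Y : Type*} [TopologicalSpace Y] [ChartedSpace (Euc n) Y] [IsManifold (𝓡∂ (n + 1)) ∞ B]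

lemma exists_interiorChart {z : B} (hz : z ∈ (𝓡∂ (n + 1)).interior B) :
    ∃ κ : InteriorChart n B, z ∈ κ.toChart.source := by
  have key : ∀ y ∈ (chartAt (EuclideanHalfSpace (n + 1)) z).source,
      y ∈ (𝓡∂ (n + 1)).interior B ↔
        0 < (chartAt (EuclideanHalfSpace (n + 1)) z y).val 0 := fun y hy => by
    refine ((𝓡∂ (n + 1)).isInteriorPoint_iff_of_mem_atlas (n := ∞) (by simp)
      (chart_mem_atlas _ z) hy).trans ?_
    rw [OpenPartialHomeomorph.extend_target, interior_inter,
      interior_range_modelWithCornersEuclideanHalfSpace,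
      (((chartAt (EuclideanHalfSpace (n + 1)) z).open_target).preimage
        (𝓡∂ (n + 1)).continuous_symm).interior_eq]
    refine ⟨fun h => h.2, fun h => ⟨?_, h⟩⟩
    change (𝓡∂ (n + 1)).symm ((𝓡∂ (n + 1)) (chartAt (EuclideanHalfSpace (n + 1)) z y)) ∈
      (chartAt (EuclideanHalfSpace (n + 1)) z).target
    rw [(𝓡∂ (n + 1)).left_inv]
    exact OpenPartialHomeomorph.map_source _ hy
  refine ⟨⟨(chartAt _ z).trans (openHalfSpace n), fun y hy => ?_, ?_, ?_⟩, ?_⟩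
  · rw [OpenPartialHomeomorph.trans_source] at hy
    exact (key y hy.1).2 hy.2
  · rw [OpenPartialHomeomorph.trans_source]
    exact ((𝓡∂ (n + 1)).contMDiff (n := ∞)).comp_contMDiffOn
      ((contMDiffOn_chart (I := 𝓡∂ (n + 1)) (n := ∞) (x := z)).mono inter_subset_left)
  · rw [OpenPartialHomeomorph.trans_target]
    refine (contMDiffOn_chart_symm (I := 𝓡∂ (n + 1)) (n := ∞) (x := z)).comp
      (((𝓡∂ (n + 1)).contMDiffOn_symm (n := ∞)).mono ?_) fun v hv => hv.2
    rintro v ⟨hv, -⟩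
    rw [range_modelWithCornersEuclideanHalfSpace]
    exact le_of_lt (show 0 < v 0 from hv)
  · rw [OpenPartialHomeomorph.trans_source]
    exact ⟨mem_chart_source _ z, (key z (mem_chart_source _ z)).1 hz⟩

variable [IsManifold (𝓡 n) ∞ Y] (c : Collar n B Y)

/-- Local diffeomorphisms preserve interior points, and a point of the half line times Y is interior
when its first coordinate is positive. -/
lemma Collar.mem_interior_iff {w : EuclideanHalfSpace 1 × Y} (hw : w ∈ c.toMap.source) :
    c.toMap w ∈ (𝓡∂ (n + 1)).interior B ↔ 0 < w.1.val 0 := by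
  refine ⟨fun h => ?_, c.interior_of_pos hw⟩
  have hloc : IsLocalDiffeomorphAt ((𝓡∂ 1).prod (𝓡 n)) (𝓡∂ (n + 1)) ∞ c.toMap w :=
    ⟨⟨c.toMap.toPartialEquiv, c.toMap.open_source, c.toMap.open_target, c.contMDiffOn,
      c.contMDiffOn_symm⟩, hw, fun _ _ => rfl⟩
  have h1 := (hloc.isInteriorPoint_iff (by simp)).2 h
  change w ∈ ((𝓡∂ 1).prod (𝓡 n)).interior (EuclideanHalfSpace 1 × Y) at h1
  rw [ModelWithCorners.interior_prod] at h1
  have h2 : extChartAt (𝓡∂ 1) w.1 w.1 ∈ interior (range (𝓡∂ 1)) := h1.1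
  rw [interior_range_modelWithCornersEuclideanHalfSpace] at h2
  have e : extChartAt (𝓡∂ 1) w.1 w.1 = w.1.val := by
    rw [extChartAt_coe, chartAt_self_eq]
    rfl
  rw [e] at h2
  exact h2

omit [ChartedSpace (Euc n) Y] [IsManifold (𝓡 n) ∞ Y] in
lemma continuous_coord :
    Continuous fun w : EuclideanHalfSpace 1 × Y => w.1.val 0 :=
  (PiLp.continuous_apply 2 _ 0).comp (continuous_subtype_val.comp continuous_fst)

lemma halfPt_val (x : ℝ) (hx : 0 ≤ x) : (halfPt x).val 0 = x := max_eq_left hx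

lemma eq_halfPt (x : EuclideanHalfSpace 1) : x = halfPt (x.val 0) := by
  apply Subtype.ext
  ext i
  fin_cases i
  simp only [Fin.zero_eta]
  exact (halfPt_val _ x.2).symm

omit [IsManifold (𝓡∂ (n + 1)) ∞ B] [IsManifold (𝓡 n) ∞ Y] in
lemma Collar.boundaryPt_mem (y : Y) : (halfPt 0, y) ∈ c.toMap.source := by
  rw [c.source_eq]
  change (halfPt 0).val 0 < 1
  rw [halfPt_val 0 le_rfl]
  exact one_pos

lemma Collar.exists_of_mem_boundary {z : B} (hz : z ∉ (𝓡∂ (n + 1)).interior B) :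
    ∃ y, c.toMap (halfPt 0, y) = z := by
  have hz' : z ∈ (𝓡∂ (n + 1)).boundary B := by rwa [← ModelWithCorners.compl_interior]
  have h1 := c.boundary_subset hz'
  set w := c.toMap.symm z with hw
  have hws : w ∈ c.toMap.source := c.toMap.map_target h1
  have hcw : c.toMap w = z := c.toMap.right_inv h1
  have h2 : ¬ 0 < w.1.val 0 := fun h => hz (hcw ▸ c.interior_of_pos hws h)
  have h3 : w.1.val 0 = 0 := le_antisymm (not_lt.1 h2) w.1.2
  refine ⟨w.2, ?_⟩
  have e : (halfPt 0, w.2) = w := Prod.ext (by rw [eq_halfPt w.1, h3]) rfl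
  rw [e, hcw]

lemma Collar.boundaryPt_notMem_interior (y : Y) :
    c.toMap (halfPt 0, y) ∉ (𝓡∂ (n + 1)).interior B := by
  rw [c.mem_interior_iff (c.boundaryPt_mem y), halfPt_val 0 le_rfl]
  exact lt_irrefl 0

omit [IsManifold (𝓡∂ (n + 1)) ∞ B] [IsManifold (𝓡 n) ∞ Y] in
include c in
lemma Collar.t2Space [T2Space B] : T2Space Y := by
  refine T2Space.of_injective_continuous (f := fun y => c.toMap (halfPt 0, y)) (fun y y' h => ?_) ?_
  · have := c.toMap.injOn (c.boundaryPt_mem y) (c.boundaryPt_mem y') h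
    exact congrArg Prod.snd this
  · exact c.toMap.continuousOn.comp_continuous (by fun_prop) c.boundaryPt_mem

include c in
-- Y is a continuous image of the boundary of B, which is closed in a compact space.
lemma Collar.compactSpace [CompactSpace B] : CompactSpace Y := by
  have h1 : IsCompact ((𝓡∂ (n + 1)).boundary B) :=
    ((𝓡∂ (n + 1)).isClosed_boundary (n := ∞) (by simp)).isCompact
  have h2 := h1.image_of_continuousOn (f := fun z => (c.toMap.symm z).2)
    (continuous_snd.comp_continuousOn (c.toMap.continuousOn_symm.mono c.boundary_subset))
  refine ⟨h2.of_isClosed_subset isClosed_univ fun y _ => ⟨c.toMap (halfPt 0, y), ?_, ?_⟩⟩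
  · rw [← ModelWithCorners.compl_interior]
    exact c.boundaryPt_notMem_interior y
  · simp only [c.toMap.left_inv (c.boundaryPt_mem y)]

/-- The tube lemma, with Y compact: a closed set inside the interior stays away from a whole strip
near the boundary. -/
lemma Collar.exists_lt_notMem [T2Space B] [CompactSpace B] {S : Set B} (hS : IsClosed S)
    (hSi : S ⊆ (𝓡∂ (n + 1)).interior B) :
    ∃ a : ℝ, 0 < a ∧ a < 1 ∧ ∀ w ∈ c.toMap.source, w.1.val 0 ≤ a → c.toMap w ∉ S := by
  have := c.compactSpace
  have hO : IsOpen (c.toMap.source ∩ c.toMap ⁻¹' Sᶜ) :=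
    c.toMap.isOpen_inter_preimage hS.isOpen_compl
  obtain ⟨u, v, hu, -, h0u, hv, huv⟩ := generalized_tube_lemma (s := {halfPt 0}) (t := (univ : Set Y))
    isCompact_singleton isCompact_univ hO (by
      rintro ⟨x, y⟩ ⟨rfl, -⟩
      exact ⟨c.boundaryPt_mem y, fun h => c.boundaryPt_notMem_interior y (hSi h)⟩)
  have hc : ∀ᶠ x in 𝓝 (0 : ℝ), halfPt x ∈ u :=
    continuous_halfPt.continuousAt.eventually (hu.mem_nhds (h0u rfl))
  obtain ⟨ε, hε, h⟩ := Metric.eventually_nhds_iff.1 hc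
  refine ⟨min (ε / 2) (1 / 2), by positivity, (min_le_right _ _).trans_lt (by norm_num),
    fun w hw hwa => ?_⟩
  have h1 : halfPt (w.1.val 0) ∈ u := h (by
    rw [Real.dist_0_eq_abs, abs_of_nonneg w.1.2]
    exact (hwa.trans (min_le_left _ _)).trans_lt (by linarith))
  rw [← eq_halfPt] at h1
  exact (huv (mk_mem_prod h1 (hv (mem_univ w.2)))).2

/-- The part `[0,a] × Y` of the collar. -/
def Collar.tube (a : ℝ) : Set B := c.toMap '' {w | w.1.val 0 ≤ a}

lemma Collar.isClosed_tube [T2Space B] [CompactSpace B] {a : ℝ} (ha : a < 1) :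
    IsClosed (c.tube a) := by
  have := c.compactSpace
  have h1 : {w : EuclideanHalfSpace 1 × Y | w.1.val 0 ≤ a} ⊆ c.toMap.source := fun w hw => by
    rw [c.source_eq]
    exact lt_of_le_of_lt hw ha
  have h2 : IsCompact {w : EuclideanHalfSpace 1 × Y | w.1.val 0 ≤ a} := by
    refine ((isCompact_Icc (a := (0 : ℝ)) (b := a)).image continuous_halfPt |>.prod
      (isCompact_univ (X := Y))).of_isClosed_subset (isClosed_le continuous_coord continuous_const)
      fun w hw => ⟨⟨w.1.val 0, ⟨w.1.2, hw⟩, (eq_halfPt w.1).symm⟩, mem_univ _⟩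
  exact (h2.image_of_continuousOn (c.toMap.continuousOn.mono h1)).isClosed

/-- Pointwise choices of localizations with prescribed properties P and R are made finite by
compactness of Y and of the set where θ vanishes or is not defined. The uniqueness proof needs norms
whose localizations are adapted to a given piece. -/
lemma exists_normData [T2Space B] [CompactSpace B] (θ : Cutoff)
    (P : ∀ η : BoundaryChart n Y, 𝓓(η.dom, ℝ) → Prop)
    (R : ∀ κ : InteriorChart n B, 𝓓(κ.dom, ℝ) → Prop)
    (hP : ∀ y : Y, ∃ (η : BoundaryChart n Y) (ψ : 𝓓(η.dom, ℝ)),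
      P η ψ ∧ y ∈ η.1.source ∧ ψ (η.1 y) ≠ 0)
    (hR : ∀ z ∈ (𝓡∂ (n + 1)).interior B,
      (∀ w ∈ c.toMap.source, c.toMap w = z → θ.toFun (w.1.val 0) = 0) →
      ∃ (κ : InteriorChart n B) (χ : 𝓓(κ.dom, ℝ)),
        R κ χ ∧ z ∈ κ.toChart.source ∧ χ (κ.toChart z) ≠ 0) :
    ∃ N : NormData c, N.θ = θ ∧ (∀ i, P (N.η i) (N.ψ i)) ∧ ∀ j, R (N.κ j) (N.χ j) := by
  have := c.compactSpace
  choose η ψ hP hη hψ using hP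
  obtain ⟨t, ht⟩ := isCompact_univ.elim_nhds_subcover
    (fun y => {y' | y' ∈ (η y).1.source ∧ ψ y ((η y).1 y') ≠ 0}) fun y _ => by
      have h1 := (η y).1.continuousOn.isOpen_inter_preimage (η y).1.open_source
        ((ψ y).continuous.isOpen_preimage {0}ᶜ isOpen_compl_singleton)
      exact h1.mem_nhds (x := y) ⟨hη y, hψ y⟩
  set S : Set B := (c.toMap '' (c.toMap.source ∩ {w | θ.toFun (w.1.val 0) ≠ 0}))ᶜ with hS
  have hSc : IsClosed S := by
    rw [hS, isClosed_compl_iff]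
    refine c.toMap.isOpen_image_source_inter ?_
    exact (θ.contDiff.continuous.comp continuous_coord).isOpen_preimage {0}ᶜ isOpen_compl_singleton
  have hSi : S ⊆ (𝓡∂ (n + 1)).interior B := by
    intro z hz
    by_contra hzi
    obtain ⟨y, rfl⟩ := c.exists_of_mem_boundary hzi
    refine hz ⟨_, ⟨c.boundaryPt_mem y, ?_⟩, rfl⟩
    change θ.toFun ((halfPt 0).val 0) ≠ 0
    rw [halfPt_val 0 le_rfl, θ.eq_one.self_of_nhds]
    exact one_ne_zero
  have hR' : ∀ z : S, ∃ (κ : InteriorChart n B) (χ : 𝓓(κ.dom, ℝ)),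
        R κ χ ∧ z.1 ∈ κ.toChart.source ∧ χ (κ.toChart z.1) ≠ 0 := fun z =>
    hR z.1 (hSi z.2) fun w hw hwz => by
      by_contra h0
      exact z.2 ⟨w, ⟨hw, h0⟩, hwz⟩
  choose κ χ hR' hκ hχ using hR'
  obtain ⟨t', ht'⟩ := hSc.isCompact.elim_nhds_subcover'
    (fun z hz => {z' | z' ∈ (κ ⟨z, hz⟩).toChart.source ∧
      χ ⟨z, hz⟩ ((κ ⟨z, hz⟩).toChart z') ≠ 0}) fun z hz => by
      have h1 := (κ ⟨z, hz⟩).toChart.continuousOn.isOpen_inter_preimage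
        (κ ⟨z, hz⟩).toChart.open_source
        ((χ ⟨z, hz⟩).continuous.isOpen_preimage {0}ᶜ isOpen_compl_singleton)
      exact h1.mem_nhds (x := z) ⟨hκ ⟨z, hz⟩, hχ ⟨z, hz⟩⟩
  refine ⟨⟨θ, t.card, fun i => η (t.equivFin.symm i), fun i => ψ _, t'.card,
    fun j => κ (t'.equivFin.symm j), fun j => χ _, fun y => ?_, fun z hz => ?_⟩, rfl,
    fun i => hP _, fun j => hR' _⟩
  · obtain ⟨y', hy', h⟩ := mem_iUnion₂.1 (ht.2 (mem_univ y))
    obtain ⟨i, hi⟩ := t.equivFin.symm.surjective ⟨y', hy'⟩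
    refine ⟨i, ?_⟩
    rw [hi]
    exact h
  · by_cases hzS : z ∈ S
    · obtain ⟨z', hz', h⟩ := mem_iUnion₂.1 (ht' hzS)
      obtain ⟨j, hj⟩ := t'.equivFin.symm.surjective ⟨z', hz'⟩
      refine Or.inr ⟨j, ?_⟩
      rw [hj]
      exact h
    · rw [hS, mem_compl_iff, not_not] at hzS
      obtain ⟨w, hw, hwz⟩ := hzS
      exact Or.inl ⟨w, hw.1, hwz, hw.2⟩

end Geometry

/-! ### Approximation by compactly supported functions; separation by the norms -/

section Density

variable {d : ℕ}

/-- The family is 1 - χ(x/(N+1)) with χ = 1 near the unit ball. Since 1 - χ vanishes there, each of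
its derivatives is bounded by C_i‖y‖, and rescaling produces the small factor 1/(N+1). -/
lemma exists_cutoff_family : ∃ (a : ℕ → Euc d → ℝ) (C : ℕ → ℝ),
    (∀ i, 0 ≤ C i) ∧ (∀ N, BddDeriv (a N)) ∧ (∀ N, HasCompactSupport fun x => 1 - a N x) ∧
    ∀ N i x, ‖iteratedFDeriv ℝ i (a N) x‖ ≤ C i * (‖x‖ / (N + 1)) := by
  obtain ⟨χ, hχ, -⟩ := exists_test_eq_one (Ω := ⊤) (isCompact_closedBall (0 : Euc d) 1)
    (subset_univ _)
  have h0 : BddDeriv fun x => 1 - χ x := (BddDeriv.const 1).sub (BddDeriv.test χ)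
  choose C hC using h0.bound
  have hC0 : ∀ i, 0 ≤ C i := fun i => (norm_nonneg _).trans (hC i 0)
  have key : ∀ i y, ‖iteratedFDeriv ℝ i (fun x => 1 - χ x) y‖ ≤ C i * ‖y‖ := by
    intro i y
    by_cases hy : ‖y‖ ≤ 1
    · have h1 : (fun x => 1 - χ x) =ᶠ[𝓝 y] 0 := by
        have := hχ.filter_mono (nhds_le_nhdsSet (mem_closedBall_zero_iff.2 hy))
        filter_upwards [this] with x hx
        simp [hx]
      have h2 := (h1.iteratedFDeriv ℝ i).eq_of_nhds
      rw [h2, iteratedFDeriv_zero]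
      simp only [Pi.zero_apply, norm_zero]
      exact mul_nonneg (hC0 i) (norm_nonneg y)
    · exact (hC i y).trans (le_mul_of_one_le_right (hC0 i) (not_le.1 hy).le)
  set T : ℕ → Euc d →L[ℝ] Euc d := fun N => ((N : ℝ) + 1)⁻¹ • ContinuousLinearMap.id ℝ (Euc d)
  have hT : ∀ N x, T N x = ((N : ℝ) + 1)⁻¹ • x := fun N x => rfl
  have hTn : ∀ N, ‖T N‖ ≤ 1 := fun N => by
    refine ContinuousLinearMap.opNorm_le_bound _ zero_le_one fun x => ?_
    rw [hT, norm_smul, Real.norm_of_nonneg (by positivity)]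
    gcongr
    exact inv_le_one_of_one_le₀ (by linarith [(Nat.cast_nonneg N : (0 : ℝ) ≤ N)])
  refine ⟨fun N x => 1 - χ (T N x), C, hC0, fun N => h0.comp_clm (T N), fun N => ?_, fun N i x => ?_⟩
  · have h1 : (fun x => 1 - (1 - χ (T N x))) = χ ∘ (Homeomorph.smulOfNeZero (((N : ℝ) + 1)⁻¹)
        (by positivity) : Euc d ≃ₜ Euc d) := by
      ext x
      simp [hT]
    rw [h1]
    exact χ.hasCompactSupport.comp_homeomorph _
  · have e : (fun x => 1 - χ (T N x)) = (fun x => 1 - χ x) ∘ T N := rfl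
    beta_reduce
    rw [e, (T N).iteratedFDeriv_comp_right h0.contDiff x (by exact_mod_cast le_top)]
    refine (ContinuousMultilinearMap.norm_compContinuousLinearMap_le _ _).trans ?_
    refine (mul_le_of_le_one_right (norm_nonneg _)
      (Finset.prod_le_one (fun _ _ => norm_nonneg _) fun _ _ => hTn N)).trans ?_
    refine (key i _).trans_eq ?_
    rw [hT, norm_smul, Real.norm_of_nonneg (by positivity), div_eq_inv_mul]

lemma BddDeriv.mulS_apply {a : Euc d → ℝ} (ha : BddDeriv a) (φ : 𝓢(Euc d, ℂ)) (x : Euc d) :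
    mulS a φ x = a x * φ x :=
  (ha.multSeq 1).mulS_apply 0 φ x

/-- The remainder a_N U is small in each Schwartz seminorm: the factor ‖x‖/(N+1) is paid for by one
more power of decay. -/
lemma dense_hasCompactSupport : Dense {U : 𝓢(Euc d, ℂ) | HasCompactSupport U} := by
  obtain ⟨a, C, hC0, ha, hc, hb⟩ := exists_cutoff_family (d := d)
  intro U
  have hV : ∀ N, HasCompactSupport (U - mulS (a N) U) := fun N => by
    have e : ⇑(U - mulS (a N) U) = fun x => ((1 - a N x : ℝ) : ℂ) * U x := by
      ext x
      rw [sub_apply, (ha N).mulS_apply]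
      push_cast
      ring
    rw [e]
    exact ((hc N).comp_left (g := fun t : ℝ => (t : ℂ)) Complex.ofReal_zero).mul_right
  refine mem_closure_of_tendsto (b := atTop) (f := fun N => U - mulS (a N) U) ?_
    (Eventually.of_forall hV)
  rw [(schwartz_withSeminorms ℝ (Euc d) ℂ).tendsto_nhds]
  rintro ⟨k, l⟩ ε hε
  set D : ℝ := ∑ i ∈ Finset.range (l + 1), (l.choose i : ℝ) * C i *
    SchwartzMap.seminorm ℝ (k + 1) (l - i) U
  have hbound : ∀ N : ℕ, SchwartzMap.seminorm ℝ k l (mulS (a N) U) ≤ |D| / ((N : ℝ) + 1) := by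
    intro N
    refine SchwartzMap.seminorm_le_bound ℝ k l _ (by positivity) fun x => ?_
    have e : ⇑(mulS (a N) U) = fun x => a N x • U x := by
      ext x
      rw [(ha N).mulS_apply, Complex.real_smul]
    rw [e]
    have h1 := norm_iteratedFDeriv_smul_le (ha N).contDiff (U.smooth ⊤) x (n := l)
      (by exact_mod_cast le_top)
    calc ‖x‖ ^ k * ‖iteratedFDeriv ℝ l (fun x => a N x • U x) x‖
        ≤ ‖x‖ ^ k * ∑ i ∈ Finset.range (l + 1), (l.choose i : ℝ) *
          ‖iteratedFDeriv ℝ i (a N) x‖ * ‖iteratedFDeriv ℝ (l - i) U x‖ := by gcongr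
      _ ≤ D / ((N : ℝ) + 1) := by
        rw [Finset.mul_sum, Finset.sum_div]
        refine Finset.sum_le_sum fun i _ => ?_
        have h2 := hb N i x
        have h3 := SchwartzMap.le_seminorm ℝ (k + 1) (l - i) U x
        calc ‖x‖ ^ k * ((l.choose i : ℝ) * ‖iteratedFDeriv ℝ i (a N) x‖ *
              ‖iteratedFDeriv ℝ (l - i) U x‖)
            ≤ ‖x‖ ^ k * ((l.choose i : ℝ) * (C i * (‖x‖ / (N + 1))) *
              ‖iteratedFDeriv ℝ (l - i) U x‖) := by gcongr
          _ = (l.choose i : ℝ) * C i * (‖x‖ ^ (k + 1) * ‖iteratedFDeriv ℝ (l - i) U x‖) /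
              ((N : ℝ) + 1) := by ring
          _ ≤ _ := by
            have := hC0 i
            gcongr
      _ ≤ |D| / ((N : ℝ) + 1) := by
        gcongr
        exact le_abs_self D
  have hlim : Tendsto (fun N : ℕ => |D| / ((N : ℝ) + 1)) atTop (𝓝 0) :=
    tendsto_const_nhds.div_atTop (tendsto_atTop_add_const_right _ _ tendsto_natCast_atTop_atTop)
  filter_upwards [hlim.eventually_lt_const hε] with N hN
  have e : U - mulS (a N) U - U = -mulS (a N) U := by abel
  rw [e, map_neg_eq_map]
  exact (hbound N).trans_lt hN

variable {s : ℝ} {p : ℝ≥0∞} [Fact (1 ≤ p)]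

/-- Λ^s is a continuous bijection of the Schwartz space, so density of compactly supported functions
there passes to the H^s_p norm. -/
lemma exists_approx (hp : p < ⊤) (s : ℝ) (f : Lp ℂ p (volume : Measure (Euc d))) {ε : ℝ}
    (hε : 0 < ε) : ∃ U : 𝓢(Euc d, ℂ), HasCompactSupport U ∧ ‖f - (bessel s U).toLp p volume‖ < ε := by
  have h1 : Continuous fun U : 𝓢(Euc d, ℂ) => (bessel s U).toLp p volume :=
    (SchwartzMap.toLpCLM ℂ ℂ p volume).continuous.comp (bessel s).continuous
  have h2 : DenseRange fun U : 𝓢(Euc d, ℂ) => (bessel s U).toLp p volume := by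
    have hdense : DenseRange (SchwartzMap.toLpCLM ℂ ℂ p (volume : Measure (Euc d))) :=
      SchwartzMap.denseRange_toLpCLM hp.ne
    refine hdense.mono ?_
    rintro _ ⟨U, rfl⟩
    refine ⟨bessel (-s) U, ?_⟩
    simp only [bessel_bessel, add_neg_cancel, bessel_zero]
    rfl
  have h3 := h2.dense_image h1 dense_hasCompactSupport
  obtain ⟨_, hb, U, hU, rfl⟩ := Metric.dense_iff.1 h3 f ε hε
  rw [Metric.mem_ball, dist_comm, dist_eq_norm] at hb
  exact ⟨U, hU, hb⟩

variable {Ω : Opens (Euc d)}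

lemma locNorm_eq_zero {v : 𝓓'(Ω, ℂ)} {χ : Euc d → ℝ}
    (h : ∀ (φ : 𝓓((⊤ : Opens (Euc d)), ℝ)) (ψ : 𝓓(Ω, ℝ)), (∀ x, ψ x = χ x * φ x) → v ψ = 0) :
    locNorm s p v χ = 0 := by
  refine le_antisymm ((locNorm_le (w := 0) (f := 0) (fun φ ψ e => (h φ ψ e).symm) ?_).trans_eq
    enorm_zero) zero_le
  rw [map_zero]
  exact (map_zero (Lp.toTemperedDistributionCLM ℂ volume p)).symm

/-- By Hölder's inequality |v ψ| is at most a constant, depending on φ, times the localized norm.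
The 1 added to the constant in the proof keeps it nonzero. -/
lemma apply_eq_zero_of_locNorm_eq_zero (hp1 : 1 ≤ p) {v : 𝓓'(Ω, ℂ)} {χ : Euc d → ℝ}
    (h : locNorm s p v χ = 0) {φ : 𝓓((⊤ : Opens (Euc d)), ℝ)} {ψ : 𝓓(Ω, ℝ)}
    (e : ∀ x, ψ x = χ x * φ x) : v ψ = 0 := by
  have hp' : ENNReal.HolderConjugate p (1 - p⁻¹)⁻¹ :=
    ENNReal.HolderConjugate.inv_one_sub_inv' hp1
  have : Fact (1 ≤ (1 - p⁻¹)⁻¹) := by simp [fact_iff]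
  set L := (bessel (-s) (testToSchwartz φ)).toLp (1 - p⁻¹)⁻¹ volume
  have key := le_mul_locNorm_add (s := s) (p := p) (v := v) (χ := χ) (C := ‖L‖₊ + 1)
    (by positivity) (a := ‖v ψ‖ₑ) (b := 0) fun w f hw hf => ?_
  · rw [h, mul_zero, add_zero] at key
    simpa using key
  · rw [← hw φ ψ e, apply_eq_lpPair (p' := (1 - p⁻¹)⁻¹) hf, add_zero]
    have h1 : ‖lpPair p (1 - p⁻¹)⁻¹ f L‖ ≤ (‖L‖ + 1) * ‖f‖ := by
      have := norm_lpPair_le (p := p) (p' := (1 - p⁻¹)⁻¹) f L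
      nlinarith [norm_nonneg f, norm_nonneg L]
    have h2 : ‖lpPair p (1 - p⁻¹)⁻¹ f L‖₊ ≤ (‖L‖₊ + 1) * ‖f‖₊ := h1
    refine (ENNReal.coe_le_coe.2 h2).trans_eq ?_
    rw [ENNReal.coe_mul]
    rfl

/-- A partition of unity, organised as an induction on compact sets: a test function supported in O
∪ O' is split by a cut-off that is 1 near the part of its support outside O'. -/
lemma eq_zero_of_locally {v : 𝓓'(Ω, ℂ)} (h : ∀ x ∈ Ω, ∃ O : Set (Euc d), IsOpen O ∧ x ∈ O ∧
    ∀ φ : 𝓓(Ω, ℝ), tsupport φ ⊆ O → v φ = 0) (φ : 𝓓(Ω, ℝ)) : v φ = 0 := by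
  have key : ∃ O : Set (Euc d), IsOpen O ∧ tsupport φ ⊆ O ∧
      ∀ φ : 𝓓(Ω, ℝ), tsupport φ ⊆ O → v φ = 0 := by
    refine φ.hasCompactSupport.isCompact.induction_on
      (p := fun S => ∃ O : Set (Euc d), IsOpen O ∧ S ⊆ O ∧
        ∀ φ : 𝓓(Ω, ℝ), tsupport φ ⊆ O → v φ = 0) ?_ ?_ ?_ ?_
    · refine ⟨∅, isOpen_empty, Subset.rfl, fun φ hφ => ?_⟩
      have : φ = 0 := TestFunction.ext fun x =>
        image_eq_zero_of_notMem_tsupport fun hx => hφ hx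
      rw [this, map_zero]
    · rintro S S' hS ⟨O, hO, hSO, h⟩
      exact ⟨O, hO, hS.trans hSO, h⟩
    · rintro S S' ⟨O, hO, hSO, h⟩ ⟨O', hO', hSO', h'⟩
      refine ⟨O ∪ O', hO.union hO', union_subset_union hSO hSO', fun φ hφ => ?_⟩
      have hK : IsCompact (tsupport φ \ O') := φ.hasCompactSupport.isCompact.diff hO'
      obtain ⟨χ, hχ, -⟩ := exists_test_eq_one (Ω := ⟨O, hO⟩) hK fun x hx =>
        (hφ hx.1).resolve_right hx.2
      have e : φ = mulTest χ χ.contDiff.contDiffOn φ +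
          mulTest (fun x => 1 - χ x) (contDiff_const.sub χ.contDiff).contDiffOn φ := by
        refine TestFunction.ext fun x => ?_
        rw [add_apply, mulTest_apply, mulTest_apply]
        ring
      rw [e, map_add, h, h', add_zero]
      · intro x hx
        by_contra hxO
        have hxφ : x ∈ tsupport φ := tsupport_smul_subset_left _ _ hx
        have h1 := hχ.filter_mono (nhds_le_nhdsSet (show x ∈ tsupport φ \ O' from ⟨hxφ, hxO⟩))
        refine notMem_tsupport_iff_eventuallyEq.2 ?_ hx
        filter_upwards [h1] with y hy
        simp [hy]
      · exact (tsupport_smul_subset_right _ _).trans χ.tsupport_subset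
    · intro x hx
      obtain ⟨O, hO, hxO, h⟩ := h x (φ.tsupport_subset hx)
      exact ⟨O, mem_nhdsWithin_of_mem_nhds (hO.mem_nhds hxO), O, hO, Subset.rfl, h⟩
  obtain ⟨O, -, hs, h⟩ := key
  exact h φ hs

end Density

/-! ### Local vanishing, and definiteness of the cone norm -/

section Vanishing

variable {n : ℕ} {B : Type*} [TopologicalSpace B] [ChartedSpace (EuclideanHalfSpace (n + 1)) B]
  {Y : Type*} [TopologicalSpace Y] [ChartedSpace (Euc n) Y]

lemma InteriorChart.tsupport_transfer {κ κ' : InteriorChart n B} {φ : 𝓓(κ.dom, ℝ)}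
    {φ' : 𝓓(κ'.dom, ℝ)} (h : tsupport φ ⊆ κ'.overlap κ) (h' : tsupport φ' ⊆ κ.overlap κ')
    (e : ∀ x ∈ κ.overlap κ', φ' x = |(fderiv ℝ (κ.toChart ∘ κ'.toChart.symm) x).det| *
      φ (κ.toChart (κ'.toChart.symm x))) :
    tsupport φ' ⊆ κ'.transition κ '' tsupport φ := by
  refine closure_minimal (fun x hx => ?_) (φ.hasCompactSupport.isCompact.image_of_continuousOn
    ((κ'.contDiffOn_transition κ).continuousOn.mono h)).isClosed
  have hxo := h' (subset_tsupport _ hx)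
  have h1 := e x hxo
  refine ⟨κ.transition κ' x, subset_tsupport _ fun h0 => hx ?_, κ.transition_transition κ' hxo⟩
  rw [h1]
  exact mul_eq_zero_of_right _ h0

/-- The distribution `u` vanishes near the point `z`. -/
def VanishNear (u : IntDistribution n B) (z : B) : Prop :=
  ∃ O : Set B, IsOpen O ∧ z ∈ O ∧ ∀ (κ : InteriorChart n B) (φ : 𝓓(κ.dom, ℝ)),
    (∀ x ∈ tsupport φ, κ.toChart.symm x ∈ O) → u.1 κ φ = 0

lemma eq_zero_of_vanishNear {u : IntDistribution n B}
    (h : ∀ z ∈ (𝓡∂ (n + 1)).interior B, VanishNear u z) : u = 0 := by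
  refine Subtype.ext (funext fun κ => ContinuousLinearMap.ext fun φ => ?_)
  refine eq_zero_of_locally (fun x hx => ?_) φ
  obtain ⟨O, hO, hxO, hv⟩ := h _ (κ.source_subset (κ.toChart.map_target hx))
  exact ⟨_, κ.toChart.symm.isOpen_inter_preimage hO, ⟨hx, hxO⟩,
    fun φ hφ => hv κ φ fun y hy => (hφ hy).2⟩

variable {s : ℝ} {p : ℝ≥0∞} [Fact (1 ≤ p)]

/-- Where ζ does not vanish, test functions can be divided by it, so ζ u = 0 forces u = 0 there. -/
lemma vanishNear_of_locNorm_eq_zero (hp1 : 1 ≤ p) {u : IntDistribution n B}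
    {κ : InteriorChart n B} {ζ : Euc (n + 1) → ℝ} (hζ : ContDiff ℝ ∞ ζ)
    (h0 : locNorm s p (u.1 κ) ζ = 0) {z : B} (hz : z ∈ κ.toChart.source)
    (hζz : ζ (κ.toChart z) ≠ 0) : VanishNear u z := by
  have hU : IsOpen {x | ζ x ≠ 0} := hζ.continuous.isOpen_preimage {0}ᶜ isOpen_compl_singleton
  refine ⟨_, κ.toChart.isOpen_inter_preimage hU, ⟨hz, hζz⟩, fun κ' φ hφ => ?_⟩
  have h : tsupport φ ⊆ κ.overlap κ' := fun x hx => ⟨φ.tsupport_subset hx, (hφ x hx).1⟩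
  obtain ⟨φ', h', e⟩ := κ'.exists_transfer κ h
  rw [u.2 κ' κ φ φ' h h' e]
  have hs : tsupport φ' ⊆ {x | ζ x ≠ 0} :=
    (InteriorChart.tsupport_transfer h h' e).trans (by
      rintro _ ⟨y, hy, rfl⟩
      exact (hφ y hy).2)
  have hc : ContDiffOn ℝ ∞ (fun x => (ζ x)⁻¹) {x | ζ x ≠ 0} := hζ.contDiffOn.inv fun x hx => hx
  refine apply_eq_zero_of_locNorm_eq_zero hp1 h0
    (φ := mkTest ⊤ (fun x => φ' x • (ζ x)⁻¹)
      (contDiff_mul_of_tsupport_subset hU hc φ'.contDiff hs) φ'.hasCompactSupport.smul_right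
      (subset_univ _)) fun x => ?_
  rw [mkTest_apply]
  by_cases hx : φ' x = 0
  · simp [hx]
  · have := hs (subset_tsupport _ hx)
    rw [smul_eq_mul, mul_left_comm, mul_inv_cancel₀ this, mul_one]

variable [IsManifold (𝓡∂ (n + 1)) ∞ B] [IsManifold (𝓡 n) ∞ Y] {c : Collar n B Y}

lemma Collar.mem_logChart_source {w : EuclideanHalfSpace 1 × Y} (hw : w ∈ c.toMap.source)
    (h0 : 0 < w.1.val 0) {η : BoundaryChart n Y} (hη : w.2 ∈ η.1.source) :
    c.toMap w ∈ (c.logChart η).toChart.source := by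
  change c.toMap w ∈ (c.toMap.symm.trans (logCoord η.1)).source
  rw [OpenPartialHomeomorph.trans_source]
  refine ⟨c.toMap.map_source hw, ?_⟩
  rw [mem_preimage, c.toMap.left_inv hw]
  exact ⟨h0, hη⟩

lemma Collar.logChart_apply {w : EuclideanHalfSpace 1 × Y} (hw : w ∈ c.toMap.source)
    (η : BoundaryChart n Y) : (c.logChart η).toChart (c.toMap w) =
      consPt (-Real.log (w.1.val 0)) (η.1 w.2) := by
  change logCoord η.1 (c.toMap.symm (c.toMap w)) = _
  rw [c.toMap.left_inv hw]
  rfl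

lemma Collar.logChart_symm_apply (η : BoundaryChart n Y) (v : Euc (n + 1)) :
    (c.logChart η).toChart.symm v = c.toMap (halfPt (Real.exp (-v 0)), η.1.symm (tailPt v)) := rfl

lemma eq_zero_of_coneNorm_eq_zero (hp1 : 1 ≤ p) {γ : ℝ} {N : NormData c} {u : IntDistribution n B}
    (h : coneNorm N s γ p u = 0) : u = 0 := by
  rw [coneNorm, add_eq_zero, Finset.sum_eq_zero_iff, Finset.sum_eq_zero_iff] at h
  refine eq_zero_of_vanishNear fun z hz => ?_
  rcases N.cover_interior z hz with ⟨w, hw, rfl, hθ⟩ | ⟨j, hj, hχ⟩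
  · rw [c.mem_interior_iff hw] at hz
    obtain ⟨i, hi, hψ⟩ := N.cover_boundary w.2
    refine vanishNear_of_locNorm_eq_zero hp1 (contDiff_collarWeight γ N.θ (N.ψ i))
      (h.1 i (Finset.mem_univ i)) (c.mem_logChart_source hw hz hi) ?_
    rw [c.logChart_apply hw]
    simp only [collarWeight, consPt_zero, tailPt_consPt, neg_neg, Real.exp_log hz]
    exact mul_ne_zero (mul_ne_zero (Real.exp_pos _).ne' hθ) hψ
  · exact vanishNear_of_locNorm_eq_zero hp1 (N.χ j).contDiff (h.2 j (Finset.mem_univ j)) hj hχ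

end Vanishing

/-! ### Smooth functions on the interior, as elements and as multipliers -/

section SmoothFunctions

variable {n : ℕ} {B : Type*} [TopologicalSpace B] [ChartedSpace (EuclideanHalfSpace (n + 1)) B]
  {Y : Type*} [TopologicalSpace Y] [ChartedSpace (Euc n) Y]
  {F : Type*} [NormedAddCommGroup F]

/-- The function `P` in the coordinates of the chart `κ`, as a function on `B`, extended by
zero. -/
def InteriorChart.pullback (κ : InteriorChart n B) (P : Euc (n + 1) → F) (z : B) : F :=
  open Classical in if z ∈ κ.toChart.source then P (κ.toChart z) else 0

lemma InteriorChart.pullback_of_mem (κ : InteriorChart n B) (P : Euc (n + 1) → F) {z : B}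
    (hz : z ∈ κ.toChart.source) : κ.pullback P z = P (κ.toChart z) := if_pos hz

lemma InteriorChart.pullback_of_notMem (κ : InteriorChart n B) (P : Euc (n + 1) → F) {z : B}
    (hz : z ∉ κ.toChart.source) : κ.pullback P z = 0 := if_neg hz

lemma InteriorChart.pullback_symm (κ : InteriorChart n B) (P : Euc (n + 1) → F) {x : Euc (n + 1)}
    (hx : x ∈ κ.toChart.target) : κ.pullback P (κ.toChart.symm x) = P x := by
  rw [κ.pullback_of_mem P (κ.toChart.map_target hx), κ.toChart.right_inv hx]

lemma InteriorChart.pullback_eq_zero (κ : InteriorChart n B) {P : Euc (n + 1) → F} {z : B}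
    (hz : z ∉ κ.toChart.symm '' tsupport P) : κ.pullback P z = 0 := by
  by_cases h : z ∈ κ.toChart.source
  · rw [κ.pullback_of_mem P h]
    exact image_eq_zero_of_notMem_tsupport fun h' => hz ⟨_, h', κ.toChart.left_inv h⟩
  · exact κ.pullback_of_notMem P h

lemma InteriorChart.isCompact_symm_image (κ : InteriorChart n B) {K : Set (Euc (n + 1))}
    (hK : IsCompact K) (hKκ : K ⊆ κ.dom) : IsCompact (κ.toChart.symm '' K) :=
  hK.image_of_continuousOn (κ.toChart.continuousOn_symm.mono hKκ)

lemma InteriorChart.symm_image_subset (κ : InteriorChart n B) {K : Set (Euc (n + 1))}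
    (hKκ : K ⊆ κ.dom) : κ.toChart.symm '' K ⊆ κ.toChart.source := by
  rintro _ ⟨x, hx, rfl⟩
  exact κ.toChart.map_target (hKκ hx)

variable [NormedSpace ℝ F] [IsManifold (𝓡∂ (n + 1)) ∞ B] [IsManifold (𝓡 n) ∞ Y] {c : Collar n B Y}
  {s γ : ℝ} {p : ℝ≥0∞} [Fact (1 ≤ p)]

omit [IsManifold (𝓡∂ (n + 1)) ∞ B] [IsManifold (𝓡 n) ∞ Y] in
lemma Collar.mem_source_of_pos (c : Collar n B Y) {r : ℝ} (hr : 0 < r) (y : Y) :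
    (halfPt (Real.exp (-r)), y) ∈ c.toMap.source := by
  rw [c.source_eq]
  change (halfPt (Real.exp (-r))).val 0 < 1
  rw [halfPt_val _ (Real.exp_pos _).le, Real.exp_lt_one_iff]
  linarith

/-- Functions on `B` that are smooth in the interior. -/
def SmoothInside (n : ℕ) {B : Type*} [TopologicalSpace B]
    [ChartedSpace (EuclideanHalfSpace (n + 1)) B] (G : B → F) : Prop :=
  ∀ κ : InteriorChart n B, ContDiffOn ℝ ∞ (fun x => G (κ.toChart.symm x)) κ.toChart.target

omit [IsManifold (𝓡∂ (n + 1)) ∞ B] in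
-- The closed set S may reach the boundary of B: only its interior part has to lie in the chart.
-- This covers bumps in the collar.
lemma InteriorChart.smoothInside (κ : InteriorChart n B) {P : Euc (n + 1) → F}
    (hP : ContDiff ℝ ∞ P) {G : B → F} (hG : ∀ z ∈ κ.toChart.source, G z = P (κ.toChart z))
    {S : Set B} (hS : IsClosed S) (hSκ : S ∩ (𝓡∂ (n + 1)).interior B ⊆ κ.toChart.source)
    (h0 : ∀ z ∉ S, G z = 0) : SmoothInside n G := by
  intro κ' x hx
  refine ContDiffAt.contDiffWithinAt ?_
  by_cases hx' : κ'.toChart.symm x ∈ κ.toChart.source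
  · have hO := (κ.isOpen_overlap κ').mem_nhds ⟨hx, hx'⟩
    refine (hP.contDiffAt.comp x ((κ.contDiffOn_transition κ').contDiffAt hO)).congr_of_eventuallyEq ?_
    filter_upwards [hO] with y hy
    exact hG _ hy.2
  · have h2 := (κ'.toChart.symm.isOpen_inter_preimage hS.isOpen_compl).mem_nhds (x := x)
      ⟨hx, fun h => hx' (hSκ ⟨h, κ'.source_subset (κ'.toChart.map_target hx)⟩)⟩
    refine (contDiffAt_const (c := (0 : F))).congr_of_eventuallyEq ?_
    filter_upwards [h2] with y hy
    exact h0 _ hy.2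

omit [IsManifold (𝓡∂ (n + 1)) ∞ B] in
lemma InteriorChart.smoothInside_pullback [T2Space B] (κ : InteriorChart n B)
    {P : Euc (n + 1) → F} (hP : ContDiff ℝ ∞ P) (hc : HasCompactSupport P)
    (hs : tsupport P ⊆ κ.dom) : SmoothInside n (κ.pullback P) :=
  κ.smoothInside hP (fun _ hz => κ.pullback_of_mem P hz)
    (κ.isCompact_symm_image hc.isCompact hs).isClosed
    (inter_subset_left.trans (κ.symm_image_subset hs)) fun _ hz => κ.pullback_eq_zero hz

lemma locMem_of_contDiff {d : ℕ} {Ω : Opens (Euc d)} {v : 𝓓'(Ω, ℂ)} {χ : Euc d → ℝ} {G : Euc d → ℂ}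
    (hv : ∀ φ : 𝓓(Ω, ℝ), v φ = ∫ x, (φ x : ℂ) * G x)
    (h : ContDiff ℝ ∞ fun x => χ x • G x) (hc : HasCompactSupport fun x => χ x • G x) :
    LocMem s p v χ := by
  refine ⟨(hc.toSchwartzMap h : 𝓢(Euc d, ℂ)), fun φ ψ e => ?_, SchwartzMap.memSobolev _⟩
  rw [hv]
  refine (SchwartzMap.toTemperedDistributionCLM_apply_apply _ _ _).trans ?_
  refine integral_congr_ae (Eventually.of_forall fun x => ?_)
  simp [e]
  ring

lemma SmoothInside.contDiff_collarWeight_smul {G : B → F} (hG : SmoothInside n G)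
    (c : Collar n B Y) (γ : ℝ) (θ : Cutoff) {η : BoundaryChart n Y} (ψ : 𝓓(η.dom, ℝ)) :
    ContDiff ℝ ∞ fun x => collarWeight γ θ ψ x • G ((c.logChart η).toChart.symm x) :=
  contDiff_mul_of_tsupport_subset (c.logChart η).toChart.open_target (hG _)
    (contDiff_collarWeight γ θ ψ) (tsupport_collarWeight_subset c γ θ ψ)

/-- Since S misses the strip x ≤ a, the product lives in 0 ≤ r ≤ -log a, and in the support of ψ in
the other variables. -/
lemma hasCompactSupport_collarWeight_smul [T2Space B] [CompactSpace B] {G : B → F} {S : Set B}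
    (hS : IsClosed S) (hSi : S ⊆ (𝓡∂ (n + 1)).interior B) (h0 : ∀ z ∉ S, G z = 0)
    (c : Collar n B Y) (γ : ℝ) (θ : Cutoff) {η : BoundaryChart n Y} (ψ : 𝓓(η.dom, ℝ)) :
    HasCompactSupport fun x => collarWeight γ θ ψ x • G ((c.logChart η).toChart.symm x) := by
  obtain ⟨a, ha, ha1, h⟩ := c.exists_lt_notMem hS hSi
  have hK : IsCompact ((fun z : ℝ × Euc n => consPt z.1 z.2) ''
      (Icc 0 (-Real.log a) ×ˢ tsupport ψ)) :=
    (isCompact_Icc.prod ψ.hasCompactSupport.isCompact).image contDiff_consPt.continuous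
  refine HasCompactSupport.of_support_subset_isCompact hK fun x hx => ?_
  have hx1 : collarWeight γ θ ψ x ≠ 0 := left_ne_zero_of_smul hx
  have hx2 : G ((c.logChart η).toChart.symm x) ≠ 0 := right_ne_zero_of_smul hx
  have hxd : x ∈ (c.logChart η).toChart.target :=
    tsupport_collarWeight_subset c γ θ ψ (subset_tsupport _ hx1)
  rw [c.logChart_target] at hxd
  refine ⟨(x 0, tailPt x), ⟨⟨hxd.1.le, ?_⟩, subset_tsupport _ (collarWeight_ne_zero hx1).2⟩,
    consPt_tailPt x⟩
  by_contra hlt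
  refine hx2 (h0 _ ?_)
  rw [c.logChart_symm_apply]
  refine h _ (c.mem_source_of_pos hxd.1 _) ?_
  rw [halfPt_val _ (Real.exp_pos _).le, ← Real.le_log_iff_exp_le ha]
  linarith [not_le.1 hlt]

lemma exists_represents_of_smoothInside [T2Space B] [CompactSpace B] {G : B → ℂ}
    (hG : SmoothInside n G) {S : Set B} (hS : IsClosed S) (hSi : S ⊆ (𝓡∂ (n + 1)).interior B)
    (h0 : ∀ z ∉ S, G z = 0) :
    ∃ v : coneSobolev c s γ p, Represents v.1 G := by
  have hl : ∀ κ : InteriorChart n B,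
      LocallyIntegrableOn (fun x => G (κ.toChart.symm x)) κ.toChart.target volume := fun κ =>
    (hG κ).continuousOn.locallyIntegrableOn κ.toChart.open_target.measurableSet
  have hr := represents_intDistOf hl
  refine ⟨⟨intDistOf G hl, fun κ χ => ?_, fun θ η ψ => ?_⟩, hr⟩
  · exact locMem_of_contDiff (hr κ).2 (contDiff_mul_of_tsupport_subset κ.toChart.open_target (hG κ)
      χ.contDiff χ.tsupport_subset) χ.hasCompactSupport.smul_right
  · exact locMem_of_contDiff (hr _).2 (hG.contDiff_collarWeight_smul c γ θ ψ)
      (hasCompactSupport_collarWeight_smul hS hSi h0 c γ θ ψ)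

lemma coneMult_of_smoothInside {g : B → ℝ} (hg : SmoothInside n g)
    (h : ∀ (θ : Cutoff) (η : BoundaryChart n Y) (ψ : 𝓓(η.dom, ℝ)), BddDeriv fun x =>
      collarWeight (((n : ℝ) + 1) / 2) θ ψ x * g ((c.logChart η).toChart.symm x)) (σ : ℝ) :
    ConeMult c σ g := by
  refine ⟨fun κ χ => ?_, fun θ η ψ => ⟨_, (h θ η ψ).multSeq σ, tsum_singleSeq _⟩⟩
  exact ⟨_, (BddDeriv.of_hasCompactSupport (contDiff_mul_of_tsupport_subset κ.toChart.open_target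
    (hg κ) χ.contDiff χ.tsupport_subset) χ.hasCompactSupport.smul_right).multSeq σ,
    tsum_singleSeq _⟩

end SmoothFunctions

/-! ### Approximation of localized elements by functions -/

section Uniqueness

variable {n : ℕ} {B : Type*} [TopologicalSpace B] [ChartedSpace (EuclideanHalfSpace (n + 1)) B]
  {Y : Type*} [TopologicalSpace Y] [ChartedSpace (Euc n) Y]
  [IsManifold (𝓡∂ (n + 1)) ∞ B] [IsManifold (𝓡 n) ∞ Y] {c : Collar n B Y}
  {σ s γ : ℝ} {p : ℝ≥0∞} [Fact (1 ≤ p)]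

lemma eq_zero_of_forall_le_mul {x : ℝ≥0∞} {A : ℝ≥0} (h : ∀ ε : ℝ≥0, 0 < ε → x ≤ (A * ε : ℝ≥0)) :
    x = 0 := by
  refine le_antisymm (ENNReal.le_of_forall_pos_le_add fun δ hδ _ => ?_) zero_le
  rw [zero_add]
  refine (h (δ / (A + 1)) (by positivity)).trans (ENNReal.coe_le_coe.2 ?_)
  rw [mul_div_assoc', div_le_iff₀ (by positivity), mul_comm]
  gcongr
  simp

/-- The difference of two elements of the cone Sobolev space. -/
def coneSub (u v : coneSobolev c s γ p) : coneSobolev c s γ p := u + (-1 : ℂ) • v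

lemma coneSub_apply (u v : coneSobolev c s γ p) (κ : InteriorChart n B)
    (φ : 𝓓(κ.dom, ℝ)) : (coneSub u v).1.1 κ φ = u.1.1 κ φ - v.1.1 κ φ := by
  change u.1.1 κ φ + (-1 : ℂ) • v.1.1 κ φ = _
  rw [neg_one_smul, sub_eq_add_neg]

lemma map_coneSub_of_map_eq_zero (D : coneSobolev c s γ p →ₗ[ℂ] coneSobolev c s γ p)
    (u : coneSobolev c s γ p) {v : coneSobolev c s γ p} (hv : D v = 0) : D (coneSub u v) = D u := by
  have h1 : D (coneSub u v) = D u + D ((-1 : ℂ) • v) := D.map_add' u _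
  have h2 : D ((-1 : ℂ) • v) = (-1 : ℂ) • D v := D.map_smul' _ v
  rw [h1, h2, hv]
  exact (congrArg (D u + ·) (smul_zero _)).trans (add_zero _)

lemma ConeMult.op_apply_eq (hp : p < ⊤) (hp1 : 1 < p) (hs : |s| < σ) {g : B → ℝ}
    (hg : ConeMult c σ g) (u : coneSobolev c s γ p) {κ : InteriorChart n B} {φ : 𝓓(κ.dom, ℝ)}
    {a : Euc (n + 1) → ℝ} (ha : BddDeriv a) (e : ∀ x, φ x ≠ 0 → g (κ.toChart.symm x) = a x) :
    (hg.op γ hp hp1 hs u).1.1 κ φ = u.1.1 κ (mulTest a ha.contDiff.contDiffOn φ) := by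
  have h1 := hg.hasSum_op hp hp1 hs u (ha.multSeq σ) (φ := φ)
    fun x hx => by rw [tsum_singleSeq, e x hx]
  refine h1.unique ?_
  have h2 : ∀ k ≠ 0, u.1.1 κ (mulTest (singleSeq a k)
      ((ha.multSeq σ).contDiff k).contDiffOn φ) = 0 := fun k hk => by
    have : mulTest (singleSeq a k) ((ha.multSeq σ).contDiff k).contDiffOn φ = 0 :=
      TestFunction.ext fun x => by simp [singleSeq, hk]
    rw [this, map_zero]
  exact hasSum_single 0 h2

lemma ConeMult.op_apply_eq_zero (hp : p < ⊤) (hp1 : 1 < p) (hs : |s| < σ) {g : B → ℝ}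
    (hg : ConeMult c σ g) (u : coneSobolev c s γ p) {κ : InteriorChart n B} {φ : 𝓓(κ.dom, ℝ)}
    (e : ∀ x, φ x ≠ 0 → g (κ.toChart.symm x) = 0) :
    (hg.op γ hp hp1 hs u).1.1 κ φ = 0 := by
  rw [hg.op_apply_eq hp hp1 hs u (BddDeriv.const 0) e]
  have : mulTest (fun _ => (0 : ℝ)) (BddDeriv.const (d := n + 1) (0 : ℝ)).contDiff.contDiffOn φ = 0 :=
    TestFunction.ext fun x => by simp
  rw [this, map_zero]

/-- Passing from u to (1-g)u never destroys vanishing already achieved; the finite product of such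
factors relies on it. -/
lemma VanishNear.sub_op (hp : p < ⊤) (hp1 : 1 < p) (hs : |s| < σ) {g : B → ℝ}
    (hg : ConeMult c σ g) {u : coneSobolev c s γ p} {z : B} (h : VanishNear u.1 z) :
    VanishNear (coneSub u (hg.op γ hp hp1 hs u)).1 z := by
  obtain ⟨O, hO, hz, h⟩ := h
  refine ⟨O, hO, hz, fun κ φ hφ => ?_⟩
  rw [coneSub_apply]
  obtain ⟨a, ha, hsum⟩ := hg.exists_eq_of_ne_zero κ φ
  have h1 := hg.hasSum_op hp hp1 hs u ha hsum
  have h2 : ∀ k, u.1.1 κ (mulTest (a k) (ha.contDiff k).contDiffOn φ) = 0 := fun k =>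
    h κ _ fun x hx => hφ x (tsupport_smul_subset_left _ _ hx)
  simp_rw [h2] at h1
  rw [h κ φ hφ, h1.unique hasSum_zero, sub_self]

lemma vanishNear_sub_op (hp : p < ⊤) (hp1 : 1 < p) (hs : |s| < σ) {g : B → ℝ}
    (hg : ConeMult c σ g) {u : coneSobolev c s γ p} {z : B} (h : ∀ᶠ z' in 𝓝 z, g z' = 1) :
    VanishNear (coneSub u (hg.op γ hp hp1 hs u)).1 z := by
  obtain ⟨O, hO1, hO, hz⟩ := eventually_nhds_iff.1 h
  refine ⟨O, hO, hz, fun κ φ hφ => ?_⟩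
  rw [coneSub_apply]
  rw [hg.op_apply_eq hp hp1 hs u (BddDeriv.const 1) fun x hx => hO1 _ (hφ x (subset_tsupport _ hx))]
  have : mulTest (fun _ => (1 : ℝ)) (BddDeriv.const (d := n + 1) (1 : ℝ)).contDiff.contDiffOn φ = φ :=
    TestFunction.ext fun x => by simp
  rw [this, sub_self]

/-- Smooth functions `g` on `B`, with the function `a` as coordinate expression in a chart `κ`,
such that cone Sobolev norms are controlled by the localization in the chart `κ` to the support
of `a`. -/
structure IsPiece (c : Collar n B Y) (s γ σ : ℝ) (p : ℝ≥0∞) [Fact (1 ≤ p)] (g : B → ℝ)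
    (κ : InteriorChart n B) (a ζ : Euc (n + 1) → ℝ) (N : NormData c) : Prop where
  mult : ConeMult c σ g
  bddDeriv : BddDeriv a
  tsupport_subset : tsupport a ⊆ κ.dom
  eq : ∀ x ∈ κ.toChart.target, g (κ.toChart.symm x) = a x
  contDiff : ContDiff ℝ ∞ ζ
  ne_zero : ∀ x ∈ tsupport a, ζ x ≠ 0
  locMem : ∀ u ∈ coneSobolev c s γ p, LocMem s p (u.1 κ) ζ
  norm_le : ∃ K : ℝ≥0, ∀ v : IntDistribution n B,
    (∀ (κ' : InteriorChart n B) (φ : 𝓓(κ'.dom, ℝ)),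
      (∀ x ∈ κ'.dom, φ x ≠ 0 → g (κ'.toChart.symm x) = 0) → v.1 κ' φ = 0) →
    coneNorm N s γ p v ≤ K * locNorm s p (v.1 κ) ζ

variable {g : B → ℝ} {κ : InteriorChart n B} {a ζ : Euc (n + 1) → ℝ} {N : NormData c}

-- Approximate w = ζ u in H^s_p by a compactly supported Schwartz function U and take v = (a/ζ) U.
-- Then ζ(g u - v) = a (w - U), which is small because multiplication by a is bounded on H^s_p. The
-- other localizations of g u - v are controlled by `norm_le`, since this difference vanishes off g.
set_option maxHeartbeats 800000 in
lemma IsPiece.exists_approx [T2Space B] [CompactSpace B] (hg : IsPiece c s γ σ p g κ a ζ N)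
    (hp : p < ⊤) (hp1 : 1 < p) (hs : |s| < σ) (u : coneSobolev c s γ p) :
    ∃ C : ℝ≥0, ∀ ε : ℝ, 0 < ε → ∃ (v : coneSobolev c s γ p) (G : B → ℂ), Represents v.1 G ∧
      coneNorm N s γ p (coneSub (hg.mult.op γ hp hp1 hs u) v).1 ≤ C * ENNReal.ofReal ε := by
  obtain ⟨K, hK⟩ := hg.norm_le
  obtain ⟨w, hw, f, hf⟩ := hg.locMem u.1 u.2
  have hms := hg.bddDeriv.multSeq σ
  obtain ⟨C, hC⟩ := hms.exists_mul (p := p) hp hp1 hs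
  refine ⟨K * C, fun ε hε => ?_⟩
  obtain ⟨U, hU, hUε⟩ := Cone.exists_approx hp s f hε
  have ho : IsOpen {x | ζ x ≠ 0} :=
    hg.contDiff.continuous.isOpen_preimage {0}ᶜ isOpen_compl_singleton
  -- Smooth because ζ has no zeros on the support of `a`; compactly supported because `U` is, which
  -- matters in the collar, where `a` is not.
  set P : Euc (n + 1) → ℂ := fun x => a x • (((ζ x)⁻¹ : ℝ) • U x)
  have hP : ContDiff ℝ ∞ P := contDiff_mul_of_tsupport_subset ho
    ((hg.contDiff.contDiffOn.inv fun x hx => hx).smul (U.smooth ⊤).contDiffOn)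
    hg.bddDeriv.contDiff hg.ne_zero
  have hPc : HasCompactSupport P := (hU.smul_left (f := fun x => (ζ x)⁻¹)).smul_left (f := a)
  have hPs : tsupport P ⊆ κ.dom := (tsupport_smul_subset_left a _).trans hg.tsupport_subset
  obtain ⟨v, hv⟩ := exists_represents_of_smoothInside (c := c) (s := s) (γ := γ) (p := p)
    (κ.smoothInside_pullback hP hPc hPs) (κ.isCompact_symm_image hPc.isCompact hPs).isClosed
    ((κ.symm_image_subset hPs).trans κ.source_subset) (fun z hz => κ.pullback_eq_zero hz)
  set y := coneSub (hg.mult.op γ hp hp1 hs u) v with hy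
  have hKy := hK y.1
  refine ⟨v, _, hv, ?_⟩
  refine le_trans (hKy fun κ' φ hφ => ?_) ?_
  · rw [hy, coneSub_apply, hg.mult.op_apply_eq_zero hp hp1 hs u fun x hx => hφ x
      (by_contra fun h => hx (test_eq_zero h)) hx, (hv κ').2, zero_sub, neg_eq_zero]
    refine integral_eq_zero_of_ae (Eventually.of_forall fun x => ?_)
    by_cases hx : φ x = 0
    · simp [hx]
    have h1 := hφ x (by_contra fun h => hx (test_eq_zero h)) hx
    have h2 : κ.pullback P (κ'.toChart.symm x) = 0 := by
      by_cases hz : κ'.toChart.symm x ∈ κ.toChart.source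
      · rw [κ.pullback_of_mem P hz]
        rw [← κ.toChart.left_inv hz, hg.eq _ (κ.toChart.map_source hz)] at h1
        simp [P, h1]
      · exact κ.pullback_of_notMem P hz
    simp [h2]
  · have hd : TemperedDistribution.besselPotential (Euc (n + 1)) ℂ s (w - (U : 𝓢'(Euc (n + 1), ℂ))) =
        ((f - (bessel s U).toLp p volume : Lp ℂ p (volume : Measure (Euc (n + 1)))) :
          𝓢'(Euc (n + 1), ℂ)) := by
      rw [map_sub, hf, besselPotential_coe, ← Lp.toTemperedDistribution_toLp_eq (p := p)]
      exact (map_sub (Lp.toTemperedDistributionCLM ℂ volume p) f _).symm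
    obtain ⟨w', f', hf', hn, hsum⟩ := hC _ _ hd
    have hloc : IsLocalization (y.1.1 κ) ζ w' := by
      intro φ ψ e
      have h1 : w' (testToSchwartz φ) = (w - (U : 𝓢'(Euc (n + 1), ℂ))) (mulS a (testToSchwartz φ)) := by
        refine (hsum (testToSchwartz φ)).unique ?_
        refine hasSum_single 0 fun k hk => ?_
        have : mulS (singleSeq a k) (testToSchwartz φ) = 0 := by
          ext x
          rw [hms.mulS_apply]
          simp [singleSeq, hk]
        rw [this, map_zero]
      rw [h1, hy, coneSub_apply]
      change w _ - (U : 𝓢'(Euc (n + 1), ℂ)) _ = _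
      congr 1
      · rw [hg.mult.op_apply_eq hp hp1 hs u hg.bddDeriv fun x hx => hg.eq x
          (by_contra fun h => hx (test_eq_zero h))]
        exact hms.apply_mulTest hw e 0
      · rw [(hv κ).2]
        refine (SchwartzMap.toTemperedDistributionCLM_apply_apply _ _ _).trans ?_
        refine integral_congr_ae (Eventually.of_forall fun x => ?_)
        beta_reduce
        rw [hg.bddDeriv.mulS_apply, testToSchwartz_apply]
        by_cases hx : x ∈ κ.toChart.target
        · rw [κ.pullback_symm P hx, e]
          by_cases hax : a x = 0
          · simp [P, hax]
          have hζ : (ζ x : ℂ) ≠ 0 := by exact_mod_cast hg.ne_zero x (subset_tsupport _ hax)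
          simp only [P, Complex.real_smul, smul_eq_mul, Complex.ofReal_inv, Complex.ofReal_mul]
          field_simp
        · rw [image_eq_zero_of_notMem_tsupport fun h => hx (hg.tsupport_subset h),
            test_eq_zero (φ := ψ) hx]
          simp
    calc (K : ℝ≥0∞) * locNorm s p _ ζ ≤ K * (C * ENNReal.ofReal ε) := by
          gcongr
          refine (locNorm_le hloc hf').trans (hn.trans ?_)
          gcongr
          rw [← ofReal_norm]
          exact ENNReal.ofReal_le_ofReal hUε.le
      _ = _ := by rw [ENNReal.coe_mul, mul_assoc]

lemma IsPiece.apply_op_eq_zero [T2Space B] [CompactSpace B] (hg : IsPiece c s γ σ p g κ a ζ N)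
    (hp : p < ⊤) (hp1 : 1 < p) (hs : |s| < σ)
    {D : coneSobolev c s γ p →ₗ[ℂ] coneSobolev c s γ p}
    (hD : ∀ N : NormData c, ∃ C : ℝ≥0, ∀ u : coneSobolev c s γ p,
      coneNorm N s γ p (D u).1 ≤ C * coneNorm N s γ p u.1)
    (hD0 : ∀ (u : coneSobolev c s γ p) (G : B → ℂ), Represents u.1 G → D u = 0)
    (u : coneSobolev c s γ p) : D (hg.mult.op γ hp hp1 hs u) = 0 := by
  obtain ⟨C, hC⟩ := hg.exists_approx hp hp1 hs u
  obtain ⟨A, hA⟩ := hD N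
  have key : ∀ ε : ℝ≥0, 0 < ε →
      coneNorm N s γ p (D (hg.mult.op γ hp hp1 hs u)).1 ≤ (A * C * ε : ℝ≥0) := fun ε hε => by
    obtain ⟨v, G, hG, hv⟩ := hC ε hε
    have e : D (hg.mult.op γ hp hp1 hs u) = D (coneSub (hg.mult.op γ hp hp1 hs u) v) :=
      (map_coneSub_of_map_eq_zero D _ (hD0 v G hG)).symm
    rw [ENNReal.ofReal_coe_nnreal] at hv
    calc coneNorm N s γ p (D (hg.mult.op γ hp hp1 hs u)).1
        = coneNorm N s γ p (D (coneSub (hg.mult.op γ hp hp1 hs u) v)).1 := congrArg _ (congrArg _ e)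
      _ ≤ A * coneNorm N s γ p (coneSub (hg.mult.op γ hp hp1 hs u) v).1 := hA _
      _ ≤ A * (C * ε) := mul_le_mul_right hv _
      _ = (A * C * ε : ℝ≥0) := by push_cast; ring
  exact Subtype.ext (eq_zero_of_coneNorm_eq_zero (N := N) (s := s) (p := p) (γ := γ) hp1.le
    (eq_zero_of_forall_le_mul key))

end Uniqueness

/-! ### Pieces around interior points -/

section Pieces

variable {n : ℕ} {B : Type*} [TopologicalSpace B] [T2Space B] [CompactSpace B]
  [ChartedSpace (EuclideanHalfSpace (n + 1)) B]
  {Y : Type*} [TopologicalSpace Y] [ChartedSpace (Euc n) Y]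
  [IsManifold (𝓡∂ (n + 1)) ∞ B] [IsManifold (𝓡 n) ∞ Y] {c : Collar n B Y}
  {σ s γ : ℝ} {p : ℝ≥0∞} [Fact (1 ≤ p)]

/-- The distribution `v` vanishes on the test functions supported in the zero set of `g`. -/
def VanishOff (g : B → ℝ) (v : IntDistribution n B) : Prop :=
  ∀ (κ : InteriorChart n B) (φ : 𝓓(κ.dom, ℝ)),
    (∀ x ∈ κ.dom, φ x ≠ 0 → g (κ.toChart.symm x) = 0) → v.1 κ φ = 0

omit [T2Space B] [CompactSpace B] [IsManifold (𝓡∂ (n + 1)) ∞ B] in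
lemma VanishOff.locNorm_eq_zero {g : B → ℝ} {v : IntDistribution n B} (hv : VanishOff g v)
    {κ : InteriorChart n B} {χ : Euc (n + 1) → ℝ}
    (h : ∀ x ∈ κ.dom, χ x ≠ 0 → g (κ.toChart.symm x) = 0) : locNorm s p (v.1 κ) χ = 0 :=
  Cone.locNorm_eq_zero fun φ ψ e => hv κ ψ fun x hx hψ =>
    h x hx fun h0 => hψ (by rw [e, h0, zero_mul])

lemma exists_normData_le (θ : Cutoff) {g : B → ℝ} {κ : InteriorChart n B} {ζ : Euc (n + 1) → ℝ}
    (hP : ∀ y : Y, ∃ (η : BoundaryChart n Y) (ψ : 𝓓(η.dom, ℝ)),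
      (∃ K : ℝ≥0, ∀ v : IntDistribution n B, VanishOff g v →
        locNorm s p (v.1 (c.logChart η)) (collarWeight γ θ ψ) ≤ K * locNorm s p (v.1 κ) ζ) ∧
      y ∈ η.1.source ∧ ψ (η.1 y) ≠ 0)
    (hR : ∀ z ∈ (𝓡∂ (n + 1)).interior B,
      (∀ w ∈ c.toMap.source, c.toMap w = z → θ.toFun (w.1.val 0) = 0) →
      ∃ (κ' : InteriorChart n B) (χ : 𝓓(κ'.dom, ℝ)),
        (∃ K : ℝ≥0, ∀ v : IntDistribution n B, VanishOff g v →
          locNorm s p (v.1 κ') χ ≤ K * locNorm s p (v.1 κ) ζ) ∧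
        z ∈ κ'.toChart.source ∧ χ (κ'.toChart z) ≠ 0) :
    ∃ (N : NormData c) (K : ℝ≥0), ∀ v : IntDistribution n B, VanishOff g v →
      coneNorm N s γ p v ≤ K * locNorm s p (v.1 κ) ζ := by
  obtain ⟨N, rfl, h1, h2⟩ := exists_normData c θ _ _ hP hR
  choose A hA using h1
  choose C hC using h2
  refine ⟨N, ∑ i, A i + ∑ j, C j, fun v hv => ?_⟩
  push_cast
  rw [add_mul, Finset.sum_mul, Finset.sum_mul]
  exact add_le_add (Finset.sum_le_sum fun i _ => hA i v hv) (Finset.sum_le_sum fun j _ => hC j v hv)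

omit [CompactSpace B] [T2Space B] in
lemma exists_locNorm_eq_zero {S : Set B} (hS : IsClosed S) {g : B → ℝ} (h0 : ∀ z ∉ S, g z = 0)
    {z : B} (hz : z ∈ (𝓡∂ (n + 1)).interior B) (hzS : z ∉ S) :
    ∃ (κ : InteriorChart n B) (χ : 𝓓(κ.dom, ℝ)), (∀ v : IntDistribution n B, VanishOff g v →
      locNorm s p (v.1 κ) χ = 0) ∧ z ∈ κ.toChart.source ∧ χ (κ.toChart z) ≠ 0 := by
  obtain ⟨κ, hκ⟩ := exists_interiorChart hz
  obtain ⟨χ, hχ⟩ := exists_test_eq_one_near (K := {κ.toChart z})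
    (Ω := ⟨_, κ.toChart.symm.isOpen_inter_preimage hS.isOpen_compl⟩) isCompact_singleton (by
      rw [singleton_subset_iff]
      refine ⟨κ.toChart.map_source hκ, ?_⟩
      rwa [mem_preimage, κ.toChart.left_inv hκ])
  refine ⟨κ, mkTest _ χ χ.contDiff χ.hasCompactSupport (χ.tsupport_subset.trans inter_subset_left),
    fun v hv => hv.locNorm_eq_zero fun x _ hx => h0 _ ?_, hκ, ?_⟩
  · exact (χ.tsupport_subset (subset_tsupport _ hx)).2
  · rw [mkTest_apply, hχ _ rfl]
    exact one_ne_zero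

/-- The norm data are chosen so that a single chart sees g: the collar cut-off lives in a strip that
misses the support of g, and charts around points off that support use functions vanishing on it.
All these contribute zero, with constant K = 0. -/
lemma exists_isPiece_of_mem_interior (c : Collar n B Y) (s γ σ : ℝ) (p : ℝ≥0∞) [Fact (1 ≤ p)]
    {z : B} (hz : z ∈ (𝓡∂ (n + 1)).interior B) :
    ∃ g κ a ζ N, IsPiece c s γ σ p g κ a ζ N ∧ ∀ᶠ z' in 𝓝 z, g z' = 1 := by
  obtain ⟨κ, hκ⟩ := exists_interiorChart hz
  obtain ⟨χ, hχ, -⟩ := exists_test_eq_one (Ω := κ.dom) (K := {κ.toChart z}) isCompact_singleton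
    (singleton_subset_iff.2 (κ.toChart.map_source hκ))
  obtain ⟨ζ, hζ⟩ := exists_test_eq_one_near χ.hasCompactSupport χ.tsupport_subset
  set g := κ.pullback χ
  set S := κ.toChart.symm '' tsupport χ
  have hS : IsClosed S := (κ.isCompact_symm_image χ.hasCompactSupport χ.tsupport_subset).isClosed
  have hSκ : S ⊆ κ.toChart.source := κ.symm_image_subset χ.tsupport_subset
  have hSi : S ⊆ (𝓡∂ (n + 1)).interior B := hSκ.trans κ.source_subset
  have h0 : ∀ z ∉ S, g z = 0 := fun z hz => κ.pullback_eq_zero hz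
  have hg : SmoothInside n g := κ.smoothInside_pullback χ.contDiff χ.hasCompactSupport
    χ.tsupport_subset
  obtain ⟨b, hb, hb1, hbS⟩ := c.exists_lt_notMem hS hSi
  obtain ⟨θ, -, hθ⟩ := Cutoff.exists_eq_one (half_pos hb) (half_lt_self hb) hb1
  obtain ⟨N, hN⟩ := exists_normData_le (s := s) (p := p) (γ := γ) (c := c) θ (g := g) (κ := κ)
      (ζ := ζ) (fun y => by
    have hy : (chartAt (Euc n) y) y ∈ (chartAt (Euc n) y).target := mem_chart_target _ y
    obtain ⟨ψ, hψ⟩ := exists_test_eq_one_near (K := {chartAt (Euc n) y y})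
      (Ω := BoundaryChart.dom ⟨chartAt (Euc n) y, IsManifold.chart_mem_maximalAtlas y⟩)
      isCompact_singleton (singleton_subset_iff.2 hy)
    refine ⟨_, ψ, ⟨0, fun v hv => ?_⟩, mem_chart_source _ y, ?_⟩
    · rw [hv.locNorm_eq_zero fun x hx hw => h0 _ ?_]
      · exact zero_le
      · rw [InteriorChart.dom, ← SetLike.mem_coe, Opens.coe_mk, c.logChart_target] at hx
        rw [c.logChart_symm_apply]
        refine hbS _ (c.mem_source_of_pos hx.1 _) ?_
        rw [halfPt_val _ (Real.exp_pos _).le]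
        by_contra hlt
        exact (collarWeight_ne_zero hw).1 (hθ _ (not_le.1 hlt).le)
    · rw [hψ _ rfl]
      exact one_ne_zero) fun z' hz' _ => by
    by_cases hzS : z' ∈ S
    · refine ⟨κ, ζ, ⟨1, fun v _ => by rw [ENNReal.coe_one, one_mul]⟩, hSκ hzS, ?_⟩
      obtain ⟨x, hx, rfl⟩ := hzS
      rw [κ.toChart.right_inv (χ.tsupport_subset hx), hζ x hx]
      exact one_ne_zero
    · obtain ⟨κ', χ', h1, h2⟩ := exists_locNorm_eq_zero (s := s) (p := p) hS h0 hz' hzS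
      exact ⟨κ', χ', ⟨0, fun v hv => (h1 v hv).trans_le zero_le⟩, h2⟩
  refine ⟨g, κ, χ, ζ, N, ⟨coneMult_of_smoothInside hg (fun θ η ψ => .of_hasCompactSupport
    (hg.contDiff_collarWeight_smul c _ θ ψ) (hasCompactSupport_collarWeight_smul hS hSi h0 c _ θ ψ)) σ,
    .test χ, χ.tsupport_subset, fun x hx => κ.pullback_symm _ hx, ζ.contDiff,
    fun x hx => by rw [hζ x hx]; exact one_ne_zero, fun u hu => hu.1 κ ζ, hN⟩, ?_⟩
  rw [nhdsSet_singleton] at hχ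
  filter_upwards [(κ.toChart.continuousAt hκ).eventually hχ,
    κ.toChart.open_source.mem_nhds hκ] with z' h1 h2
  exact (κ.pullback_of_mem _ h2).trans h1

end Pieces

/-! ### Pieces around boundary points -/

section BoundaryPieces

variable {n : ℕ}

/-- In the variable r the cut-off is constant outside a compact interval: 0 for r < 0 and 1 for
large r. -/
lemma Cutoff.exists_iteratedFDeriv_exp_le (θ : Cutoff) (i : ℕ) :
    ∃ C : ℝ, ∀ r : ℝ, ‖iteratedFDeriv ℝ i (fun r => θ.toFun (Real.exp (-r))) r‖ ≤ C := by
  have hc : ContDiff ℝ ∞ fun r => θ.toFun (Real.exp (-r)) :=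
    θ.contDiff.comp (Real.contDiff_exp.comp contDiff_neg)
  have h1 : ∀ᶠ r : ℝ in atTop, θ.toFun (Real.exp (-r)) = 1 :=
    (Real.tendsto_exp_neg_atTop_nhds_zero).eventually θ.eq_one
  obtain ⟨R, hR⟩ := eventually_atTop.1 h1
  obtain ⟨a, ha, h0⟩ := θ.eq_zero
  have h0' : ∀ r < 0, θ.toFun (Real.exp (-r)) = 0 := fun r hr =>
    h0 _ (ha.le.trans (Real.one_le_exp (by linarith)))
  obtain ⟨C, hC⟩ := isCompact_Icc.exists_bound_of_continuousOn (s := Icc 0 R)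
    (hc.continuous_iteratedFDeriv (m := i) (by exact_mod_cast le_top)).continuousOn
  refine ⟨max C 1, fun r => ?_⟩
  by_cases hr : r < 0
  · have e : (fun r => θ.toFun (Real.exp (-r))) =ᶠ[𝓝 r] 0 := by
      filter_upwards [Iio_mem_nhds hr] with t ht
      exact h0' t ht
    rw [(e.iteratedFDeriv ℝ i).eq_of_nhds, iteratedFDeriv_zero, Pi.zero_apply, norm_zero]
    positivity
  by_cases hr' : r ≤ R
  · exact (hC r ⟨not_lt.1 hr, hr'⟩).trans (le_max_left _ _)
  · have e : (fun r => θ.toFun (Real.exp (-r))) =ᶠ[𝓝 r] fun _ => 1 := by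
      filter_upwards [Ioi_mem_nhds (not_le.1 hr')] with t ht
      exact hR t (le_of_lt ht)
    rw [(e.iteratedFDeriv ℝ i).eq_of_nhds]
    refine le_max_of_le_right ?_
    rcases Nat.eq_zero_or_pos i with rfl | hi
    · simp
    · rw [iteratedFDeriv_const_of_ne hi.ne']
      simp

lemma Cutoff.bddDeriv_exp (θ : Cutoff) :
    BddDeriv fun x : Euc (n + 1) => θ.toFun (Real.exp (-x 0)) := by
  refine ⟨θ.contDiff_exp, fun i => ?_⟩
  obtain ⟨C, hC⟩ := θ.exists_iteratedFDeriv_exp_le i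
  refine ⟨C * ∏ _j : Fin i, ‖headCLM n‖, fun x => ?_⟩
  have e : (fun x : Euc (n + 1) => θ.toFun (Real.exp (-x 0))) =
    (fun r => θ.toFun (Real.exp (-r))) ∘ headCLM n := rfl
  have hc : ContDiff ℝ ∞ fun r => θ.toFun (Real.exp (-r)) :=
    θ.contDiff.comp (Real.contDiff_exp.comp contDiff_neg)
  rw [e, (headCLM n).iteratedFDeriv_comp_right hc x (by exact_mod_cast le_top)]
  refine (ContinuousMultilinearMap.norm_compContinuousLinearMap_le _ _).trans ?_
  gcongr
  exact hC _

variable {B : Type*} [TopologicalSpace B] [ChartedSpace (EuclideanHalfSpace (n + 1)) B]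
  {Y : Type*} [TopologicalSpace Y] [ChartedSpace (Euc n) Y]

/-- The function `ψ` in the coordinates of the chart `η`, as a function on `Y`, extended by
zero. -/
def BoundaryChart.pullback (η : BoundaryChart n Y) (ψ : Euc n → ℝ) (y : Y) : ℝ :=
  open Classical in if y ∈ η.1.source then ψ (η.1 y) else 0

lemma BoundaryChart.pullback_of_mem (η : BoundaryChart n Y) (ψ : Euc n → ℝ) {y : Y}
    (hy : y ∈ η.1.source) : η.pullback ψ y = ψ (η.1 y) := if_pos hy

lemma BoundaryChart.pullback_symm (η : BoundaryChart n Y) (ψ : Euc n → ℝ) {x : Euc n}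
    (hx : x ∈ η.1.target) : η.pullback ψ (η.1.symm x) = ψ x := by
  rw [η.pullback_of_mem ψ (η.1.map_target hx), η.1.right_inv hx]

lemma BoundaryChart.pullback_eq_zero (η : BoundaryChart n Y) {ψ : Euc n → ℝ} {y : Y}
    (hy : y ∉ η.1.symm '' tsupport ψ) : η.pullback ψ y = 0 := by
  by_cases h : y ∈ η.1.source
  · rw [η.pullback_of_mem ψ h]
    exact image_eq_zero_of_notMem_tsupport fun h' => hy ⟨_, h', η.1.left_inv h⟩
  · exact if_neg h

lemma BoundaryChart.isCompact_symm_image {η : BoundaryChart n Y} (ψ : 𝓓(η.dom, ℝ)) :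
    IsCompact (η.1.symm '' tsupport ψ) :=
  ψ.hasCompactSupport.isCompact.image_of_continuousOn
    (η.1.continuousOn_symm.mono ψ.tsupport_subset)

lemma BoundaryChart.symm_image_subset {η : BoundaryChart n Y} (ψ : 𝓓(η.dom, ℝ)) :
    η.1.symm '' tsupport ψ ⊆ η.1.source := by
  rintro _ ⟨x, hx, rfl⟩
  exact η.1.map_target (ψ.tsupport_subset hx)

lemma BoundaryChart.contDiffOn_pullback [T2Space Y] {η : BoundaryChart n Y} (ψ : 𝓓(η.dom, ℝ))
    (η' : BoundaryChart n Y) :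
    ContDiffOn ℝ ∞ (fun x => η.pullback ψ (η'.1.symm x)) η'.1.target := by
  intro x hx
  refine ContDiffAt.contDiffWithinAt ?_
  by_cases hx' : η'.1.symm x ∈ η.1.source
  · have hO := (η'.1.symm.isOpen_inter_preimage η.1.open_source).mem_nhds ⟨hx, hx'⟩
    have ht : ContDiffOn ℝ ∞ (η.1 ∘ η'.1.symm) (η'.1.symm.source ∩ η'.1.symm ⁻¹' η.1.source) := by
      rw [← contMDiffOn_iff_contDiffOn]
      exact (contMDiffOn_of_mem_maximalAtlas η.2).comp
        ((contMDiffOn_symm_of_mem_maximalAtlas η'.2).mono inter_subset_left) inter_subset_right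
    refine (ψ.contDiff.contDiffAt.comp x (ht.contDiffAt hO)).congr_of_eventuallyEq ?_
    filter_upwards [hO] with y hy
    exact η.pullback_of_mem _ hy.2
  · have h2 := (η'.1.symm.isOpen_inter_preimage
      (BoundaryChart.isCompact_symm_image ψ).isClosed.isOpen_compl).mem_nhds (x := x)
      ⟨hx, fun h => hx' (BoundaryChart.symm_image_subset ψ h)⟩
    refine (contDiffAt_const (c := (0 : ℝ))).congr_of_eventuallyEq ?_
    filter_upwards [h2] with y hy
    exact η.pullback_eq_zero hy.2

variable [IsManifold (𝓡∂ (n + 1)) ∞ B] [IsManifold (𝓡 n) ∞ Y]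

/-- The function `θ(x) ψ(y)` on the collar, extended by zero. -/
def Collar.bump (c : Collar n B Y) (θ : Cutoff) {η : BoundaryChart n Y} (ψ : 𝓓(η.dom, ℝ))
    (z : B) : ℝ :=
  open Classical in if z ∈ c.toMap.target then
    θ.toFun ((c.toMap.symm z).1.val 0) * η.pullback ψ (c.toMap.symm z).2 else 0

variable {c : Collar n B Y} {θ : Cutoff} {η : BoundaryChart n Y} {ψ : 𝓓(η.dom, ℝ)}

omit [IsManifold (𝓡∂ (n + 1)) ∞ B] [IsManifold (𝓡 n) ∞ Y] in
lemma Collar.bump_apply {w : EuclideanHalfSpace 1 × Y} (hw : w ∈ c.toMap.source) :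
    c.bump θ ψ (c.toMap w) = θ.toFun (w.1.val 0) * η.pullback ψ w.2 := by
  rw [Collar.bump, if_pos (c.toMap.map_source hw), c.toMap.left_inv hw]

lemma Collar.bump_logChart_symm {η' : BoundaryChart n Y} {x : Euc (n + 1)}
    (hx : x ∈ (c.logChart η').toChart.target) :
    c.bump θ ψ ((c.logChart η').toChart.symm x) =
      θ.toFun (Real.exp (-x 0)) * η.pullback ψ (η'.1.symm (tailPt x)) := by
  rw [c.logChart_target] at hx
  rw [c.logChart_symm_apply, c.bump_apply (c.mem_source_of_pos hx.1 _),
    halfPt_val _ (Real.exp_pos _).le]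

lemma Collar.bump_logChart_symm_self {x : Euc (n + 1)} (hx : x ∈ (c.logChart η).toChart.target) :
    c.bump θ ψ ((c.logChart η).toChart.symm x) = collarWeight (((n : ℝ) + 1) / 2) θ ψ x := by
  have hx' := hx
  rw [c.logChart_target] at hx'
  rw [c.bump_logChart_symm hx, collarWeight_half, η.pullback_symm _ hx'.2]

omit [IsManifold (𝓡∂ (n + 1)) ∞ B] [IsManifold (𝓡 n) ∞ Y] in
lemma Collar.bump_eq_zero_of_notMem_tube {b : ℝ} (hθ : ∀ x, b ≤ x → θ.toFun x = 0) {z : B}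
    (hz : z ∉ c.tube b) : c.bump θ ψ z = 0 := by
  by_cases h : z ∈ c.toMap.target
  · rw [Collar.bump, if_pos h, hθ, zero_mul]
    by_contra hlt
    exact hz ⟨c.toMap.symm z, (not_le.1 hlt).le, c.toMap.right_inv h⟩
  · rw [Collar.bump, if_neg h]

lemma Collar.smoothInside_bump [T2Space B] [CompactSpace B] : SmoothInside n (c.bump θ ψ) := by
  have := c.compactSpace
  have := c.t2Space
  obtain ⟨b, hb, hθ⟩ := θ.eq_zero
  have hsub : {w : EuclideanHalfSpace 1 × Y | w.1.val 0 ≤ b} ⊆ c.toMap.source := fun w hw => by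
    rw [c.source_eq]
    exact lt_of_le_of_lt hw hb
  set W : Set (EuclideanHalfSpace 1 × Y) := {w | w.1.val 0 ≤ b ∧ w.2 ∈ η.1.symm '' tsupport ψ}
  have hWs : W ⊆ c.toMap.source := fun w hw => hsub hw.1
  have hW : IsCompact W := by
    refine ((isCompact_Icc (a := (0 : ℝ)) (b := b)).image continuous_halfPt |>.prod
      (isCompact_univ (X := Y))).of_isClosed_subset ((isClosed_le continuous_coord
        continuous_const).inter ((BoundaryChart.isCompact_symm_image ψ).isClosed.preimage
        continuous_snd)) fun w hw => ⟨⟨w.1.val 0, ⟨w.1.2, hw.1⟩, (eq_halfPt w.1).symm⟩, mem_univ _⟩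
  refine (c.logChart η).smoothInside (contDiff_collarWeight (((n : ℝ) + 1) / 2) θ ψ)
    (fun z hz => ?_) (hW.image_of_continuousOn (c.toMap.continuousOn.mono hWs)).isClosed ?_
    fun z hz => ?_
  · rw [← c.bump_logChart_symm_self ((c.logChart η).toChart.map_source hz),
      (c.logChart η).toChart.left_inv hz]
  · rintro _ ⟨⟨w, hw, rfl⟩, hi⟩
    exact c.mem_logChart_source (hWs hw) ((c.mem_interior_iff (hWs hw)).1 hi)
      (BoundaryChart.symm_image_subset ψ hw.2)
  · by_cases h : z ∈ c.toMap.target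
    · rw [Collar.bump, if_pos h]
      by_cases h1 : (c.toMap.symm z).2 ∈ η.1.symm '' tsupport ψ
      · rw [hθ, zero_mul]
        by_contra hlt
        exact hz ⟨_, ⟨(not_le.1 hlt).le, h1⟩, c.toMap.right_inv h⟩
      · rw [η.pullback_eq_zero h1, mul_zero]
    · rw [Collar.bump, if_neg h]

omit [IsManifold (𝓡 n) ∞ Y] in
lemma bddDeriv_collarWeight_half : BddDeriv (collarWeight (((n : ℝ) + 1) / 2) θ ψ) := by
  have h1 : collarWeight (((n : ℝ) + 1) / 2) θ ψ = fun x => θ.toFun (Real.exp (-x 0)) * ψ (tailPt x) :=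
    funext fun x => collarWeight_half θ ψ x
  rw [h1]
  exact θ.bddDeriv_exp.mul ((BddDeriv.test ψ).comp_clm (tailCLM n))

/-- The bump reaches the boundary, so its localizations are not compactly supported in r. They still
have bounded derivatives, being products of a function of r and a test function in y. -/
lemma Collar.coneMult_bump [T2Space B] [CompactSpace B] (σ : ℝ) : ConeMult c σ (c.bump θ ψ) := by
  have := c.t2Space
  refine coneMult_of_smoothInside c.smoothInside_bump (fun θ' η' ψ' => ?_) σ
  have h1 : BddDeriv fun x : Euc n => ψ' x • η.pullback ψ (η'.1.symm x) :=
    .of_hasCompactSupport (contDiff_mul_of_tsupport_subset η'.1.open_target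
      (BoundaryChart.contDiffOn_pullback ψ η') ψ'.contDiff ψ'.tsupport_subset)
      ψ'.hasCompactSupport.smul_right
  have h2 := (θ'.bddDeriv_exp.mul θ.bddDeriv_exp).mul (h1.comp_clm (tailCLM n))
  convert h2 using 2 with x
  change _ = _ * (ψ' (tailPt x) * η.pullback ψ (η'.1.symm (tailPt x)))
  by_cases hx : x ∈ (c.logChart η').toChart.target
  · rw [c.bump_logChart_symm hx, collarWeight_half]
    ring
  · have h3 : collarWeight (((n : ℝ) + 1) / 2) θ' ψ' x = 0 := by
      by_contra h
      exact hx (tsupport_collarWeight_subset c _ θ' ψ' (subset_tsupport _ h))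
    rw [h3, zero_mul]
    rw [collarWeight_half] at h3
    rcases mul_eq_zero.1 h3 with h | h <;> rw [h] <;> ring

lemma exists_isPiece_boundary [T2Space B] [CompactSpace B] (c : Collar n B Y) (s γ σ : ℝ)
    (p : ℝ≥0∞) [Fact (1 ≤ p)] (y₀ : Y) :
    ∃ g κ a ζ N, IsPiece c s γ σ p g κ a ζ N ∧
      ∀ᶠ z in 𝓝 (c.toMap (halfPt 0, y₀)), g z = 1 := by
  have := c.t2Space
  set ηc : Y → BoundaryChart n Y := fun y => ⟨chartAt (Euc n) y, IsManifold.chart_mem_maximalAtlas y⟩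
  have hηc : ∀ y, y ∈ (ηc y).1.source := fun y => mem_chart_source _ y
  set η := ηc y₀
  obtain ⟨ψ, hψ, -⟩ := exists_test_eq_one (Ω := η.dom) (K := {η.1 y₀}) isCompact_singleton
    (singleton_subset_iff.2 (η.1.map_source (hηc y₀)))
  obtain ⟨ψ', hψ'⟩ := exists_test_eq_one_near ψ.hasCompactSupport ψ.tsupport_subset
  -- `θ` cuts off the piece itself and `θ'` the norm: `θ'` equals 1 for x ≤ 1/2, which contains the
  -- support of `θ`. Points where `θ'` vanishes therefore lie off the piece.
  obtain ⟨θ, hθ1, hθ0⟩ := Cutoff.exists_eq_one (a := 1 / 4) (b := 1 / 2) (by norm_num)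
    (by norm_num) (by norm_num)
  obtain ⟨θ', hθ', -⟩ := Cutoff.exists_eq_one (a := 1 / 2) (b := 3 / 4) (by norm_num)
    (by norm_num) (by norm_num)
  set E := η.1.symm '' tsupport ψ
  have hE : IsClosed E := (BoundaryChart.isCompact_symm_image ψ).isClosed
  have htube : IsClosed (c.tube (1 / 2)) := c.isClosed_tube (by norm_num)
  obtain ⟨N, hN⟩ := exists_normData_le (s := s) (p := p) (γ := γ) (c := c) θ' (g := c.bump θ ψ)
      (κ := c.logChart η) (ζ := collarWeight γ θ' ψ') (fun y => by
    by_cases hy : y ∈ E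
    · refine ⟨η, ψ', ⟨1, fun v _ => by rw [ENNReal.coe_one, one_mul]⟩,
        BoundaryChart.symm_image_subset ψ hy, ?_⟩
      obtain ⟨x, hx, rfl⟩ := hy
      rw [η.1.right_inv (ψ.tsupport_subset hx), hψ' x hx]
      exact one_ne_zero
    · obtain ⟨χ, hχ⟩ := exists_test_eq_one_near (K := {(ηc y).1 y})
        (Ω := ⟨_, (ηc y).1.symm.isOpen_inter_preimage hE.isOpen_compl⟩) isCompact_singleton (by
          rw [singleton_subset_iff]
          refine ⟨(ηc y).1.map_source (hηc y), ?_⟩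
          rwa [mem_preimage, (ηc y).1.left_inv (hηc y)])
      refine ⟨ηc y, mkTest _ χ χ.contDiff χ.hasCompactSupport
        (χ.tsupport_subset.trans inter_subset_left), ⟨0, fun v hv => ?_⟩, hηc y, ?_⟩
      · rw [hv.locNorm_eq_zero fun x hx hw => ?_]
        · exact zero_le
        · rw [c.bump_logChart_symm hx, η.pullback_eq_zero, mul_zero]
          exact (χ.tsupport_subset (subset_tsupport _ (collarWeight_ne_zero hw).2)).2
      · rw [mkTest_apply, hχ _ rfl]
        exact one_ne_zero) fun z hz hzθ => by
    obtain ⟨κ, χ, h1, h2⟩ := exists_locNorm_eq_zero (s := s) (p := p) htube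
      (fun z hz => c.bump_eq_zero_of_notMem_tube (ψ := ψ) hθ0 hz) hz (fun ⟨w, hw, hwz⟩ => by
        have h3 := hzθ w (by
          rw [c.source_eq]
          exact lt_of_le_of_lt (show w.1.val 0 ≤ 1 / 2 from hw) (by norm_num)) hwz
        rw [hθ' _ hw] at h3
        exact one_ne_zero h3)
    exact ⟨κ, χ, ⟨0, fun v hv => (h1 v hv).trans_le zero_le⟩, h2⟩
  refine ⟨c.bump θ ψ, c.logChart η, collarWeight (((n : ℝ) + 1) / 2) θ ψ, collarWeight γ θ' ψ', N,
    ⟨c.coneMult_bump σ, bddDeriv_collarWeight_half, tsupport_collarWeight_subset c _ θ ψ,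
    fun x hx => c.bump_logChart_symm_self hx, contDiff_collarWeight γ θ' ψ', fun x hx => ?_,
    fun u hu => hu.2 θ' η ψ', hN⟩, ?_⟩
  · have h1 : IsClosed {x : Euc (n + 1) | Real.exp (-x 0) ≤ 1 / 2 ∧ tailPt x ∈ tsupport ψ} :=
      IsClosed.inter (isClosed_le (Real.continuous_exp.comp (headCLM n).continuous.neg)
        continuous_const) ((isClosed_tsupport ψ).preimage contDiff_tailPt.continuous)
    have h2 := closure_minimal (fun x hx => ?_) h1 hx
    · rw [collarWeight, hθ' _ h2.1, hψ' _ h2.2]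
      simp [Real.exp_ne_zero]
    · obtain ⟨h2, h3⟩ := collarWeight_ne_zero hx
      refine ⟨?_, subset_tsupport _ h3⟩
      by_contra hlt
      exact h2 (hθ0 _ (not_le.1 hlt).le)
  · have hw := c.boundaryPt_mem y₀
    have h1 : ∀ᶠ w : EuclideanHalfSpace 1 × Y in 𝓝 (halfPt 0, y₀), w.1.val 0 < 1 / 4 := by
      refine continuous_coord.continuousAt.eventually_lt continuousAt_const ?_
      rw [halfPt_val 0 le_rfl]
      norm_num
    rw [nhdsSet_singleton] at hψ
    have h2 : ∀ᶠ y in 𝓝 y₀, ψ (η.1 y) = 1 := (η.1.continuousAt (hηc y₀)).eventually hψ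
    have h3 : ∀ᶠ w : EuclideanHalfSpace 1 × Y in 𝓝 (halfPt 0, y₀), ψ (η.1 w.2) = 1 ∧
        w.2 ∈ η.1.source :=
      (continuous_snd.continuousAt (x := (halfPt 0, y₀))).eventually
        (h2.and (η.1.open_source.mem_nhds (hηc y₀)))
    have h4 := c.toMap.symm.continuousAt (c.toMap.map_source hw)
    rw [ContinuousAt, c.toMap.left_inv hw] at h4
    filter_upwards [h4.eventually h1, h4.eventually h3,
      c.toMap.open_target.mem_nhds (c.toMap.map_source hw)] with z hz1 hz2 hz3
    rw [Collar.bump, if_pos hz3, hθ1 _ hz1.le, η.pullback_of_mem _ hz2.2, hz2.1, one_mul]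

end BoundaryPieces

/-! ### Uniqueness of the operator -/

section Conclusion

variable {n : ℕ} {B : Type*} [TopologicalSpace B] [T2Space B] [CompactSpace B]
  [ChartedSpace (EuclideanHalfSpace (n + 1)) B]
  {Y : Type*} [TopologicalSpace Y] [ChartedSpace (Euc n) Y]
  [IsManifold (𝓡∂ (n + 1)) ∞ B] [IsManifold (𝓡 n) ∞ Y] {c : Collar n B Y}
  {s γ : ℝ} {p : ℝ≥0∞} [Fact (1 ≤ p)]

lemma exists_isPiece (c : Collar n B Y) (s γ σ : ℝ) (p : ℝ≥0∞) [Fact (1 ≤ p)] (z : B) :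
    ∃ g κ a ζ N, IsPiece c s γ σ p g κ a ζ N ∧ ∀ᶠ z' in 𝓝 z, g z' = 1 := by
  by_cases hz : z ∈ (𝓡∂ (n + 1)).interior B
  · exact exists_isPiece_of_mem_interior c s γ σ p hz
  · obtain ⟨y, rfl⟩ := c.exists_of_mem_boundary hz
    exact exists_isPiece_boundary c s γ σ p y

/-- D kills g v for each piece g, hence does not distinguish v from (1-g)v. Multiplying u by all
factors 1-g of a finite cover by sets where some g is locally 1 leaves an element that vanishes near
every point, and D u is its image. -/
lemma eq_zero_of_represents (hp : p < ⊤) (hp1 : 1 < p)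
    {D : coneSobolev c s γ p →ₗ[ℂ] coneSobolev c s γ p}
    (hD : ∀ N : NormData c, ∃ C : ℝ≥0, ∀ u : coneSobolev c s γ p,
      coneNorm N s γ p (D u).1 ≤ C * coneNorm N s γ p u.1)
    (hD0 : ∀ (u : coneSobolev c s γ p) (G : B → ℂ), Represents u.1 G → D u = 0)
    (u : coneSobolev c s γ p) : D u = 0 := by
  -- The pieces are smooth and multiply for every σ, so any value above |s| will do.
  have hs : |s| < |s| + 1 := lt_add_one _
  choose g κ a ζ N hg h1 using exists_isPiece c s γ (|s| + 1) p
  obtain ⟨t, ht⟩ := isCompact_univ.elim_nhds_subcover (fun z : B => {z' | ∀ᶠ z'' in 𝓝 z', g z z'' = 1})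
    fun z _ => eventually_eventually_nhds.2 (h1 z)
  -- `v` is the product of `u` with the factors 1 - `g z` for z in `t`, built one factor at a time.
  have key : ∀ t : Finset B, ∃ v : coneSobolev c s γ p, D v = D u ∧
      ∀ z ∈ t, ∀ z', (∀ᶠ z'' in 𝓝 z', g z z'' = 1) → VanishNear v.1 z' := by
    classical
    intro t
    induction t using Finset.induction_on with
    | empty => exact ⟨u, rfl, fun z hz => absurd hz (Finset.notMem_empty z)⟩
    | insert z t _ ih =>
      obtain ⟨v, hv, hvt⟩ := ih
      refine ⟨coneSub v ((hg z).mult.op γ hp hp1 hs v),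
        (map_coneSub_of_map_eq_zero D v ((hg z).apply_op_eq_zero hp hp1 hs hD hD0 v)).trans hv,
        fun z₁ hz₁ z' hz' => ?_⟩
      rcases Finset.mem_insert.1 hz₁ with rfl | hz₁
      · exact vanishNear_sub_op hp hp1 hs (hg _).mult hz'
      · exact VanishNear.sub_op hp hp1 hs (hg z).mult (hvt z₁ hz₁ z' hz')
  obtain ⟨v, hv, hvt⟩ := key t
  have h0 : v = 0 := Subtype.ext (eq_zero_of_vanishNear fun z _ => by
    obtain ⟨z₁, hz₁, h⟩ := mem_iUnion₂.1 (ht.2 (mem_univ z))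
    exact hvt z₁ hz₁ z h)
  rw [← hv, h0, map_zero]

omit [T2Space B] [CompactSpace B] [IsManifold (𝓡∂ (n + 1)) ∞ B] in
lemma Represents.eq {u v : IntDistribution n B} {G : B → ℂ} (hu : Represents u G)
    (hv : Represents v G) : u = v :=
  Subtype.ext (funext fun κ => ContinuousLinearMap.ext fun φ =>
    ((hu κ).2 φ).trans ((hv κ).2 φ).symm)

lemma eq_of_represents (hp : p < ⊤) (hp1 : 1 < p) {f : B → ℂ}
    {T T' : coneSobolev c s γ p →ₗ[ℂ] coneSobolev c s γ p}
    (hT : ∀ N : NormData c, ∃ C : ℝ≥0, ∀ u : coneSobolev c s γ p,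
      coneNorm N s γ p (T u).1 ≤ C * coneNorm N s γ p u.1)
    (hTf : ∀ (u : coneSobolev c s γ p) (g : B → ℂ), Represents u.1 g →
      Represents (T u).1 (fun z => f z * g z))
    (hT' : ∀ N : NormData c, ∃ C : ℝ≥0, ∀ u : coneSobolev c s γ p,
      coneNorm N s γ p (T' u).1 ≤ C * coneNorm N s γ p u.1)
    (hTf' : ∀ (u : coneSobolev c s γ p) (g : B → ℂ), Represents u.1 g →
      Represents (T' u).1 (fun z => f z * g z)) : T' = T := by
  have happ : ∀ u κ (φ : 𝓓(InteriorChart.dom κ, ℝ)),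
      ((T' + (-1 : ℂ) • T) u).1.1 κ φ = (T' u).1.1 κ φ - (T u).1.1 κ φ := fun u κ φ =>
    coneSub_apply (T' u) (T u) κ φ
  have h := eq_zero_of_represents hp hp1 (D := T' + (-1 : ℂ) • T) (fun N => ?_) (fun u G hG => ?_)
  · refine LinearMap.ext fun u => Subtype.ext (Subtype.ext (funext fun κ =>
      ContinuousLinearMap.ext fun φ => ?_))
    exact sub_eq_zero.1 ((happ u κ φ).symm.trans
      (congrArg (fun w : coneSobolev c s γ p => w.1.1 κ φ) (h u)))
  · obtain ⟨C, hC⟩ := hT N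
    obtain ⟨C', hC'⟩ := hT' N
    refine ⟨C' + C, fun u => (coneNorm_add_le N _ _).trans ?_⟩
    push_cast
    rw [add_mul]
    refine add_le_add (hC' u) ((coneNorm_smul_le (neg_ne_zero.2 one_ne_zero) N _).trans ?_)
    simpa using hC u
  · refine Subtype.ext (Subtype.ext (funext fun κ => ContinuousLinearMap.ext fun φ => ?_))
    exact (happ u κ φ).trans (sub_eq_zero.2
      (congrArg (fun w : IntDistribution n B => w.1 κ φ) ((hTf' u G hG).eq (hTf u G hG))))

end Conclusion

end Cone

end

theorem mainTheorem5 (n : ℕ)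
    {B : Type*} [TopologicalSpace B] [T2Space B] [CompactSpace B]
    [ChartedSpace (EuclideanHalfSpace (n + 1)) B] [IsManifold (𝓡∂ (n + 1)) ∞ B]
    {Y : Type*} [TopologicalSpace Y] [ChartedSpace (EuclideanSpace ℝ (Fin n)) Y]
    [IsManifold (𝓡 n) ∞ Y] (c : Cone.Collar n B Y)
    (p q : ℝ≥0∞) [Fact (1 ≤ p)] [Fact (1 ≤ q)] (hp : 1 < p) (hp' : p < ⊤) (hq : 1 < q)
    (hq' : q < ⊤) (σ γ : ℝ) (hσ : 0 < σ)
    (m : Cone.IntDistribution n B)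
    (hm : m ∈ Cone.coneSobolev c (σ + ((n : ℝ) + 1) / q.toReal) (((n : ℝ) + 1) / 2) q)
    (s : ℝ) (hs : -σ < s) (hs' : s < σ) :
    ∃ f : B → ℂ, Cone.Represents m f ∧
      ∃! T : Cone.coneSobolev c s γ p →ₗ[ℂ] Cone.coneSobolev c s γ p,
        (∀ N : Cone.NormData c, ∃ C : ℝ≥0, ∀ u : Cone.coneSobolev c s γ p,
          Cone.coneNorm N s γ p (T u).1 ≤ C * Cone.coneNorm N s γ p u.1) ∧
        (∀ (u : Cone.coneSobolev c s γ p) (g : B → ℂ), Cone.Represents u.1 g →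
          Cone.Represents (T u).1 (fun z => f z * g z)) := by
  have hs0 : |s| < σ := abs_lt.2 ⟨hs, hs'⟩
  obtain ⟨f, hf, hfc, hre, him⟩ := Cone.exists_represents hq hq' hσ hm
  obtain ⟨T, hT, hTf⟩ := Cone.exists_operator (γ := γ) hp' hp hs0 hfc hre him
  refine ⟨f, hf, T, ⟨hT, hTf⟩, fun T' ⟨hT', hTf'⟩ => ?_⟩
  exact Cone.eq_of_represents hp' hp hT hTf hT' hTf'
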